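/- Write points of $\mathbb C^{n+1}$ as $(z,w)\in\mathbb C^n\times\mathbb C$. Let $\Gamma\subset\mathbb C^{n+1}$ be a (possibly singular) real analytic hypersurface, i.e. the closure of the nonempty set of regular points of a closed set that is locally the zero set of a real analytic function, where a regular point is one near which the set is a smooth real analytic hypersurface. Let $0\in\Gamma$, let $U$ be an open neighbourhood of $0$, and let $\Omega$ be a connected component of $(\mathbb C^{n+1}\setminus\Gamma)\cap U$. For $z\in\mathbb C^n$ put $\gamma(z)=\{w:(z,w)\in\Gamma\}$ and $\Delta(z)=\{w:(z,w)\in\Omega\}$. Suppose that there is a domain $D\subset\mathbb C^n$ such that (i) for every $z\in D$, $\gamma(z)$ is a (regular, simple, closed) real analytic curve that bounds the bounded simply connected domain $\Delta(z)$, and $\{z\}\times\gamma(z)$ consists of regular points of $\Gamma$; (ii) $\Omega=\bigcup_{z\in D}\{z\}\times\Delta(z)$; (iii) for every $z_0\in\partial D$ the closed discs $\overline{\Delta(z)}$ converge in the Hausdorff distance to some nonempty compact subset of $\mathbb C$ as $z\to z_0$, $z\in D$. Let $f:\Gamma\to\mathbb C$ be a continuous function that is a CR function of class $C^1$ on the set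 of regular points of $\Gamma$. Let $E(f)$ be the set of all $z\in\overline D$ such that either $\gamma(z)$ is a single point, or $\gamma(z)$ is a closed real analytic curve as in (i) and $f(z,\cdot)$ extends holomorphically from $\gamma(z)$ to the domain bounded by $\gamma(z)$ (which is $\Delta(z)$ if $z\in D$); that is, it has a continuous extension to the closed disc that is holomorphic inside. If $E(f)$ is a set of uniqueness for functions holomorphic on $D$ and continuous on $\overline D$ (every such function that vanishes on $E(f)$ vanishes identically), then $f$ extends holomorphically to $\Omega$: there is a holomorphic function $F$ on $\Omega$ which, extended by $f$ to the points $(z,w)\in\Gamma$ for which $z\in D$, or $z\in\partial D$ and $\gamma(z)=\{w\}$, is continuous on the union of $\Omega$ and the set of these points. Moreover $$F(z,w)=\frac1{2\pi i}\int_{\gamma(z)}\frac{f(z,\zeta)\,d\zeta}{\zeta-w},\qquad (z,w)\in\Omega,$$ where $\gamma(z)$ is positively oriented. -/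

import Mathlib

open Set Filter Topology

/-- A closed subset of `ℂⁿ × ℂ = ℂⁿ⁺¹` that is locally the zero set of one real analytic
real-valued function. -/
def IsRealAnalyticSet {n : ℕ} (A : Set ((Fin n → ℂ) × ℂ)) : Prop :=
  IsClosed A ∧ ∀ q ∈ A, ∃ (V : Set ((Fin n → ℂ) × ℂ)) (ρ : (Fin n → ℂ) × ℂ → ℝ),
    IsOpen V ∧ q ∈ V ∧ AnalyticOnNhd ℝ ρ V ∧ A ∩ V = {p ∈ V | ρ p = 0}

/-- `ρ` is a real analytic function on the open neighbourhood `V` of `q` with `dρ(q) ≠ 0` whose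
zero set is `Γ ∩ V`; so `Γ` is a smooth real analytic hypersurface near `q`. -/
structure IsDefiningFunctionAt {n : ℕ} (Γ V : Set ((Fin n → ℂ) × ℂ))
    (ρ : (Fin n → ℂ) × ℂ → ℝ) (q : (Fin n → ℂ) × ℂ) : Prop where
  isOpen : IsOpen V
  mem : q ∈ V
  analytic : AnalyticOnNhd ℝ ρ V
  fderiv_ne_zero : fderiv ℝ ρ q ≠ 0
  inter_eq : Γ ∩ V = {p ∈ V | ρ p = 0}

/-- The set of regular points of `Γ`: those near which `Γ` is a real analytic submanifold of real
codimension one. -/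
def regularLocus {n : ℕ} (Γ : Set ((Fin n → ℂ) × ℂ)) : Set ((Fin n → ℂ) × ℂ) :=
  {q ∈ Γ | ∃ V ρ, IsDefiningFunctionAt Γ V ρ q}

/-- A (possibly singular) real analytic hypersurface of `ℂⁿ⁺¹`: the closure of the nonempty set of
regular points of a real analytic set (parts of lower dimension are discarded). -/
def IsRealAnalyticHypersurface {n : ℕ} (Γ : Set ((Fin n → ℂ) × ℂ)) : Prop :=
  Γ.Nonempty ∧ ∃ A, IsRealAnalyticSet A ∧ Γ = closure (regularLocus A)

/-- `f` is a CR function of class `C¹` on the regular part of `Γ`: near every regular point `q`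
it is the restriction to `Γ` of a `C¹` function `g` on an open subset of `ℂⁿ⁺¹`, and its
differential is complex linear on the complex tangent space
`{v | v ∈ T_q Γ and i v ∈ T_q Γ}`, where `T_q Γ = ker dρ(q)`. -/
def IsCROnRegularLocus {n : ℕ} (Γ : Set ((Fin n → ℂ) × ℂ)) (f : (Fin n → ℂ) × ℂ → ℂ) : Prop :=
  ∀ q ∈ regularLocus Γ, ∃ (V : Set ((Fin n → ℂ) × ℂ)) (ρ : (Fin n → ℂ) × ℂ → ℝ)
    (g : (Fin n → ℂ) × ℂ → ℂ),
    IsDefiningFunctionAt Γ V ρ q ∧ ContDiffOn ℝ 1 g V ∧ EqOn g f (Γ ∩ V) ∧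
    ∀ v : (Fin n → ℂ) × ℂ, fderiv ℝ ρ q v = 0 → fderiv ℝ ρ q (Complex.I • v) = 0 →
      fderiv ℝ g q (Complex.I • v) = Complex.I * fderiv ℝ g q v

/-- The fibre `{w | (z, w) ∈ S}` of `S` over `z`. It is `γ(z)` for `S = Γ` and `Δ(z)` for
`S = Ω`. -/
def fibre {n : ℕ} (S : Set ((Fin n → ℂ) × ℂ)) (z : Fin n → ℂ) : Set ℂ :=
  {w | (z, w) ∈ S}

/-- `c` is a regular, injective, 1-periodic real analytic parametrization of the closed curve `γ`
that runs once in the positive direction around the points of `Δ`. -/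
structure IsPositiveParametrization (c : ℝ → ℂ) (γ Δ : Set ℂ) : Prop where
  analytic : AnalyticOnNhd ℝ c univ
  periodic : Function.Periodic c 1
  injOn : InjOn c (Ico 0 1)
  deriv_ne_zero : ∀ t, deriv c t ≠ 0
  range_eq : range c = γ
  winding : ∀ w ∈ Δ, ∫ t in (0 : ℝ)..1, deriv c t / (c t - w) = 2 * Real.pi * Complex.I

/-- `γ` is a (connected, closed) real analytic curve in `ℂ` that bounds the bounded simply
connected domain `Δ`. -/
structure BoundsDisc (γ Δ : Set ℂ) : Prop where
  isOpen : IsOpen Δ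
  isBounded : Bornology.IsBounded Δ
  simplyConnected : IsSimplyConnected Δ
  frontier_eq : frontier Δ = γ
  exists_param : ∃ c, IsPositiveParametrization c γ Δ

/-- The function `φ` on `γ` extends holomorphically to `Δ`: there is a function that is
continuous on `Δ ∪ γ`, holomorphic on `Δ`, and equal to `φ` on `γ`. -/
def ExtendsHolomorphically (φ : ℂ → ℂ) (γ Δ : Set ℂ) : Prop :=
  ∃ g : ℂ → ℂ, ContinuousOn g (Δ ∪ γ) ∧ DifferentiableOn ℂ g Δ ∧ EqOn g φ γ

/-- The set `E(f)` of the points `z` of the closure of `D` for which `γ(z)` is a single point, or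
`γ(z)` is a closed curve and `f(z, ·)` extends holomorphically from `γ(z)` to the domain bounded
by `γ(z)`. (For `z ∈ D` this domain is `Δ(z)`.) -/
def extensionSet {n : ℕ} (Γ : Set ((Fin n → ℂ) × ℂ)) (D : Set (Fin n → ℂ))
    (f : (Fin n → ℂ) × ℂ → ℂ) : Set (Fin n → ℂ) :=
  {z ∈ closure D | (∃ w, fibre Γ z = {w}) ∨
    ∃ Δ, BoundsDisc (fibre Γ z) Δ ∧ ExtendsHolomorphically (fun ζ => f (z, ζ)) (fibre Γ z) Δ}

/-- `E` is a set of uniqueness for the functions that are continuous on the closure of `D` and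
holomorphic on `D`. -/
def IsUniquenessSet {n : ℕ} (D E : Set (Fin n → ℂ)) : Prop :=
  ∀ h : (Fin n → ℂ) → ℂ, ContinuousOn h (closure D) → DifferentiableOn ℂ h D →
    (∀ z ∈ E, h z = 0) → ∀ z ∈ closure D, h z = 0

/-! For `z ∈ D` and `k ≥ 0` consider the moment `G_k(z)`, the integral of `f(z, ζ) ζ^k dζ` over
`γ(z)`. Everything reduces to `G_k ≡ 0`. Expanding the Cauchy kernel at infinity then shows that the
Cauchy integral of `f(z, ·)` vanishes outside `γ(z)` (`BoundsDisc.cauchyInt_eq_zero_of_moments`),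
and by the Plemelj jump relation (`BoundsDisc.cauchyInt_near`) the same integral inside `γ(z)` has
the boundary values `f(z, ·)`.

The moments are holomorphic on `D` (`IsDiscFamily.differentiableOn_curveInt`). Since `f ζ^k` is
again CR, `k = 0` suffices. If `g` is a `C¹` extension of `f`, Green's formula turns the line
integral into `2i` times the integral of `∂g/∂w̄` over `Δ(z)`. Testing this against `∂̄χ` produces
the integral over `Ω` of a coefficient of `∂̄g ∧ ∂̄χ`. That form is exact, and its boundary term
vanishes because `g` satisfies the tangential Cauchy–Riemann equations along the boundary
(`setIntegral_dbarJ_eq_zero_of_level`). A continuous weak solution of the Cauchy–Riemann equations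
is holomorphic.

The moments extend continuously to the closure of `D` (`IsDiscFamily.exists_tendsto_curveInt`).
Again they are compared with area integrals, which converge because the closed discs do, provided
that the curves have bounded length. Real analyticity gives this bound for a dense set of `z`: the
curves cross almost all horizontal and vertical lines a bounded number of times, and a Crofton
argument bounds the length. The uniform crossing bound (`AnalyticAt.exists_card_zeros_le`) rests on
`exists_uniform_bound`: in an expansion `∑ a_j(s) t^j` of an analytic function, finitely many of the
`a_j` dominate all the others near the origin. This is an effective division algorithm with
Dickson's lemma; Rolle's theorem then counts zeros.

The extended moments vanish on `E(f)`. Over `D` this is Cauchy's theorem. Over the boundary, the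
limit of the closed discs is either a null set or, up to a null set, the disc bounded by `γ(z₀)`
(`IsDiscFamily.limit_curveInt_eq_zero`). The uniqueness hypothesis gives `G_k ≡ 0`.

The discs are given only as fibres of `Ω`, so it has to be proved that they cannot jump. The point
is that a defining function of `Γ` changes sign along the fibre at every point of `γ(z)`
(`IsDiscFamily.not_isLocalMin`); hence nearby curves stay near, and over `D` the frontier of `Ω`
lies in `Γ`.

Finally, `F` is holomorphic in `w` as a Cauchy integral, and in `z` because `f / (ζ - w)` is CR near
the curves. Being locally bounded, it is jointly holomorphic. Its boundary values come from the
maximum principle, over `D` with an auxiliary polynomial factor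
(`IsCauchyExtension.eventually_norm_sub_le`). -/

/-! ### Normal collars of regular closed curves. -/

/-- A `C²`, 1-periodic, regular parametrization of a simple closed curve. -/
structure IsJordanParam (c : ℝ → ℂ) : Prop where
  contDiff : ContDiff ℝ 2 c
  periodic : Function.Periodic c 1
  injOn : InjOn c (Ico 0 1)
  deriv_ne_zero : ∀ t, deriv c t ≠ 0

theorem IsPositiveParametrization.isJordanParam {c : ℝ → ℂ} {γ Δ : Set ℂ}
    (hc : IsPositiveParametrization c γ Δ) : IsJordanParam c where
  contDiff := contDiffOn_univ.1 hc.analytic.contDiffOn_of_completeSpace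
  periodic := hc.periodic
  injOn := hc.injOn
  deriv_ne_zero := hc.deriv_ne_zero

/-- Normal coordinates near a curve. -/
noncomputable def collar (c : ℝ → ℂ) (τ η : ℝ) : ℂ := c τ + η * Complex.I * deriv c τ

theorem collar_zero (c : ℝ → ℂ) (τ : ℝ) : collar c τ 0 = c τ := by simp [collar]

theorem Function.Periodic.apply_fract {E : Type*} {f : ℝ → E} (hf : Function.Periodic f 1)
    (t : ℝ) : f (Int.fract t) = f t := by
  have := hf.sub_zsmul_eq (x := t) ⌊t⌋
  rwa [zsmul_one, Int.self_sub_floor] at this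

theorem Function.Periodic.exists_bound {E : Type*} [NormedAddCommGroup E] {f : ℝ → E}
    (hf : Function.Periodic f 1) (hc : Continuous f) : ∃ B > 0, ∀ t, ‖f t‖ ≤ B := by
  obtain ⟨B, hB⟩ := isCompact_Icc.exists_bound_of_continuousOn (s := Icc (0:ℝ) 1) hc.continuousOn
  refine ⟨max B 1, by positivity, fun t => ?_⟩
  rw [← hf.apply_fract t]
  exact (hB _ ⟨Int.fract_nonneg t, (Int.fract_lt_one t).le⟩).trans (le_max_left _ _)

theorem Function.Periodic.deriv' {c : ℝ → ℂ} (hf : Function.Periodic c 1) :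
    Function.Periodic (deriv c) 1 := by
  intro t
  have : (fun x => c (x + 1)) = c := funext hf
  rw [← deriv_comp_add_const, this]

namespace IsJordanParam
variable {c : ℝ → ℂ}

theorem continuous (hc : IsJordanParam c) : Continuous c := hc.contDiff.continuous

theorem differentiable (hc : IsJordanParam c) : Differentiable ℝ c :=
  hc.contDiff.differentiable (by norm_num)

theorem contDiff_deriv (hc : IsJordanParam c) : ContDiff ℝ 1 (deriv c) := by
  have := hc.contDiff
  rw [show (2 : WithTop ℕ∞) = 1 + 1 by norm_num, contDiff_succ_iff_deriv] at this
  exact this.2.2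

theorem continuous_deriv (hc : IsJordanParam c) : Continuous (deriv c) :=
  hc.contDiff_deriv.continuous

theorem continuous_collar (hc : IsJordanParam c) :
    Continuous fun p : ℝ × ℝ => collar c p.1 p.2 := by
  have h1 := hc.continuous
  have h2 := hc.continuous_deriv
  unfold collar
  fun_prop

theorem collar_fract (hc : IsJordanParam c) (τ η : ℝ) :
    collar c (Int.fract τ) η = collar c τ η := by
  simp [collar, hc.periodic.apply_fract, hc.periodic.deriv'.apply_fract]

theorem apply_fract (hc : IsJordanParam c) (τ : ℝ) : c (Int.fract τ) = c τ := by
  simpa [collar] using hc.collar_fract τ 0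

theorem exists_lower_deriv (hc : IsJordanParam c) : ∃ m > 0, ∀ t, m ≤ ‖deriv c t‖ := by
  obtain ⟨t0, -, h0⟩ := isCompact_Icc.exists_isMinOn (s := Icc (0:ℝ) 1) ⟨0, by simp⟩
    hc.continuous_deriv.norm.continuousOn
  refine ⟨‖deriv c t0‖, norm_pos_iff.2 (hc.deriv_ne_zero t0), fun t => ?_⟩
  rw [← hc.periodic.deriv'.apply_fract t]
  exact h0 ⟨Int.fract_nonneg t, (Int.fract_lt_one t).le⟩

/-- The mean value inequality is used twice: the bound for the second derivative makes `c'`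
Lipschitz, and this bounds the derivative of the remainder. -/
theorem exists_quadratic (hc : IsJordanParam c) :
    ∃ B > 0, ∀ t τ, ‖c t - c τ - (t - τ : ℝ) * deriv c τ‖ ≤ B * |t - τ| ^ 2 := by
  obtain ⟨B, hB0, hB⟩ := hc.periodic.deriv'.deriv'.exists_bound
    (hc.contDiff_deriv.continuous_deriv (by norm_num))
  have hd : Differentiable ℝ (deriv c) := hc.contDiff_deriv.differentiable (by norm_num)
  have hL : ∀ s τ, ‖deriv c s - deriv c τ‖ ≤ B * |s - τ| := fun s τ => by
    simpa using Convex.norm_image_sub_le_of_norm_deriv_le (s := univ) (f := deriv c)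
      (fun x _ => hd x) (fun x _ => hB x) convex_univ (mem_univ τ) (mem_univ s)
  refine ⟨B, hB0, fun t τ => ?_⟩
  have key := Convex.norm_image_sub_le_of_norm_hasDerivWithin_le (s := uIcc τ t)
    (f := fun x => c x - (x - τ : ℝ) * deriv c τ) (f' := fun x => deriv c x - deriv c τ)
    (C := B * |t - τ|) (x := τ) (y := t)
    (fun x _ => by
      have h1 := (hc.differentiable x).hasDerivAt
      have h2 : HasDerivAt (fun x : ℝ => ((x - τ : ℝ) : ℂ) * deriv c τ) (1 * deriv c τ) x := by
        have := ((hasDerivAt_id x).sub_const τ).ofReal_comp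
        simpa using this.mul_const (deriv c τ)
      have h3 := (h1.sub h2).hasDerivWithinAt (s := uIcc τ t)
      rw [one_mul] at h3
      exact h3)
    (fun x hx => (hL x τ).trans (mul_le_mul_of_nonneg_left (by
      exact abs_sub_left_of_mem_uIcc hx) hB0.le)) (convex_uIcc _ _)
    left_mem_uIcc right_mem_uIcc
  have e : c t - c τ - (t - τ : ℝ) * deriv c τ =
    (c t - (t - τ : ℝ) * deriv c τ) - (c τ - (τ - τ : ℝ) * deriv c τ) := by simp; ring
  rw [e]
  refine key.trans (le_of_eq ?_)
  rw [Real.norm_eq_abs]; ring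

theorem eq_add_int (hc : IsJordanParam c) {t τ : ℝ} (h : c t = c τ) :
    Int.fract t = Int.fract τ :=
  hc.injOn ⟨Int.fract_nonneg _, Int.fract_lt_one _⟩ ⟨Int.fract_nonneg _, Int.fract_lt_one _⟩
    (by rw [hc.apply_fract, hc.apply_fract, h])

theorem ne_of_abs_sub (hc : IsJordanParam c) {t τ : ℝ} (h : 0 < |t - τ|) (h1 : |t - τ| < 1) :
    c t ≠ c τ := by
  intro e
  have := hc.eq_add_int e
  obtain ⟨z, hz⟩ := Int.fract_eq_fract.1 this
  rw [hz] at h h1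
  norm_cast at h h1
  omega

/-- For `t` near `τ` the difference is `c'(τ) ((t - τ) - iη)` up to a quadratic error. For `t` far
from `τ`, injectivity and compactness separate `c t` from `c τ`, and a small `η` does not matter.
The bound keeps the collar off the curve and later controls the Cauchy kernel. -/
theorem exists_collar_lower (hc : IsJordanParam c) : ∃ κ > 0, ∃ δ > 0, ∀ τ η t : ℝ,
    |η| ≤ δ → |t - τ| ≤ 1 / 2 → κ * (|t - τ| + |η|) ≤ ‖c t - collar c τ η‖ := by
  obtain ⟨m, hm, hm'⟩ := hc.exists_lower_deriv
  obtain ⟨B, hB, hB'⟩ := hc.exists_quadratic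
  obtain ⟨M, hM, hM'⟩ := hc.periodic.deriv'.exists_bound hc.continuous_deriv
  -- Below this distance the quadratic remainder is at most `m / 4` times `|t - τ|`, half of what
  -- the linear term provides.
  set δ₁ := min (1 / 2) (m / (4 * B)) with hδ₁
  have hδ₁0 : 0 < δ₁ := by positivity
  -- the distance between far points
  obtain ⟨d, hd, hd'⟩ : ∃ d > 0, ∀ t τ : ℝ, δ₁ ≤ |t - τ| → |t - τ| ≤ 1 / 2 → d ≤ ‖c t - c τ‖ := by
    set S : Set (ℝ × ℝ) := Icc 0 1 ×ˢ Icc (-1/2) (1/2) ∩ {p | δ₁ ≤ |p.2|} with hS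
    have hSc : IsCompact S := (isCompact_Icc.prod isCompact_Icc).inter_right
      (isClosed_le continuous_const continuous_snd.abs)
    have hne : S.Nonempty := ⟨(0, 1/2), by
      simp only [hS, mem_inter_iff, mem_prod, mem_Icc, mem_ofPred_eq]
      refine ⟨by norm_num, ?_⟩
      rw [abs_of_pos (by norm_num)]; exact min_le_left _ _⟩
    have hcont : Continuous fun p : ℝ × ℝ => ‖c (p.1 + p.2) - c p.1‖ := by
      have := hc.continuous; fun_prop
    obtain ⟨p, hp, hmin⟩ := hSc.exists_isMinOn hne hcont.continuousOn
    refine ⟨_, norm_pos_iff.2 (sub_ne_zero.2 (hc.ne_of_abs_sub (t := p.1 + p.2) (τ := p.1) ?_ ?_)),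
      fun t τ h1 h2 => ?_⟩
    · simpa using hδ₁0.trans_le hp.2
    · have := hp.1.2
      simp only [mem_Icc] at this
      rw [add_sub_cancel_left, abs_lt]; constructor <;> linarith
    · have hmem : ((Int.fract τ, t - τ) : ℝ × ℝ) ∈ S := by
        refine ⟨⟨⟨Int.fract_nonneg _, (Int.fract_lt_one _).le⟩, ?_⟩, h1⟩
        rw [abs_le] at h2
        constructor <;> simp only <;> linarith
      have := hmin hmem
      simp only [mem_ofPred_eq] at this
      rw [hc.apply_fract] at this
      have e : c (Int.fract τ + (t - τ)) = c t := by
        have := hc.periodic.sub_zsmul_eq (x := t) ⌊τ⌋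
        rw [← this]; congr 1; rw [zsmul_one, Int.fract]; ring
      rwa [e] at this
  -- The bound `d / (2M)` keeps the normal displacement below `d / 2`; the bound `1 / 2` gives `|t -
  -- τ| + |η| ≤ 1` in the far case.
  refine ⟨min (m / 4) (d / 4), by positivity, min (d / (2 * M)) (1 / 2), by positivity,
    fun τ η t hη ht => ?_⟩
  have hη1 := hη.trans (min_le_left _ _)
  have hη2 := hη.trans (min_le_right _ _)
  by_cases hnear : |t - τ| < δ₁
  · have h1 : |t - τ| ≤ m / (4 * B) := hnear.le.trans (min_le_right _ _)
    have e : c t - collar c τ η = deriv c τ * (((t - τ : ℝ) : ℂ) - η * Complex.I) +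
        (c t - c τ - (t - τ : ℝ) * deriv c τ) := by simp only [collar]; ring
    have h2 : ‖c t - c τ - (t - τ : ℝ) * deriv c τ‖ ≤ m / 4 * |t - τ| := by
      refine (hB' t τ).trans ?_
      have : B * |t - τ| ≤ m / 4 := by
        calc B * |t - τ| ≤ B * (m / (4 * B)) := by gcongr
          _ = m / 4 := by field_simp
      nlinarith [abs_nonneg (t - τ)]
    have h3 : (|t - τ| + |η|) / 2 ≤ ‖((t - τ : ℝ) : ℂ) - η * Complex.I‖ := by
      have a1 := Complex.abs_re_le_norm (((t - τ : ℝ) : ℂ) - η * Complex.I)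
      have a2 := Complex.abs_im_le_norm (((t - τ : ℝ) : ℂ) - η * Complex.I)
      simp at a1 a2
      push_cast
      linarith
    have h4 : m * ((|t - τ| + |η|) / 2) ≤
        ‖deriv c τ * (((t - τ : ℝ) : ℂ) - η * Complex.I)‖ := by
      rw [norm_mul]; gcongr; exact hm' τ
    rw [e]
    have h5 := norm_sub_le_norm_add (deriv c τ * (((t - τ : ℝ) : ℂ) - η * Complex.I))
      (c t - c τ - (t - τ : ℝ) * deriv c τ)
    have h6 : min (m / 4) (d / 4) * (|t - τ| + |η|) ≤ m / 4 * (|t - τ| + |η|) := by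
      gcongr; exact min_le_left _ _
    nlinarith [abs_nonneg (t - τ), abs_nonneg η]
  · push Not at hnear
    have h1 := hd' t τ hnear ht
    have e : c t - collar c τ η = (c t - c τ) - η * Complex.I * deriv c τ := by
      simp only [collar]; ring
    have h2 : ‖(η : ℂ) * Complex.I * deriv c τ‖ ≤ d / 2 := by
      rw [norm_mul, norm_mul, Complex.norm_I, mul_one, Complex.norm_real, Real.norm_eq_abs]
      calc |η| * ‖deriv c τ‖ ≤ d / (2 * M) * M := by gcongr; exact hM' τ
        _ = d / 2 := by field_simp
    rw [e]
    have h5 := norm_sub_norm_le (c t - c τ) (η * Complex.I * deriv c τ)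
    have h6 : min (m / 4) (d / 4) * (|t - τ| + |η|) ≤ d / 4 * (1 / 2 + 1 / 2) := by
      gcongr; exact min_le_right _ _
    linarith

/-- A point of the plane lies on the normal of its nearest point on the curve. -/
theorem exists_eq_collar (hc : IsJordanParam c) (w : ℂ) :
    ∃ τ η : ℝ, w = collar c τ η ∧ |η| * ‖deriv c τ‖ = Metric.infDist w (range c) := by
  have hcont : Continuous fun t => ‖c t - w‖ := by have := hc.continuous; fun_prop
  have hcomp : IsCompact (range c) := by
    have : range c = c '' Icc 0 1 := by
      refine Subset.antisymm ?_ (image_subset_range _ _)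
      rintro _ ⟨t, rfl⟩
      exact ⟨Int.fract t, ⟨Int.fract_nonneg t, (Int.fract_lt_one t).le⟩, hc.apply_fract t⟩
    rw [this]; exact isCompact_Icc.image hc.continuous
  obtain ⟨_, ⟨τ, rfl⟩, hτ⟩ := hcomp.exists_infDist_eq_dist (range_nonempty c) w
  have hmin : IsLocalMin (fun t => ‖c t - w‖ ^ 2) τ := by
    refine Filter.Eventually.of_forall fun t => ?_
    have : Metric.infDist w (range c) ≤ dist w (c t) := Metric.infDist_le_dist_of_mem ⟨t, rfl⟩
    rw [hτ, dist_eq_norm', dist_eq_norm'] at this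
    exact pow_le_pow_left₀ (norm_nonneg _) this 2
  have hder : HasDerivAt (fun t => ‖c t - w‖ ^ 2) (2 * inner ℝ (c τ - w) (deriv c τ)) τ :=
    ((hc.differentiable τ).hasDerivAt.sub_const w).norm_sq
  have h0 := hmin.hasDerivAt_eq_zero hder
  have hne := hc.deriv_ne_zero τ
  -- The first order condition at the nearest point says that `w - c τ` is orthogonal to `c'(τ)`,
  -- that is, the quotient `q` is purely imaginary.
  obtain ⟨q, hq⟩ : ∃ q : ℂ, w - c τ = q * deriv c τ := ⟨(w - c τ) / deriv c τ, by field_simp⟩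
  have hq0 : q.re = 0 := by
    have e : c τ - w = - (q * deriv c τ) := by rw [← hq]; ring
    rw [e] at h0
    rw [Complex.inner] at h0
    have hn : Complex.normSq (deriv c τ) ≠ 0 := by simpa using hne
    have : q.re * Complex.normSq (deriv c τ) = 0 := by
      simp at h0
      rw [Complex.normSq_apply]
      linear_combination -h0
    exact (mul_eq_zero.1 this).resolve_right hn
  have hq1 : q = q.im * Complex.I := by
    apply Complex.ext <;> simp [hq0]
  refine ⟨τ, q.im, ?_, ?_⟩
  · rw [collar, ← hq1, ← hq]; ring
  · rw [hτ, dist_eq_norm, hq, norm_mul]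
    congr 1
    conv_rhs => rw [hq1]
    simp

end IsJordanParam


/-! ### Winding integrals and the Jordan curve theorem for regular curves. -/

/-- The (unnormalized) winding integral of the closed curve `c` around `w`. -/
noncomputable def wind (c : ℝ → ℂ) (w : ℂ) : ℂ := ∫ t in (0 : ℝ)..1, deriv c t / (c t - w)

theorem range_eq_image_Icc {c : ℝ → ℂ} (hp : Function.Periodic c 1) :
    range c = c '' Icc 0 1 := by
  refine Subset.antisymm ?_ (image_subset_range _ _)
  rintro _ ⟨t, rfl⟩
  exact ⟨Int.fract t, ⟨Int.fract_nonneg t, (Int.fract_lt_one t).le⟩, hp.apply_fract t⟩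

theorem isCompact_range_of_periodic {c : ℝ → ℂ} (hp : Function.Periodic c 1)
    (hc : Continuous c) : IsCompact (range c) := by
  rw [range_eq_image_Icc hp]; exact isCompact_Icc.image hc

/-- The quotient `(c - w') / (c - w)` stays in the unit disc around `1`, where the principal
logarithm is smooth. The difference of the two integrands is therefore the derivative of a periodic
function. -/
theorem wind_eq_of_dist_lt {c : ℝ → ℂ} (hc : ContDiff ℝ 1 c) (hp : Function.Periodic c 1)
    {w w' : ℂ} (h : ∀ t, dist w' w < dist (c t) w) : wind c w' = wind c w := by
  have h0 : ∀ t, c t - w ≠ 0 := fun t e => by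
    have := h t; rw [dist_eq_norm (c t), e, norm_zero] at this; exact absurd this (not_lt.2 dist_nonneg)
  have hq : ∀ t, ‖(c t - w') / (c t - w) - 1‖ < 1 := fun t => by
    have e : (c t - w') / (c t - w) - 1 = - (w' - w) / (c t - w) := by
      have := h0 t; field_simp; ring
    rw [e, norm_div, norm_neg, ← dist_eq_norm, ← dist_eq_norm,
      div_lt_one (dist_nonneg.trans_lt (h t))]
    exact h t
  have hs : ∀ t, (c t - w') / (c t - w) ∈ Complex.slitPlane := fun t => by
    have := Complex.mem_slitPlane_of_norm_lt_one (hq t); simpa using this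
  have h0' : ∀ t, c t - w' ≠ 0 := fun t e => by
    have := Complex.slitPlane_ne_zero (hs t); simp [e] at this
  have hcd := hc.differentiable (by norm_num)
  have hcc : Continuous (deriv c) := hc.continuous_deriv (by norm_num)
  have hder : ∀ t, HasDerivAt (fun t => Complex.log ((c t - w') / (c t - w)))
      (deriv c t / (c t - w') - deriv c t / (c t - w)) t := fun t => by
    have d := (hcd t).hasDerivAt
    have h3 : HasDerivAt (fun t => (c t - w') / (c t - w)) _ t :=
      (d.sub_const w').div (d.sub_const w) (h0 t)
    convert h3.clog_real (hs t) using 1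
    have := h0 t; have := h0' t
    field_simp
  have i1 : IntervalIntegrable (fun t => deriv c t / (c t - w')) MeasureTheory.volume 0 1 :=
    (hcc.div (hc.continuous.sub continuous_const) h0').intervalIntegrable _ _
  have i2 : IntervalIntegrable (fun t => deriv c t / (c t - w)) MeasureTheory.volume 0 1 :=
    (hcc.div (hc.continuous.sub continuous_const) h0).intervalIntegrable _ _
  have := intervalIntegral.integral_eq_sub_of_hasDerivAt (fun t _ => hder t) (i1.sub i2)
  rw [intervalIntegral.integral_sub i1 i2] at this
  have hp0 : c 1 = c 0 := by simpa using hp 0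
  rw [hp0, sub_self, sub_eq_zero] at this
  exact this

theorem wind_eq_of_isPreconnected {c : ℝ → ℂ} (hc : ContDiff ℝ 1 c) (hp : Function.Periodic c 1)
    {S : Set ℂ} (hS : IsPreconnected S) (hd : Disjoint S (range c)) {w w' : ℂ} (hw : w ∈ S)
    (hw' : w' ∈ S) : wind c w = wind c w' := by
  refine hS.induction₂ (fun x y => wind c x = wind c y) (fun x hx => ?_)
    (fun x y z _ _ _ h1 h2 => h1.trans h2) (fun x y _ _ h => h.symm) hw hw'
  have hK := (isCompact_range_of_periodic hp hc.continuous).isClosed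
  have hx' : x ∉ range c := fun h => hd.ne_of_mem hx h rfl
  have hpos := (hK.notMem_iff_infDist_pos (range_nonempty c)).1 hx'
  have : Metric.ball x (Metric.infDist x (range c)) ∈ 𝓝[S] x :=
    mem_nhdsWithin_of_mem_nhds (Metric.ball_mem_nhds _ hpos)
  filter_upwards [this] with y hy
  exact (wind_eq_of_dist_lt hc hp fun t => (Metric.mem_ball.1 hy).trans_le (by
    rw [dist_comm (c t)]
    exact Metric.infDist_le_dist_of_mem ⟨t, rfl⟩)).symm

/-- The integral is constant on the connected set and tends to zero at infinity. -/
theorem wind_eq_zero_of_not_isBounded {c : ℝ → ℂ} (hc : ContDiff ℝ 1 c)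
    (hp : Function.Periodic c 1) {S : Set ℂ} (hS : IsPreconnected S)
    (hd : Disjoint S (range c)) (hb : ¬ Bornology.IsBounded S) {w : ℂ} (hw : w ∈ S) :
    wind c w = 0 := by
  obtain ⟨M, hM, hM'⟩ := hp.deriv'.exists_bound (hc.continuous_deriv (by norm_num))
  obtain ⟨R, hR, hR'⟩ := hp.exists_bound hc.continuous
  by_contra hne
  have hpos : 0 < ‖wind c w‖ := norm_pos_iff.2 hne
  -- A point this far away makes the integral at most half of its supposed nonzero value.
  obtain ⟨w', hw', hw'R⟩ : ∃ w' ∈ S, R + 2 * M / ‖wind c w‖ < ‖w'‖ := by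
    by_contra! h
    exact hb (isBounded_iff_forall_norm_le.2 ⟨_, h⟩)
  have e := wind_eq_of_isPreconnected hc hp hS hd hw hw'
  have hq : 0 < 2 * M / ‖wind c w‖ := by positivity
  have bound : ‖wind c w'‖ ≤ (M / (2 * M / ‖wind c w‖)) * |1 - 0| := by
    refine intervalIntegral.norm_integral_le_of_norm_le_const fun t _ => ?_
    rw [norm_div]
    have : 2 * M / ‖wind c w‖ ≤ ‖c t - w'‖ := by
      have := norm_sub_norm_le w' (c t)
      rw [norm_sub_rev] at this
      have := hR' t
      linarith
    gcongr
    exact hM' t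
  rw [← e] at bound
  have : M / (2 * M / ‖wind c w‖) * |1 - 0| = ‖wind c w‖ / 2 := by
    simp; field_simp
  linarith

/-- Components of an open set are open here, so each is also relatively closed. Consequently the
components of the exterior of a curve have their frontier on the curve. -/
theorem frontier_connectedComponentIn_inter {X : Type*} [TopologicalSpace X]
    [LocallyConnectedSpace X] {O : Set X} (hO : IsOpen O) (x : X) :
    frontier (connectedComponentIn O x) ∩ O = ∅ := by
  rw [eq_empty_iff_forall_notMem]
  rintro p ⟨hp, hpO⟩
  have h1 : IsOpen (connectedComponentIn O p) := hO.connectedComponentIn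
  have h2 : IsOpen (connectedComponentIn O x) := hO.connectedComponentIn
  obtain ⟨y, hy1, hy2⟩ := mem_closure_iff.1 (frontier_subset_closure hp) _ h1
    (mem_connectedComponentIn hpO)
  have e := (connectedComponentIn_eq hy1).trans (connectedComponentIn_eq hy2).symm
  rw [h2.frontier_eq, ← e] at hp
  exact hp.2 (mem_connectedComponentIn hpO)

/-- The interior and the exterior of `V` would separate `S`. This is the recurring tool for showing
that a connected set lies on one side of a curve or of `Γ`. -/
theorem IsPreconnected.subset_of_disjoint_frontier {X : Type*} [TopologicalSpace X] {S V : Set X}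
    (hS : IsPreconnected S) (h : (S ∩ V).Nonempty) (hd : Disjoint S (frontier V)) : S ⊆ V := by
  intro y hy
  by_contra hyV
  have h1 : S ⊆ interior V ∪ (closure V)ᶜ := fun p hp => by
    by_contra hn
    rw [mem_union, not_or, notMem_compl_iff] at hn
    exact hd.ne_of_mem hp ⟨hn.2, hn.1⟩ rfl
  have hcl : ∀ {p}, p ∈ S → p ∈ V → p ∈ interior V := fun hp hpV =>
    (h1 hp).resolve_right fun hn => hn (subset_closure hpV)
  obtain ⟨x, hxS, hxV⟩ := h
  obtain ⟨p, -, hp1, hp2⟩ := hS _ _ isOpen_interior isClosed_closure.isOpen_compl h1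
    ⟨x, hxS, hcl hxS hxV⟩ ⟨y, hy, (h1 hy).resolve_left fun hn => hyV (interior_subset hn)⟩
  exact hp2 (subset_closure (interior_subset hp1))

theorem BoundsDisc.disjoint {γ Δ : Set ℂ} (hb : BoundsDisc γ Δ) : Disjoint Δ γ := by
  rw [← hb.frontier_eq, disjoint_comm]
  rw [hb.isOpen.frontier_eq]
  exact disjoint_sdiff_left

theorem BoundsDisc.closure_eq {γ Δ : Set ℂ} (hb : BoundsDisc γ Δ) : closure Δ = Δ ∪ γ := by
  rw [← hb.frontier_eq, closure_eq_self_union_frontier]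

theorem BoundsDisc.isPreconnected {γ Δ : Set ℂ} (hb : BoundsDisc γ Δ) : IsPreconnected Δ :=
  hb.simplyConnected.isPathConnected.isConnected.isPreconnected

theorem BoundsDisc.nonempty {γ Δ : Set ℂ} (hb : BoundsDisc γ Δ) : Δ.Nonempty :=
  hb.simplyConnected.nonempty

theorem BoundsDisc.isCompact_closure {γ Δ : Set ℂ} (hb : BoundsDisc γ Δ) :
    IsCompact (closure Δ) := hb.isBounded.isCompact_closure

theorem BoundsDisc.isOpen_ext {γ Δ : Set ℂ} (hb : BoundsDisc γ Δ) : IsOpen (Δ ∪ γ)ᶜ := by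
  rw [← hb.closure_eq]; exact isClosed_closure.isOpen_compl

theorem BoundsDisc.not_isBounded_ext {γ Δ : Set ℂ} (hb : BoundsDisc γ Δ) :
    ¬ Bornology.IsBounded (Δ ∪ γ)ᶜ := by
  intro h
  have h1 : Bornology.IsBounded (Δ ∪ γ) := by
    rw [← hb.closure_eq]; exact hb.isBounded.closure
  have := h1.union h
  rw [union_compl_self] at this
  exact NoncompactSpace.noncompact_univ
    (Metric.isCompact_of_isClosed_isBounded isClosed_univ this)

theorem IsJordanParam.exists_int_near {c : ℝ → ℂ} (hc : IsJordanParam c) (t τ : ℝ) :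
    ∃ t', |t' - τ| ≤ 1 / 2 ∧ c t' = c t := by
  refine ⟨t - round (t - τ), ?_, ?_⟩
  · have := abs_sub_round (t - τ)
    rwa [show t - round (t - τ) - τ = t - τ - round (t - τ) by ring]
  · have := hc.periodic.sub_zsmul_eq (x := t) (round (t - τ))
    rwa [zsmul_one] at this

/-- The Jordan curve theorem for a regular curve: one side of the curve belongs to `Δ`, the other
one to the exterior, and the exterior is connected. -/
theorem BoundsDisc.jordan {c : ℝ → ℂ} {γ Δ : Set ℂ} (hb : BoundsDisc γ Δ)
    (hc : IsJordanParam c) (hr : range c = γ) :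
    IsPreconnected (Δ ∪ γ)ᶜ ∧ ∃ δ > 0, ∃ σ : ℝ, (σ = 1 ∨ σ = -1) ∧
      ∀ τ η, 0 < η → η < δ → collar c τ (σ * η) ∈ Δ ∧ collar c τ (-σ * η) ∈ (Δ ∪ γ)ᶜ := by
  obtain ⟨κ, hκ, δ, hδ, hlow⟩ := hc.exists_collar_lower
  obtain ⟨m, hm, hm'⟩ := hc.exists_lower_deriv
  have hoff : ∀ τ η, 0 < |η| → |η| < δ → collar c τ η ∉ γ := by
    rintro τ η h1 h2 h
    rw [← hr] at h
    obtain ⟨t, ht⟩ := h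
    obtain ⟨t', ht', e⟩ := hc.exists_int_near t τ
    have := hlow τ η t' h2.le ht'
    rw [e, ht, sub_self, norm_zero] at this
    have : 0 < κ * (|t' - τ| + |η|) := by positivity
    linarith
  -- the two sides
  let side : ℝ → Set ℂ := fun σ => (fun p : ℝ × ℝ => collar c p.1 (σ * p.2)) '' (univ ×ˢ Ioo 0 δ)
  have hside_conn : ∀ σ, IsPreconnected (side σ) := fun σ =>
    (isPreconnected_univ.prod isPreconnected_Ioo).image _
      (hc.continuous_collar.comp (continuous_fst.prodMk
        (continuous_const.mul continuous_snd))).continuousOn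
  have hside_off : ∀ σ, (σ = 1 ∨ σ = -1) → Disjoint (side σ) γ := by
    rintro σ hσ
    rw [Set.disjoint_left]
    rintro _ ⟨⟨τ, η⟩, ⟨-, h1, h2⟩, rfl⟩ h
    have e : |σ * η| = η := by
      rcases hσ with rfl | rfl <;> simp [abs_of_pos h1]
    exact hoff τ (σ * η) (by rw [e]; exact h1) (by rw [e]; exact h2) h
  -- Such a `V` has points arbitrarily close to the curve. The nearest-point normal puts one of them
  -- in a side collar, and this collar, connected and off `γ`, lies in `V` as a whole.
  have key : ∀ V : Set ℂ, V.Nonempty → Disjoint V γ → frontier V ⊆ γ →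
      side 1 ⊆ V ∨ side (-1) ⊆ V := by
    intro V hV hVγ hfr
    have hne : V ≠ univ := by
      rintro rfl
      exact Set.disjoint_left.1 hVγ (mem_univ (c 0)) (hr ▸ ⟨0, rfl⟩)
    obtain ⟨p, hp⟩ := nonempty_frontier_iff.2 ⟨hV, hne⟩
    obtain ⟨w, hw, hwp⟩ := Metric.mem_closure_iff.1 (frontier_subset_closure hp) (δ * m) (by positivity)
    obtain ⟨τ, η, e, hη⟩ := hc.exists_eq_collar w
    have hη2 : |η| < δ := by
      have h1 : Metric.infDist w (range c) ≤ dist w p :=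
        Metric.infDist_le_dist_of_mem (hr ▸ hfr hp)
      rw [← hη, dist_comm] at h1
      have h2 := h1.trans_lt hwp
      have h3 : |η| * m ≤ |η| * ‖deriv c τ‖ := by gcongr; exact hm' τ
      exact lt_of_mul_lt_mul_right (h3.trans_lt h2) hm.le
    have hη0 : η ≠ 0 := by
      rintro rfl
      rw [collar_zero] at e
      exact Set.disjoint_left.1 hVγ hw (hr ▸ ⟨τ, e.symm⟩)
    rcases hη0.lt_or_gt with h | h
    · right
      refine (hside_conn _).subset_of_disjoint_frontier ⟨w, ⟨(τ, -η), ⟨mem_univ _, ?_, ?_⟩, ?_⟩, hw⟩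
        ((hside_off _ (Or.inr rfl)).mono_right hfr)
      · simpa using h
      · rwa [abs_of_neg h] at hη2
      · simp [e]
    · left
      refine (hside_conn _).subset_of_disjoint_frontier ⟨w, ⟨(τ, η), ⟨mem_univ _, ?_, ?_⟩, ?_⟩, hw⟩
        ((hside_off _ (Or.inl rfl)).mono_right hfr)
      · exact h
      · rwa [abs_of_pos h] at hη2
      · simp [e]
  have hside_ne : ∀ σ, (side σ).Nonempty := fun σ =>
    ⟨_, (0, δ / 2), ⟨mem_univ _, half_pos hδ, half_lt_self hδ⟩, rfl⟩
  have hΔ := key Δ hb.nonempty hb.disjoint hb.frontier_eq.le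
  have hcomp : ∀ x ∈ (Δ ∪ γ)ᶜ, side 1 ⊆ connectedComponentIn (Δ ∪ γ)ᶜ x ∨
      side (-1) ⊆ connectedComponentIn (Δ ∪ γ)ᶜ x := fun x hx => by
    have hsub := connectedComponentIn_subset (Δ ∪ γ)ᶜ x
    refine key _ ⟨x, mem_connectedComponentIn hx⟩ ?_ fun p hp => ?_
    · exact Set.disjoint_left.2 fun p hp hpγ => hsub hp (Or.inr hpγ)
    · by_contra hpγ
      have h1 : p ∉ (Δ ∪ γ)ᶜ := fun h =>
        (eq_empty_iff_forall_notMem.1 (frontier_connectedComponentIn_inter hb.isOpen_ext x)) p ⟨hp, h⟩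
      rw [notMem_compl_iff] at h1
      obtain ⟨y, hy, hyΔ⟩ := mem_closure_iff.1 (frontier_subset_closure hp) Δ hb.isOpen
        (h1.resolve_right hpγ)
      exact hsub hyΔ (Or.inl hy)
  -- `Δ` occupies one side, so every component of the exterior must contain the other side; hence
  -- there is only one component.
  obtain ⟨σ, hσ, hσΔ, hσE⟩ : ∃ σ : ℝ, (σ = 1 ∨ σ = -1) ∧ side σ ⊆ Δ ∧
      ∀ x ∈ (Δ ∪ γ)ᶜ, side (-σ) ⊆ connectedComponentIn (Δ ∪ γ)ᶜ x := by
    have hcon : ∀ σ, side σ ⊆ Δ → ∀ x, ¬ side σ ⊆ connectedComponentIn (Δ ∪ γ)ᶜ x :=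
      fun σ h1 x h2 => by
        obtain ⟨y, hy⟩ := hside_ne σ
        exact connectedComponentIn_subset _ x (h2 hy) (Or.inl (h1 hy))
    rcases hΔ with h | h
    · exact ⟨1, Or.inl rfl, h, fun x hx => (hcomp x hx).resolve_left (hcon _ h x)⟩
    · refine ⟨-1, Or.inr rfl, h, fun x hx => ?_⟩
      rw [neg_neg]
      exact (hcomp x hx).resolve_right (hcon _ h x)
  obtain ⟨x₀, hx₀⟩ : (Δ ∪ γ)ᶜ.Nonempty := by
    by_contra h
    rw [not_nonempty_iff_eq_empty] at h
    exact hb.not_isBounded_ext (h ▸ Bornology.isBounded_empty)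
  refine ⟨?_, δ, hδ, σ, hσ, fun τ η h1 h2 => ⟨hσΔ ⟨(τ, η), ⟨mem_univ _, h1, h2⟩, rfl⟩,
    connectedComponentIn_subset _ x₀ (hσE x₀ hx₀ ⟨(τ, η), ⟨mem_univ _, h1, h2⟩, rfl⟩)⟩⟩
  have : (Δ ∪ γ)ᶜ = connectedComponentIn (Δ ∪ γ)ᶜ x₀ := by
    refine Subset.antisymm (fun x hx => ?_) (connectedComponentIn_subset _ _)
    obtain ⟨y, hy⟩ := hside_ne (-σ)
    rw [(connectedComponentIn_eq (hσE x₀ hx₀ hy)).trans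
      (connectedComponentIn_eq (hσE x hx hy)).symm]
    exact mem_connectedComponentIn hx
  rw [this]
  exact isPreconnected_connectedComponentIn

theorem BoundsDisc.isPreconnected_ext {γ Δ : Set ℂ} (hb : BoundsDisc γ Δ) :
    IsPreconnected (Δ ∪ γ)ᶜ := by
  obtain ⟨c, hc⟩ := hb.exists_param
  exact (hb.jordan hc.isJordanParam hc.range_eq).1

/-- Every point of the curve is a limit of exterior points. -/
theorem BoundsDisc.mem_closure_ext {γ Δ : Set ℂ} (hb : BoundsDisc γ Δ) {p : ℂ} (hp : p ∈ γ) :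
    p ∈ closure (Δ ∪ γ)ᶜ := by
  obtain ⟨c, hc⟩ := hb.exists_param
  obtain ⟨-, δ, hδ, σ, hσ, h⟩ := hb.jordan hc.isJordanParam hc.range_eq
  rw [← hc.range_eq] at hp
  obtain ⟨τ, rfl⟩ := hp
  have h1 : Tendsto (fun η : ℝ => collar c τ (-σ * η)) (𝓝[>] 0) (𝓝 (c τ)) := by
    have : Continuous fun η : ℝ => collar c τ (-σ * η) :=
      hc.isJordanParam.continuous_collar.comp (continuous_const.prodMk (by fun_prop))
    have h2 := this.tendsto 0
    simp only [mul_zero, collar_zero] at h2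
    exact h2.mono_left nhdsWithin_le_nhds
  refine mem_closure_of_tendsto h1 ?_
  filter_upwards [Ioo_mem_nhdsGT hδ] with η hη using (h τ η hη.1 hη.2).2

theorem IsPositiveParametrization.wind_eq {c : ℝ → ℂ} {γ Δ : Set ℂ}
    (hc : IsPositiveParametrization c γ Δ) {w : ℂ} (hw : w ∈ Δ) :
    wind c w = 2 * Real.pi * Complex.I := hc.winding w hw

theorem BoundsDisc.wind_ext {c : ℝ → ℂ} {γ Δ : Set ℂ} (hb : BoundsDisc γ Δ)
    (hc : IsJordanParam c) (hr : range c = γ) {w : ℂ} (hw : w ∈ (Δ ∪ γ)ᶜ) : wind c w = 0 :=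
  wind_eq_zero_of_not_isBounded (hc.contDiff.of_le (by norm_num)) hc.periodic hb.isPreconnected_ext
    (hr ▸ Set.disjoint_left.2 fun _ hp hpγ => hp (Or.inr hpγ)) hb.not_isBounded_ext hw


/-! ### Null curves, `∂̄` derivatives and the Cauchy–Pompeiu formula. -/

open MeasureTheory in
-- The curve is also the image of the plane under `z ↦ c (re z)`, whose differential is singular
-- everywhere because it kills `i`.
theorem volume_range_eq_zero {c : ℝ → ℂ} (hc : Differentiable ℝ c) : volume (range c) = 0 := by
  have h : c '' univ = (fun z : ℂ => c z.re) '' univ := by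
    rw [image_univ, image_univ]
    ext w; constructor
    · rintro ⟨t, rfl⟩; exact ⟨(t : ℂ), by simp⟩
    · rintro ⟨z, rfl⟩; exact ⟨z.re, rfl⟩
  rw [← image_univ, h]
  refine addHaar_image_eq_zero_of_det_fderivWithin_eq_zero volume
    (f' := fun z => (fderiv ℝ c z.re).comp Complex.reCLM) (fun z _ => ?_) (fun z _ => ?_)
  · exact ((hc z.re).hasFDerivAt.comp z Complex.reCLM.hasFDerivAt).hasFDerivWithinAt
  · rw [ContinuousLinearMap.det]
    by_contra hdet
    have hu := LinearMap.equivOfDetNeZero _ hdet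
    have hinj : Function.Injective ((fderiv ℝ c z.re).comp Complex.reCLM : ℂ →L[ℝ] ℂ) := by
      have := (LinearMap.equivOfDetNeZero
        (((fderiv ℝ c z.re).comp Complex.reCLM : ℂ →L[ℝ] ℂ) : ℂ →ₗ[ℝ] ℂ) hdet).injective
      exact this
    have : Complex.I = 0 := hinj (by simp)
    exact Complex.I_ne_zero this

/-- The derivative of `g` in the antiholomorphic direction belonging to `v`. -/
noncomputable def dbarDir {E : Type*} [NormedAddCommGroup E] [NormedSpace ℝ E] [SMul ℂ E]
    (g : E → ℂ) (v x : E) : ℂ :=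
  (fderiv ℝ g x v + Complex.I * fderiv ℝ g x (Complex.I • v)) / 2

theorem continuous_dbarDir {E : Type*} [NormedAddCommGroup E] [NormedSpace ℝ E] [SMul ℂ E]
    {g : E → ℂ} (hg : ContDiff ℝ 1 g) (v : E) : Continuous (dbarDir g v) := by
  have := hg.continuous_fderiv (by norm_num)
  unfold dbarDir
  fun_prop

theorem tsupport_dbarDir_subset {E : Type*} [NormedAddCommGroup E] [NormedSpace ℝ E] [SMul ℂ E]
    (g : E → ℂ) (v : E) : tsupport (dbarDir g v) ⊆ tsupport g := by
  refine closure_minimal (fun x hx => ?_) (isClosed_tsupport g)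
  by_contra h
  refine hx ?_
  have : fderiv ℝ g x = 0 := by
    by_contra hne
    exact h (support_fderiv_subset ℝ hne)
  simp [dbarDir, this]

theorem HasCompactSupport.dbarDir {E : Type*} [NormedAddCommGroup E] [NormedSpace ℝ E] [SMul ℂ E]
    {g : E → ℂ} (hg : HasCompactSupport g) (v : E) : HasCompactSupport (dbarDir g v) :=
  hg.of_isClosed_subset (isClosed_tsupport _) (tsupport_dbarDir_subset g v)

noncomputable section CauchyPompeiu
open MeasureTheory

/-- The point of the unit circle with angle `θ`. -/
def unitPt (θ : ℝ) : ℂ := Real.cos θ + Real.sin θ * Complex.I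

theorem continuous_unitPt : Continuous unitPt := by unfold unitPt; fun_prop

theorem norm_unitPt (θ : ℝ) : ‖unitPt θ‖ = 1 := by
  rw [unitPt, Complex.ofReal_cos, Complex.ofReal_sin, ← Complex.exp_mul_I]
  exact Complex.norm_exp_ofReal_mul_I θ

theorem hasDerivAt_unitPt (θ : ℝ) : HasDerivAt unitPt (Complex.I * unitPt θ) θ := by
  have h1 := (Real.hasDerivAt_cos θ).ofReal_comp
  have h2 := ((Real.hasDerivAt_sin θ).ofReal_comp).mul_const Complex.I
  refine (h1.add h2).congr_deriv ?_
  simp only [unitPt, mul_add]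
  push_cast
  linear_combination (-Complex.sin θ) * Complex.I_mul_I

theorem unitPt_inv (θ : ℝ) : (unitPt θ)⁻¹ = Real.cos θ - Real.sin θ * Complex.I := by
  have h : unitPt θ ≠ 0 := norm_ne_zero_iff.1 (by rw [norm_unitPt]; norm_num)
  field_simp
  simp only [unitPt]
  have := Complex.cos_sq_add_sin_sq (θ : ℂ)
  push_cast
  linear_combination -this + Complex.sin θ ^ 2 * Complex.I_sq

/-- The Cauchy–Pompeiu formula for functions of compact support. -/
theorem integral_dbar_div_sub {φ : ℂ → ℂ} (hφ : ContDiff ℝ 1 φ) (hs : HasCompactSupport φ)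
    (w : ℂ) : ∫ ζ, dbarDir φ 1 ζ / (ζ - w) = -Real.pi * φ w := by
  obtain ⟨R₀, hR₀⟩ := hs.isCompact.isBounded.subset_closedBall (0 : ℂ)
  set R := max (R₀ + ‖w‖) 0 with hR
  have hfc : Continuous (fderiv ℝ φ) := hφ.continuous_fderiv (by norm_num)
  have hout : ∀ r θ : ℝ, R < |r| → w + r * unitPt θ ∉ tsupport φ := fun r θ hr h => by
    have h1 := hR₀ h
    rw [mem_closedBall_zero_iff] at h1
    have h2 : ‖(r : ℂ) * unitPt θ‖ = |r| := by rw [norm_mul, norm_unitPt]; simp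
    have h3 : ‖(r : ℂ) * unitPt θ‖ - ‖w‖ ≤ ‖w + r * unitPt θ‖ := by
      rw [add_comm]; have := norm_sub_le_norm_add ((r : ℂ) * unitPt θ) w; linarith
    have := le_max_left (R₀ + ‖w‖) 0
    rw [h2] at h3
    linarith
  have hfd0 : ∀ r θ : ℝ, R < |r| → fderiv ℝ φ (w + r * unitPt θ) = 0 := fun r θ hr => by
    by_contra hne
    exact hout r θ hr (support_fderiv_subset ℝ hne)
  -- In polar coordinates around `w`, `A` is the radial derivative and `B` the angular derivative
  -- divided by `r`. The Jacobian cancels the pole, leaving `(A + iB) / 2`. The radial integral of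
  -- `A` is `-φ(w)`, and `B` integrates to zero over each circle.
  let A : ℝ × ℝ → ℂ := fun p => fderiv ℝ φ (w + p.1 * unitPt p.2) (unitPt p.2)
  let B : ℝ × ℝ → ℂ := fun p => fderiv ℝ φ (w + p.1 * unitPt p.2) (Complex.I * unitPt p.2)
  have hu := continuous_unitPt
  have hA : Continuous A := by
    have : Continuous fun p : ℝ × ℝ => w + p.1 * unitPt p.2 := by fun_prop
    exact (hfc.comp this).clm_apply (hu.comp continuous_snd)
  have hB : Continuous B := by
    have : Continuous fun p : ℝ × ℝ => w + p.1 * unitPt p.2 := by fun_prop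
    exact (hfc.comp this).clm_apply (continuous_const.mul (hu.comp continuous_snd))
  have hint : ∀ G : ℝ × ℝ → ℂ, Continuous G → (∀ p : ℝ × ℝ, R < |p.1| → G p = 0) →
      IntegrableOn G (Ioi 0 ×ˢ Ioo (-Real.pi) Real.pi) := fun G hG h0 => by
    have h1 : IntegrableOn G (Icc 0 R ×ˢ Icc (-Real.pi) Real.pi) :=
      hG.continuousOn.integrableOn_compact (isCompact_Icc.prod isCompact_Icc)
    refine h1.of_forall_sdiff_eq_zero (measurableSet_Ioi.prod measurableSet_Ioo) fun p hp => h0 p ?_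
    by_contra hle
    rw [not_lt] at hle
    refine hp.2 ⟨⟨le_of_lt hp.1.1, (le_abs_self _).trans hle⟩, Ioo_subset_Icc_self hp.1.2⟩
  have hAi := hint A hA fun p hp => by simp [A, hfd0 p.1 p.2 hp]
  have hBi := hint B hB fun p hp => by simp [B, hfd0 p.1 p.2 hp]
  have hA1 : ∀ θ : ℝ, ∫ r in Ioi (0:ℝ), A (r, θ) = - φ w := fun θ => by
    have hder : ∀ r ∈ Ici (0:ℝ), HasDerivAt (fun r : ℝ => φ (w + r * unitPt θ)) (A (r, θ)) r :=
      fun r _ => by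
        have h1 : HasDerivAt (fun r : ℝ => w + r * unitPt θ) (unitPt θ) r := by
          simpa using ((hasDerivAt_id r).ofReal_comp.mul_const (unitPt θ)).const_add w
        exact ((hφ.differentiable (by norm_num) _).hasFDerivAt).comp_hasDerivAt r h1
    have hi : IntegrableOn (fun r => A (r, θ)) (Ioi 0) := by
      refine (Continuous.integrable_of_hasCompactSupport
        (hA.comp (continuous_id.prodMk continuous_const)) ?_).integrableOn
      refine HasCompactSupport.intro (isCompact_Icc (a := -R) (b := R)) fun r hr => ?_
      have : R < |r| := by
        by_contra hle
        exact hr (abs_le.1 (not_lt.1 hle))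
      simp [A, hfd0 r θ this]
    have ht : Tendsto (fun r : ℝ => φ (w + r * unitPt θ)) atTop (𝓝 0) := by
      refine tendsto_const_nhds.congr' ?_
      filter_upwards [eventually_gt_atTop R] with r hr
      exact (image_eq_zero_of_notMem_tsupport (hout r θ (hr.trans_le (le_abs_self r)))).symm
    have := integral_Ioi_of_hasDerivAt_of_tendsto' hder hi ht
    simpa using this
  have hB1 : ∀ r ∈ Ioi (0:ℝ), ∫ θ in Ioo (-Real.pi) Real.pi, B (r, θ) = 0 := fun r hr => by
    have hr0 : (r : ℂ) ≠ 0 := by exact_mod_cast (ne_of_gt hr)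
    have hder : ∀ θ : ℝ, HasDerivAt (fun θ : ℝ => (r : ℂ)⁻¹ * φ (w + r * unitPt θ)) (B (r, θ)) θ :=
      fun θ => by
        have h1 : HasDerivAt (fun θ : ℝ => w + r * unitPt θ) (r * (Complex.I * unitPt θ)) θ :=
          ((hasDerivAt_unitPt θ).const_mul (r : ℂ)).const_add w
        have h2 := (((hφ.differentiable (by norm_num) _).hasFDerivAt).comp_hasDerivAt θ h1).const_mul
          (r : ℂ)⁻¹
        refine h2.congr_deriv ?_
        rw [← Complex.real_smul (x := r) (z := Complex.I * unitPt θ), map_smul, Complex.real_smul,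
          ← mul_assoc, inv_mul_cancel₀ hr0, one_mul]
    have hpi : -Real.pi ≤ Real.pi := by linarith [Real.pi_pos]
    rw [← integral_Ioc_eq_integral_Ioo, ← intervalIntegral.integral_of_le hpi,
      intervalIntegral.integral_eq_sub_of_hasDerivAt (fun θ _ => hder θ)
      ((hB.comp (continuous_const.prodMk continuous_id)).intervalIntegrable _ _)]
    simp [unitPt]
  have hAint : ∫ p in Ioi (0:ℝ) ×ˢ Ioo (-Real.pi) Real.pi, A p = -(2 * Real.pi) * φ w := by
    rw [Measure.volume_eq_prod] at hAi ⊢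
    rw [← setIntegral_prod_swap, setIntegral_prod (fun z : ℝ × ℝ => A z.swap) hAi.swap]
    simp only [Prod.swap_prod_mk, hA1]
    rw [setIntegral_const]
    rw [measureReal_def, Real.volume_Ioo, ENNReal.toReal_ofReal (by linarith [Real.pi_pos]),
      Complex.real_smul]
    push_cast; ring
  have hBint : ∫ p in Ioi (0:ℝ) ×ˢ Ioo (-Real.pi) Real.pi, B p = 0 := by
    rw [Measure.volume_eq_prod] at hBi ⊢
    rw [setIntegral_prod _ hBi, setIntegral_congr_fun measurableSet_Ioi hB1]
    simp
  calc ∫ ζ, dbarDir φ 1 ζ / (ζ - w) = ∫ u, dbarDir φ 1 (u + w) / u := by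
        rw [← integral_add_right_eq_self _ w]; simp
    _ = ∫ p in polarCoord.target, p.1 •
          (dbarDir φ 1 (Complex.polarCoord.symm p + w) / Complex.polarCoord.symm p) :=
        (Complex.integral_comp_polarCoord_symm fun u => dbarDir φ 1 (u + w) / u).symm
    _ = ∫ p in Ioi (0:ℝ) ×ˢ Ioo (-Real.pi) Real.pi, (1 / 2 : ℂ) * (A p + Complex.I * B p) := by
        rw [show polarCoord.target = Ioi (0:ℝ) ×ˢ Ioo (-Real.pi) Real.pi from rfl]
        refine setIntegral_congr_fun (measurableSet_Ioi.prod measurableSet_Ioo) fun p hp => ?_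
        have hr : (p.1 : ℂ) ≠ 0 := by exact_mod_cast (ne_of_gt hp.1)
        have e : Complex.polarCoord.symm p = p.1 * unitPt p.2 := by
          rw [Complex.polarCoord_symm_apply]; rfl
        have hne : unitPt p.2 ≠ 0 := norm_ne_zero_iff.1 (by rw [norm_unitPt]; norm_num)
        simp only [e, A, B, dbarDir, add_comm _ w, Complex.real_smul, smul_eq_mul, mul_one]
        set L := fderiv ℝ φ (w + p.1 * unitPt p.2)
        have hL : ∀ a b : ℝ, L (a + b * Complex.I) = a * L 1 + b * L Complex.I := fun a b => by
          rw [show (a + b * Complex.I : ℂ) = a • (1:ℂ) + b • Complex.I by simp, map_add, map_smul,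
            map_smul, Complex.real_smul, Complex.real_smul]
        have h1 : L (unitPt p.2) = Real.cos p.2 * L 1 + Real.sin p.2 * L Complex.I := hL _ _
        have h2 : L (Complex.I * unitPt p.2) = -Real.sin p.2 * L 1 + Real.cos p.2 * L Complex.I := by
          have : Complex.I * unitPt p.2 = ((-Real.sin p.2 : ℝ) : ℂ) + (Real.cos p.2 : ℝ) * Complex.I := by
            simp only [unitPt]; push_cast
            linear_combination Complex.sin p.2 * Complex.I_mul_I
          rw [this, hL]; push_cast; ring
        rw [h1, h2]
        have e3 : (p.1 : ℂ) * ((L 1 + Complex.I * L Complex.I) / 2 / (p.1 * unitPt p.2)) =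
            (L 1 + Complex.I * L Complex.I) / 2 * (unitPt p.2)⁻¹ := by
          field_simp
        rw [e3, unitPt_inv]
        linear_combination (-(Real.sin p.2 * L Complex.I) / 2) * Complex.I_mul_I
    _ = -Real.pi * φ w := by
        rw [integral_const_mul, integral_add hAi (hBi.const_mul _), integral_const_mul, hAint, hBint]
        ring
end CauchyPompeiu

/-! ### Green's formula. -/

noncomputable section Green
open MeasureTheory

/-- The Jacobian `r` of polar coordinates cancels the singularity. -/
theorem lintegral_inv_norm_ball_lt_top (R : ℝ) :
    ∫⁻ u in Metric.ball (0 : ℂ) R, ‖u‖ₑ⁻¹ < ⊤ := by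
  rw [← lintegral_indicator Metric.isOpen_ball.measurableSet,
    ← Complex.lintegral_comp_polarCoord_symm]
  have : ∫⁻ p in polarCoord.target, ENNReal.ofReal p.1 •
      (Metric.ball (0 : ℂ) R).indicator (fun u => ‖u‖ₑ⁻¹) (Complex.polarCoord.symm p) ≤
      ∫⁻ p : ℝ × ℝ, (Ioo 0 R ×ˢ Ioo (-Real.pi) Real.pi).indicator (fun _ => 1) p := by
    rw [← lintegral_indicator polarCoord.open_target.measurableSet]
    refine lintegral_mono fun p => ?_
    by_cases hp : p ∈ polarCoord.target
    · rw [indicator_of_mem hp]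
      have hn : ‖Complex.polarCoord.symm p‖ = p.1 := by
        rw [Complex.norm_polarCoord_symm, abs_of_pos hp.1]
      by_cases hb : Complex.polarCoord.symm p ∈ Metric.ball (0 : ℂ) R
      · rw [indicator_of_mem hb, indicator_of_mem]
        · rw [smul_eq_mul, ← ofReal_norm, hn]
          exact ENNReal.mul_inv_le_one _
        · rw [mem_ball_zero_iff, hn] at hb
          exact ⟨⟨hp.1, hb⟩, hp.2⟩
      · rw [indicator_of_notMem hb]; simp
    · rw [indicator_of_notMem hp]; simp
  refine this.trans_lt ?_
  rw [lintegral_indicator (measurableSet_Ioo.prod measurableSet_Ioo), setLIntegral_const, one_mul,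
    Measure.volume_eq_prod, Measure.prod_prod]
  exact ENNReal.mul_lt_top (by simp) (by simp)

/-- Uniform integrability of `ψ(ζ) / (ζ - w)` for bounded `w`. -/
theorem exists_lintegral_div_sub_le {ψ : ℂ → ℂ} (hψ : Continuous ψ) (hs : HasCompactSupport ψ)
    (R : ℝ) : ∃ C : ENNReal, C < ⊤ ∧ ∀ w, ‖w‖ ≤ R → ∫⁻ ζ, ‖ψ ζ / (ζ - w)‖ₑ ≤ C := by
  obtain ⟨M, hM⟩ := hψ.bounded_above_of_compact_support hs
  obtain ⟨R₀, hR₀⟩ := hs.isCompact.isBounded.subset_ball (0 : ℂ)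
  refine ⟨ENNReal.ofReal M * ∫⁻ u in Metric.ball (0 : ℂ) (R₀ + R), ‖u‖ₑ⁻¹,
    ENNReal.mul_lt_top ENNReal.ofReal_lt_top (lintegral_inv_norm_ball_lt_top _), fun w hw => ?_⟩
  rw [← lintegral_add_right_eq_self _ w, ← lintegral_indicator Metric.isOpen_ball.measurableSet,
    ← lintegral_const_mul']
  · refine lintegral_mono fun u => ?_
    rw [add_sub_cancel_right]
    by_cases hu : u ∈ Metric.ball (0 : ℂ) (R₀ + R)
    · rw [indicator_of_mem hu]
      by_cases h0 : u = 0
      · simp [h0]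
      · rw [div_eq_mul_inv, enorm_mul, enorm_inv h0]
        gcongr
        rw [← ofReal_norm]
        exact ENNReal.ofReal_le_ofReal (hM _)
    · rw [indicator_of_notMem hu]
      have : u + w ∉ tsupport ψ := fun h => hu (by
        have := hR₀ h
        rw [mem_ball_zero_iff] at this ⊢
        have h3 : ‖u‖ ≤ ‖u + w‖ + ‖w‖ := by
          have := norm_sub_le (u + w) w; rwa [add_sub_cancel_right] at this
        linarith)
      simp [image_eq_zero_of_notMem_tsupport this]
  · exact ENNReal.ofReal_ne_top

/-- The complex line integral of `φ` along the closed curve `c`. -/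
def curveInt (c : ℝ → ℂ) (φ : ℂ → ℂ) : ℂ := ∫ t in (0 : ℝ)..1, φ (c t) * deriv c t

/-- Green's formula for a closed curve, in terms of winding integrals. -/
theorem curveInt_eq_integral_wind {c : ℝ → ℂ} (hc : ContDiff ℝ 1 c) (hp : Function.Periodic c 1)
    {φ : ℂ → ℂ} (hφ : ContDiff ℝ 1 φ) (hs : HasCompactSupport φ) :
    curveInt c φ = (Real.pi : ℂ)⁻¹ * ∫ ζ, dbarDir φ 1 ζ * wind c ζ := by
  have hψ := continuous_dbarDir hφ (1 : ℂ)
  have hψs := hs.dbarDir (1 : ℂ)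
  have hcc : Continuous (deriv c) := hc.continuous_deriv (by norm_num)
  have hcm := hc.continuous
  obtain ⟨M, hM, hM'⟩ := hp.deriv'.exists_bound hcc
  obtain ⟨R, hR, hR'⟩ := hp.exists_bound hc.continuous
  obtain ⟨C, hC, hC'⟩ := exists_lintegral_div_sub_le hψ hψs R
  have hpi : (Real.pi : ℂ) ≠ 0 := by exact_mod_cast Real.pi_ne_zero
  have hmeas : Measurable fun p : ℝ × ℂ => dbarDir φ 1 p.2 / (p.2 - c p.1) * deriv c p.1 := by
    have h1 : Measurable fun p : ℝ × ℂ => dbarDir φ 1 p.2 := (hψ.comp continuous_snd).measurable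
    have h2 : Measurable fun p : ℝ × ℂ => p.2 - c p.1 :=
      (continuous_snd.sub (hcm.comp continuous_fst)).measurable
    have h3 : Measurable fun p : ℝ × ℂ => deriv c p.1 := (hcc.comp continuous_fst).measurable
    exact (h1.div h2).mul h3
  have hint : Integrable (fun p : ℝ × ℂ => dbarDir φ 1 p.2 / (p.2 - c p.1) * deriv c p.1)
      ((volume.restrict (Ioc (0:ℝ) 1)).prod volume) := by
    refine ⟨hmeas.aestronglyMeasurable, ?_⟩
    rw [hasFiniteIntegral_iff_enorm, lintegral_prod _ hmeas.enorm.aemeasurable]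
    calc ∫⁻ t in Ioc (0:ℝ) 1, ∫⁻ ζ, ‖dbarDir φ 1 ζ / (ζ - c t) * deriv c t‖ₑ
        ≤ ∫⁻ t in Ioc (0:ℝ) 1, C * ENNReal.ofReal M := by
          refine lintegral_mono fun t => ?_
          simp only [enorm_mul]
          rw [lintegral_mul_const' _ _ enorm_ne_top]
          gcongr
          · exact hC' _ (hR' t)
          · rw [← ofReal_norm]; exact ENNReal.ofReal_le_ofReal (hM' t)
      _ < ⊤ := by
          rw [setLIntegral_const]
          exact ENNReal.mul_lt_top (ENNReal.mul_lt_top hC ENNReal.ofReal_lt_top) (by simp)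
  have hswap := integral_integral_swap (f := fun t ζ => dbarDir φ 1 ζ / (ζ - c t) * deriv c t) hint
  -- Cauchy–Pompeiu writes each value `φ(c t)` as an area integral; after Fubini the inner integral
  -- over `t` is a winding integral.
  have h1 : ∀ t, φ (c t) * deriv c t =
      -(Real.pi : ℂ)⁻¹ * ∫ ζ, dbarDir φ 1 ζ / (ζ - c t) * deriv c t := fun t => by
    rw [integral_mul_const, integral_dbar_div_sub hφ hs]
    field_simp
  have h2 : ∀ ζ, ∫ t in Ioc (0:ℝ) 1, dbarDir φ 1 ζ / (ζ - c t) * deriv c t =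
      - (dbarDir φ 1 ζ * wind c ζ) := fun ζ => by
    rw [wind, intervalIntegral.integral_of_le zero_le_one, ← integral_const_mul, ← integral_neg]
    congr 1; ext t
    rw [← neg_sub (c t) ζ, div_neg]; ring
  rw [curveInt, intervalIntegral.integral_of_le zero_le_one]
  simp_rw [h1]
  rw [integral_const_mul, hswap]
  simp_rw [h2]
  rw [integral_neg]; ring

/-- Green's formula for the domain bounded by a positively oriented curve. -/
theorem BoundsDisc.curveInt_eq {c : ℝ → ℂ} {γ Δ : Set ℂ} (hb : BoundsDisc γ Δ)
    (hc : IsPositiveParametrization c γ Δ) {φ : ℂ → ℂ} (hφ : ContDiff ℝ 1 φ)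
    (hs : HasCompactSupport φ) :
    curveInt c φ = 2 * Complex.I * ∫ ζ in Δ, dbarDir φ 1 ζ := by
  have hj := hc.isJordanParam
  have hγ : volume γ = 0 := hc.range_eq ▸ volume_range_eq_zero hj.differentiable
  have hpi : (Real.pi : ℂ) ≠ 0 := by exact_mod_cast Real.pi_ne_zero
  rw [curveInt_eq_integral_wind (hj.contDiff.of_le (by norm_num)) hj.periodic hφ hs]
  have : ∫ ζ, dbarDir φ 1 ζ * wind c ζ =
      ∫ ζ, Δ.indicator (fun ζ => dbarDir φ 1 ζ * (2 * Real.pi * Complex.I)) ζ := by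
    refine integral_congr_ae ?_
    have hae : ∀ᵐ ζ, ζ ∉ γ := measure_eq_zero_iff_ae_notMem.1 hγ
    filter_upwards [hae] with ζ hζ
    by_cases h : ζ ∈ Δ
    · rw [indicator_of_mem h, hc.wind_eq h]
    · rw [indicator_of_notMem h, hb.wind_ext hj hc.range_eq (fun h' => h'.elim h hζ), mul_zero]
  rw [this, integral_indicator hb.isOpen.measurableSet, integral_mul_const]
  field_simp

end Green


/-! ### Smooth cutoffs, extension and approximation. -/

open Manifold in
/-- Smooth cutoff functions. -/
theorem exists_contDiff_cutoff {E : Type*} [NormedAddCommGroup E] [NormedSpace ℝ E]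
    [FiniteDimensional ℝ E] {K O : Set E} (hK : IsCompact K) (hO : IsOpen O) (hKO : K ⊆ O) :
    ∃ χ : E → ℝ, ContDiff ℝ 2 χ ∧ HasCompactSupport χ ∧ tsupport χ ⊆ O ∧
      (∀ᶠ x in 𝓝ˢ K, χ x = 1) ∧ ∀ x, χ x ∈ Icc (0 : ℝ) 1 := by
  have := FiniteDimensional.proper ℝ E
  obtain ⟨L, hL, hKL, hLO⟩ := exists_compact_between hK hO hKO
  obtain ⟨f, h1, h0, hf⟩ := exists_contMDiffMap_one_nhds_of_subset_interior (n := 2)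
    𝓘(ℝ, E) hK.isClosed hKL
  have hsub : tsupport f ⊆ L := closure_minimal (fun x hx => by
    by_contra h; exact hx (h0 x h)) hL.isClosed
  exact ⟨f, f.contMDiff.contDiff, hL.of_isClosed_subset (isClosed_tsupport _) hsub,
    hsub.trans hLO, h1, hf⟩

/-- Tietze extension in terms of functions on the whole space. -/
theorem ContinuousOn.exists_continuous_extension {X : Type*} [TopologicalSpace X] [NormalSpace X]
    {s : Set X} (hs : IsClosed s) {f : X → ℂ} (hf : ContinuousOn f s) :
    ∃ g : X → ℂ, Continuous g ∧ EqOn g f s := by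
  obtain ⟨g, hg⟩ := ContinuousMap.exists_restrict_eq hs ⟨_, hf.domRestrict⟩
  exact ⟨g, g.continuous, fun x hx => congrArg (fun k : C(s, ℂ) => k ⟨x, hx⟩) hg⟩

/-- Extend by Tietze, approximate uniformly by a smooth function, and cut off. This makes Green's
formula available for boundary data that are only continuous. -/
theorem exists_contDiff_approx_on_compact {E : Type*} [NormedAddCommGroup E] [NormedSpace ℝ E]
    [FiniteDimensional ℝ E] {K : Set E} (hK : IsCompact K) {f : E → ℂ}
    (hf : ContinuousOn f K) {ε : ℝ} (hε : 0 < ε) :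
    ∃ p : E → ℂ, ContDiff ℝ 1 p ∧ HasCompactSupport p ∧ ∀ x ∈ K, ‖p x - f x‖ ≤ ε := by
  obtain ⟨χ, hχ, hχs, -, hχ1, -⟩ := exists_contDiff_cutoff hK isOpen_univ (subset_univ K)
  obtain ⟨g, hg, hgf⟩ := hf.exists_continuous_extension hK.isClosed
  obtain ⟨p, hp, hpε, -⟩ := hg.exists_contDiff_approx 1 (ε := fun _ => ε) continuous_const
    (fun _ => hε)
  refine ⟨fun x => χ x * p x, ?_, ?_, fun x hx => ?_⟩
  · exact (Complex.ofRealCLM.contDiff.comp (hχ.of_le (by norm_num))).mul (by exact_mod_cast hp)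
  · exact (hχs.comp_left (g := fun r : ℝ => (r : ℂ)) Complex.ofReal_zero).mul_right
  · beta_reduce
    rw [hχ1.self_of_nhdsSet x hx, Complex.ofReal_one, one_mul, ← hgf hx, ← dist_eq_norm]
    exact (hpε x).le

/-! ### Line integrals over closed curves. -/

noncomputable section CurveIntegral
open MeasureTheory

/-- The length of a closed curve. -/
def curveLen (c : ℝ → ℂ) : ℝ := ∫ t in (0 : ℝ)..1, ‖deriv c t‖

theorem curveLen_nonneg (c : ℝ → ℂ) : 0 ≤ curveLen c :=
  intervalIntegral.integral_nonneg zero_le_one fun _ _ => norm_nonneg _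

theorem norm_curveInt_le {c : ℝ → ℂ} (hc : ContDiff ℝ 1 c) {φ : ℂ → ℂ} {ε : ℝ}
    (hφ : ∀ w ∈ range c, ‖φ w‖ ≤ ε) : ‖curveInt c φ‖ ≤ ε * curveLen c := by
  have hcc : Continuous (deriv c) := hc.continuous_deriv (by norm_num)
  rw [curveInt, curveLen, ← intervalIntegral.integral_const_mul]
  refine intervalIntegral.norm_integral_le_of_norm_le zero_le_one (ae_of_all _ fun t _ => ?_)
    ((continuous_const.mul hcc.norm).intervalIntegrable _ _)
  rw [norm_mul]
  gcongr
  exact hφ _ ⟨t, rfl⟩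

theorem intervalIntegrable_curve {c : ℝ → ℂ} (hc : ContDiff ℝ 1 c) {φ : ℂ → ℂ}
    (hφ : ContinuousOn φ (range c)) (a b : ℝ) :
    IntervalIntegrable (fun t => φ (c t) * deriv c t) volume a b := by
  have hcc : Continuous (deriv c) := hc.continuous_deriv (by norm_num)
  exact ((hφ.comp_continuous hc.continuous fun t => ⟨t, rfl⟩).mul hcc).intervalIntegrable _ _

theorem curveInt_sub {c : ℝ → ℂ} (hc : ContDiff ℝ 1 c) {φ ψ : ℂ → ℂ}
    (hφ : ContinuousOn φ (range c)) (hψ : ContinuousOn ψ (range c)) :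
    curveInt c (fun w => φ w - ψ w) = curveInt c φ - curveInt c ψ := by
  simp only [curveInt, sub_mul]
  exact intervalIntegral.integral_sub (intervalIntegrable_curve hc hφ _ _)
    (intervalIntegrable_curve hc hψ _ _)

theorem curveInt_congr {c : ℝ → ℂ} {φ ψ : ℂ → ℂ} (h : EqOn φ ψ (range c)) :
    curveInt c φ = curveInt c ψ := by
  simp only [curveInt]
  congr 1; ext t; rw [h ⟨t, rfl⟩]

theorem curveInt_const_mul {c : ℝ → ℂ} (a : ℂ) (φ : ℂ → ℂ) :
    curveInt c (fun w => a * φ w) = a * curveInt c φ := by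
  simp only [curveInt, mul_assoc]
  exact intervalIntegral.integral_const_mul _ _

theorem IsPositiveParametrization.contDiff_one {c : ℝ → ℂ} {γ Δ : Set ℂ}
    (hc : IsPositiveParametrization c γ Δ) : ContDiff ℝ 1 c :=
  hc.isJordanParam.contDiff.of_le (by norm_num)

theorem IsPositiveParametrization.isCompact {c : ℝ → ℂ} {γ Δ : Set ℂ}
    (hc : IsPositiveParametrization c γ Δ) : IsCompact γ :=
  hc.range_eq ▸ isCompact_range_of_periodic hc.periodic hc.contDiff_one.continuous

/-- The line integral does not depend on the positive parametrization. -/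
theorem BoundsDisc.curveInt_eq_curveInt {c c' : ℝ → ℂ} {γ Δ : Set ℂ} (hb : BoundsDisc γ Δ)
    (hc : IsPositiveParametrization c γ Δ) (hc' : IsPositiveParametrization c' γ Δ) {φ : ℂ → ℂ}
    (hφ : ContinuousOn φ γ) : curveInt c φ = curveInt c' φ := by
  rw [← sub_eq_zero, ← norm_eq_zero]
  refine le_antisymm (le_of_forall_pos_le_add fun ε hε => ?_) (norm_nonneg _)
  have hL : 0 < curveLen c + curveLen c' + 1 := by
    linarith [curveLen_nonneg c, curveLen_nonneg c']
  obtain ⟨p, hp, hps, hpφ⟩ := exists_contDiff_approx_on_compact hc.isCompact hφ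
    (div_pos hε hL)
  -- After smooth approximation, Green's formula produces an area integral over `Δ` in which the
  -- parametrization does not occur.
  have key : ∀ d, IsPositiveParametrization d γ Δ →
      ‖curveInt d φ - 2 * Complex.I * ∫ ζ in Δ, dbarDir p 1 ζ‖ ≤
        ε / (curveLen c + curveLen c' + 1) * curveLen d := fun d hd => by
    rw [← hb.curveInt_eq hd hp hps, ← curveInt_sub hd.contDiff_one (hd.range_eq ▸ hφ)
      hp.continuous.continuousOn]
    refine norm_curveInt_le hd.contDiff_one fun w hw => ?_
    rw [norm_sub_rev]
    exact hpφ w (hd.range_eq ▸ hw)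
  have h1 := key c hc
  have h2 := key c' hc'
  rw [norm_sub_rev] at h2
  have h3 := norm_sub_le_norm_sub_add_norm_sub (curveInt c φ)
    (2 * Complex.I * ∫ ζ in Δ, dbarDir p 1 ζ) (curveInt c' φ)
  have h4 : ε / (curveLen c + curveLen c' + 1) * (curveLen c + curveLen c') ≤ ε := by
    rw [div_mul_eq_mul_div, div_le_iff₀ hL]; nlinarith
  linarith [mul_add (ε / (curveLen c + curveLen c' + 1)) (curveLen c) (curveLen c')]

/-- A holomorphic function on an open set integrates to zero along a closed curve that does not
wind around the points of the complement. -/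
theorem curveInt_eq_zero_of_wind {c : ℝ → ℂ} (hc : ContDiff ℝ 1 c) (hp : Function.Periodic c 1)
    {Δ : Set ℂ} (hΔ : IsOpen Δ) (hb : Bornology.IsBounded Δ) (hr : range c ⊆ Δ)
    (hw : ∀ w ∉ Δ, wind c w = 0) {g : ℂ → ℂ} (hg : DifferentiableOn ℂ g Δ) :
    curveInt c g = 0 := by
  -- A compact subset of `Δ`, outside which the winding integral is zero. Cut off near `Z`, `g`
  -- becomes a test function for Green's formula and stays holomorphic near `Z`, so at each point
  -- one factor of the area integrand vanishes.
  set Z : Set ℂ := {w | wind c w ≠ 0} ∪ range c with hZ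
  have hZΔ : Z ⊆ Δ := by
    rintro w (h | h)
    · by_contra hn; exact h (hw w hn)
    · exact hr h
  have hrc := isCompact_range_of_periodic hp hc.continuous
  have hZc : IsClosed Z := by
    rw [← isOpen_compl_iff, isOpen_iff_mem_nhds]
    intro w hw
    simp only [hZ, mem_compl_iff, mem_union, not_or, mem_ofPred_eq, not_not] at hw
    obtain ⟨r, hr0, hrb⟩ := Metric.isOpen_iff.1 hrc.isClosed.isOpen_compl w hw.2
    filter_upwards [Metric.ball_mem_nhds w hr0] with y hy hyZ
    rcases hyZ with h | h
    · refine h ?_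
      rw [wind_eq_of_isPreconnected hc hp (convex_ball w r).isPreconnected
        (Set.disjoint_left.2 fun p hp => hrb hp) hy (Metric.mem_ball_self hr0), hw.1]
    · exact hrb hy h
  have hZK : IsCompact Z := Metric.isCompact_of_isClosed_isBounded hZc (hb.subset hZΔ)
  obtain ⟨χ, hχ, hχs, hχΔ, hχ1, -⟩ := exists_contDiff_cutoff hZK hΔ hZΔ
  set φ : ℂ → ℂ := fun w => χ w * g w with hφ
  have hts : tsupport φ ⊆ tsupport χ := by
    refine closure_mono fun w hw => ?_
    rw [Function.mem_support] at hw ⊢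
    intro h; exact hw (by simp [hφ, h])
  have hφd : ContDiff ℝ 1 φ := by
    rw [contDiff_iff_contDiffAt]
    intro x
    by_cases hx : x ∈ tsupport φ
    · have h1 : ContDiffAt ℂ 1 g x := (hg.analyticAt (hΔ.mem_nhds (hχΔ (hts hx)))).contDiffAt
      exact (Complex.ofRealCLM.contDiff.comp (hχ.of_le (by norm_num))).contDiffAt.mul
        (h1.restrict_scalars ℝ)
    · exact contDiffAt_const.congr_of_eventuallyEq
        (notMem_tsupport_iff_eventuallyEq.1 hx)
  have hφs : HasCompactSupport φ := hχs.of_isClosed_subset (isClosed_tsupport _) hts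
  have e : curveInt c g = curveInt c φ := curveInt_congr fun w hw => by
    simp [hφ, hχ1.self_of_nhdsSet w (Or.inr hw)]
  rw [e, curveInt_eq_integral_wind hc hp hφd hφs]
  have : ∀ ζ, dbarDir φ 1 ζ * wind c ζ = 0 := fun ζ => by
    by_cases hζ : ζ ∈ Z
    · have h1 : φ =ᶠ[𝓝 ζ] g := by
        filter_upwards [eventually_nhdsSet_iff_forall.1 hχ1 ζ hζ] with w hw
        simp [hφ, hw]
      have h2 : DifferentiableAt ℂ g ζ := hg.differentiableAt (hΔ.mem_nhds (hZΔ hζ))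
      have h3 : fderiv ℝ g ζ = (fderiv ℂ g ζ).restrictScalars ℝ :=
        h2.fderiv_restrictScalars ℝ
      rw [dbarDir, h1.fderiv_eq, h3]
      simp only [ContinuousLinearMap.coe_restrictScalars']
      rw [map_smul, smul_eq_mul, ← mul_assoc, Complex.I_mul_I]
      ring
    · have : wind c ζ = 0 := by
        by_contra h; exact hζ (Or.inl h)
      rw [this, mul_zero]
  simp [this]

end CurveIntegral


/-! ### Cauchy integrals, moments and the jump relation. -/

noncomputable section Jump
open MeasureTheory

theorem IsJordanParam.contDiff_collar {c : ℝ → ℂ} (hc : IsJordanParam c) (s : ℝ) :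
    ContDiff ℝ 1 fun t => collar c t s := by
  unfold collar
  exact (hc.contDiff.of_le (by norm_num)).add (contDiff_const.mul hc.contDiff_deriv)

theorem IsJordanParam.deriv_collar {c : ℝ → ℂ} (hc : IsJordanParam c) (s t : ℝ) :
    deriv (fun t => collar c t s) t = deriv c t + s * Complex.I * deriv (deriv c) t := by
  have h1 := (hc.differentiable t).hasDerivAt
  have h2 := (hc.contDiff_deriv.differentiable (by norm_num) t).hasDerivAt
  exact (h1.add (h2.const_mul (s * Complex.I))).deriv

/-- Cauchy's theorem for functions continuous up to the boundary. -/
theorem BoundsDisc.curveInt_eq_zero {c : ℝ → ℂ} {γ Δ : Set ℂ} (hb : BoundsDisc γ Δ)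
    (hc : IsJordanParam c) (hr : range c = γ) {g : ℂ → ℂ}
    (hg : ContinuousOn g (Δ ∪ γ)) (hd : DifferentiableOn ℂ g Δ) : curveInt c g = 0 := by
  obtain ⟨-, δ, hδ, σ, hσ, hside⟩ := hb.jordan hc hr
  have hcomp : IsCompact (Δ ∪ γ) := hb.closure_eq ▸ hb.isCompact_closure
  obtain ⟨M, hM⟩ := hcomp.exists_bound_of_continuousOn hg
  obtain ⟨M₁, hM₁, hM₁'⟩ := hc.periodic.deriv'.exists_bound hc.continuous_deriv
  obtain ⟨M₂, hM₂, hM₂'⟩ := hc.periodic.deriv'.deriv'.exists_bound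
    (hc.contDiff_deriv.continuous_deriv (by norm_num))
  have hcc2 := hc.contDiff_deriv.continuous_deriv (by norm_num)
  -- The parallel curve at height `s` lies inside `Δ`. The complement of `Δ` is connected, being
  -- between the exterior and its closure, and unbounded, so the parallel curve does not wind around
  -- its points.
  have hzero : ∀ s ∈ Ioo 0 δ, curveInt (fun t => collar c t (σ * s)) g = 0 := fun s hs => by
    have hp : Function.Periodic (fun t => collar c t (σ * s)) 1 := fun t => by
      simp only [collar, hc.periodic t, hc.periodic.deriv' t]
    have hrs : range (fun t => collar c t (σ * s)) ⊆ Δ := by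
      rintro _ ⟨t, rfl⟩; exact (hside t s hs.1 hs.2).1
    refine curveInt_eq_zero_of_wind (hc.contDiff_collar _) hp hb.isOpen hb.isBounded hrs ?_ hd
    intro w hw
    refine wind_eq_zero_of_not_isBounded (hc.contDiff_collar _) hp (S := Δᶜ) ?_
      (Set.disjoint_left.2 fun p h1 h2 => h1 (hrs h2)) ?_ hw
    · refine hb.isPreconnected_ext.subset_closure (compl_subset_compl.2 subset_union_left) ?_
      intro p hp
      by_cases h : p ∈ γ
      · exact hb.mem_closure_ext h
      · exact subset_closure fun h' => h'.elim hp h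
    · intro h
      exact hb.not_isBounded_ext (h.subset (compl_subset_compl.2 subset_union_left))
  -- Only continuity of `g` up to the boundary enters here; the tangents converge because `c` is
  -- `C²`.
  have hlim : Tendsto (fun s : ℝ => curveInt (fun t => collar c t (σ * s)) g) (𝓝[>] 0)
      (𝓝 (curveInt c g)) := by
    refine intervalIntegral.tendsto_integral_filter_of_dominated_convergence
      (fun _ => M * (M₁ + δ * M₂)) ?_ ?_ intervalIntegrable_const ?_
    · filter_upwards [Ioo_mem_nhdsGT hδ] with s hs
      have h1 : Continuous fun t => g (collar c t (σ * s)) :=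
        hg.comp_continuous (hc.contDiff_collar _).continuous
          fun t => Or.inl (hside t s hs.1 hs.2).1
      exact (h1.mul ((hc.contDiff_collar _).continuous_deriv (by norm_num))).aestronglyMeasurable
    · filter_upwards [Ioo_mem_nhdsGT hδ] with s hs
      refine ae_of_all _ fun t _ => ?_
      have hM0 : 0 ≤ M := (norm_nonneg _).trans (hM _ (Or.inl (hside t s hs.1 hs.2).1))
      rw [norm_mul, hc.deriv_collar]
      refine mul_le_mul (hM _ (Or.inl (hside t s hs.1 hs.2).1)) ?_ (norm_nonneg _) hM0
      refine (norm_add_le _ _).trans (add_le_add (hM₁' t) ?_)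
      rw [norm_mul, norm_mul, Complex.norm_I, mul_one, Complex.norm_real, Real.norm_eq_abs]
      refine mul_le_mul ?_ (hM₂' t) (norm_nonneg _) hδ.le
      have : |σ * s| = s := by rcases hσ with rfl | rfl <;> simp [abs_of_pos hs.1]
      rw [this]; exact hs.2.le
    · refine ae_of_all _ fun t _ => ?_
      refine Tendsto.mul ?_ ?_
      · have h1 : Tendsto (fun s : ℝ => collar c t (σ * s)) (𝓝[>] 0) (𝓝[Δ ∪ γ] (c t)) := by
          refine tendsto_nhdsWithin_iff.2 ⟨?_, ?_⟩
          · have : Continuous fun s : ℝ => collar c t (σ * s) :=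
              hc.continuous_collar.comp (continuous_const.prodMk (by fun_prop))
            have h2 := this.tendsto 0
            simp only [mul_zero, collar_zero] at h2
            exact h2.mono_left nhdsWithin_le_nhds
          · filter_upwards [Ioo_mem_nhdsGT hδ] with s hs using Or.inl (hside t s hs.1 hs.2).1
        exact (hg (c t) (Or.inr (hr ▸ ⟨t, rfl⟩))).tendsto.comp h1
      · simp only [hc.deriv_collar]
        have : Continuous fun s : ℝ => deriv c t + ((σ * s : ℝ) : ℂ) * Complex.I *
            deriv (deriv c) t := by fun_prop
        have h2 := this.tendsto 0
        simp only [mul_zero, Complex.ofReal_zero, zero_mul, add_zero] at h2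
        exact h2.mono_left nhdsWithin_le_nhds
  refine tendsto_nhds_unique hlim (tendsto_const_nhds.congr' ?_)
  filter_upwards [Ioo_mem_nhdsGT hδ] with s hs using (hzero s hs).symm

/-- The Cauchy integral of `φ` over `c`, without the factor `(2πi)⁻¹`. -/
def cauchyInt (c : ℝ → ℂ) (φ : ℂ → ℂ) (w : ℂ) : ℂ := curveInt c fun ζ => φ ζ / (ζ - w)

theorem differentiableOn_cauchyInt {c : ℝ → ℂ} (hc : ContDiff ℝ 1 c)
    (hp : Function.Periodic c 1) {φ : ℂ → ℂ} (hφ : ContinuousOn φ (range c)) :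
    DifferentiableOn ℂ (cauchyInt c φ) (range c)ᶜ := by
  intro w hw
  have hrc := isCompact_range_of_periodic hp hc.continuous
  obtain ⟨r, hr, hrb⟩ := Metric.isOpen_iff.1 hrc.isClosed.isOpen_compl w hw
  obtain ⟨S, hS⟩ := hrc.exists_bound_of_continuousOn hφ
  have hcc : Continuous (deriv c) := hc.continuous_deriv (by norm_num)
  have hφc : Continuous fun t => φ (c t) := hφ.comp_continuous hc.continuous fun t => ⟨t, rfl⟩
  have hcm := hc.continuous
  obtain ⟨M, hM, hM'⟩ := hp.deriv'.exists_bound hcc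
  have hne : ∀ x ∈ Metric.ball w (r / 2), ∀ t, r / 2 ≤ ‖c t - x‖ := fun x hx t => by
    by_contra! h
    have hcr : c t ∈ Metric.ball w r := by
      rw [Metric.mem_ball] at hx ⊢
      have := dist_triangle (c t) x w
      rw [dist_eq_norm (c t) x] at this
      linarith
    exact hrb hcr ⟨t, rfl⟩
  have hne0 : ∀ x ∈ Metric.ball w (r / 2), ∀ t, c t - x ≠ 0 := fun x hx t h => by
    have := hne x hx t
    rw [h, norm_zero] at this; linarith
  have hcont : ∀ x ∈ Metric.ball w (r / 2),
      Continuous fun t => φ (c t) / (c t - x) * deriv c t := fun x hx =>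
    (hφc.div (hcm.sub continuous_const) (hne0 x hx)).mul hcc
  have key := intervalIntegral.hasDerivAt_integral_of_dominated_loc_of_deriv_le
    (μ := volume) (a := 0) (b := 1)
    (F := fun x t => φ (c t) / (c t - x) * deriv c t)
    (F' := fun x t => φ (c t) / (c t - x) ^ 2 * deriv c t) (x₀ := w)
    (s := Metric.ball w (r / 2)) (bound := fun _ => S / (r / 2) ^ 2 * M)
    (Metric.ball_mem_nhds w (half_pos hr)) ?_ ?_ ?_ ?_ ?_ ?_
  · exact key.2.differentiableAt.differentiableWithinAt
  · filter_upwards [Metric.ball_mem_nhds w (half_pos hr)] with x hx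
    exact (hcont x hx).aestronglyMeasurable
  · exact (hcont w (Metric.mem_ball_self (half_pos hr))).intervalIntegrable _ _
  · refine Continuous.aestronglyMeasurable ?_
    exact (hφc.div ((hcm.sub continuous_const).pow 2)
      fun t => pow_ne_zero 2 (hne0 w (Metric.mem_ball_self (half_pos hr)) t)).mul hcc
  · refine ae_of_all _ fun t _ x hx => ?_
    rw [norm_mul, norm_div, norm_pow]
    have := hne x hx t
    have h2 := hS (c t) ⟨t, rfl⟩
    have h3 : 0 ≤ S := (norm_nonneg _).trans h2
    gcongr
    exact hM' t
  · exact intervalIntegrable_const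
  · refine ae_of_all _ fun t _ x hx => ?_
    have h1 : HasDerivAt (fun x => c t - x) (-1) x := by
      simpa using (hasDerivAt_id x).const_sub (c t)
    have h2 := (h1.inv (hne0 x hx t)).const_mul (φ (c t)) |>.mul_const (deriv c t)
    refine h2.congr_deriv ?_
    rw [neg_neg]; ring

/-- A Cauchy integral with vanishing moments vanishes outside the curve. -/
theorem BoundsDisc.cauchyInt_eq_zero_of_moments {c : ℝ → ℂ} {γ Δ : Set ℂ} (hb : BoundsDisc γ Δ)
    (hc : IsJordanParam c) (hr : range c = γ) {φ : ℂ → ℂ} (hφ : ContinuousOn φ γ)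
    (hm : ∀ k : ℕ, curveInt c (fun ζ => φ ζ * ζ ^ k) = 0) {w : ℂ} (hw : w ∈ (Δ ∪ γ)ᶜ) :
    cauchyInt c φ w = 0 := by
  have hc1 : ContDiff ℝ 1 c := hc.contDiff.of_le (by norm_num)
  obtain ⟨R, hR, hR'⟩ := hc.periodic.exists_bound hc.continuous
  obtain ⟨S, hS⟩ := (isCompact_range_of_periodic hc.periodic hc.continuous).exists_bound_of_continuousOn
    (hr ▸ hφ)
  -- For `|w| > R` the geometric expansion of the kernel leaves the moments, which vanish, and a
  -- remainder of order `(R / |w|)^N`. The connectedness of the exterior then propagates the zero by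
  -- the identity theorem.
  have hfar : ∀ w : ℂ, R < ‖w‖ → cauchyInt c φ w = 0 := fun w hw => by
    have hw0 : w ≠ 0 := norm_ne_zero_iff.1 (hR.trans hw).ne'
    have hne : ∀ ζ ∈ range c, ζ - w ≠ 0 := by
      rintro _ ⟨t, rfl⟩ h
      rw [sub_eq_zero] at h
      have := hR' t; rw [h] at this; linarith
    have hcont : ∀ N : ℕ, ContinuousOn (fun ζ => φ ζ / (ζ - w) * (ζ / w) ^ N) (range c) := fun N =>
      ((hr ▸ hφ : ContinuousOn φ (range c)).div (by fun_prop) hne).mul (by fun_prop)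
    have step : ∀ N : ℕ, cauchyInt c φ w = curveInt c fun ζ => φ ζ / (ζ - w) * (ζ / w) ^ N := by
      intro N
      induction N with
      | zero => simp [cauchyInt]
      | succ N ih =>
        rw [ih, ← sub_eq_zero, ← curveInt_sub hc1 (hcont N) (hcont (N + 1))]
        have : EqOn (fun ζ => φ ζ / (ζ - w) * (ζ / w) ^ N - φ ζ / (ζ - w) * (ζ / w) ^ (N + 1))
            (fun ζ => (-(w ^ (N + 1))⁻¹) * (φ ζ * ζ ^ N)) (range c) := fun ζ hζ => by
          have := hne ζ hζ
          simp only [div_pow]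
          field_simp
          ring
        rw [curveInt_congr this, curveInt_const_mul, hm, mul_zero]
    have hle : ∀ N : ℕ, ‖cauchyInt c φ w‖ ≤ S / (‖w‖ - R) * (R / ‖w‖) ^ N * curveLen c :=
      fun N => by
        rw [step N]
        refine norm_curveInt_le hc1 ?_
        rintro _ ⟨t, rfl⟩
        rw [norm_mul, norm_div, norm_pow, norm_div]
        have h1 : ‖w‖ - R ≤ ‖c t - w‖ := by
          have := norm_sub_norm_le w (c t); rw [norm_sub_rev] at this; linarith [hR' t]
        have h2 := hS _ ⟨t, rfl⟩
        have h3 : 0 ≤ S := (norm_nonneg _).trans h2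
        have h4 : 0 < ‖w‖ - R := by linarith
        gcongr
        exact hR' t
    have ht : Tendsto (fun N : ℕ => S / (‖w‖ - R) * (R / ‖w‖) ^ N * curveLen c) atTop (𝓝 0) := by
      have := tendsto_pow_atTop_nhds_zero_of_lt_one (r := R / ‖w‖) (by positivity)
        ((div_lt_one (hR.trans hw)).2 hw)
      simpa using (this.const_mul (S / (‖w‖ - R))).mul_const (curveLen c)
    exact norm_le_zero_iff.1 (ge_of_tendsto' ht hle)
  have hd : DifferentiableOn ℂ (cauchyInt c φ) (Δ ∪ γ)ᶜ :=
    (differentiableOn_cauchyInt hc1 hc.periodic (hr ▸ hφ)).mono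
      (compl_subset_compl.2 (hr ▸ subset_union_right))
  obtain ⟨w₀, hw₀, hw₀R⟩ : ∃ w₀ ∈ (Δ ∪ γ)ᶜ, R < ‖w₀‖ := by
    by_contra! h
    exact hb.not_isBounded_ext (isBounded_iff_forall_norm_le.2 ⟨R, h⟩)
  refine (hd.analyticOnNhd hb.isOpen_ext).eqOn_zero_of_preconnected_of_eventuallyEq_zero
    hb.isPreconnected_ext hw₀ ?_ hw
  filter_upwards [(isOpen_lt continuous_const continuous_norm).mem_nhds hw₀R] with w hw
  exact hfar w hw

theorem Function.Periodic.uniformContinuous {f : ℝ → ℂ} (hf : Function.Periodic f 1)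
    (hc : Continuous f) : UniformContinuous f := by
  rw [Metric.uniformContinuous_iff]
  intro ε hε
  obtain ⟨δ, hδ, h⟩ := Metric.uniformContinuousOn_iff.1
    (isCompact_Icc.uniformContinuousOn_of_continuous (s := Icc (-1 : ℝ) 2) hc.continuousOn) ε hε
  refine ⟨min δ 1, by positivity, fun a b hab => ?_⟩
  have e : ∀ x, f (x - ⌊a⌋) = f x := fun x => by
    have := hf.sub_zsmul_eq (x := x) ⌊a⌋
    rwa [zsmul_one] at this
  rw [← e a, ← e b]
  have h0 := Int.fract_nonneg a
  have h1 := Int.fract_lt_one a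
  rw [Int.fract] at h0 h1
  have h2 := hab.trans_le (min_le_right _ _)
  rw [Real.dist_eq, abs_lt] at h2
  refine h _ ⟨by linarith, by linarith⟩ _ ⟨by linarith, by linarith⟩ ?_
  rw [dist_sub_right]
  exact hab.trans_le (min_le_left _ _)

/-- The primitive is an arctangent. What matters is that the bound does not depend on the distance
`a` to the boundary. -/
theorem integral_poisson_le {a : ℝ} (ha : 0 < a) (τ x y : ℝ) :
    ∫ t in x..y, a / ((t - τ) ^ 2 + a ^ 2) ≤ Real.pi := by
  have hder : ∀ t, HasDerivAt (fun t => Real.arctan ((t - τ) / a))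
      (a / ((t - τ) ^ 2 + a ^ 2)) t := fun t => by
    have h := (((hasDerivAt_id t).sub_const τ).div_const a).arctan
    refine h.congr_deriv ?_
    have : (t - τ) ^ 2 + a ^ 2 ≠ 0 := by positivity
    have : a ^ 2 + (t - τ) ^ 2 ≠ 0 := by positivity
    simp only [id]
    field_simp
    ring
  have hcont : Continuous fun t => a / ((t - τ) ^ 2 + a ^ 2) :=
    continuous_const.div (by fun_prop) fun t => by positivity
  rw [intervalIntegral.integral_eq_sub_of_hasDerivAt (fun t _ => hder t)
    (hcont.intervalIntegrable _ _)]
  linarith [Real.arctan_lt_pi_div_two ((y - τ) / a), Real.neg_pi_div_two_lt_arctan ((x - τ) / a)]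

/-- Reflect the point `w` in the curve to `w'`. The Cauchy integral vanishes at `w'`, so it may be
subtracted; the difference of the two kernels has total integral `2πi` and is bounded by a Poisson
kernel, hence it concentrates at `τ`. All constants are uniform in `τ`. -/
theorem BoundsDisc.cauchyInt_near {c : ℝ → ℂ} {γ Δ : Set ℂ} (hb : BoundsDisc γ Δ)
    (hc : IsPositiveParametrization c γ Δ) {φ : ℂ → ℂ} (hφ : ContinuousOn φ γ)
    (hext : ∀ w ∈ (Δ ∪ γ)ᶜ, cauchyInt c φ w = 0) {ε : ℝ} (hε : 0 < ε) :
    ∃ η₀ > 0, ∀ τ η, |η| < η₀ → collar c τ η ∈ Δ →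
      ‖cauchyInt c φ (collar c τ η) - 2 * Real.pi * Complex.I * φ (c τ)‖ ≤ ε := by
  have hj := hc.isJordanParam
  have hr := hc.range_eq
  have hc1 := hc.contDiff_one
  obtain ⟨-, δ, hδ, σ, hσ, hside⟩ := hb.jordan hj hr
  obtain ⟨κ, hκ, δ', hδ', hlow⟩ := hj.exists_collar_lower
  obtain ⟨M, hM, hM'⟩ := hc.periodic.deriv'.exists_bound hj.continuous_deriv
  set ψ : ℝ → ℂ := fun t => φ (c t) with hψ
  have hψc : Continuous ψ := hφ.comp_continuous hj.continuous fun t => hr ▸ ⟨t, rfl⟩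
  have hψp : Function.Periodic ψ 1 := fun t => by simp only [hψ, hc.periodic t]
  obtain ⟨S, hS, hS'⟩ := hψp.exists_bound hψc
  -- The constant in the comparison of the difference kernel with the Poisson kernel.
  set C := 2 * M ^ 2 / κ ^ 2 with hC
  have hC0 : 0 < C := by positivity
  have hε' : 0 < ε / (2 * C * Real.pi) := by have := Real.pi_pos; positivity
  obtain ⟨ρ, hρ, hρ'⟩ := Metric.uniformContinuous_iff.1
    (hψp.uniformContinuous hψc) _ hε'
  -- With this constant the oscillation of `ψ` is at most a small number plus `D (t - τ)²` for every
  -- `t`. The quadratic part, multiplied by the Poisson kernel, contributes no more than `D |η|`.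
  set D := 2 * S / ρ ^ 2 with hD
  have hD0 : 0 < D := by positivity
  refine ⟨min (min δ δ') (ε / (2 * C * D)), by positivity, fun τ η hη hw => ?_⟩
  have hη1 : |η| < δ := hη.trans_le ((min_le_left _ _).trans (min_le_left _ _))
  have hη2 : |η| < δ' := hη.trans_le ((min_le_left _ _).trans (min_le_right _ _))
  have hη3 : |η| < ε / (2 * C * D) := hη.trans_le (min_le_right _ _)
  have hη0 : η ≠ 0 := by
    rintro rfl
    rw [collar_zero] at hw
    exact Set.disjoint_left.1 hb.disjoint hw (hr ▸ ⟨τ, rfl⟩)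
  have ha : 0 < |η| := abs_pos.2 hη0
  -- The other sign would put `w` in the exterior.
  have hησ : η = σ * |η| := by
    have h1 := hside τ |η| ha hη1
    by_contra hne
    have : η = -σ * |η| := by
      rcases hσ with rfl | rfl <;> rcases abs_choice η with h | h <;> rw [h] at hne ⊢ <;>
        first | (exfalso; apply hne; ring1) | ring1
    rw [← this] at h1
    exact h1.2 (Or.inl hw)
  have hw' : collar c τ (-η) ∈ (Δ ∪ γ)ᶜ := by
    have := (hside τ |η| ha hη1).2
    rwa [neg_mul, ← hησ] at this
  set w := collar c τ η with hwdef
  set w' := collar c τ (-η) with hwdef'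
  have hne : ∀ t, c t - w ≠ 0 := fun t h =>
    Set.disjoint_left.1 hb.disjoint hw (hr ▸ ⟨t, sub_eq_zero.1 h⟩)
  have hne' : ∀ t, c t - w' ≠ 0 := fun t h => hw' (Or.inr (hr ▸ ⟨t, sub_eq_zero.1 h⟩))
  have hcm := hj.continuous
  have hcc := hj.continuous_deriv
  set K : ℝ → ℂ := fun t => deriv c t / (c t - w) - deriv c t / (c t - w') with hK
  have i1 : Continuous fun t => deriv c t / (c t - w) := hcc.div (hcm.sub continuous_const) hne
  have i2 : Continuous fun t => deriv c t / (c t - w') := hcc.div (hcm.sub continuous_const) hne'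
  have hKc : Continuous K := i1.sub i2
  have hKint : ∫ t in (0:ℝ)..1, K t = 2 * Real.pi * Complex.I := by
    rw [hK, intervalIntegral.integral_sub (i1.intervalIntegrable _ _) (i2.intervalIntegrable _ _)]
    have h1 := hc.wind_eq hw
    have h2 := hb.wind_ext hj hr hw'
    rw [wind] at h1 h2
    rw [h1, h2, sub_zero]
  have hφK : cauchyInt c φ w = ∫ t in (0:ℝ)..1, ψ t * K t := by
    rw [← sub_zero (cauchyInt c φ w), ← hext w' hw', cauchyInt, cauchyInt, curveInt, curveInt,
      ← intervalIntegral.integral_sub]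
    · congr 1; ext t; simp only [hK, hψ]; ring
    · exact ((hψc.div (hcm.sub continuous_const) hne).mul hcc).intervalIntegrable _ _
    · exact ((hψc.div (hcm.sub continuous_const) hne').mul hcc).intervalIntegrable _ _
  -- The period is shifted so that `τ` is its midpoint and `|t - τ| ≤ 1 / 2`, as the collar estimate
  -- requires.
  have hdiff : cauchyInt c φ w - 2 * Real.pi * Complex.I * φ (c τ) =
      ∫ t in (τ - 1/2)..(τ - 1/2 + 1), (ψ t - ψ τ) * K t := by
    have hper : Function.Periodic (fun t => (ψ t - ψ τ) * K t) 1 := fun t => by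
      simp only [hK, hψp t, hc.periodic t, hc.periodic.deriv' t]
    rw [hper.intervalIntegral_add_eq (τ - 1/2) 0, zero_add, hφK, ← hKint,
      ← intervalIntegral.integral_mul_const, ← intervalIntegral.integral_sub]
    · congr 1; ext t; simp only [hψ]; ring
    · exact (hψc.mul hKc).intervalIntegrable _ _
    · exact (hKc.mul continuous_const).intervalIntegrable _ _
  rw [hdiff]
  have hKb : ∀ t, |t - τ| ≤ 1 / 2 → ‖K t‖ ≤ C * (|η| / ((t - τ) ^ 2 + |η| ^ 2)) := fun t ht => by
    have l1 := hlow τ η t hη2.le ht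
    have l2 := hlow τ (-η) t (by rw [abs_neg]; exact hη2.le) ht
    rw [abs_neg] at l2
    have e : K t = deriv c t * (2 * η * Complex.I * deriv c τ) / ((c t - w) * (c t - w')) := by
      have h1 := hne t
      have h2 := hne' t
      have : w - w' = 2 * η * Complex.I * deriv c τ := by
        simp only [hwdef, hwdef', collar]; push_cast; ring
      rw [← this]
      simp only [hK]
      field_simp
      ring
    have h3 : κ ^ 2 * ((t - τ) ^ 2 + |η| ^ 2) ≤ ‖c t - w‖ * ‖c t - w'‖ := by
      calc κ ^ 2 * ((t - τ) ^ 2 + |η| ^ 2) ≤ (κ * (|t - τ| + |η|)) * (κ * (|t - τ| + |η|)) := by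
            rw [← sq_abs (t - τ)]
            nlinarith [mul_nonneg (abs_nonneg (t - τ)) ha.le, sq_nonneg κ,
              mul_nonneg (sq_nonneg κ) (mul_nonneg (abs_nonneg (t - τ)) ha.le)]
        _ ≤ _ := by gcongr
    rw [e, norm_div, norm_mul, norm_mul (c t - w), norm_mul _ (deriv c τ), norm_mul, norm_mul,
      Complex.norm_I, Complex.norm_real, Real.norm_eq_abs]
    have h4 : 0 < (t - τ) ^ 2 + |η| ^ 2 := by positivity
    calc ‖deriv c t‖ * (‖(2:ℂ)‖ * |η| * 1 * ‖deriv c τ‖) / (‖c t - w‖ * ‖c t - w'‖)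
        ≤ M * (2 * |η| * 1 * M) / (κ ^ 2 * ((t - τ) ^ 2 + |η| ^ 2)) := by
          gcongr
          · exact hM' t
          · simp
          · exact hM' τ
      _ = C * (|η| / ((t - τ) ^ 2 + |η| ^ 2)) := by rw [hC]; field_simp
  have hψb : ∀ t, ‖ψ t - ψ τ‖ ≤ ε / (2 * C * Real.pi) + D * (t - τ) ^ 2 := fun t => by
    by_cases h : |t - τ| < ρ
    · have := hρ' (by rwa [Real.dist_eq] : dist t τ < ρ)
      rw [dist_eq_norm] at this
      nlinarith [sq_nonneg (t - τ)]
    · push Not at h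
      have h1 : ‖ψ t - ψ τ‖ ≤ 2 * S := (norm_sub_le _ _).trans (by linarith [hS' t, hS' τ])
      have h2 : 2 * S ≤ D * (t - τ) ^ 2 := by
        rw [hD, div_mul_eq_mul_div, le_div_iff₀ (by positivity), ← sq_abs (t - τ)]
        gcongr
      linarith
  have hle : τ - 1/2 ≤ τ - 1/2 + 1 := by linarith
  have hpc : Continuous fun t => |η| / ((t - τ) ^ 2 + |η| ^ 2) :=
    continuous_const.div (by fun_prop) fun t => by positivity
  calc ‖∫ t in (τ - 1/2)..(τ - 1/2 + 1), (ψ t - ψ τ) * K t‖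
      ≤ ∫ t in (τ - 1/2)..(τ - 1/2 + 1), (ε / (2 * Real.pi) * (|η| / ((t - τ) ^ 2 + |η| ^ 2))
          + C * D * |η|) := by
        refine intervalIntegral.norm_integral_le_of_norm_le hle (ae_of_all _ fun t ht => ?_)
          (((continuous_const.mul hpc).add continuous_const).intervalIntegrable _ _)
        have ht' : |t - τ| ≤ 1 / 2 := abs_le.2 ⟨by linarith [ht.1], by linarith [ht.2]⟩
        rw [norm_mul]
        have h4 : 0 < (t - τ) ^ 2 + |η| ^ 2 := by positivity
        have h5 : (t - τ) ^ 2 / ((t - τ) ^ 2 + |η| ^ 2) ≤ 1 := by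
          rw [div_le_one h4]; nlinarith [sq_nonneg η]
        calc ‖ψ t - ψ τ‖ * ‖K t‖ ≤ (ε / (2 * C * Real.pi) + D * (t - τ) ^ 2) *
              (C * (|η| / ((t - τ) ^ 2 + |η| ^ 2))) :=
              mul_le_mul (hψb t) (hKb t ht') (norm_nonneg _) (by positivity)
          _ = ε / (2 * Real.pi) * (|η| / ((t - τ) ^ 2 + |η| ^ 2)) +
              C * D * |η| * ((t - τ) ^ 2 / ((t - τ) ^ 2 + |η| ^ 2)) := by
              have := Real.pi_pos; field_simp
          _ ≤ _ := by
              exact add_le_add_right (mul_le_of_le_one_right (by positivity) h5) _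
    _ ≤ ε / 2 + C * D * |η| := by
        have i3 : Continuous fun t => ε / (2 * Real.pi) * (|η| / ((t - τ) ^ 2 + |η| ^ 2)) :=
          continuous_const.mul hpc
        rw [intervalIntegral.integral_add (i3.intervalIntegrable _ _) intervalIntegrable_const, intervalIntegral.integral_const_mul,
          intervalIntegral.integral_const]
        have h1 := integral_poisson_le ha τ (τ - 1/2) (τ - 1/2 + 1)
        have h2 : ε / (2 * Real.pi) * ∫ t in (τ - 1/2)..(τ - 1/2 + 1),
            |η| / ((t - τ) ^ 2 + |η| ^ 2) ≤ ε / (2 * Real.pi) * Real.pi := by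
          have := Real.pi_pos; gcongr
        have h3 : ε / (2 * Real.pi) * Real.pi = ε / 2 := by have := Real.pi_pos; field_simp
        rw [add_sub_cancel_left, one_smul]
        linarith
    _ ≤ ε := by
        have : C * D * |η| ≤ C * D * (ε / (2 * C * D)) := by gcongr
        have h3 : C * D * (ε / (2 * C * D)) = ε / 2 := by field_simp
        linarith

open Classical in
/-- The Cauchy integral with boundary values `φ` on the curve. -/
def cauchyExt (c : ℝ → ℂ) (φ : ℂ → ℂ) (w : ℂ) : ℂ :=
  if w ∈ range c then φ w else (2 * Real.pi * Complex.I)⁻¹ * cauchyInt c φ w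

theorem two_pi_I_ne_zero : (2 * Real.pi * Complex.I : ℂ) ≠ 0 := by
  simp [Real.pi_ne_zero]

theorem BoundsDisc.cauchyExt_of_mem {c : ℝ → ℂ} {γ Δ : Set ℂ} (hb : BoundsDisc γ Δ)
    (hr : range c = γ) {φ : ℂ → ℂ} {w : ℂ} (hw : w ∈ Δ) :
    cauchyExt c φ w = (2 * Real.pi * Complex.I)⁻¹ * cauchyInt c φ w :=
  if_neg fun h => Set.disjoint_left.1 hb.disjoint hw (hr ▸ h)

/-- If the Cauchy integral vanishes outside the curve, it extends `φ` to the inside. -/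
theorem BoundsDisc.continuousOn_cauchyExt {c : ℝ → ℂ} {γ Δ : Set ℂ} (hb : BoundsDisc γ Δ)
    (hc : IsPositiveParametrization c γ Δ) {φ : ℂ → ℂ} (hφ : ContinuousOn φ γ)
    (hext : ∀ w ∈ (Δ ∪ γ)ᶜ, cauchyInt c φ w = 0) :
    DifferentiableOn ℂ (cauchyExt c φ) Δ ∧ ContinuousOn (cauchyExt c φ) (Δ ∪ γ) := by
  have hj := hc.isJordanParam
  have hr := hc.range_eq
  have hdiff : DifferentiableOn ℂ (cauchyExt c φ) Δ := by
    have h1 := (differentiableOn_cauchyInt hc.contDiff_one hc.periodic (hr ▸ hφ)).mono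
      (s := Δ) fun w hw h => Set.disjoint_left.1 hb.disjoint hw (hr ▸ h)
    exact (h1.const_mul _).congr fun w hw => hb.cauchyExt_of_mem hr hw
  refine ⟨hdiff, fun w hw => ?_⟩
  rcases hw with hw | hw
  · exact (hdiff.differentiableAt (hb.isOpen.mem_nhds hw)).continuousAt.continuousWithinAt
  · rw [Metric.continuousWithinAt_iff']
    intro ε hε
    have hval : ∀ p ∈ γ, cauchyExt c φ p = φ p := fun p hp => if_pos (hr ▸ hp)
    have h2 : 0 < ‖(2 * Real.pi * Complex.I : ℂ)‖ := norm_pos_iff.2 two_pi_I_ne_zero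
    obtain ⟨η₀, hη₀, hnear⟩ := hb.cauchyInt_near hc hφ hext
      (ε := ε / 2 * ‖(2 * Real.pi * Complex.I : ℂ)‖) (by positivity)
    obtain ⟨ρ, hρ, hφρ⟩ := Metric.continuousOn_iff.1 hφ w hw (ε / 2) (half_pos hε)
    obtain ⟨m, hm, hm'⟩ := hj.exists_lower_deriv
    have hmin : 0 < min (ρ / 2) (η₀ * m) := by positivity
    filter_upwards [mem_nhdsWithin_of_mem_nhds (Metric.ball_mem_nhds w hmin),
      self_mem_nhdsWithin] with x hx hxm
    rw [Metric.mem_ball] at hx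
    rw [hval w hw]
    have hx1 := hx.trans_le (min_le_left _ _)
    have hx2 := hx.trans_le (min_le_right _ _)
    rcases hxm with hxΔ | hxγ
    -- The value at an inner point is compared with the value at its nearest boundary point, which
    -- is also close to `w`.
    · obtain ⟨τ, η, e, hη⟩ := hj.exists_eq_collar x
      have hinf : Metric.infDist x (range c) ≤ dist x w :=
        Metric.infDist_le_dist_of_mem (hr ▸ hw)
      have hη1 : |η| < η₀ := by
        have : |η| * m ≤ |η| * ‖deriv c τ‖ := by gcongr; exact hm' τ
        rw [hη] at this
        exact lt_of_mul_lt_mul_right ((this.trans hinf).trans_lt hx2) hm.le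
      have h3 := hnear τ η hη1 (e ▸ hxΔ)
      rw [← e] at h3
      have h4 : dist (c τ) w < ρ := by
        have h5 : dist x (c τ) = |η| * ‖deriv c τ‖ := by
          rw [e, collar, dist_eq_norm, add_sub_cancel_left, norm_mul, norm_mul, Complex.norm_I,
            mul_one, Complex.norm_real, Real.norm_eq_abs]
        have := dist_triangle_left (c τ) w x
        rw [h5, hη] at this
        linarith
      have h5 := hφρ (c τ) (hr ▸ ⟨τ, rfl⟩) h4
      have h6 : dist (cauchyExt c φ x) (φ (c τ)) ≤ ε / 2 := by
        rw [hb.cauchyExt_of_mem hr hxΔ, dist_eq_norm]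
        have : (2 * Real.pi * Complex.I)⁻¹ * cauchyInt c φ x - φ (c τ) =
            (2 * Real.pi * Complex.I)⁻¹ *
              (cauchyInt c φ x - 2 * Real.pi * Complex.I * φ (c τ)) := by
          rw [mul_sub, ← mul_assoc, inv_mul_cancel₀ two_pi_I_ne_zero, one_mul]
        rw [this, norm_mul, norm_inv]
        calc _ ≤ ‖(2 * Real.pi * Complex.I : ℂ)‖⁻¹ * (ε / 2 * ‖(2 * Real.pi * Complex.I : ℂ)‖) := by
              gcongr
          _ = ε / 2 := by field_simp
      linarith [dist_triangle (cauchyExt c φ x) (φ (c τ)) (φ w)]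
    · rw [hval x hxγ]
      have := hφρ x hxγ (by linarith)
      linarith

end Jump


/-! ### Weighted power series, a monomial order and Dickson's lemma. -/

noncomputable section PowerSeriesDivision

/-- The natural number `∏ pᵢ ^ αᵢ` (with `pᵢ` the `i`-th prime) that encodes a multi-index. -/
def multiCode {m : ℕ} (α : Fin m → ℕ) : ℕ := ∏ i : Fin m, Nat.nth Nat.Prime (i : ℕ) ^ α i

theorem multiCode_add {m : ℕ} (α β : Fin m → ℕ) :
    multiCode (α + β) = multiCode α * multiCode β := by
  simp [multiCode, pow_add, Finset.prod_mul_distrib]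

theorem multiCode_pos {m : ℕ} (α : Fin m → ℕ) : 0 < multiCode α :=
  Finset.prod_pos fun i _ => pow_pos (Nat.prime_nth_prime i).pos _

/-- Unique factorization. Comparing codes is therefore a well-founded total order on multi-indices
that respects addition, which is the monomial order used for division. -/
theorem multiCode_injective (m : ℕ) : Function.Injective (multiCode (m := m)) := by
  intro α β h
  have key : ∀ (α : Fin m → ℕ) (j : Fin m),
      (multiCode α).factorization (Nat.nth Nat.Prime j) = α j := fun α j => by
    rw [multiCode, Nat.factorization_prod (S := Finset.univ)
      (g := fun i : Fin m => Nat.nth Nat.Prime (i : ℕ) ^ α i)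
      fun i _ => pow_ne_zero _ (Nat.prime_nth_prime i).ne_zero]
    simp only [Finsupp.coe_finsetSum, Finset.sum_apply]
    rw [Finset.sum_eq_single j]
    · simp
    · intro i _ hij
      have : Nat.nth Nat.Prime i ≠ Nat.nth Nat.Prime j := fun h =>
        hij (Fin.ext (Nat.nth_injective Nat.infinite_setOfPred_prime h))
      simp [Finsupp.single_eq_of_ne, this.symm]
    · simp
  funext j
  rw [← key α j, ← key β j, h]

/-- The weight of a multi-index. -/
def multiWeight {m : ℕ} (σ : ℕ) (α : Fin m → ℕ) : ℝ := ((multiCode α : ℝ) ^ σ)⁻¹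

theorem multiWeight_pos {m : ℕ} (σ : ℕ) (α : Fin m → ℕ) : 0 < multiWeight σ α := by
  have := multiCode_pos α
  unfold multiWeight; positivity

theorem multiWeight_add {m : ℕ} (σ : ℕ) (α β : Fin m → ℕ) :
    multiWeight σ (α + β) = multiWeight σ α * multiWeight σ β := by
  simp [multiWeight, multiCode_add, mul_pow, mul_comm]

theorem multiWeight_le_one {m : ℕ} (σ : ℕ) (α : Fin m → ℕ) : multiWeight σ α ≤ 1 := by
  have : (1 : ℝ) ≤ multiCode α := by exact_mod_cast multiCode_pos α
  exact inv_le_one_of_one_le₀ (one_le_pow₀ this)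

theorem multiWeight_anti {m : ℕ} {σ σ' : ℕ} (h : σ ≤ σ') (α : Fin m → ℕ) :
    multiWeight σ' α ≤ multiWeight σ α := by
  have : (1 : ℝ) ≤ multiCode α := by exact_mod_cast multiCode_pos α
  unfold multiWeight
  gcongr

/-- One more power of the code in the weight makes terms with large code small; the division
algorithm ends with this gain. -/
theorem multiWeight_succ {m : ℕ} (σ : ℕ) (α : Fin m → ℕ) :
    multiWeight (σ + 1) α = multiWeight σ α / multiCode α := by
  simp [multiWeight, pow_succ, div_eq_mul_inv, mul_comm]

/-- The monomial `s ^ α`. -/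
def multiPow {m : ℕ} (s : Fin m → ℝ) (α : Fin m → ℕ) : ℝ := ∏ i, s i ^ α i

theorem multiPow_add {m : ℕ} (s : Fin m → ℝ) (α β : Fin m → ℕ) :
    multiPow s (α + β) = multiPow s α * multiPow s β := by
  simp [multiPow, pow_add, Finset.prod_mul_distrib]

/-- The polydisc on which the monomials are bounded by the weights. -/
def weightPolydisc (m σ : ℕ) : Set (Fin m → ℝ) :=
  {s | ∀ i : Fin m, |s i| ≤ ((Nat.nth Nat.Prime i : ℝ) ^ σ)⁻¹}

theorem abs_multiPow_le {m σ : ℕ} {s : Fin m → ℝ} (hs : s ∈ weightPolydisc m σ)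
    (α : Fin m → ℕ) : |multiPow s α| ≤ multiWeight σ α := by
  rw [multiPow, multiWeight, multiCode, Finset.abs_prod]
  push_cast
  rw [← Finset.prod_pow, ← Finset.prod_inv_distrib]
  refine Finset.prod_le_prod (fun i _ => abs_nonneg _) fun i _ => ?_
  rw [abs_pow, ← pow_mul, mul_comm, pow_mul, ← inv_pow]
  exact pow_le_pow_left₀ (abs_nonneg _) (hs i) _

/-- Absolute convergence of the power series with coefficients `b`, at the weights `σ`. -/
def WSummable {m : ℕ} (σ : ℕ) (b : (Fin m → ℕ) → ℝ) : Prop :=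
  Summable fun α => |b α| * multiWeight σ α

def wNorm {m : ℕ} (σ : ℕ) (b : (Fin m → ℕ) → ℝ) : ℝ := ∑' α, |b α| * multiWeight σ α

def psEval {m : ℕ} (b : (Fin m → ℕ) → ℝ) (s : Fin m → ℝ) : ℝ := ∑' α, b α * multiPow s α

theorem wNorm_nonneg {m : ℕ} (σ : ℕ) (b : (Fin m → ℕ) → ℝ) : 0 ≤ wNorm σ b :=
  tsum_nonneg fun α => mul_nonneg (abs_nonneg _) (multiWeight_pos σ α).le

theorem WSummable.mono {m σ σ' : ℕ} {b : (Fin m → ℕ) → ℝ} (hb : WSummable σ b) (h : σ ≤ σ') :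
    WSummable σ' b :=
  Summable.of_nonneg_of_le (fun α => mul_nonneg (abs_nonneg _) (multiWeight_pos σ' α).le)
    (fun α => mul_le_mul_of_nonneg_left (multiWeight_anti h α) (abs_nonneg _)) hb

theorem WSummable.summable_eval {m σ : ℕ} {b : (Fin m → ℕ) → ℝ} (hb : WSummable σ b)
    {s : Fin m → ℝ} (hs : s ∈ weightPolydisc m σ) : Summable fun α => b α * multiPow s α := by
  refine Summable.of_norm_bounded hb fun α => ?_
  rw [Real.norm_eq_abs, abs_mul]
  exact mul_le_mul_of_nonneg_left (abs_multiPow_le hs α) (abs_nonneg _)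

theorem WSummable.add {m σ : ℕ} {b b' : (Fin m → ℕ) → ℝ} (hb : WSummable σ b)
    (hb' : WSummable σ b') : WSummable σ (b + b') :=
  Summable.of_nonneg_of_le (fun α => mul_nonneg (abs_nonneg _) (multiWeight_pos σ α).le)
    (fun α => by
      rw [Pi.add_apply, ← add_mul]
      exact mul_le_mul_of_nonneg_right (abs_add_le _ _) (multiWeight_pos σ α).le)
    (Summable.add hb hb')

theorem WSummable.smul {m σ : ℕ} {b : (Fin m → ℕ) → ℝ} (hb : WSummable σ b) (c : ℝ) :
    WSummable σ (c • b) :=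
  (Summable.mul_left |c| hb).congr fun α => by simp [abs_mul, mul_assoc]

open Classical in
/-- Multiplication of a power series by the monomial `s ^ β`. -/
def psShift {m : ℕ} (β : Fin m → ℕ) : ((Fin m → ℕ) → ℝ) →ₗ[ℝ] ((Fin m → ℕ) → ℝ) where
  toFun b α := if β ≤ α then b (α - β) else 0
  map_add' b b' := by ext α; by_cases h : β ≤ α <;> simp [h]
  map_smul' c b := by ext α; by_cases h : β ≤ α <;> simp [h]

theorem psShift_apply_add {m : ℕ} (β α : Fin m → ℕ) (b : (Fin m → ℕ) → ℝ) :
    psShift β b (β + α) = b α := by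
  simp [psShift]

theorem psShift_apply_of_not {m : ℕ} {β α : Fin m → ℕ} (b : (Fin m → ℕ) → ℝ) (h : ¬ β ≤ α) :
    psShift β b α = 0 := by
  simp [psShift, h]

theorem psShift_psShift {m : ℕ} (β β' : Fin m → ℕ) (b : (Fin m → ℕ) → ℝ) :
    psShift β (psShift β' b) = psShift (β + β') b := by
  ext α
  by_cases h : β ≤ α
  · obtain ⟨α', rfl⟩ := exists_add_of_le h
    rw [psShift_apply_add]
    by_cases h' : β' ≤ α'
    · obtain ⟨α'', rfl⟩ := exists_add_of_le h'
      rw [psShift_apply_add, ← add_assoc, psShift_apply_add]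
    · rw [psShift_apply_of_not _ h', psShift_apply_of_not]
      intro h2; exact h' (by simpa using h2)
  · rw [psShift_apply_of_not _ h, psShift_apply_of_not]
    intro h2; exact h (le_trans (by simp) h2)

/-- The exponents that are at least `β` are exactly the translates `β + α`, so the sum can be
reindexed. -/
theorem hasSum_shift {m : ℕ} (β : Fin m → ℕ) {g : (Fin m → ℕ) → ℝ} {f : (Fin m → ℕ) → ℝ} {a : ℝ}
    (hf : HasSum f a) (h1 : ∀ α, g (β + α) = f α) (h0 : ∀ α, ¬ β ≤ α → g α = 0) : HasSum g a := by
  have hinj : Function.Injective fun α : Fin m → ℕ => β + α := add_right_injective β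
  refine (hinj.hasSum_iff fun α hα => h0 α fun h => hα ?_).1 (?_ : HasSum (g ∘ fun α => β + α) a)
  · obtain ⟨α', rfl⟩ := exists_add_of_le h
    exact ⟨α', rfl⟩
  · simpa [Function.comp_def, h1] using hf

theorem hasSum_wNorm_shift {m σ : ℕ} (β : Fin m → ℕ) {b : (Fin m → ℕ) → ℝ} (hb : WSummable σ b) :
    HasSum (fun α => |psShift β b α| * multiWeight σ α) (multiWeight σ β * wNorm σ b) := by
  refine hasSum_shift β (hb.hasSum.mul_left (multiWeight σ β)) (fun α => ?_) fun α h => ?_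
  · rw [psShift_apply_add, multiWeight_add]; ring
  · simp [psShift_apply_of_not b h]

theorem WSummable.psShift {m σ : ℕ} {b : (Fin m → ℕ) → ℝ} (hb : WSummable σ b) (β : Fin m → ℕ) :
    WSummable σ (psShift β b) := (hasSum_wNorm_shift β hb).summable

theorem psEval_shift {m σ : ℕ} (β : Fin m → ℕ) {b : (Fin m → ℕ) → ℝ} (hb : WSummable σ b)
    {s : Fin m → ℝ} (hs : s ∈ weightPolydisc m σ) :
    psEval (psShift β b) s = multiPow s β * psEval b s := by
  refine (hasSum_shift β ((hb.summable_eval hs).hasSum.mul_left (multiPow s β)) (fun α => ?_)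
    fun α h => ?_).tsum_eq
  · rw [psShift_apply_add, multiPow_add]; ring
  · simp [psShift_apply_of_not b h]

theorem psEval_add {m σ : ℕ} {b b' : (Fin m → ℕ) → ℝ} (hb : WSummable σ b)
    (hb' : WSummable σ b') {s : Fin m → ℝ} (hs : s ∈ weightPolydisc m σ) :
    psEval (b + b') s = psEval b s + psEval b' s := by
  rw [psEval, psEval, psEval, ← (hb.summable_eval hs).tsum_add (hb'.summable_eval hs)]
  congr 1; ext α; simp [add_mul]

theorem psEval_smul {m : ℕ} (c : ℝ) (b : (Fin m → ℕ) → ℝ) (s : Fin m → ℝ) :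
    psEval (c • b) s = c * psEval b s := by
  rw [psEval, psEval, ← tsum_mul_left]
  congr 1; ext α; simp [mul_assoc]

/-- The real span of the monomial multiples of a family of power series. -/
def psModule {m : ℕ} (a : ℕ → (Fin m → ℕ) → ℝ) : Submodule ℝ ((Fin m → ℕ) → ℝ) :=
  Submodule.span ℝ {f | ∃ j β, f = psShift β (a j)}

theorem psShift_mem {m : ℕ} {a : ℕ → (Fin m → ℕ) → ℝ} {f : (Fin m → ℕ) → ℝ}
    (hf : f ∈ psModule a) (β : Fin m → ℕ) : psShift β f ∈ psModule a := by
  refine Submodule.span_induction (p := fun f _ => psShift β f ∈ psModule a) ?_ ?_ ?_ ?_ hf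
  · rintro _ ⟨j, β', rfl⟩
    exact Submodule.subset_span ⟨j, β + β', psShift_psShift _ _ _⟩
  · simp
  · intro x y _ _ hx hy; rw [map_add]; exact add_mem hx hy
  · intro c x _ hx; rw [map_smul]; exact Submodule.smul_mem _ c hx

theorem mem_psModule {m : ℕ} (a : ℕ → (Fin m → ℕ) → ℝ) (j : ℕ) : a j ∈ psModule a := by
  refine Submodule.subset_span ⟨j, 0, ?_⟩
  ext α
  conv_rhs => rw [← zero_add α]
  rw [psShift_apply_add]

theorem wsummable_of_mem {m σ : ℕ} {a : ℕ → (Fin m → ℕ) → ℝ} (ha : ∀ j, WSummable σ (a j))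
    {f : (Fin m → ℕ) → ℝ} (hf : f ∈ psModule a) : WSummable σ f := by
  refine Submodule.span_induction (p := fun f _ => WSummable σ f) ?_ ?_ ?_ ?_ hf
  · rintro _ ⟨j, β, rfl⟩; exact (ha j).psShift β
  · simp [WSummable, summable_zero]
  · intro x y _ _ hx hy; exact hx.add hy
  · intro c x _ hx; exact hx.smul c

/-- Members of the span are bounded by finitely many generators. -/
theorem exists_eval_le_of_mem {m σ : ℕ} {a : ℕ → (Fin m → ℕ) → ℝ} (ha : ∀ j, WSummable σ (a j))
    {f : (Fin m → ℕ) → ℝ} (hf : f ∈ psModule a) : ∃ (N : ℕ) (C : ℝ), 0 ≤ C ∧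
      ∀ s ∈ weightPolydisc m σ, ∀ μ, (∀ i ≤ N, |psEval (a i) s| ≤ μ) → |psEval f s| ≤ C * μ := by
  refine Submodule.span_induction (p := fun f _ => ∃ (N : ℕ) (C : ℝ), 0 ≤ C ∧
      ∀ s ∈ weightPolydisc m σ, ∀ μ, (∀ i ≤ N, |psEval (a i) s| ≤ μ) → |psEval f s| ≤ C * μ)
    ?_ ?_ ?_ ?_ hf
  · rintro _ ⟨j, β, rfl⟩
    refine ⟨j, 1, zero_le_one, fun s hs μ hμ => ?_⟩
    rw [psEval_shift β (ha j) hs, abs_mul]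
    exact mul_le_mul ((abs_multiPow_le hs β).trans (multiWeight_le_one σ β)) (hμ j le_rfl)
      (abs_nonneg _) zero_le_one
  · exact ⟨0, 0, le_rfl, fun s _ μ _ => by simp [psEval]⟩
  · rintro x y hx hy ⟨N, C, hC, h⟩ ⟨N', C', hC', h'⟩
    refine ⟨max N N', C + C', by positivity, fun s hs μ hμ => ?_⟩
    rw [psEval_add (wsummable_of_mem ha hx) (wsummable_of_mem ha hy) hs, add_mul]
    exact (abs_add_le _ _).trans (add_le_add
      (h s hs μ fun i hi => hμ i (hi.trans (le_max_left _ _)))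
      (h' s hs μ fun i hi => hμ i (hi.trans (le_max_right _ _))))
  · rintro c x hx ⟨N, C, hC, h⟩
    refine ⟨N, |c| * C, by positivity, fun s hs μ hμ => ?_⟩
    rw [psEval_smul, abs_mul, mul_assoc]
    exact mul_le_mul_of_nonneg_left (h s hs μ hμ) (abs_nonneg _)

/-- `α` is the leading exponent of `f`, the one with the smallest code. -/
def IsLeadExp {m : ℕ} (f : (Fin m → ℕ) → ℝ) (α : Fin m → ℕ) : Prop :=
  f α ≠ 0 ∧ ∀ β, f β ≠ 0 → multiCode α ≤ multiCode β

/-- Dickson's lemma. -/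
theorem exists_finite_basis {m : ℕ} (S : Set (Fin m → ℕ)) :
    ∃ T ⊆ S, T.Finite ∧ ∀ α ∈ S, ∃ τ ∈ T, τ ≤ α := by
  refine ⟨{τ | Minimal (· ∈ S) τ}, fun τ hτ => hτ.prop, ?_, fun α hα => ?_⟩
  · exact (setOfPred_minimal_antichain _).finite_of_partiallyWellOrderedOn (Set.isPWO_of_wellQuasiOrderedLE _)
  · obtain ⟨τ, hτα, hτ⟩ := exists_minimal_le_of_wellFoundedLT (· ∈ S) α hα
    exact ⟨τ, hτ, hτα⟩

/-- For large weights the leading term of a power series dominates the others. -/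
theorem eventually_lead_dominates {m σ₀ : ℕ} {f : (Fin m → ℕ) → ℝ} (hf : WSummable σ₀ f)
    {τ : Fin m → ℕ} (hτ : IsLeadExp f τ) (h1 : f τ = 1) :
    ∀ᶠ σ in atTop, wNorm σ f ≤ 3 / 2 * multiWeight σ τ := by
  have hn : (0 : ℝ) < multiCode τ := by exact_mod_cast multiCode_pos τ
  -- Every other exponent that occurs has code at least `multiCode τ + 1`. Raising the weight
  -- exponent by `k` thus shrinks its term, relative to the leading one, by at least `q^k`.
  set q : ℝ := multiCode τ / (multiCode τ + 1) with hq
  have hq1 : q < 1 := by rw [hq, div_lt_one (by positivity)]; linarith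
  have ht : Tendsto (fun k : ℕ => wNorm σ₀ f * q ^ k) atTop (𝓝 0) := by
    simpa using (tendsto_pow_atTop_nhds_zero_of_lt_one (by positivity) hq1).const_mul (wNorm σ₀ f)
  have hev := (ht.eventually (gt_mem_nhds (show 0 < 1 / 2 * multiWeight σ₀ τ by
    have := multiWeight_pos σ₀ τ; positivity)))
  obtain ⟨k₀, hk₀⟩ := eventually_atTop.1 hev
  refine eventually_atTop.2 ⟨σ₀ + k₀, fun σ hσ => ?_⟩
  obtain ⟨k, rfl⟩ := Nat.exists_eq_add_of_le (le_of_add_le_left hσ)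
  have hk := hk₀ k (by omega)
  have hsum : WSummable (σ₀ + k) f := hf.mono (by omega)
  have hpt : ∀ α, |f α| * multiWeight (σ₀ + k) α ≤
      (if α = τ then multiWeight (σ₀ + k) τ else 0) +
        (|f α| * multiWeight σ₀ α) * (q ^ k / (multiCode τ : ℝ) ^ k) := fun α => by
    by_cases h : α = τ
    · subst h
      rw [if_pos rfl, h1, abs_one, one_mul]
      have := multiWeight_pos σ₀ α
      have : 0 ≤ 1 * multiWeight σ₀ α * (q ^ k / (multiCode α : ℝ) ^ k) := by positivity
      linarith
    · rw [if_neg h, zero_add]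
      by_cases h0 : f α = 0
      · simp [h0]
      have hlt : multiCode τ < multiCode α :=
        lt_of_le_of_ne (hτ.2 α h0) fun e => h (multiCode_injective m e.symm)
      have hlt' : (multiCode τ : ℝ) + 1 ≤ multiCode α := by exact_mod_cast hlt
      have hα : (0 : ℝ) < multiCode α := by linarith
      rw [mul_assoc]
      refine mul_le_mul_of_nonneg_left ?_ (abs_nonneg _)
      have e1 : multiWeight (σ₀ + k) α = multiWeight σ₀ α * ((multiCode α : ℝ) ^ k)⁻¹ := by
        simp [multiWeight, pow_add, mul_comm]
      have e2 : q ^ k / (multiCode τ : ℝ) ^ k = (((multiCode τ : ℝ) + 1) ^ k)⁻¹ := by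
        rw [hq, div_pow]; field_simp
      rw [e1, e2]
      refine mul_le_mul_of_nonneg_left ?_ (multiWeight_pos _ _).le
      gcongr
  have hs1 : Summable fun α => if α = τ then multiWeight (σ₀ + k) τ else 0 :=
    (hasSum_ite_eq τ _).summable
  have hs2 : Summable fun α => (|f α| * multiWeight σ₀ α) * (q ^ k / (multiCode τ : ℝ) ^ k) :=
    Summable.mul_right _ hf
  calc wNorm (σ₀ + k) f ≤ ∑' α, ((if α = τ then multiWeight (σ₀ + k) τ else 0) +
        (|f α| * multiWeight σ₀ α) * (q ^ k / (multiCode τ : ℝ) ^ k)) :=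
        hsum.tsum_le_tsum hpt (hs1.add hs2)
    _ = multiWeight (σ₀ + k) τ + wNorm σ₀ f * q ^ k / (multiCode τ : ℝ) ^ k := by
        rw [hs1.tsum_add hs2, tsum_ite_eq, tsum_mul_right, wNorm, mul_div_assoc]
    _ ≤ 3 / 2 * multiWeight (σ₀ + k) τ := by
        have e1 : multiWeight (σ₀ + k) τ = multiWeight σ₀ τ / (multiCode τ : ℝ) ^ k := by
          simp [multiWeight, pow_add, div_eq_mul_inv, mul_comm]
        have : wNorm σ₀ f * q ^ k / (multiCode τ : ℝ) ^ k ≤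
            1 / 2 * multiWeight σ₀ τ / (multiCode τ : ℝ) ^ k := by gcongr
        rw [e1]
        have e3 : 1 / 2 * multiWeight σ₀ τ / (multiCode τ : ℝ) ^ k =
          1 / 2 * (multiWeight σ₀ τ / (multiCode τ : ℝ) ^ k) := by ring
        linarith

end PowerSeriesDivision


/-! ### Division with uniform estimates. -/

section Division

/-- On the polydisc with exponent `σ + 1` each monomial gains the inverse of its code, which is at
most `1 / j`. -/
theorem wNorm_smul_tsum_le {m σ : ℕ} {b : (Fin m → ℕ) → ℝ} (hb : WSummable σ b) {s : Fin m → ℝ}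
    {j : ℕ} (hj : 0 < j) (hsupp : ∀ α, b α ≠ 0 → j ≤ multiCode α)
    (hs : s ∈ weightPolydisc m (σ + 1)) : |psEval b s| ≤ (1 / j : ℝ) * wNorm σ b := by
  have hj' : (0 : ℝ) < j := by exact_mod_cast hj
  rw [psEval, wNorm, ← tsum_mul_left, ← Real.norm_eq_abs]
  refine tsum_of_norm_bounded ((hb.mul_left (1 / j : ℝ)).hasSum) fun α => ?_
  rw [Real.norm_eq_abs, abs_mul]
  by_cases h : b α = 0
  · simp [h]
  · have h1 : (j : ℝ) ≤ multiCode α := by exact_mod_cast hsupp α h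
    calc |b α| * |multiPow s α| ≤ |b α| * multiWeight (σ + 1) α := by
          gcongr; exact abs_multiPow_le hs α
      _ = |b α| * multiWeight σ α / multiCode α := by rw [multiWeight_succ]; ring
      _ ≤ |b α| * multiWeight σ α / j := by
          have := (multiWeight_pos σ α).le
          gcongr
      _ = _ := by ring

theorem weightPolydisc_anti {m σ σ' : ℕ} (h : σ ≤ σ') : weightPolydisc m σ' ⊆ weightPolydisc m σ := by
  intro s hs i
  refine (hs i).trans ?_
  have : (1 : ℝ) ≤ Nat.nth Nat.Prime i := by exact_mod_cast (Nat.prime_nth_prime i).one_lt.le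
  gcongr

theorem wNorm_anti {m σ σ' : ℕ} (h : σ ≤ σ') {b : (Fin m → ℕ) → ℝ} (hb : WSummable σ b) :
    wNorm σ' b ≤ wNorm σ b :=
  (hb.mono h).tsum_le_tsum
    (fun α => mul_le_mul_of_nonneg_left (multiWeight_anti h α) (abs_nonneg _)) hb

/-- Successive division by finitely many elements, effectively. -/
theorem abs_psEval_le_of_division {m σ : ℕ} {a : ℕ → (Fin m → ℕ) → ℝ} (ha : ∀ j, WSummable σ (a j))
    {T : Set (Fin m → ℕ)} (g : (Fin m → ℕ) → (Fin m → ℕ) → ℝ)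
    (hT : ∀ b ∈ psModule a, ∀ β, IsLeadExp b β → ∃ τ ∈ T, τ ≤ β)
    (hg : ∀ τ ∈ T, g τ ∈ psModule a ∧ IsLeadExp (g τ) τ ∧ g τ τ = 1 ∧
      wNorm σ (g τ) ≤ 3 / 2 * multiWeight σ τ)
    {s : Fin m → ℝ} (hs : s ∈ weightPolydisc m (σ + 1)) {κ : ℝ} (hκ : 0 ≤ κ)
    (hgs : ∀ τ ∈ T, |psEval (g τ) s| ≤ κ * multiWeight σ τ) (k : ℕ) :
    ∀ j : ℕ, 0 < j → ∀ b ∈ psModule a, (∀ α, b α ≠ 0 → j ≤ multiCode α) →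
      |psEval b s| ≤ (2 * κ + 1 / ((j : ℝ) + k)) * wNorm σ b := by
  have hs' := weightPolydisc_anti (Nat.le_succ σ) hs
  induction k with
  -- Without any division only the bound for terms of large code is used. The smaller polydisc, with
  -- exponent `σ + 1`, is there for this case.
  | zero =>
    intro j hj b hb hsupp
    refine (wNorm_smul_tsum_le (wsummable_of_mem ha hb) hj hsupp hs).trans ?_
    have := wNorm_nonneg σ b
    gcongr
    simp; linarith
  | succ k ih =>
    intro j hj b hb hsupp
    by_cases hex : ∃ β, b β ≠ 0 ∧ multiCode β = j
    -- The exponent of code `j` is leading, hence a translate `δ + τ` of some `τ ∈ T`. Subtracting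
    -- `c` times the shifted `g τ` moves all codes beyond `j`.
    · obtain ⟨β, hβ0, hβ⟩ := hex
      have hlead : IsLeadExp b β := ⟨hβ0, fun α hα => hβ ▸ hsupp α hα⟩
      obtain ⟨τ, hτT, hτβ⟩ := hT b hb β hlead
      obtain ⟨hgM, hgl, hg1, hgn⟩ := hg τ hτT
      obtain ⟨δ, rfl⟩ := exists_add_of_le hτβ
      rw [add_comm τ δ] at *
      set c := b (δ + τ) with hc
      set G := psShift δ (g τ) with hG
      have hGM : G ∈ psModule a := psShift_mem hgM δ
      have hG1 : G (δ + τ) = 1 := by rw [hG, psShift_apply_add, hg1]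
      have hb'M : b + (-c) • G ∈ psModule a := add_mem hb (Submodule.smul_mem _ _ hGM)
      have hGs : ∀ α, G α ≠ 0 → j ≤ multiCode α := fun α hα => by
        by_cases hle : δ ≤ α
        · obtain ⟨α', rfl⟩ := exists_add_of_le hle
          rw [hG, psShift_apply_add] at hα
          rw [← hβ, multiCode_add, multiCode_add]
          exact Nat.mul_le_mul_left _ (hgl.2 α' hα)
        · exact absurd (psShift_apply_of_not _ hle) hα
      have hb'0 : (b + (-c) • G) (δ + τ) = 0 := by simp [hG1, ← hc]
      have hb's : ∀ α, (b + (-c) • G) α ≠ 0 → j + 1 ≤ multiCode α := fun α hα => by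
        have h1 : j ≤ multiCode α := by
          by_contra hlt
          apply hα
          have e1 : b α = 0 := by by_contra h; exact hlt (hsupp α h)
          have e2 : G α = 0 := by by_contra h; exact hlt (hGs α h)
          simp [e1, e2]
        rcases h1.eq_or_lt with h | h
        · exact absurd (by rw [← multiCode_injective m (hβ.trans h)]; exact hb'0) hα
        · exact h
      have hbS := wsummable_of_mem ha hb
      have hGS := wsummable_of_mem ha hGM
      have hb'S := wsummable_of_mem ha hb'M
      have hGn : wNorm σ G ≤ 3 / 2 * multiWeight σ (δ + τ) := by
        have e : wNorm σ G = multiWeight σ δ * wNorm σ (g τ) :=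
          (hasSum_wNorm_shift δ (wsummable_of_mem ha hgM)).tsum_eq
        rw [e, multiWeight_add]
        have := multiWeight_pos σ δ
        nlinarith
      -- The leading terms cancel, saving `2|c|` times the weight, while `G` costs at most `3/2` of
      -- it. The drop by a half pays for the value of the subtracted multiple: each step costs
      -- `κ|c|` times the weight, so all steps together cost at most `2κ` times the norm.
      have hnorm : wNorm σ (b + (-c) • G) ≤ wNorm σ b - 1 / 2 * |c| * multiWeight σ (δ + τ) := by
        have hpt : ∀ α, |(b + (-c) • G) α| * multiWeight σ α ≤ |b α| * multiWeight σ α +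
            |c| * (|G α| * multiWeight σ α) -
              (if α = δ + τ then 2 * |c| * multiWeight σ (δ + τ) else 0) := fun α => by
          by_cases h : α = δ + τ
          · subst h
            rw [hb'0, if_pos rfl, hG1, ← hc]
            simp only [abs_zero, zero_mul, abs_one]
            linarith
          · rw [if_neg h, sub_zero, ← mul_assoc, ← add_mul]
            refine mul_le_mul_of_nonneg_right ?_ (multiWeight_pos σ α).le
            refine (abs_add_le _ _).trans ?_
            simp [abs_mul]
        have hs1 := (hbS.hasSum.add (hGS.hasSum.mul_left |c|)).sub
          (hasSum_ite_eq (δ + τ) (2 * |c| * multiWeight σ (δ + τ)))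
        have h2 := hasSum_le hpt hb'S.hasSum hs1
        have h3 : |c| * wNorm σ G ≤ |c| * (3 / 2 * multiWeight σ (δ + τ)) := by gcongr
        unfold wNorm at *
        linarith
      have hev : psEval b s = psEval (b + (-c) • G) s + c * (multiPow s δ * psEval (g τ) s) := by
        rw [psEval_add hbS (hGS.smul _) hs', psEval_smul, hG,
          psEval_shift δ (wsummable_of_mem ha hgM) hs']
        ring
      have h1 := ih (j + 1) (Nat.succ_pos j) _ hb'M hb's
      have h2 : |c * (multiPow s δ * psEval (g τ) s)| ≤ |c| * (κ * multiWeight σ (δ + τ)) := by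
        rw [abs_mul, abs_mul, multiWeight_add]
        have := mul_le_mul (abs_multiPow_le hs' δ) (hgs τ hτT) (abs_nonneg _)
          (multiWeight_pos σ δ).le
        refine mul_le_mul_of_nonneg_left (this.trans (le_of_eq (by ring))) (abs_nonneg _)
      have e : ((j + 1 : ℕ) : ℝ) + k = (j : ℝ) + (k + 1 : ℕ) := by push_cast; ring
      rw [e] at h1
      set ε : ℝ := 1 / ((j : ℝ) + (k + 1 : ℕ))
      have hε : 0 ≤ ε := by positivity
      have h3 : (2 * κ + ε) * wNorm σ (b + (-c) • G) ≤
          (2 * κ + ε) * (wNorm σ b - 1 / 2 * |c| * multiWeight σ (δ + τ)) := by gcongr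
      have h4 : 0 ≤ ε * (|c| * multiWeight σ (δ + τ)) := by
        have := (multiWeight_pos σ (δ + τ)).le; positivity
      rw [hev]
      refine (abs_add_le _ _).trans ?_
      nlinarith
    · push Not at hex
      have := ih (j + 1) (Nat.succ_pos j) b hb fun α hα =>
        lt_of_le_of_ne (hsupp α hα) (hex α hα).symm
      have e : ((j + 1 : ℕ) : ℝ) + k = (j : ℝ) + (k + 1 : ℕ) := by push_cast; ring
      rwa [e] at this

/-- In a family of convergent power series, all of them are bounded by finitely many, uniformly
near the origin. -/
theorem exists_uniform_bound {m σ₀ : ℕ} {a : ℕ → (Fin m → ℕ) → ℝ} (ha : ∀ j, WSummable σ₀ (a j)) :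
    ∃ σ ≥ σ₀, ∃ (N : ℕ) (C : ℝ), 0 ≤ C ∧ ∀ s ∈ weightPolydisc m σ, ∀ μ,
      (∀ i ≤ N, |psEval (a i) s| ≤ μ) → ∀ j, |psEval (a j) s| ≤ C * wNorm σ₀ (a j) * μ := by
  -- Finitely many leading exponents divide all others. Finiteness is what allows one weight `σ` and
  -- one index bound for all divisors.
  obtain ⟨T, hTS, hTf, hT⟩ := exists_finite_basis {α | ∃ f ∈ psModule a, IsLeadExp f α}
  have hex : ∀ τ ∈ T, ∃ f ∈ psModule a, IsLeadExp f τ ∧ f τ = 1 := fun τ hτ => by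
    obtain ⟨f, hf, hl⟩ := hTS hτ
    refine ⟨(f τ)⁻¹ • f, Submodule.smul_mem _ _ hf, ⟨?_, fun β hβ => hl.2 β fun h => hβ ?_⟩, ?_⟩
    · simp [hl.1]
    · simp [h]
    · simp [hl.1]
  choose! g hgM hgl hg1 using hex
  have hev : ∀ᶠ σ in atTop, ∀ τ ∈ T, wNorm σ (g τ) ≤ 3 / 2 * multiWeight σ τ :=
    hTf.eventually_all.2 fun τ hτ =>
      eventually_lead_dominates (wsummable_of_mem ha (hgM τ hτ)) (hgl τ hτ) (hg1 τ hτ)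
  obtain ⟨σ, hσ, hσ₀⟩ := (hev.and (eventually_ge_atTop σ₀)).exists
  have haσ : ∀ j, WSummable σ (a j) := fun j => (ha j).mono hσ₀
  have hb : ∀ τ ∈ T, ∃ (N : ℕ) (C : ℝ), 0 ≤ C ∧ ∀ s ∈ weightPolydisc m σ, ∀ μ,
      (∀ i ≤ N, |psEval (a i) s| ≤ μ) → |psEval (g τ) s| ≤ C * μ := fun τ hτ =>
    exists_eval_le_of_mem haσ (hgM τ hτ)
  choose! N C hC hNC using hb
  obtain ⟨N', hN'⟩ := (hTf.image N).bddAbove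
  obtain ⟨C', hC'⟩ := (hTf.image fun τ => C τ / multiWeight σ τ).bddAbove
  refine ⟨σ + 1, by omega, N', 2 * max C' 0, by positivity, fun s hs μ hμ j => ?_⟩
  have hμ0 : 0 ≤ μ := (abs_nonneg _).trans (hμ 0 (Nat.zero_le _))
  have hs' := weightPolydisc_anti (Nat.le_succ σ) hs
  -- Letting the number of division steps tend to infinity removes the undivided remainder.
  have hlim : Tendsto (fun k : ℕ => (2 * (max C' 0 * μ) + 1 / (((1 : ℕ) : ℝ) + k)) * wNorm σ (a j))
      atTop (𝓝 ((2 * (max C' 0 * μ) + 0) * wNorm σ (a j))) := by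
    refine (tendsto_const_nhds.add ?_).mul_const _
    have := tendsto_one_div_add_atTop_nhds_zero_nat (𝕜 := ℝ)
    refine this.congr fun k => ?_
    push_cast; rw [add_comm]
  have h1 := ge_of_tendsto' hlim fun k => abs_psEval_le_of_division haσ (T := T) g
    (fun b hb β hβ => hT β ⟨b, hb, hβ⟩)
    (fun τ hτ => ⟨hgM τ hτ, hgl τ hτ, hg1 τ hτ, hσ τ hτ⟩) hs (κ := max C' 0 * μ) (by positivity)
    (fun τ hτ => ?_) k 1 Nat.one_pos (a j) (mem_psModule a j) fun α _ => multiCode_pos α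
  · refine h1.trans ?_
    have h2 := wNorm_anti hσ₀ (ha j)
    have : (2 * (max C' 0 * μ) + 0) * wNorm σ (a j) ≤ (2 * (max C' 0 * μ) + 0) * wNorm σ₀ (a j) := by
      gcongr
    linarith
  · have h3 := hNC τ hτ s hs' μ fun i hi => hμ i (hi.trans (hN' (mem_image_of_mem _ hτ)))
    have h4 : C τ / multiWeight σ τ ≤ max C' 0 :=
      (hC' (mem_image_of_mem _ hτ)).trans (le_max_left _ _)
    rw [div_le_iff₀ (multiWeight_pos σ τ)] at h4
    nlinarith

end Division

/-! ### Counting zeros by Rolle's theorem. -/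

section ZeroCount

/-- Rolle's theorem between consecutive zeros; the points found are distinct because the gaps are
disjoint. -/
theorem exists_finset_zeros_deriv {f f' : ℝ → ℝ} {δ : ℝ}
    (hf : ∀ t, |t| < δ → HasDerivAt f (f' t) t) (Z : Finset ℝ)
    (hZ : ∀ t ∈ Z, |t| < δ ∧ f t = 0) :
    ∃ Z' : Finset ℝ, (∀ t ∈ Z', |t| < δ ∧ f' t = 0) ∧ Z.card ≤ Z'.card + 1 := by
  rcases Nat.eq_zero_or_pos Z.card with h0 | hpos
  · exact ⟨∅, by simp, by omega⟩
  obtain ⟨k, hk⟩ : ∃ k, Z.card = k + 1 := ⟨Z.card - 1, by omega⟩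
  let e := Z.orderEmbOfFin hk
  have he : ∀ i, |e i| < δ ∧ f (e i) = 0 := fun i => hZ _ (Finset.orderEmbOfFin_mem Z hk i)
  have hr : ∀ i : Fin k, ∃ t, e i.castSucc < t ∧ t < e i.succ ∧ f' t = 0 := fun i => by
    have hlt : e i.castSucc < e i.succ := e.strictMono Fin.castSucc_lt_succ
    have habs : ∀ t ∈ Icc (e i.castSucc) (e i.succ), |t| < δ := fun t ht => by
      have h1 := abs_lt.1 (he i.castSucc).1
      have h2 := abs_lt.1 (he i.succ).1
      exact abs_lt.2 ⟨by linarith [ht.1], by linarith [ht.2]⟩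
    obtain ⟨t, ht, ht0⟩ := exists_hasDerivAt_eq_zero hlt
      (fun t ht => (hf t (habs t ht)).continuousAt.continuousWithinAt)
      ((he _).2.trans (he _).2.symm) fun t ht => hf t (habs t (Ioo_subset_Icc_self ht))
    exact ⟨t, ht.1, ht.2, ht0⟩
  choose t ht1 ht2 ht0 using hr
  have hmono : StrictMono t := fun i j hij => by
    have : e i.succ ≤ e j.castSucc := e.monotone (by
      rw [Fin.le_def]; simpa using hij)
    linarith [ht2 i, ht1 j]
  refine ⟨Finset.univ.map ⟨t, hmono.injective⟩, fun x hx => ?_, by simp [hk]⟩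
  obtain ⟨i, -, rfl⟩ := Finset.mem_map.1 hx
  have h1 := abs_lt.1 (he i.castSucc).1
  have h2 := abs_lt.1 (he i.succ).1
  exact ⟨abs_lt.2 ⟨h1.1.trans (ht1 i), (ht2 i).trans h2.2⟩, ht0 i⟩

/-- A power series with a uniformly nonzero `i`-th coefficient has at most `i` zeros near `0`. -/
theorem exists_card_zeros_le (i : ℕ) : ∀ (C R : ℝ), 0 < C → 0 < R → ∃ δ > 0, ∀ b : ℕ → ℝ,
    (∀ j, |b j| ≤ C * R ^ j) → 1 ≤ |b i| → ∀ Z : Finset ℝ,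
      (∀ t ∈ Z, |t| < δ ∧ ∑' j, b j * t ^ j = 0) → Z.card ≤ i := by
  induction i with
  | zero =>
    intro C R hC hR
    -- For such `t` the terms of positive degree add up to less than `1`, so they cannot cancel the
    -- constant term.
    refine ⟨1 / (2 * R * (C + 1)), by positivity, fun b hb hb0 Z hZ => ?_⟩
    rw [Nat.le_zero, Finset.card_eq_zero, Finset.eq_empty_iff_forall_notMem]
    intro t ht
    obtain ⟨ht1, ht2⟩ := hZ t ht
    have hq : R * |t| < 1 / (2 * (C + 1)) := by
      rw [lt_div_iff₀ (by positivity)] at ht1 ⊢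
      linarith
    have hq2 : R * |t| < 1 / 2 := hq.trans_le (by gcongr; linarith)
    have hq0 : 0 ≤ R * |t| := by positivity
    have hbd : ∀ j, ‖b j * t ^ j‖ ≤ C * (R * |t|) ^ j := fun j => by
      rw [Real.norm_eq_abs, abs_mul, abs_pow, mul_pow, ← mul_assoc]
      gcongr
      exact hb j
    have hgs := (summable_geometric_of_lt_one hq0 (by linarith)).mul_left C
    have hsum : Summable fun j => b j * t ^ j := Summable.of_norm_bounded hgs hbd
    rw [hsum.tsum_eq_zero_add] at ht2
    have h1 : ‖∑' j, b (j + 1) * t ^ (j + 1)‖ ≤ C * (R * |t|) * (1 - R * |t|)⁻¹ := by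
      refine tsum_of_norm_bounded ((hasSum_geometric_of_lt_one hq0 (by linarith)).mul_left _)
        fun (j : ℕ) => (hbd (j + 1)).trans (le_of_eq (by ring))
    have h2 : (1 - R * |t|)⁻¹ ≤ 2 := by
      rw [inv_le_comm₀ (by linarith) (by norm_num)]; linarith
    have h3 : C * (R * |t|) * (1 - R * |t|)⁻¹ ≤ C * (R * |t|) * 2 := by gcongr
    have h4 : C * (R * |t|) * 2 < 1 := by
      have : (C + 1) * (R * |t|) < 1 / 2 := by
        calc (C + 1) * (R * |t|) < (C + 1) * (1 / (2 * (C + 1))) := by gcongr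
          _ = 1 / 2 := by field_simp
      nlinarith
    simp only [pow_zero, mul_one] at ht2
    have h5 : |b 0| = ‖∑' j, b (j + 1) * t ^ (j + 1)‖ := by
      rw [Real.norm_eq_abs, ← abs_neg]; congr 1; linarith
    linarith
  | succ i ih =>
    intro C R hC hR
    -- The derivative has the coefficients `(j + 1) b (j + 1)`, bounded by `C R (2R)^j` since `j + 1
    -- ≤ 2^j`, and its `i`-th coefficient is still at least `1` in modulus.
    obtain ⟨δ, hδ, h⟩ := ih (C * R) (2 * R) (by positivity) (by positivity)
    -- Within radius `1 / (4R)` the differentiated series is dominated by a geometric series of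
    -- ratio `1 / 2`.
    refine ⟨min δ (1 / (4 * R)), by positivity, fun b hb hbi Z hZ => ?_⟩
    set ρ : ℝ := 1 / (4 * R) with hρ
    have hder : ∀ t, |t| < ρ → HasDerivAt (fun t => ∑' j, b j * t ^ j)
        (∑' j : ℕ, ((j : ℝ) + 1) * b (j + 1) * t ^ j) t := fun t ht => by
      have hu : Summable fun j : ℕ => (j : ℝ) * (C * R ^ j * ρ ^ (j - 1)) := by
        rw [← summable_nat_add_iff 1]
        have : Summable fun j : ℕ => C * R * (1 / 2 : ℝ) ^ j :=
          (summable_geometric_of_lt_one (by norm_num) (by norm_num)).mul_left _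
        refine Summable.of_nonneg_of_le (fun j => by positivity) (fun j => ?_) this
        have e : ((j + 1 : ℕ) : ℝ) ≤ 2 ^ j := by
          exact_mod_cast Nat.succ_le_of_lt (Nat.lt_two_pow_self (n := j))
        have e2 : R ^ j * ρ ^ j = (1 / 4 : ℝ) ^ j := by
          rw [← mul_pow, hρ]; congr 1; field_simp
        calc ((j + 1 : ℕ) : ℝ) * (C * R ^ (j + 1) * ρ ^ (j + 1 - 1))
            = C * R * (((j + 1 : ℕ) : ℝ) * (R ^ j * ρ ^ j)) := by
              rw [Nat.add_sub_cancel, pow_succ]; ring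
          _ ≤ C * R * (2 ^ j * (1 / 4 : ℝ) ^ j) := by rw [e2]; gcongr
          _ = C * R * (1 / 2 : ℝ) ^ j := by rw [← mul_pow]; norm_num
      have hd := hasDerivAt_tsum_of_isPreconnected (t := Ioo (-ρ) ρ)
        (g := fun j t => b j * t ^ j) (g' := fun j t => b j * ((j : ℝ) * t ^ (j - 1)))
        hu isOpen_Ioo isPreconnected_Ioo
        (fun j y _ => (hasDerivAt_pow j y).const_mul (b j)) (fun j y hy => by
          rw [Real.norm_eq_abs, abs_mul, abs_mul, abs_pow, Nat.abs_cast]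
          have hy' : |y| ≤ ρ := (abs_lt.2 hy).le
          calc |b j| * ((j : ℝ) * |y| ^ (j - 1)) ≤ C * R ^ j * ((j : ℝ) * ρ ^ (j - 1)) := by
                gcongr; exact hb j
            _ = _ := by ring) (y₀ := 0) ⟨by simp [hρ]; positivity, by positivity⟩
        (summable_of_ne_finset_zero (s := {0}) fun j hj => by
          simp at hj; simp [hj]) (abs_lt.1 ht)
      convert! hd using 1
      have hs2 : Summable fun j : ℕ => b j * ((j : ℝ) * t ^ (j - 1)) :=
        Summable.of_norm_bounded hu fun j => by
          rw [Real.norm_eq_abs, abs_mul, abs_mul, abs_pow, Nat.abs_cast]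
          calc |b j| * ((j : ℝ) * |t| ^ (j - 1)) ≤ C * R ^ j * ((j : ℝ) * ρ ^ (j - 1)) := by
                gcongr; exact hb j
            _ = _ := by ring
      rw [hs2.tsum_eq_zero_add]
      simp only [Nat.cast_zero, zero_mul, mul_zero, zero_add, Nat.add_sub_cancel]
      refine tsum_congr fun j => ?_
      push_cast; ring
    obtain ⟨Z', hZ', hcard⟩ := exists_finset_zeros_deriv (δ := min δ ρ)
      (fun t ht => hder t (ht.trans_le (min_le_right _ _))) Z hZ
    have := h (fun j : ℕ => ((j : ℝ) + 1) * b (j + 1)) (fun j => ?_) ?_ Z' fun t ht =>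
      ⟨(hZ' t ht).1.trans_le (min_le_left _ _), (hZ' t ht).2⟩
    · omega
    · rw [abs_mul]
      have e : |(j : ℝ) + 1| ≤ 2 ^ j := by
        rw [abs_of_pos (by positivity)]
        exact_mod_cast (Nat.lt_two_pow_self : j < 2 ^ j)
      calc |(j : ℝ) + 1| * |b (j + 1)| ≤ 2 ^ j * (C * R ^ (j + 1)) := by
            gcongr; exact hb _
        _ = C * R * (2 * R) ^ j := by rw [mul_pow, pow_succ]; ring
    · rw [abs_mul, abs_of_pos (by positivity : (0 : ℝ) < (i : ℝ) + 1)]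
      nlinarith [Nat.cast_nonneg (α := ℝ) i]

end ZeroCount


/-! ### Monomial expansions and uniform finiteness. -/

section Expansion

/-- The exponents with which `none` and the `some i` occur in a word. -/
def wordExp {m : ℕ} (w : Σ k, (Fin k → Option (Fin m))) : ℕ × (Fin m → ℕ) :=
  ((Finset.univ.filter fun l => w.2 l = none).card,
    fun i => (Finset.univ.filter fun l => w.2 l = some i).card)

theorem prod_word {m : ℕ} (y : Option (Fin m) → ℝ) (w : Σ k, (Fin k → Option (Fin m))) :
    ∏ l, y (w.2 l) = y none ^ (wordExp w).1 * multiPow (fun i => y (some i)) (wordExp w).2 := by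
  rw [← Finset.prod_fiberwise (s := Finset.univ) (g := w.2), Fintype.prod_option]
  have h : ∀ o : Option (Fin m), ∏ l ∈ Finset.univ.filter (fun l => w.2 l = o), y (w.2 l) =
      y o ^ (Finset.univ.filter fun l => w.2 l = o).card := fun o => by
    rw [Finset.prod_congr rfl fun l hl => by rw [(Finset.mem_filter.1 hl).2], Finset.prod_const]
  simp only [h, wordExp, multiPow]

theorem hasSum_fibrewise {W K : Type*} (key : W → K) (c : W → ℝ) {g : K → ℝ} {a : ℝ}
    (h : HasSum (fun w => c w * g (key w)) a) :
    HasSum (fun κ => (∑' w : key ⁻¹' {κ}, c w) * g κ) a := by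
  have h1 := h.tsum_fiberwise key
  have e : (fun κ => (∑' w : key ⁻¹' {κ}, c w) * g κ) =
      fun κ => ∑' w : key ⁻¹' {κ}, c w * g (key w) := by
    funext κ
    rw [← tsum_mul_right]
    exact tsum_congr fun w => by rw [show key w = κ from w.2]
  rw [e]
  exact h1

theorem summable_fibrewise {W K : Type*} (key : W → K) (c : W → ℝ) {g : K → ℝ} (hg : ∀ κ, 0 < g κ)
    (h : Summable fun w => |c w| * g (key w)) :
    Summable fun κ => |∑' w : key ⁻¹' {κ}, c w| * g κ := by
  refine Summable.of_nonneg_of_le (fun κ => mul_nonneg (abs_nonneg _) (hg κ).le) (fun κ => ?_)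
    (hasSum_fibrewise key (fun w => |c w|) h.hasSum).summable
  refine mul_le_mul_of_nonneg_right ?_ (hg κ).le
  refine norm_tsum_le_tsum_norm (f := fun w : key ⁻¹' {κ} => c w) ?_
  refine ((h.subtype (key ⁻¹' {κ})).mul_right (g κ)⁻¹).congr fun w => ?_
  simp only [Function.comp_apply]
  rw [show key w.1 = κ from w.2, mul_assoc, mul_inv_cancel₀ (hg κ).ne', mul_one, Real.norm_eq_abs]

/-- The expansion of an analytic function of several variables into monomials. -/
theorem exists_monomial_expansion {m : ℕ} {Φ : (Option (Fin m) → ℝ) → ℝ} (hΦ : AnalyticAt ℝ Φ 0) :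
    ∃ (A : ℕ × (Fin m → ℕ) → ℝ) (r : ℝ), 0 < r ∧ r ≤ 1 ∧
      (Summable fun κ => |A κ| * (r ^ κ.1 * multiPow (fun _ => r) κ.2)) ∧
      ∀ y : Option (Fin m) → ℝ, (∀ o, |y o| ≤ r) →
        HasSum (fun κ => A κ * (y none ^ κ.1 * multiPow (fun i => y (some i)) κ.2)) (Φ y) := by
  obtain ⟨p, R, hp⟩ := hΦ
  obtain ⟨M, hM⟩ : ∃ M : ℝ, M = (Fintype.card (Option (Fin m)) : ℝ) := ⟨_, rfl⟩
  have hM1 : 1 ≤ M := by rw [hM]; simp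
  obtain ⟨R', hR'0, hR'⟩ := ENNReal.lt_iff_exists_nnreal_btwn.1 hp.r_pos
  have hR'pos : (0 : ℝ) < R' := by exact_mod_cast hR'0
  -- There are `M^k` words of length `k` in `M` variables, so absolute convergence over words needs
  -- `M r ≤ R'`.
  set r : ℝ := min 1 (R' / M) / 2 with hr
  have hr0 : 0 < r := by positivity
  have hr1 : r ≤ 1 := by rw [hr]; linarith [min_le_left 1 (R' / M)]
  have hMr : M * r ≤ R' := by
    have : r ≤ R' / M := by
      rw [hr]; linarith [min_le_right 1 ((R' : ℝ) / M), div_pos hR'pos (by linarith : 0 < M)]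
    rw [le_div_iff₀ (by linarith)] at this; linarith
  have hrR : r < R' := by
    have : r < R' / M := by
      rw [hr]; linarith [min_le_right 1 ((R' : ℝ) / M), div_pos hR'pos (by linarith : 0 < M)]
    exact this.trans_le (div_le_self hR'pos.le hM1)
  -- The value of the `k`-linear coefficient on basis vectors. Words record the order of the
  -- factors; it is forgotten afterwards by summing over words with equal exponents.
  let c : (Σ k, (Fin k → Option (Fin m))) → ℝ :=
    fun w => p w.1 fun l => Pi.single (w.2 l) (1 : ℝ)
  have hc : ∀ w, |c w| ≤ ‖p w.1‖ := fun w => by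
    refine ((p w.1).le_opNorm _).trans ?_
    have : ∏ l, ‖(Pi.single (w.2 l) (1 : ℝ) : Option (Fin m) → ℝ)‖ ≤ 1 :=
      Finset.prod_le_one (fun _ _ => norm_nonneg _) fun l _ => by
        rw [pi_norm_le_iff_of_nonneg zero_le_one]
        intro o
        by_cases h : o = w.2 l
        · subst h; simp
        · simp [h]
    exact mul_le_of_le_one_right (norm_nonneg _) this
  have hmain : Summable fun w : Σ k, (Fin k → Option (Fin m)) => |c w| * r ^ w.1 := by
    rw [summable_sigma_of_nonneg fun w => by positivity]
    refine ⟨fun k => (hasSum_fintype _).summable, ?_⟩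
    have hs : Summable fun k : ℕ => ‖p k‖ * (R' : ℝ) ^ k :=
      p.summable_norm_mul_pow (hR'.trans_le hp.r_le)
    refine Summable.of_nonneg_of_le (fun k => tsum_nonneg fun w => by positivity) (fun k => ?_) hs
    rw [tsum_fintype]
    calc ∑ w : Fin k → Option (Fin m), |c ⟨k, w⟩| * r ^ k
        ≤ ∑ _w : Fin k → Option (Fin m), ‖p k‖ * r ^ k :=
          Finset.sum_le_sum fun w _ => by have := hc ⟨k, w⟩; gcongr
      _ = ‖p k‖ * (M * r) ^ k := by
          rw [Finset.sum_const, Finset.card_univ, Fintype.card_fun, nsmul_eq_mul, mul_pow, hM,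
            Fintype.card_fin]
          push_cast; ring
      _ ≤ ‖p k‖ * (R' : ℝ) ^ k := by gcongr
  have hexp : ∀ y : Option (Fin m) → ℝ, (∀ o, |y o| ≤ r) →
      HasSum (fun w => c w * ∏ l, y (w.2 l)) (Φ y) := fun y hy => by
    have hS : Summable fun w : Σ k, (Fin k → Option (Fin m)) => c w * ∏ l, y (w.2 l) := by
      refine Summable.of_norm_bounded hmain fun w => ?_
      rw [Real.norm_eq_abs, abs_mul, Finset.abs_prod]
      gcongr
      calc ∏ l, |y (w.2 l)| ≤ ∏ _l : Fin w.1, r :=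
            Finset.prod_le_prod (fun _ _ => abs_nonneg _) fun l _ => hy _
        _ = r ^ w.1 := by simp
    have hyb : y ∈ Metric.eball (0 : Option (Fin m) → ℝ) R := by
      have : ‖y‖ ≤ r := (pi_norm_le_iff_of_nonneg hr0.le).2 hy
      rw [mem_eball_zero_iff]
      refine lt_trans ?_ hR'
      rw [← ofReal_norm, ENNReal.ofReal_lt_coe_iff (norm_nonneg _)]
      · exact this.trans_lt hrR
    have h1 := hp.hasSum hyb
    rw [zero_add] at h1
    have h2 := hS.hasSum.sigma (g := fun k => p k fun _ => y) fun k => by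
      have : p k (fun _ => y) = ∑ w : Fin k → Option (Fin m), c ⟨k, w⟩ * ∏ l, y (w l) := by
        have hy' : y = ∑ o, y o • (Pi.single o (1 : ℝ) : Option (Fin m) → ℝ) := by
          ext o; simp [Finset.sum_apply, Pi.single_apply]
        conv_lhs => rw [hy']
        rw [ContinuousMultilinearMap.map_sum]
        refine Finset.sum_congr rfl fun w _ => ?_
        rw [ContinuousMultilinearMap.map_smul_univ, smul_eq_mul, mul_comm]
      rw [this]
      exact hasSum_fintype _
    rw [h1.unique h2]
    exact hS.hasSum
  refine ⟨fun κ => ∑' w : wordExp ⁻¹' {κ}, c w, r, hr0, hr1, ?_, fun y hy => ?_⟩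
  · refine summable_fibrewise wordExp c (fun κ => ?_) (hmain.congr fun w => ?_)
    · have : 0 < multiPow (fun _ : Fin m => r) κ.2 := Finset.prod_pos fun _ _ => by positivity
      positivity
    · rw [← prod_word (fun _ => r) w]; simp
  · refine hasSum_fibrewise wordExp c (g := fun κ => y none ^ κ.1 * multiPow (fun i => y (some i)) κ.2) ?_
    simpa only [prod_word] using hexp y hy

/-- An analytic function as a power series in one variable with coefficients that are power series
in the others. -/
theorem exists_expansion {m : ℕ} {Φ : (Option (Fin m) → ℝ) → ℝ} (hΦ : AnalyticAt ℝ Φ 0) :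
    ∃ (a : ℕ → (Fin m → ℕ) → ℝ) (σ : ℕ) (B R : ℝ), 0 < B ∧ 0 < R ∧ (∀ j, WSummable σ (a j)) ∧
      (∀ j, wNorm σ (a j) ≤ B * R ^ j) ∧ ∀ y : Option (Fin m) → ℝ,
        (fun i => y (some i)) ∈ weightPolydisc m σ → |y none| ≤ R⁻¹ →
          Φ y = ∑' j, psEval (a j) (fun i => y (some i)) * y none ^ j := by
  obtain ⟨A, r, hr0, hr1, hA, hΦA⟩ := exists_monomial_expansion hΦ
  -- All primes are at least `2`, so this `σ` places the weighted polydisc inside the polydisc of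
  -- radius `r`.
  obtain ⟨σ, hσ⟩ := exists_pow_lt_of_lt_one hr0 (by norm_num : (1 / 2 : ℝ) < 1)
  have hpr : ∀ i : ℕ, ((Nat.nth Nat.Prime i : ℝ) ^ σ)⁻¹ ≤ r := fun i => by
    refine le_trans ?_ hσ.le
    rw [one_div, inv_pow]
    have : (2 : ℝ) ≤ Nat.nth Nat.Prime i := by exact_mod_cast (Nat.prime_nth_prime i).two_le
    gcongr
  have hwt : ∀ α : Fin m → ℕ, multiWeight σ α ≤ multiPow (fun _ => r) α := fun α => by
    rw [multiPow, multiWeight, multiCode]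
    push_cast
    rw [← Finset.prod_pow, ← Finset.prod_inv_distrib]
    refine Finset.prod_le_prod (fun i _ => by positivity) fun i _ => ?_
    rw [← pow_mul, mul_comm, pow_mul, ← inv_pow]
    exact pow_le_pow_left₀ (by positivity) (hpr _) _
  have hmp : ∀ α : Fin m → ℕ, 0 < multiPow (fun _ => r) α := fun α =>
    Finset.prod_pos fun _ _ => by positivity
  set B := ∑' κ : ℕ × (Fin m → ℕ), |A κ| * (r ^ κ.1 * multiPow (fun _ => r) κ.2) with hB
  have hfac : ∀ j, Summable fun α => |A (j, α)| * multiPow (fun _ => r) α := fun j => by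
    refine ((hA.prod_factor j).mul_left (r ^ j)⁻¹).congr fun α => ?_
    field_simp
  have hws : ∀ j, WSummable σ fun α => A (j, α) := fun j =>
    Summable.of_nonneg_of_le (fun α => mul_nonneg (abs_nonneg _) (multiWeight_pos σ α).le)
      (fun α => mul_le_mul_of_nonneg_left (hwt α) (abs_nonneg _)) (hfac j)
  refine ⟨fun j α => A (j, α), σ, B + 1, r⁻¹, ?_, by positivity, hws, fun j => ?_,
    fun y hy hyn => ?_⟩
  · have : 0 ≤ B := tsum_nonneg fun κ => by have := (hmp κ.2).le; positivity
    positivity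
  · calc wNorm σ (fun α => A (j, α)) ≤ ∑' α, |A (j, α)| * multiPow (fun _ => r) α :=
          (hws j).tsum_le_tsum (fun α => mul_le_mul_of_nonneg_left (hwt α) (abs_nonneg _)) (hfac j)
      _ = (r⁻¹) ^ j * ∑' α, |A (j, α)| * (r ^ j * multiPow (fun _ => r) α) := by
          rw [← tsum_mul_left]
          exact tsum_congr fun α => by rw [inv_pow]; field_simp
      _ ≤ (r⁻¹) ^ j * B := by
          gcongr
          have h1 := hA.prod
          have h2 := h1.le_tsum j fun i _ => tsum_nonneg fun α => by
            have := (hmp α).le; positivity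
          rw [hA.tsum_prod] at hB
          exact hB ▸ h2
      _ ≤ (B + 1) * r⁻¹ ^ j := by
          have : 0 < r⁻¹ ^ j := by positivity
          nlinarith
  · rw [inv_inv] at hyn
    have hyo : ∀ o, |y o| ≤ r := by
      rintro (_ | i)
      · exact hyn
      · exact (hy i).trans (hpr i)
    have h := hΦA y hyo
    have h1 : HasSum (fun j => ∑' α, A (j, α) * (y none ^ j * multiPow (fun i => y (some i)) α))
        (Φ y) := h.prod_fiberwise fun j => (h.summable.prod_factor j).hasSum
    rw [← h1.tsum_eq]
    refine tsum_congr fun j => ?_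
    rw [psEval, ← tsum_mul_right]
    exact tsum_congr fun α => by ring

/-- Among the finitely many coefficients that dominate all others, choose the largest at the
parameter `s`. If it is zero, so is the whole series in `t`. Otherwise division by it gives a series
with uniformly bounded coefficients, one of them of modulus `1`, and its index bounds the number of
zeros. -/
theorem exists_card_zeros_le_of_analyticAt {m : ℕ} {Φ : (Option (Fin m) → ℝ) → ℝ}
    (hΦ : AnalyticAt ℝ Φ 0) : ∃ δ > 0, ∃ N : ℕ, ∀ s : Fin m → ℝ, (∀ i, |s i| < δ) →
      (∀ t, |t| < δ → Φ (fun o => o.elim t s) = 0) ∨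
      ∀ Z : Finset ℝ, (∀ t ∈ Z, |t| < δ ∧ Φ (fun o => o.elim t s) = 0) → Z.card ≤ N := by
  obtain ⟨a, σ₀, B, R, hB, hR, haS, haB, hexp⟩ := exists_expansion hΦ
  obtain ⟨σ, hσ, N, C, hC, hdiv⟩ := exists_uniform_bound haS
  choose δ hδ hδZ using fun i => exists_card_zeros_le i (C * B + 1) R (by positivity) hR
  have hδ₁ : ∃ δ₁ > 0, ∀ i ≤ N, δ₁ ≤ δ i := by
    obtain ⟨i, hi, h⟩ := (Finset.range (N + 1)).exists_min_image δ ⟨0, by simp⟩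
    exact ⟨δ i, hδ i, fun j hj => h j (by simpa using Nat.lt_succ_of_le hj)⟩
  obtain ⟨δ₁, hδ₁0, hδ₁⟩ := hδ₁
  have hδ₂ : ∃ δ₂ > 0, ∀ s : Fin m → ℝ, (∀ i, |s i| < δ₂) → s ∈ weightPolydisc m σ := by
    rcases isEmpty_or_nonempty (Fin m) with h | h
    · exact ⟨1, one_pos, fun s _ i => (h.false i).elim⟩
    obtain ⟨i, -, h⟩ := (Finset.univ : Finset (Fin m)).exists_min_image
      (fun i => ((Nat.nth Nat.Prime (i : ℕ) : ℝ) ^ σ)⁻¹) Finset.univ_nonempty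
    refine ⟨((Nat.nth Nat.Prime (i : ℕ) : ℝ) ^ σ)⁻¹, ?_, fun s hs j =>
      (hs j).le.trans (h j (Finset.mem_univ j))⟩
    have := (Nat.prime_nth_prime i).pos
    positivity
  obtain ⟨δ₂, hδ₂0, hδ₂⟩ := hδ₂
  refine ⟨min (min δ₁ δ₂) R⁻¹, by positivity, N, fun s hs => ?_⟩
  have hsw : s ∈ weightPolydisc m σ := hδ₂ s fun i =>
    (hs i).trans_le ((min_le_left _ _).trans (min_le_right _ _))
  have hval : ∀ t, |t| < min (min δ₁ δ₂) R⁻¹ →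
      Φ (fun o => o.elim t s) = ∑' j, psEval (a j) s * t ^ j := fun t ht =>
    hexp (fun o => o.elim t s) (weightPolydisc_anti hσ hsw) (ht.le.trans (min_le_right _ _))
  obtain ⟨i, hi, hmax⟩ := (Finset.range (N + 1)).exists_max_image
    (fun i => |psEval (a i) s|) ⟨0, by simp⟩
  have hiN : i ≤ N := Nat.lt_succ_iff.1 (Finset.mem_range.1 hi)
  have hall := hdiv s hsw |psEval (a i) s| fun j hj => hmax j (by simpa using Nat.lt_succ_of_le hj)
  by_cases h0 : psEval (a i) s = 0
  · left
    intro t ht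
    rw [hval t ht]
    have : ∀ j, psEval (a j) s = 0 := fun j => by
      have := hall j
      rw [h0, abs_zero, mul_zero] at this
      exact abs_nonpos_iff.1 this
    simp [this]
  · right
    intro Z hZ
    have hpos : 0 < |psEval (a i) s| := abs_pos.2 h0
    refine (hδZ i (fun j => psEval (a j) s / |psEval (a i) s|) (fun j => ?_) ?_ Z fun t ht =>
      ⟨(hZ t ht).1.trans_le ((min_le_left _ _).trans ((min_le_left _ _).trans (hδ₁ i hiN))),
        ?_⟩).trans hiN
    · rw [abs_div, abs_abs, div_le_iff₀ hpos]
      refine (hall j).trans (mul_le_mul_of_nonneg_right ?_ hpos.le)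
      calc C * wNorm σ₀ (a j) ≤ C * (B * R ^ j) := by gcongr; exact haB j
        _ ≤ (C * B + 1) * R ^ j := by
          have : 0 < R ^ j := by positivity
          nlinarith
    · rw [abs_div, abs_abs, div_self hpos.ne']
    · have h1 := (hZ t ht).2
      rw [hval t (hZ t ht).1] at h1
      have : ∀ j, psEval (a j) s / |psEval (a i) s| * t ^ j =
          (psEval (a j) s * t ^ j) * |psEval (a i) s|⁻¹ := fun j => by ring
      simp_rw [this, tsum_mul_right, h1, zero_mul]

/-- **Uniform finiteness**: on all short segments of a given direction near a point, an analytic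
function vanishes identically or has a bounded number of zeros. -/
theorem AnalyticAt.exists_card_zeros_le {E : Type*} [NormedAddCommGroup E] [NormedSpace ℝ E]
    [FiniteDimensional ℝ E] {ρ : E → ℝ} {q : E} (hρ : AnalyticAt ℝ ρ q) (e : E) :
    ∃ δ > 0, ∃ N : ℕ, ∀ p ∈ Metric.ball q δ, (∀ t, |t| < δ → ρ (p + t • e) = 0) ∨
      ∀ Z : Finset ℝ, (∀ t ∈ Z, |t| < δ ∧ ρ (p + t • e) = 0) → Z.card ≤ N := by
  let b := Module.finBasis ℝ E
  -- The base point gets a full set of coordinates and `e` an additional one. The redundancy is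
  -- harmless, since only analyticity of the composition is needed.
  let L : (Option (Fin (Module.finrank ℝ E)) → ℝ) →L[ℝ] E :=
    LinearMap.toContinuousLinearMap
      (∑ i, (LinearMap.proj (some i)).smulRight (b i) + (LinearMap.proj none).smulRight e)
  have hL : ∀ y, L y = ∑ i, y (some i) • b i + y none • e := fun y => by simp [L]
  have hΦ : AnalyticAt ℝ (fun y => ρ (q + L y)) 0 := by
    refine AnalyticAt.fun_comp (g := ρ) (f := fun y => q + L y) ?_ ?_
    · simpa using hρ
    · exact analyticAt_const.add (L.analyticAt 0)
  obtain ⟨δ, hδ, N, h⟩ := exists_card_zeros_le_of_analyticAt hΦ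
  have hev : ∀ᶠ p in 𝓝 q, ∀ i, |b.repr (p - q) i| < δ := by
    rw [eventually_all]
    intro i
    have hc : Continuous fun p => |b.repr (p - q) i| := by
      have : Continuous (b.coord i) := (b.coord i).continuous_of_finiteDimensional
      exact (this.comp (continuous_id.sub continuous_const)).abs
    exact (hc.tendsto q).eventually (gt_mem_nhds (by simpa using hδ))
  obtain ⟨δ', hδ', hball⟩ := Metric.eventually_nhds_iff_ball.1 hev
  have hval : ∀ p t, q + L (fun o => o.elim t fun i => b.repr (p - q) i) = p + t • e :=
    fun p t => by
      rw [hL]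
      simp only [Option.elim_some, Option.elim_none]
      rw [b.sum_repr, ← add_assoc, add_sub_cancel]
  refine ⟨min δ δ', by positivity, N, fun p hp => ?_⟩
  have := h (fun i => b.repr (p - q) i) (hball p (Metric.ball_subset_ball (min_le_right _ _) hp))
  simp only [hval] at this
  rcases this with h1 | h1
  · exact Or.inl fun t ht => h1 t (ht.trans_le (min_le_left _ _))
  · exact Or.inr fun Z hZ => h1 Z fun t ht => ⟨(hZ t ht).1.trans_le (min_le_left _ _), (hZ t ht).2⟩

end Expansion


/-! ### Length of curves with few crossings, and the area of their tubes. -/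

section Length
open MeasureTheory

/-- A Crofton type bound for the variation over a uniform partition, in terms of the number of
crossings of the levels. -/
theorem sum_abs_sub_le_of_card {x : ℝ → ℝ} (hx : Continuous x) {R : ℝ} (hR : ∀ t, |x t| ≤ R)
    {S : Set ℝ} (hS : S.Finite) {N : ℕ}
    (hN : ∀ a ∉ S, ∀ Z : Finset ℝ, (∀ t ∈ Z, t ∈ Ico (0 : ℝ) 1 ∧ x t = a) → Z.card ≤ N) (M : ℕ) :
    ∑ k ∈ Finset.range M, |x ((k + 1 : ℕ) / M) - x ((k : ℕ) / M)| ≤ N * (2 * R) := by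
  classical
  have hR0 : 0 ≤ R := (abs_nonneg _).trans (hR 0)
  let τ : ℕ → ℝ := fun k => (k : ℝ) / M
  -- The levels crossed in the `k`-th step. The measure of this interval is the increment, and at a
  -- level `a` the indicators add up to the number of steps that cross it.
  let I : ℕ → Set ℝ := fun k => uIoc (x (τ k)) (x (τ (k + 1)))
  have hI : ∀ k, I k ⊆ Icc (-R) R := fun k a ha => by
    have h1 := abs_le.1 (hR (τ k))
    have h2 := abs_le.1 (hR (τ (k + 1)))
    rcases mem_uIoc.1 ha with h | h
    · exact ⟨by linarith, by linarith⟩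
    · exact ⟨by linarith, by linarith⟩
  have hint : ∀ k, ∫ a in Icc (-R) R, (I k).indicator (fun _ => (1 : ℝ)) a =
      |x (τ (k + 1)) - x (τ k)| := fun k => by
    rw [setIntegral_indicator measurableSet_uIoc, inter_eq_right.2 (hI k), setIntegral_const,
      smul_eq_mul, mul_one, measureReal_def, Real.volume_uIoc,
      ENNReal.toReal_ofReal (abs_nonneg _)]
  have hintg : ∀ k, IntegrableOn ((I k).indicator fun _ => (1 : ℝ)) (Icc (-R) R) := fun k =>
    (integrableOn_const (by simp)).indicator measurableSet_uIoc
  have hle : ∀ᵐ a ∂volume.restrict (Icc (-R) R),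
      ∑ k ∈ Finset.range M, (I k).indicator (fun _ => (1 : ℝ)) a ≤ N := by
    -- Discarding the values at the partition points makes each crossing interior to its step, so
    -- different steps yield different parameters.
    have hfin : (S ∪ (fun k : ℕ => x (τ k)) '' Iic M).Finite := hS.union ((finite_Iic M).image _)
    refine ae_restrict_of_ae ?_
    filter_upwards [compl_mem_ae_iff.2 (hfin.measure_zero volume)] with a ha
    rw [mem_compl_iff, mem_union, not_or] at ha
    have h1 : ∀ k ∈ (Finset.range M).filter (fun k => a ∈ I k),
        ∃ t, τ k < t ∧ t < τ (k + 1) ∧ x t = a := fun k hk => by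
      obtain ⟨hkM, hka⟩ := Finset.mem_filter.1 hk
      rw [Finset.mem_range] at hkM
      have hM : (0 : ℝ) < M := by exact_mod_cast lt_of_le_of_lt (Nat.zero_le k) hkM
      have hlt : τ k ≤ τ (k + 1) := by simp only [τ]; gcongr; simp
      obtain ⟨t, ht, hta⟩ := intermediate_value_uIcc (hx.continuousOn (s := uIcc (τ k) (τ (k + 1))))
        (uIoc_subset_uIcc hka)
      rw [uIcc_of_le hlt] at ht
      refine ⟨t, lt_of_le_of_ne ht.1 fun h => ha.2 ⟨k, hkM.le, ?_⟩,
        lt_of_le_of_ne ht.2 fun h => ha.2 ⟨k + 1, hkM, ?_⟩, hta⟩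
      · simp only [h, hta]
      · simp only [← h, hta]
    choose! t ht1 ht2 hta using h1
    have hmono : ∀ k ∈ (Finset.range M).filter (fun k => a ∈ I k),
        ∀ l ∈ (Finset.range M).filter (fun k => a ∈ I k), k < l → t k < t l := fun k hk l hl h => by
      have hM : (0 : ℝ) < M := by
        exact_mod_cast lt_of_le_of_lt (Nat.zero_le k) (Finset.mem_range.1 (Finset.mem_filter.1 hk).1)
      have : τ (k + 1) ≤ τ l := by
        simp only [τ]; gcongr; exact_mod_cast h
      linarith [ht2 k hk, ht1 l hl]
    have hcard : (((Finset.range M).filter (fun k => a ∈ I k)).image t).card =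
        ((Finset.range M).filter (fun k => a ∈ I k)).card :=
      Finset.card_image_of_injOn fun k hk l hl h => by
        rcases lt_trichotomy k l with h' | h' | h'
        · exact absurd h (hmono k hk l hl h').ne
        · exact h'
        · exact absurd h (hmono l hl k hk h').ne'
    have := hN a ha.1 (((Finset.range M).filter (fun k => a ∈ I k)).image t) fun s hs => by
      obtain ⟨k, hk, rfl⟩ := Finset.mem_image.1 hs
      have hkM := Finset.mem_range.1 (Finset.mem_filter.1 hk).1
      have hM : (0 : ℝ) < M := by exact_mod_cast lt_of_le_of_lt (Nat.zero_le k) hkM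
      have h0 : 0 ≤ τ k := by positivity
      have h1 : τ (k + 1) ≤ 1 := by
        simp only [τ]; rw [div_le_one hM]; exact_mod_cast hkM
      exact ⟨⟨by linarith [ht1 k hk], by linarith [ht2 k hk]⟩, hta k hk⟩
    rw [hcard] at this
    have e : ∑ k ∈ Finset.range M, (I k).indicator (fun _ => (1 : ℝ)) a =
        (((Finset.range M).filter (fun k => a ∈ I k)).card : ℝ) := by
      simp only [indicator_apply, Finset.sum_ite, Finset.sum_const_zero, Finset.sum_const]
      simp
    rw [e]
    exact_mod_cast this
  calc ∑ k ∈ Finset.range M, |x ((k + 1 : ℕ) / M) - x ((k : ℕ) / M)|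
      = ∑ k ∈ Finset.range M, ∫ a in Icc (-R) R, (I k).indicator (fun _ => (1 : ℝ)) a :=
        Finset.sum_congr rfl fun k _ => (hint k).symm
    _ = ∫ a in Icc (-R) R, ∑ k ∈ Finset.range M, (I k).indicator (fun _ => (1 : ℝ)) a :=
        (integral_finsetSum _ fun k _ => hintg k).symm
    _ ≤ ∫ _a in Icc (-R) R, (N : ℝ) :=
        integral_mono_ae (integrable_finsetSum _ fun k _ => hintg k)
          (integrableOn_const (by simp)) hle
    _ = N * (2 * R) := by
        rw [setIntegral_const, measureReal_def, Real.volume_Icc,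
          ENNReal.toReal_ofReal (by linarith), smul_eq_mul]; ring

/-- On a fine uniform partition `|x'|` exceeds the slope of the step by at most `ε`, by the mean
value theorem, so the integral is bounded by the variation over the partition plus `ε`. -/
theorem integral_abs_deriv_le_of_card {x : ℝ → ℝ} (hx : ContDiff ℝ 1 x) {R : ℝ}
    (hR : ∀ t, |x t| ≤ R) {S : Set ℝ} (hS : S.Finite) {N : ℕ}
    (hN : ∀ a ∉ S, ∀ Z : Finset ℝ, (∀ t ∈ Z, t ∈ Ico (0 : ℝ) 1 ∧ x t = a) → Z.card ≤ N) :
    ∫ t in (0 : ℝ)..1, |deriv x t| ≤ N * (2 * R) := by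
  have hd : Continuous (deriv x) := hx.continuous_deriv le_rfl
  refine le_of_forall_pos_le_add fun ε hε => ?_
  obtain ⟨δ, hδ, hunif⟩ := Metric.uniformContinuousOn_iff.1
    (isCompact_Icc.uniformContinuousOn_of_continuous (s := Icc (0 : ℝ) 1) hd.continuousOn) ε hε
  obtain ⟨M, hM⟩ := exists_nat_gt δ⁻¹
  have hM0 : (0 : ℝ) < M := (inv_pos.2 hδ).trans hM
  have hMδ : 1 / (M : ℝ) < δ := by rw [div_lt_comm₀ hM0 hδ, one_div]; exact hM
  let τ : ℕ → ℝ := fun k => (k : ℝ) / M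
  have hstep : ∀ k, τ (k + 1) - τ k = 1 / M := fun k => by
    simp only [τ]; push_cast; ring
  have hk : ∀ k ∈ Finset.range M, ∫ t in τ k..τ (k + 1), |deriv x t| ≤
      |x (τ (k + 1)) - x (τ k)| + ε / M := fun k hk => by
    have hkM := Finset.mem_range.1 hk
    have hlt : τ k < τ (k + 1) := by have := hstep k; have := one_div_pos.2 hM0; linarith
    obtain ⟨ξ, hξ, hξe⟩ := exists_deriv_eq_slope x hlt hx.continuous.continuousOn
      (hx.differentiable (by norm_num)).differentiableOn
    have h0 : 0 ≤ τ k := by positivity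
    have h1 : τ (k + 1) ≤ 1 := by
      simp only [τ]; rw [div_le_one hM0]; exact_mod_cast hkM
    have hb : ∀ t ∈ Icc (τ k) (τ (k + 1)), |deriv x t| ≤ |deriv x ξ| + ε := fun t ht => by
      have h := hunif t ⟨h0.trans ht.1, ht.2.trans h1⟩ ξ ⟨h0.trans hξ.1.le, hξ.2.le.trans h1⟩ (by
        rw [Real.dist_eq, abs_lt]
        have := hstep k
        constructor <;> linarith [ht.1, ht.2, hξ.1, hξ.2])
      rw [Real.dist_eq] at h
      have := abs_sub_abs_le_abs_sub (deriv x t) (deriv x ξ)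
      linarith
    calc ∫ t in τ k..τ (k + 1), |deriv x t| ≤ ∫ _t in τ k..τ (k + 1), (|deriv x ξ| + ε) :=
          intervalIntegral.integral_mono_on hlt.le (hd.abs.intervalIntegrable _ _)
            (intervalIntegrable_const) hb
      _ = (τ (k + 1) - τ k) * |deriv x ξ| + ε / M := by
          rw [intervalIntegral.integral_const, smul_eq_mul, mul_add, hstep]; ring
      _ = _ := by
          rw [hξe, abs_div, abs_of_pos (sub_pos.2 hlt), mul_div_cancel₀ _ (sub_pos.2 hlt).ne']
  have hsum := intervalIntegral.sum_integral_adjacent_intervals (f := fun t => |deriv x t|)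
    (μ := volume) (a := τ) (n := M) fun k _ => hd.abs.intervalIntegrable _ _
  have e0 : τ 0 = 0 := by simp [τ]
  have e1 : τ M = 1 := div_self hM0.ne'
  rw [e0, e1] at hsum
  rw [← hsum]
  refine (Finset.sum_le_sum hk).trans ?_
  rw [Finset.sum_add_distrib]
  have := sum_abs_sub_le_of_card hx.continuous hR hS hN M
  have e2 : ∑ _k ∈ Finset.range M, ε / (M : ℝ) = ε := by
    rw [Finset.sum_const, Finset.card_range, nsmul_eq_mul, mul_div_cancel₀ _ hM0.ne']
  rw [e2]
  exact add_le_add this le_rfl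

/-- A simple curve that crosses almost all horizontal and vertical lines a bounded number of times
has bounded length. -/
theorem curveLen_le_of_card {c : ℝ → ℂ} (hc : ContDiff ℝ 1 c)
    (hinj : InjOn c (Ico 0 1)) {R : ℝ} (hR : ∀ w ∈ range c, ‖w‖ ≤ R) {S : Set ℝ} (hS : S.Finite)
    {N : ℕ} (hN : ∀ a ∉ S, ∀ Z : Finset ℂ, (∀ w ∈ Z, w ∈ range c) →
      ((∀ w ∈ Z, w.re = a) → Z.card ≤ N) ∧ ((∀ w ∈ Z, w.im = a) → Z.card ≤ N)) :
    curveLen c ≤ 2 * (N * (2 * R)) := by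
  classical
  have hre : ContDiff ℝ 1 fun t => (c t).re := Complex.reCLM.contDiff.comp hc
  have him : ContDiff ℝ 1 fun t => (c t).im := Complex.imCLM.contDiff.comp hc
  have hd : ∀ t, HasDerivAt c (deriv c t) t := fun t =>
    (hc.differentiable (by norm_num) t).hasDerivAt
  have hdre : ∀ t, deriv (fun t => (c t).re) t = (deriv c t).re := fun t =>
    (Complex.reCLM.hasFDerivAt.comp_hasDerivAt t (hd t)).deriv
  have hdim : ∀ t, deriv (fun t => (c t).im) t = (deriv c t).im := fun t =>
    (Complex.imCLM.hasFDerivAt.comp_hasDerivAt t (hd t)).deriv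
  have hcard : ∀ Z : Finset ℝ, (∀ t ∈ Z, t ∈ Ico (0 : ℝ) 1) → (Z.image c).card = Z.card :=
    fun Z hZ => Finset.card_image_of_injOn (hinj.mono fun t ht => hZ t ht)
  have h1 := integral_abs_deriv_le_of_card hre (R := R)
    (fun t => (Complex.abs_re_le_norm _).trans (hR _ ⟨t, rfl⟩)) hS (N := N) fun a ha Z hZ => by
      rw [← hcard Z fun t ht => (hZ t ht).1]
      refine (hN a ha (Z.image c) ?_).1 ?_
      · intro w hw; obtain ⟨t, -, rfl⟩ := Finset.mem_image.1 hw; exact ⟨t, rfl⟩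
      · intro w hw; obtain ⟨t, ht, rfl⟩ := Finset.mem_image.1 hw; exact (hZ t ht).2
  have h2 := integral_abs_deriv_le_of_card him (R := R)
    (fun t => (Complex.abs_im_le_norm _).trans (hR _ ⟨t, rfl⟩)) hS (N := N) fun a ha Z hZ => by
      rw [← hcard Z fun t ht => (hZ t ht).1]
      refine (hN a ha (Z.image c) ?_).2 ?_
      · intro w hw; obtain ⟨t, -, rfl⟩ := Finset.mem_image.1 hw; exact ⟨t, rfl⟩
      · intro w hw; obtain ⟨t, ht, rfl⟩ := Finset.mem_image.1 hw; exact (hZ t ht).2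
  simp only [hdre] at h1
  simp only [hdim] at h2
  have hcc : Continuous (deriv c) := hc.continuous_deriv le_rfl
  have hi1 : IntervalIntegrable (fun t => |(deriv c t).re|) volume 0 1 :=
    (Complex.continuous_re.comp hcc).abs.intervalIntegrable _ _
  have hi2 : IntervalIntegrable (fun t => |(deriv c t).im|) volume 0 1 :=
    (Complex.continuous_im.comp hcc).abs.intervalIntegrable _ _
  calc curveLen c ≤ ∫ t in (0 : ℝ)..1, (|(deriv c t).re| + |(deriv c t).im|) :=
        intervalIntegral.integral_mono_on zero_le_one (hcc.norm.intervalIntegrable _ _)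
          (hi1.add hi2) fun t _ => Complex.norm_le_abs_re_add_abs_im _
    _ ≤ 2 * (N * (2 * R)) := by
        rw [intervalIntegral.integral_add hi1 hi2]; linarith

/-- The area of a neighbourhood of a curve of bounded length. -/
theorem volume_thickening_curve_le {c : ℝ → ℂ} (hc : ContDiff ℝ 1 c) {L η : ℝ}
    (hL : curveLen c ≤ L) (hη : 0 < η) :
    volume (Metric.thickening η (c '' Icc 0 1)) ≤
      ENNReal.ofReal (4 * Real.pi * (L * η + η ^ 2)) := by
  have hL0 : 0 ≤ L := (curveLen_nonneg c).trans hL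
  have hcc : Continuous fun t => ‖deriv c t‖ := (hc.continuous_deriv le_rfl).norm
  let s : ℝ → ℝ := fun τ => ∫ t in (0 : ℝ)..τ, ‖deriv c t‖
  have hsc : Continuous s :=
    intervalIntegral.continuous_primitive (fun a b => hcc.intervalIntegrable a b) 0
  have hs0 : s 0 = 0 := intervalIntegral.integral_same
  have hsub : ∀ τ τ', s τ - s τ' = ∫ t in τ'..τ, ‖deriv c t‖ := fun τ τ' =>
    intervalIntegral.integral_interval_sub_left (hcc.intervalIntegrable _ _)
      (hcc.intervalIntegrable _ _)
  have hmono : ∀ τ ≤ 1, s τ ≤ L := fun τ hτ => by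
    have : 0 ≤ s 1 - s τ := by
      rw [hsub]; exact intervalIntegral.integral_nonneg hτ fun _ _ => norm_nonneg _
    linarith [show s 1 = curveLen c from rfl]
  have hdist : ∀ τ τ', ‖c τ - c τ'‖ ≤ |s τ - s τ'| := fun τ τ' => by
    rw [hsub, ← intervalIntegral.integral_deriv_eq_sub
      (fun t _ => (hc.differentiable (by norm_num) t))
      ((hc.continuous_deriv le_rfl).intervalIntegrable _ _)]
    exact intervalIntegral.norm_integral_le_abs_integral_norm
  set N := ⌊L / η⌋₊ with hN
  -- The curve is cut into blocks of arc length `η`, and `p` is the point where block `k` begins. If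
  -- block `k` is never reached, `0` is a dummy value. Balls of radius `2η` around these points
  -- cover the tube.
  have hex : ∀ k : ℕ, ∃ p : ℂ, ∀ τ ∈ Icc (0 : ℝ) 1, ⌊s τ / η⌋₊ = k → ‖c τ - p‖ ≤ η := fun k => by
    by_cases h : ∃ τ ∈ Icc (0 : ℝ) 1, s τ = k * η
    · obtain ⟨τ', hτ', hsτ'⟩ := h
      refine ⟨c τ', fun τ hτ hk => (hdist τ τ').trans ?_⟩
      have hs : 0 ≤ s τ := intervalIntegral.integral_nonneg hτ.1 fun _ _ => norm_nonneg _
      have h1 := Nat.floor_le (div_nonneg hs hη.le)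
      have h2 := Nat.lt_floor_add_one (s τ / η)
      rw [hk, le_div_iff₀ hη] at h1
      rw [hk, div_lt_iff₀ hη] at h2
      rw [hsτ', abs_le]
      constructor <;> nlinarith
    · refine ⟨0, fun τ hτ hk => (h ?_).elim⟩
      have hs : 0 ≤ s τ := intervalIntegral.integral_nonneg hτ.1 fun _ _ => norm_nonneg _
      have h1 := Nat.floor_le (div_nonneg hs hη.le)
      rw [hk, le_div_iff₀ hη] at h1
      obtain ⟨τ', hτ', he⟩ := intermediate_value_Icc hτ.1 hsc.continuousOn
        (show (k : ℝ) * η ∈ Icc (s 0) (s τ) from ⟨by rw [hs0]; positivity, h1⟩)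
      exact ⟨τ', ⟨hτ'.1, hτ'.2.trans hτ.2⟩, he⟩
  choose p hp using hex
  have hcov : Metric.thickening η (c '' Icc 0 1) ⊆
      ⋃ k ∈ Finset.range (N + 1), Metric.ball (p k) (2 * η) := by
    intro w hw
    obtain ⟨_, ⟨τ, hτ, rfl⟩, hd⟩ := Metric.mem_thickening_iff.1 hw
    rw [mem_iUnion₂]
    refine ⟨⌊s τ / η⌋₊, ?_, ?_⟩
    · rw [Finset.mem_range, Nat.lt_succ_iff]
      exact Nat.floor_le_floor (div_le_div_of_nonneg_right (hmono τ hτ.2) hη.le)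
    · rw [Metric.mem_ball]
      have h1 := hp _ τ hτ rfl
      have h2 := dist_triangle w (c τ) (p ⌊s τ / η⌋₊)
      rw [dist_eq_norm (c τ)] at h2
      linarith
  calc volume (Metric.thickening η (c '' Icc 0 1))
      ≤ ∑ k ∈ Finset.range (N + 1), volume (Metric.ball (p k) (2 * η)) :=
        (measure_mono hcov).trans (measure_biUnion_finset_le _ _)
    _ = ENNReal.ofReal ((N + 1) * ((2 * η) ^ 2 * Real.pi)) := by
        simp only [Complex.volume_ball, Finset.sum_const, Finset.card_range, nsmul_eq_mul]
        rw [ENNReal.ofReal_mul (show (0 : ℝ) ≤ N + 1 by positivity),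
          ENNReal.ofReal_mul (show (0 : ℝ) ≤ (2 * η) ^ 2 by positivity),
          ENNReal.ofReal_pow (show (0 : ℝ) ≤ 2 * η by positivity)]
        congr 1
        · rw [show ((N : ℝ) + 1) = ((N + 1 : ℕ) : ℝ) by push_cast; rfl, ENNReal.ofReal_natCast]
        · congr 1
          rw [← NNReal.coe_real_pi, ENNReal.ofReal_coe_nnreal]
    _ ≤ _ := by
        refine ENNReal.ofReal_le_ofReal ?_
        have h1 : (N : ℝ) ≤ L / η := Nat.floor_le (div_nonneg hL0 hη.le)
        have h2 : (N : ℝ) * η ≤ L := by rwa [le_div_iff₀ hη] at h1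
        have hπ := Real.pi_pos
        have : (N : ℝ) * η * (4 * η * Real.pi) ≤ L * (4 * η * Real.pi) := by gcongr
        nlinarith

end Length

/-! ### Few crossings for fibres over a dense set of parameters. -/

section GenericFibres

/-- A column on which `G` vanishes identically meets the row through `y₁` in a zero. That row
contains a nonzero value, hence has at most `N` zeros, and so there are at most `N` such columns. -/
theorem exists_finite_forall_card_le {G : ℝ → ℝ → ℝ} {δ : ℝ} {N : ℕ} {x₁ y₁ : ℝ}
    (hx₁ : |x₁| < δ) (h₁ : G x₁ y₁ ≠ 0)
    (hrow : (∀ t, |t| < δ → G t y₁ = 0) ∨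
      ∀ Z : Finset ℝ, (∀ t ∈ Z, |t| < δ ∧ G t y₁ = 0) → Z.card ≤ N)
    (hy₁ : |y₁| < δ) {N' : ℕ} (hcol : ∀ x, |x| < δ → (∀ t, |t| < δ → G x t = 0) ∨
      ∀ Z : Finset ℝ, (∀ t ∈ Z, |t| < δ ∧ G x t = 0) → Z.card ≤ N') :
    ∃ S : Set ℝ, S.Finite ∧ ∀ x ∉ S, |x| < δ →
      ∀ Z : Finset ℝ, (∀ t ∈ Z, |t| < δ ∧ G x t = 0) → Z.card ≤ N' := by
  refine ⟨{x | |x| < δ ∧ ∀ t, |t| < δ → G x t = 0}, ?_, fun x hx hxδ => ?_⟩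
  · have h2 := hrow.resolve_left fun h => h₁ (h x₁ hx₁)
    by_contra hinf
    obtain ⟨Z, hZ, hcard⟩ := Set.Infinite.exists_subset_card_eq hinf (N + 1)
    have := h2 Z fun t ht => ⟨(hZ ht).1, (hZ ht).2 _ hy₁⟩
    omega
  · exact (hcol x hxδ).resolve_left fun h => hx ⟨hxδ, h⟩

/-- `S` meets almost all horizontal and vertical lines in at most `N` points. -/
def HasFewCrossings (S : Set ℂ) (N : ℕ) : Prop :=
  ∃ T : Set ℝ, T.Finite ∧ ∀ a ∉ T, ∀ Z : Finset ℂ, (∀ w ∈ Z, w ∈ S) →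
    ((∀ w ∈ Z, w.re = a) → Z.card ≤ N) ∧ ((∀ w ∈ Z, w.im = a) → Z.card ≤ N)

theorem HasFewCrossings.mono {S S' : Set ℂ} {N : ℕ} (h : HasFewCrossings S N) (hS : S' ⊆ S) :
    HasFewCrossings S' N := by
  obtain ⟨T, hT, h⟩ := h
  exact ⟨T, hT, fun a ha Z hZ => h a ha Z fun w hw => hS (hZ w hw)⟩

theorem HasFewCrossings.union {S S' : Set ℂ} {N N' : ℕ} (h : HasFewCrossings S N)
    (h' : HasFewCrossings S' N') : HasFewCrossings (S ∪ S') (N + N') := by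
  classical
  obtain ⟨T, hT, h⟩ := h
  obtain ⟨T', hT', h'⟩ := h'
  refine ⟨T ∪ T', hT.union hT', fun a ha Z hZ => ?_⟩
  rw [mem_union, not_or] at ha
  have h1 := h a ha.1 (Z.filter (· ∈ S)) fun w hw => (Finset.mem_filter.1 hw).2
  have h2 := h' a ha.2 (Z.filter (¬ · ∈ S)) fun w hw =>
    (hZ w (Finset.mem_filter.1 hw).1).resolve_left (Finset.mem_filter.1 hw).2
  have hc := Finset.card_filter_add_card_filter_not (s := Z) (· ∈ S)
  refine ⟨fun hw => ?_, fun hw => ?_⟩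
  · have := h1.1 fun w hw' => hw w (Finset.mem_filter.1 hw').1
    have := h2.1 fun w hw' => hw w (Finset.mem_filter.1 hw').1
    omega
  · have := h1.2 fun w hw' => hw w (Finset.mem_filter.1 hw').1
    have := h2.2 fun w hw' => hw w (Finset.mem_filter.1 hw').1
    omega

theorem hasFewCrossings_empty : HasFewCrossings ∅ 0 :=
  ⟨∅, finite_empty, fun a _ Z hZ => by
    have : Z = ∅ := Finset.eq_empty_of_forall_notMem fun w hw => hZ w hw
    simp [this]⟩

theorem regularLocus_subset {n : ℕ} (A : Set ((Fin n → ℂ) × ℂ)) : regularLocus A ⊆ A :=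
  fun _ h => h.1

/-- No regular points where the set has interior. -/
theorem disjoint_closure_regularLocus {n : ℕ} {A O : Set ((Fin n → ℂ) × ℂ)} (hO : IsOpen O)
    (h : O ⊆ A) : Disjoint O (closure (regularLocus A)) := by
  rw [Set.disjoint_left]
  intro p hp hpc
  obtain ⟨q, hqO, -, V, ρ, hd⟩ := mem_closure_iff.1 hpc O hO hp
  apply hd.fderiv_ne_zero
  have : ρ =ᶠ[𝓝 q] fun _ => 0 := by
    filter_upwards [hO.mem_nhds hqO, hd.isOpen.mem_nhds hd.mem] with x hx hxV
    have : x ∈ A ∩ V := ⟨h hx, hxV⟩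
    rw [hd.inter_eq] at this
    exact this.2
  rw [this.fderiv_eq]
  simp

theorem IsRealAnalyticHypersurface.isClosed {n : ℕ} {Γ : Set ((Fin n → ℂ) × ℂ)}
    (hΓ : IsRealAnalyticHypersurface Γ) : IsClosed Γ := by
  obtain ⟨-, A, -, rfl⟩ := hΓ
  exact isClosed_closure

theorem card_image_re_eq {a : ℝ} (w₀ : ℂ) (Z : Finset ℂ) (h : ∀ w ∈ Z, w.re = a) :
    (Z.image fun w => w.im - w₀.im).card = Z.card :=
  Finset.card_image_of_injOn fun w hw w' hw' he =>
    Complex.ext ((h w hw).trans (h w' hw').symm) (by simpa using he)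

theorem card_image_im_eq {a : ℝ} (w₀ : ℂ) (Z : Finset ℂ) (h : ∀ w ∈ Z, w.im = a) :
    (Z.image fun w => w.re - w₀.re).card = Z.card :=
  Finset.card_image_of_injOn fun w hw w' hw' he =>
    Complex.ext (by simpa using he) ((h w hw).trans (h w' hw').symm)

/-- Apply uniform finiteness to a local equation `ρ` in the real and in the imaginary direction of
`w`. If `ρ` vanishes identically over `O`, the analytic set has interior there and contributes
nothing to `Γ`. Otherwise `ρ ≠ 0` at some `(z, w₁)`, and this persists on an open set of `z`, for
which only finitely many lines are exceptional. Shrinking `O` is why one obtains a dense set of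
parameters only. -/
theorem IsRealAnalyticHypersurface.exists_fewCrossings_near {n : ℕ} {Γ : Set ((Fin n → ℂ) × ℂ)}
    (hΓ : IsRealAnalyticHypersurface Γ) (z₀ : Fin n → ℂ) (w₀ : ℂ) :
    ∃ δ > 0, ∃ N : ℕ, ∀ O : Set (Fin n → ℂ), IsOpen O → O.Nonempty → O ⊆ Metric.ball z₀ δ →
      ∃ O' ⊆ O, IsOpen O' ∧ O'.Nonempty ∧
        ∀ z ∈ O', HasFewCrossings (fibre Γ z ∩ Metric.ball w₀ δ) N := by
  classical
  obtain ⟨-, A, ⟨hAc, hA⟩, rfl⟩ := hΓ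
  have hsub : closure (regularLocus A) ⊆ A := closure_minimal (regularLocus_subset A) hAc
  by_cases hq : (z₀, w₀) ∈ A
  · obtain ⟨V, ρ, hV, hqV, hρ, hAV⟩ := hA _ hq
    obtain ⟨δ₀, hδ₀, hball⟩ := Metric.isOpen_iff.1 hV _ hqV
    obtain ⟨δ₁, hδ₁, N₁, h₁⟩ := (hρ _ hqV).exists_card_zeros_le ((0 : Fin n → ℂ), (1 : ℂ))
    obtain ⟨δ₂, hδ₂, N₂, h₂⟩ := (hρ _ hqV).exists_card_zeros_le ((0 : Fin n → ℂ), Complex.I)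
    set δ := min δ₀ (min δ₁ δ₂) with hδ
    have hδ0 : 0 < δ := by positivity
    refine ⟨δ, hδ0, max N₁ N₂, fun O hO hOne hOδ => ?_⟩
    have hmemV : ∀ z ∈ O, ∀ w ∈ Metric.ball w₀ δ, (z, w) ∈ V := fun z hz w hw => hball <| by
      rw [← ball_prod_same]
      exact ⟨Metric.ball_subset_ball (min_le_left _ _) (hOδ hz),
        Metric.ball_subset_ball (min_le_left _ _) hw⟩
    by_cases hB : ∀ z ∈ O, ∀ w ∈ Metric.ball w₀ δ, ρ (z, w) = 0
    · refine ⟨O, Subset.rfl, hO, hOne, fun z hz => ?_⟩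
      have : O ×ˢ Metric.ball w₀ δ ⊆ A := fun p hp => by
        have : p ∈ {p ∈ V | ρ p = 0} := ⟨hmemV _ hp.1 _ hp.2, hB _ hp.1 _ hp.2⟩
        rw [← hAV] at this
        exact this.1
      have hd := disjoint_closure_regularLocus (hO.prod Metric.isOpen_ball) this
      have he : fibre (closure (regularLocus A)) z ∩ Metric.ball w₀ δ = ∅ := by
        rw [eq_empty_iff_forall_notMem]
        rintro w ⟨hw1, hw2⟩
        exact Set.disjoint_left.1 hd (show (z, w) ∈ O ×ˢ Metric.ball w₀ δ from ⟨hz, hw2⟩) hw1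
      rw [he]
      obtain ⟨T, hT, h⟩ := hasFewCrossings_empty
      exact ⟨T, hT, fun a ha Z hZ => ⟨fun hw => ((h a ha Z hZ).1 hw).trans (Nat.zero_le _),
        fun hw => ((h a ha Z hZ).2 hw).trans (Nat.zero_le _)⟩⟩
    · push Not at hB
      obtain ⟨z₁, hz₁, w₁, hw₁, hne⟩ := hB
      have hcont : ContinuousAt (fun z => ρ (z, w₁)) z₁ :=
        ContinuousAt.comp (g := ρ) (f := fun z => (z, w₁)) (hρ _ (hmemV _ hz₁ _ hw₁)).continuousAt
          (by fun_prop)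
      obtain ⟨O₁, hO₁s, hO₁, hzO₁⟩ := mem_nhds_iff.1 (hcont.eventually_ne hne)
      refine ⟨O ∩ O₁, inter_subset_left, hO.inter hO₁, ⟨z₁, hz₁, hzO₁⟩, fun z hz => ?_⟩
      have hne' : ρ (z, w₁) ≠ 0 := hO₁s hz.2
      let G : ℝ → ℝ → ℝ := fun x y => ρ (z, w₀ + x + y * Complex.I)
      have hzδ : dist z z₀ < δ := hOδ hz.1
      have hx₁ : |w₁.re - w₀.re| < δ :=
        (Complex.abs_re_le_norm (w₁ - w₀)).trans_lt (by rwa [← dist_eq_norm])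
      have hy₁ : |w₁.im - w₀.im| < δ :=
        (Complex.abs_im_le_norm (w₁ - w₀)).trans_lt (by rwa [← dist_eq_norm])
      have hw : ∀ w : ℂ, w₀ + (w.re - w₀.re : ℝ) + (w.im - w₀.im : ℝ) * Complex.I = w := fun w => by
        apply Complex.ext <;> simp
      have hG₁ : G (w₁.re - w₀.re) (w₁.im - w₀.im) ≠ 0 := by
        simp only [G]; rw [hw]; exact hne'
      have hrow : ∀ y, |y| < δ → (∀ t, |t| < δ → G t y = 0) ∨
          ∀ Z : Finset ℝ, (∀ t ∈ Z, |t| < δ ∧ G t y = 0) → Z.card ≤ N₁ := fun y hy => by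
        have := h₁ (z, w₀ + y * Complex.I) (by
          rw [← ball_prod_same]
          refine ⟨hzδ.trans_le ((min_le_right _ _).trans (min_le_left _ _)), ?_⟩
          rw [Metric.mem_ball, dist_eq_norm]
          simpa using hy.trans_le ((min_le_right _ _).trans (min_le_left _ _)))
        have e : ∀ t : ℝ, ρ ((z, w₀ + y * Complex.I) + t • ((0 : Fin n → ℂ), (1 : ℂ))) = G t y :=
          fun t => by
            simp only [G]; congr 1
            ext1
            · simp
            · simp; ring
        simp only [e] at this
        have hle : δ ≤ δ₁ := (min_le_right _ _).trans (min_le_left _ _)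
        exact this.imp (fun h t ht => h t (ht.trans_le hle)) fun h Z hZ => h Z fun t ht =>
          ⟨(hZ t ht).1.trans_le hle, (hZ t ht).2⟩
      have hcol : ∀ x, |x| < δ → (∀ t, |t| < δ → G x t = 0) ∨
          ∀ Z : Finset ℝ, (∀ t ∈ Z, |t| < δ ∧ G x t = 0) → Z.card ≤ N₂ := fun x hx => by
        have := h₂ (z, w₀ + x) (by
          rw [← ball_prod_same]
          refine ⟨hzδ.trans_le ((min_le_right _ _).trans (min_le_right _ _)), ?_⟩
          rw [Metric.mem_ball, dist_eq_norm]
          simpa using hx.trans_le ((min_le_right _ _).trans (min_le_right _ _)))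
        have e : ∀ t : ℝ, ρ ((z, w₀ + x) + t • ((0 : Fin n → ℂ), Complex.I)) = G x t :=
          fun t => by
            simp only [G]; congr 1
            ext1
            · simp
            · simp
        simp only [e] at this
        have hle : δ ≤ δ₂ := (min_le_right _ _).trans (min_le_right _ _)
        exact this.imp (fun h t ht => h t (ht.trans_le hle)) fun h Z hZ => h Z fun t ht =>
          ⟨(hZ t ht).1.trans_le hle, (hZ t ht).2⟩
      obtain ⟨S₁, hS₁, hS₁'⟩ := exists_finite_forall_card_le hx₁ hG₁ (hrow _ hy₁) hy₁ hcol
      obtain ⟨S₂, hS₂, hS₂'⟩ := exists_finite_forall_card_le (G := fun y x => G x y) hy₁ hG₁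
        (hcol _ hx₁) hx₁ hrow
      have hzero : ∀ w ∈ fibre (closure (regularLocus A)) z ∩ Metric.ball w₀ δ,
          |w.re - w₀.re| < δ ∧ |w.im - w₀.im| < δ ∧
            G (w.re - w₀.re) (w.im - w₀.im) = 0 := fun w hwf => by
        have hwδ : ‖w - w₀‖ < δ := by rw [← dist_eq_norm]; exact hwf.2
        refine ⟨(Complex.abs_re_le_norm (w - w₀)).trans_lt hwδ,
          (Complex.abs_im_le_norm (w - w₀)).trans_lt hwδ, ?_⟩
        simp only [G]
        rw [hw]
        have : (z, w) ∈ A ∩ V := ⟨hsub hwf.1, hmemV _ hz.1 _ hwf.2⟩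
        rw [hAV] at this
        exact this.2
      refine ⟨(fun x => x + w₀.re) '' S₁ ∪ (fun x => x + w₀.im) '' S₂,
        (hS₁.image _).union (hS₂.image _), fun a ha Z hZ => ?_⟩
      rw [mem_union, not_or] at ha
      rcases Z.eq_empty_or_nonempty with rfl | ⟨w', hw'⟩
      · simp
      refine ⟨fun hre => ?_, fun him => ?_⟩
      · rw [← card_image_re_eq w₀ Z hre]
        refine (hS₁' (a - w₀.re) (fun h => ha.1 ⟨_, h, by simp⟩)
          (hre w' hw' ▸ (hzero w' (hZ w' hw')).1) _ fun t ht => ?_).trans (le_max_right _ _)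
        obtain ⟨w, hwZ, rfl⟩ := Finset.mem_image.1 ht
        have := hzero w (hZ w hwZ)
        exact ⟨this.2.1, by rw [← hre w hwZ]; exact this.2.2⟩
      · rw [← card_image_im_eq w₀ Z him]
        refine (hS₂' (a - w₀.im) (fun h => ha.2 ⟨_, h, by simp⟩)
          (him w' hw' ▸ (hzero w' (hZ w' hw')).2.1) _ fun t ht => ?_).trans (le_max_left _ _)
        obtain ⟨w, hwZ, rfl⟩ := Finset.mem_image.1 ht
        have := hzero w (hZ w hwZ)
        exact ⟨this.1, by rw [← him w hwZ]; exact this.2.2⟩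
  · obtain ⟨δ, hδ, hball⟩ := Metric.isOpen_iff.1 hAc.isOpen_compl _ hq
    refine ⟨δ, hδ, 0, fun O hO hOne hOδ => ⟨O, Subset.rfl, hO, hOne, fun z hz => ?_⟩⟩
    refine hasFewCrossings_empty.mono ?_
    rintro w ⟨hw1, hw2⟩
    refine hball (?_ : (z, w) ∈ _) (hsub hw1)
    rw [← ball_prod_same]
    exact ⟨hOδ hz, hw2⟩

/-- Near every point there is a dense set of parameters for which the fibres of a real analytic
hypersurface, in a bounded region, have a bounded number of crossings. -/
theorem IsRealAnalyticHypersurface.exists_fewCrossings {n : ℕ} {Γ : Set ((Fin n → ℂ) × ℂ)}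
    (hΓ : IsRealAnalyticHypersurface Γ) (z₀ : Fin n → ℂ) (R : ℝ) :
    ∃ r > 0, ∃ N : ℕ, ∀ O : Set (Fin n → ℂ), IsOpen O → O.Nonempty → O ⊆ Metric.ball z₀ r →
      ∃ z ∈ O, HasFewCrossings (fibre Γ z ∩ Metric.closedBall 0 R) N := by
  choose δ hδ N h using fun w₀ => hΓ.exists_fewCrossings_near z₀ w₀
  obtain ⟨t, -, ht⟩ := (isCompact_closedBall (0 : ℂ) R).elim_nhds_subcover
    (fun w => Metric.ball w (δ w)) fun w _ => Metric.ball_mem_nhds w (hδ w)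
  -- Induction over the finite cover. The set of good parameters for the balls already treated is
  -- open, so it can be shrunk again for the next ball.
  have key : ∀ t : Finset ℂ, ∃ r > 0, ∃ N : ℕ, ∀ O : Set (Fin n → ℂ), IsOpen O → O.Nonempty →
      O ⊆ Metric.ball z₀ r → ∃ O' ⊆ O, IsOpen O' ∧ O'.Nonempty ∧
        ∀ z ∈ O', HasFewCrossings (fibre Γ z ∩ ⋃ w ∈ t, Metric.ball w (δ w)) N := fun t => by
    classical
    induction t using Finset.induction_on with
    | empty =>
      refine ⟨1, one_pos, 0, fun O hO hne _ => ⟨O, Subset.rfl, hO, hne, fun z _ => ?_⟩⟩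
      simpa using hasFewCrossings_empty
    | insert w t _ ih =>
      obtain ⟨r, hr, N', h'⟩ := ih
      refine ⟨min r (δ w), lt_min hr (hδ w), N w + N', fun O hO hne hOr => ?_⟩
      obtain ⟨O₁, hO₁s, hO₁, hne₁, h₁⟩ :=
        h' O hO hne (hOr.trans (Metric.ball_subset_ball (min_le_left _ _)))
      obtain ⟨O₂, hO₂s, hO₂, hne₂, h₂⟩ := h w O₁ hO₁ hne₁
        ((hO₁s.trans hOr).trans (Metric.ball_subset_ball (min_le_right _ _)))
      refine ⟨O₂, hO₂s.trans hO₁s, hO₂, hne₂, fun z hz => ?_⟩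
      rw [Finset.set_biUnion_insert, inter_union_distrib_left]
      exact (h₂ z hz).union (h₁ z (hO₂s hz))
  obtain ⟨r, hr, N', h'⟩ := key t
  refine ⟨r, hr, N', fun O hO hne hOr => ?_⟩
  obtain ⟨O', hO's, -, ⟨z, hz⟩, hz'⟩ := h' O hO hne hOr
  exact ⟨z, hO's hz, (hz' z hz).mono (inter_subset_inter_right _ ht)⟩

end GenericFibres


/-! ### Families of discs: nearby fibres do not jump. -/

/-- A family of discs `Ω_z`, over an open set `D`, bounded by regular points of `Γ`. -/
structure IsDiscFamily {n : ℕ} (Γ Ω : Set ((Fin n → ℂ) × ℂ)) (D : Set (Fin n → ℂ)) : Prop where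
  isClosed : IsClosed Γ
  isOpen : IsOpen Ω
  isOpen_base : IsOpen D
  disc : ∀ z ∈ D, BoundsDisc (fibre Γ z) (fibre Ω z)
  reg : ∀ z ∈ D, ∀ w ∈ fibre Γ z, (z, w) ∈ regularLocus Γ
  base : ∀ p ∈ Ω, p.1 ∈ D

theorem isClosed_fibre {n : ℕ} {S : Set ((Fin n → ℂ) × ℂ)} (hS : IsClosed S) (z : Fin n → ℂ) :
    IsClosed (fibre S z) := hS.preimage (by fun_prop : Continuous fun w : ℂ => (z, w))

theorem isOpen_fibre {n : ℕ} {S : Set ((Fin n → ℂ) × ℂ)} (hS : IsOpen S) (z : Fin n → ℂ) :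
    IsOpen (fibre S z) := hS.preimage (by fun_prop : Continuous fun w : ℂ => (z, w))

/-- A compact set in the complement of a fibre of a closed set is in the complement of the fibres
nearby. -/
theorem eventually_disjoint_fibre {n : ℕ} {Γ : Set ((Fin n → ℂ) × ℂ)} (hΓ : IsClosed Γ)
    {z₁ : Fin n → ℂ} {K : Set ℂ} (hK : IsCompact K) (hd : Disjoint K (fibre Γ z₁)) :
    ∀ᶠ z in 𝓝 z₁, Disjoint K (fibre Γ z) := by
  have : ∀ᶠ z in 𝓝 z₁, ∀ w ∈ K, (z, w) ∉ Γ :=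
    hK.eventually_forall_of_forall_eventually fun w hw =>
      hΓ.isOpen_compl.mem_nhds fun h => Set.disjoint_left.1 hd hw h
  filter_upwards [this] with z hz
  exact Set.disjoint_left.2 fun w hw hw' => hz w hw hw'

theorem IsDefiningFunctionAt.neg {n : ℕ} {Γ V : Set ((Fin n → ℂ) × ℂ)}
    {ρ : (Fin n → ℂ) × ℂ → ℝ} {q : (Fin n → ℂ) × ℂ} (h : IsDefiningFunctionAt Γ V ρ q) :
    IsDefiningFunctionAt Γ V (fun p => -ρ p) q where
  isOpen := h.isOpen
  mem := h.mem
  analytic := h.analytic.neg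
  fderiv_ne_zero := by
    rw [fderiv_fun_neg, neg_ne_zero]; exact h.fderiv_ne_zero
  inter_eq := by rw [h.inter_eq]; simp

namespace IsDiscFamily

variable {n : ℕ} {Γ Ω : Set ((Fin n → ℂ) × ℂ)} {D : Set (Fin n → ℂ)}

/-- If an exterior point becomes an interior one, then the curve goes off to infinity. -/
theorem eventually_disjoint_ball (h : IsDiscFamily Γ Ω D) {z₁ : Fin n → ℂ} (hz₁ : z₁ ∈ D) {w₁ : ℂ}
    (hw₁ : w₁ ∈ (fibre Ω z₁ ∪ fibre Γ z₁)ᶜ) {R : ℝ} (hR0 : 0 ≤ R)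
    (hR : closure (fibre Ω z₁) ⊆ Metric.ball 0 R) :
    ∀ᶠ z in 𝓝 z₁, w₁ ∈ fibre Ω z → Disjoint (fibre Γ z) (Metric.ball 0 R) := by
  have hb := h.disc z₁ hz₁
  have hsph : Metric.sphere (0 : ℂ) R ⊆ (fibre Ω z₁ ∪ fibre Γ z₁)ᶜ := fun w hw hw' => by
    rw [← hb.closure_eq] at hw'
    have := hR hw'
    rw [mem_ball_zero_iff] at this
    rw [mem_sphere_zero_iff_norm] at hw
    exact this.ne hw
  have hsne : (R : ℂ) ∈ Metric.sphere (0 : ℂ) R := by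
    simp [abs_of_nonneg hR0]
  have hpc : IsPathConnected (fibre Ω z₁ ∪ fibre Γ z₁)ᶜ :=
    hb.isOpen_ext.isConnected_iff_isPathConnected.1 ⟨⟨w₁, hw₁⟩, hb.isPreconnected_ext⟩
  obtain ⟨γ, hγ⟩ := hpc.joinedIn w₁ hw₁ R (hsph hsne)
  -- A compact connected set joining `w₁` to a large circle off `γ(z₁)`, hence off the nearby
  -- curves. If `w₁` lies in a nearby disc, so does the circle. The connected unbounded exterior
  -- then cannot enter the ball, and the curve lies in the closure of the exterior.
  set S : Set ℂ := range γ ∪ Metric.sphere 0 R with hS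
  have hSK : IsCompact S := (isCompact_range γ.continuous).union (isCompact_sphere _ _)
  have hSc : IsPreconnected S := by
    refine IsPreconnected.union (R : ℂ) ⟨1, by simp⟩ hsne
      (isPreconnected_range γ.continuous) ?_
    exact isPreconnected_sphere (by simp) _ _
  have hSd : Disjoint S (fibre Γ z₁) := by
    rw [Set.disjoint_left]
    rintro w (⟨t, rfl⟩ | hw) hw'
    · exact hγ t (Or.inr hw')
    · exact hsph hw (Or.inr hw')
  filter_upwards [eventually_disjoint_fibre h.isClosed hSK hSd] with z hz hwz
  have hzD : z ∈ D := h.base _ hwz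
  have hbz := h.disc z hzD
  have hSΔ : S ⊆ fibre Ω z := hSc.subset_of_disjoint_frontier
    ⟨w₁, Or.inl ⟨0, by simp⟩, hwz⟩ (by rw [hbz.frontier_eq]; exact hz)
  have hext : Disjoint (fibre Ω z ∪ fibre Γ z)ᶜ (Metric.ball 0 R) := by
    rw [Set.disjoint_iff_inter_eq_empty, ← not_nonempty_iff_eq_empty]
    intro hne
    have := hbz.isPreconnected_ext.subset_of_disjoint_frontier hne (by
      rw [Set.disjoint_left]
      intro w hw hw'
      exact hw (Or.inl (hSΔ (Or.inr (Metric.frontier_ball_subset_sphere hw')))))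
    exact hbz.not_isBounded_ext (Metric.isBounded_ball.subset this)
  rw [Set.disjoint_left]
  intro w hw hwb
  obtain ⟨w', hw'b, hw'⟩ := mem_closure_iff.1 (hbz.mem_closure_ext hw) _ Metric.isOpen_ball hwb
  exact Set.disjoint_left.1 hext hw' hw'b

/-- If the nearby curves meet a fixed ball then the exterior is locally constant. -/
theorem notMem_closure_of_eventually (h : IsDiscFamily Γ Ω D) {z₁ : Fin n → ℂ} (hz₁ : z₁ ∈ D)
    {R : ℝ} (hR : ∀ᶠ z in 𝓝 z₁, (fibre Γ z ∩ Metric.ball 0 R).Nonempty) {w₁ : ℂ}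
    (hw₁ : w₁ ∈ (fibre Ω z₁ ∪ fibre Γ z₁)ᶜ) : (z₁, w₁) ∉ closure Ω := by
  have hb := h.disc z₁ hz₁
  obtain ⟨R', hR'⟩ := hb.isCompact_closure.isBounded.subset_ball 0
  have hR'' : closure (fibre Ω z₁) ⊆ Metric.ball 0 (max (max R R') 0) :=
    hR'.trans (Metric.ball_subset_ball ((le_max_right _ _).trans (le_max_left _ _)))
  obtain ⟨δ, hδ, hball⟩ := Metric.nhds_basis_closedBall.mem_iff.1 (hb.isOpen_ext.mem_nhds hw₁)
  have hd := eventually_disjoint_fibre h.isClosed (isCompact_closedBall w₁ δ)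
    (Set.disjoint_left.2 fun w hw hw' => hball hw (Or.inr hw'))
  have hev := (hR.and (h.eventually_disjoint_ball hz₁ hw₁ (le_max_right _ _) hR'')).and hd
  have key : ∀ᶠ p in 𝓝 (z₁, w₁), p ∉ Ω := by
    rw [nhds_prod_eq]
    filter_upwards [hev.prod_mk (Metric.closedBall_mem_nhds w₁ hδ)] with p hp hpΩ
    obtain ⟨⟨⟨hne, hdis⟩, hd'⟩, hpw⟩ := hp
    have hsub : Metric.closedBall w₁ δ ⊆ fibre Ω p.1 :=
      (convex_closedBall w₁ δ).isPreconnected.subset_of_disjoint_frontier ⟨p.2, hpw, hpΩ⟩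
        (by rw [(h.disc _ (h.base _ hpΩ)).frontier_eq]; exact hd')
    obtain ⟨w, hw, hwb⟩ := hne
    exact Set.disjoint_left.1 (hdis (hsub (Metric.mem_closedBall_self hδ.le))) hw
      (Metric.ball_subset_ball ((le_max_left _ _).trans (le_max_left _ _)) hwb)
  rw [mem_closure_iff_frequently, not_frequently]
  exact key

/-- A sign change of the defining function on a ball survives small changes of `z`, and the
intermediate value theorem yields a zero. -/
theorem eventually_inter_nonempty_of_sign {V : Set ((Fin n → ℂ) × ℂ)} {ρ : (Fin n → ℂ) × ℂ → ℝ}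
    (hρ : ContinuousOn ρ V) (hV : IsOpen V) (hΓV : Γ ∩ V = {p ∈ V | ρ p = 0}) {z₁ : Fin n → ℂ}
    {p : ℂ} {r : ℝ} (hr : Metric.ball (z₁, p) r ⊆ V) {w w' : ℂ} (hw : w ∈ Metric.ball p r)
    (hw' : w' ∈ Metric.ball p r) (h1 : ρ (z₁, w) < 0) (h2 : 0 < ρ (z₁, w')) :
    ∀ᶠ z in 𝓝 z₁, (fibre Γ z ∩ Metric.ball p r).Nonempty := by
  rw [← ball_prod_same] at hr
  have hr0 : 0 < r := dist_nonneg.trans_lt hw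
  have hc : ∀ w ∈ Metric.ball p r, ContinuousAt (fun z => ρ (z, w)) z₁ := fun w hw =>
    ContinuousAt.comp (g := ρ) (f := fun z => (z, w))
      (hρ.continuousAt (hV.mem_nhds (hr ⟨Metric.mem_ball_self hr0, hw⟩))) (by fun_prop)
  filter_upwards [(hc w hw).eventually (gt_mem_nhds h1), (hc w' hw').eventually (lt_mem_nhds h2),
    Metric.ball_mem_nhds z₁ hr0] with z hz1 hz2 hz
  have hcz : ContinuousOn (fun w => ρ (z, w)) (Metric.ball p r) :=
    hρ.comp (by fun_prop) fun w hw => hr ⟨hz, hw⟩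
  obtain ⟨x, hx, hx0⟩ := (convex_ball p r).isPreconnected.intermediate_value hw hw' hcz
    ⟨hz1.le, hz2.le⟩
  have : (z, x) ∈ Γ ∩ V := by rw [hΓV]; exact ⟨hr ⟨hz, hx⟩, hx0⟩
  exact ⟨x, this.1, hx⟩

/-- The defining function changes its sign on the fibre. -/
theorem not_isLocalMin (h : IsDiscFamily Γ Ω D) {z₁ : Fin n → ℂ} (hz₁ : z₁ ∈ D) {p : ℂ}
    (hp : p ∈ fibre Γ z₁) {V : Set ((Fin n → ℂ) × ℂ)} {ρ : (Fin n → ℂ) × ℂ → ℝ}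
    (hd : IsDefiningFunctionAt Γ V ρ (z₁, p)) : ¬ IsLocalMin (fun w => ρ (z₁, w)) p := by
  intro hmin
  have hb := h.disc z₁ hz₁
  have hzero : ∀ q ∈ V, q ∈ Γ ↔ ρ q = 0 := fun q hq => by
    have := Set.ext_iff.1 hd.inter_eq q
    simpa [hq] using this
  have hdiff : ∀ q ∈ V, DifferentiableAt ℝ ρ q := fun q hq => (hd.analytic q hq).differentiableAt
  -- a direction in which `ρ` decreases
  have hv : ∃ v : Fin n → ℂ, fderiv ℝ ρ (z₁, p) (v, 0) < 0 := by
    -- The differential vanishes in the fibre direction at a local minimum, so it must be nonzero in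
    -- some direction `v` of the base.
    have hu : ∀ u : ℂ, fderiv ℝ ρ (z₁, p) (0, u) = 0 := fun u => by
      have h1 : HasFDerivAt (fun w : ℂ => ρ (z₁, w))
          ((fderiv ℝ ρ (z₁, p)).comp (ContinuousLinearMap.inr ℝ (Fin n → ℂ) ℂ)) p :=
        HasFDerivAt.comp (g := ρ) (f := fun w => (z₁, w)) p (hdiff _ hd.mem).hasFDerivAt
          (hasFDerivAt_prodMk_right z₁ p)
      have := hmin.hasFDerivAt_eq_zero h1
      simpa using congrArg (fun L => L u) this
    obtain ⟨⟨v, u⟩, hvu⟩ : ∃ x, fderiv ℝ ρ (z₁, p) x ≠ 0 := by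
      by_contra hcon
      push Not at hcon
      exact hd.fderiv_ne_zero (ContinuousLinearMap.ext hcon)
    have e : fderiv ℝ ρ (z₁, p) (v, u) = fderiv ℝ ρ (z₁, p) (v, 0) := by
      rw [show ((v, u) : (Fin n → ℂ) × ℂ) = (v, 0) + (0, u) by simp, map_add, hu, add_zero]
    rw [e] at hvu
    rcases lt_or_gt_of_ne hvu with hlt | hgt
    · exact ⟨v, hlt⟩
    · refine ⟨-v, ?_⟩
      rw [show ((-v, 0) : (Fin n → ℂ) × ℂ) = -(v, 0) by simp, map_neg]
      linarith
  obtain ⟨v, hv⟩ := hv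
  have hfc : ContinuousAt (fun q => fderiv ℝ ρ q (v, 0)) (z₁, p) :=
    ((hd.analytic _ hd.mem).fderiv.continuousAt).clm_apply continuousAt_const
  obtain ⟨r, hr0, hr⟩ := Metric.eventually_nhds_iff_ball.1
    ((hfc.eventually (gt_mem_nhds hv)).and ((hd.isOpen.mem_nhds hd.mem)))
  obtain ⟨r', hr'0, hr'⟩ := Metric.eventually_nhds_iff_ball.1 hmin
  have hρp : ρ (z₁, p) = 0 := (hzero _ hd.mem).1 hp
  set s := min r r' with hs
  have hs0 : 0 < s := lt_min hr0 hr'0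
  -- Moving the base point along `v` strictly decreases `ρ` near `p`. At time `0` the function is
  -- nonnegative on the fibre, and for `t > 0` it is negative at `p`. Following the two sides of
  -- `γ(z₁)` in time leads to a contradiction.
  let Z : ℝ → Fin n → ℂ := fun t => z₁ + t • v
  have hZ0 : Z 0 = z₁ := by simp [Z]
  have hZc : Continuous Z := by fun_prop
  have hpos : ∀ w ∈ Metric.ball p s, w ∉ fibre Γ z₁ → 0 < ρ (z₁, w) := fun w hw hwΓ => by
    have h1 : 0 ≤ ρ (z₁, w) := by
      have : ρ (z₁, p) ≤ ρ (z₁, w) := hr' w (Metric.ball_subset_ball (min_le_right _ _) hw)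
      rwa [hρp] at this
    refine lt_of_le_of_ne h1 fun he => hwΓ ((hzero _ ?_).2 he.symm)
    refine (hr _ ?_).2
    rw [← ball_prod_same]
    exact ⟨Metric.mem_ball_self hr0, Metric.ball_subset_ball (min_le_left _ _) hw⟩
  -- a time interval with control
  have hev : ∀ᶠ t in 𝓝[≥] (0 : ℝ), Z t ∈ D ∧ Z t ∈ Metric.ball z₁ s := by
    have : Tendsto Z (𝓝[≥] 0) (𝓝 z₁) := by
      have := hZc.tendsto 0
      rw [hZ0] at this
      exact this.mono_left nhdsWithin_le_nhds
    exact this.eventually (Filter.Eventually.and (h.isOpen_base.mem_nhds hz₁)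
      (Metric.ball_mem_nhds z₁ hs0))
  obtain ⟨wl, hwl, hwlb⟩ : ∃ w ∈ fibre Ω z₁, w ∈ Metric.ball p s := by
    have : p ∈ closure (fibre Ω z₁) := by rw [hb.closure_eq]; exact Or.inr hp
    obtain ⟨w, hw1, hw2⟩ := mem_closure_iff.1 this _ Metric.isOpen_ball (Metric.mem_ball_self hs0)
    exact ⟨w, hw2, hw1⟩
  have hΩΓ : ∀ z ∈ D, ∀ w ∈ fibre Ω z, w ∉ fibre Γ z := fun z hz w hw hw' =>
    Set.disjoint_left.1 (h.disc z hz).disjoint hw hw'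
  have hmemV : ∀ z ∈ Metric.ball z₁ s, ∀ w ∈ Metric.ball p s,
      fderiv ℝ ρ (z, w) (v, 0) < 0 ∧ (z, w) ∈ V := fun z hz w hw => hr _ <| by
    rw [← ball_prod_same]
    exact ⟨Metric.ball_subset_ball (min_le_left _ _) hz, Metric.ball_subset_ball (min_le_left _ _) hw⟩
  have hev2 : ∀ᶠ t in 𝓝[≥] (0 : ℝ), 0 < ρ (Z t, wl) := by
    have hc : ContinuousAt (fun t => ρ (Z t, wl)) 0 := by
      refine ContinuousAt.comp (g := ρ) (f := fun t => (Z t, wl)) ?_ (by fun_prop)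
      rw [hZ0]
      exact (hdiff _ (hmemV z₁ (Metric.mem_ball_self hs0) wl hwlb).2).continuousAt
    refine (hc.eventually (lt_mem_nhds ?_)).filter_mono nhdsWithin_le_nhds
    simp only [hZ0]
    exact hpos wl hwlb (hΩΓ z₁ hz₁ wl hwl)
  obtain ⟨t₁, ht₁0, ht₁⟩ := mem_nhdsGE_iff_exists_Icc_subset.1 (hev.and hev2)
  have hanti : ∀ w ∈ Metric.ball p s, StrictAntiOn (fun t => ρ (Z t, w)) (Icc 0 t₁) := fun w hw => by
    have hder : ∀ t ∈ Icc (0 : ℝ) t₁, HasDerivAt (fun t => ρ (Z t, w))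
        (fderiv ℝ ρ (Z t, w) (v, 0)) t := fun t ht => by
      have h1 : HasDerivAt (fun t => (Z t, w)) (v, (0 : ℂ)) t := by
        have : HasDerivAt Z v t := by
          have := ((hasDerivAt_id t).smul_const v).const_add z₁
          rwa [one_smul] at this
        exact this.prodMk (hasDerivAt_const t w)
      exact (hdiff _ (hmemV _ (ht₁ ht).1.2 w hw).2).hasFDerivAt.comp_hasDerivAt t h1
    refine strictAntiOn_of_deriv_neg (convex_Icc _ _)
      (fun t ht => (hder t ht).continuousAt.continuousWithinAt) fun t ht => ?_
    rw [interior_Icc] at ht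
    rw [(hder t (Ioo_subset_Icc_self ht)).deriv]
    exact (hmemV _ (ht₁ (Ioo_subset_Icc_self ht)).1.2 w hw).1
  have h0mem : (0 : ℝ) ∈ Icc 0 t₁ := ⟨le_rfl, ht₁0.le⟩
  have hpneg : ∀ t ∈ Ioc 0 t₁, ρ (Z t, p) < 0 := fun t ht => by
    have := hanti p (Metric.mem_ball_self hs0) h0mem ⟨ht.1.le, ht.2⟩ ht.1
    simp only [hZ0, hρp] at this
    exact this
  -- no jumps at positive times
  have hmeet : ∀ t ∈ Ioc 0 t₁, ∀ᶠ z in 𝓝 (Z t), (fibre Γ z ∩ Metric.ball p s).Nonempty := by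
    intro t ht
    have ht' : t ∈ Icc 0 t₁ := ⟨ht.1.le, ht.2⟩
    have hcw : ∀ w ∈ Metric.ball p s, ContinuousAt (fun z => ρ (z, w)) (Z t) := fun w hw =>
      ContinuousAt.comp (g := ρ) (f := fun z => (z, w))
        (hdiff _ (hmemV _ (ht₁ ht').1.2 w hw).2).continuousAt (by fun_prop)
    filter_upwards [(hcw p (Metric.mem_ball_self hs0)).eventually (gt_mem_nhds (hpneg t ht)),
      (hcw wl hwlb).eventually (lt_mem_nhds (ht₁ ht').2),
      Metric.isOpen_ball.mem_nhds (ht₁ ht').1.2] with z hz1 hz2 hz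
    have hcz : ContinuousOn (fun w => ρ (z, w)) (Metric.ball p s) := fun w hw =>
      (ContinuousAt.comp (g := ρ) (f := fun w => (z, w))
        (hdiff _ (hmemV z hz w hw).2).continuousAt (by fun_prop)).continuousWithinAt
    obtain ⟨x, hx, hx0⟩ := (convex_ball p s).isPreconnected.intermediate_value
      (Metric.mem_ball_self hs0) hwlb hcz ⟨hz1.le, hz2.le⟩
    exact ⟨x, (hzero _ (hmemV z hz x hx).2).2 hx0, hx⟩
  obtain ⟨R, hR⟩ := (hb.isCompact_closure.isBounded.union
    (Metric.isBounded_ball (x := p) (r := s))).subset_ball 0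
  have hRp : 0 < R := by
    have := hR (Or.inr (Metric.mem_ball_self hs0))
    rw [mem_ball_zero_iff] at this
    exact (norm_nonneg _).trans_lt this
  have hnj : ∀ t ∈ Ioc 0 t₁, ∀ w, (Z t, w) ∉ Γ → (Z t, w) ∉ Ω → (Z t, w) ∉ closure Ω :=
    fun t ht w hwΓ hwΩ => h.notMem_closure_of_eventually (ht₁ ⟨ht.1.le, ht.2⟩).1.1 (R := R)
      ((hmeet t ht).mono fun z hz => hz.mono (inter_subset_inter_right _
        fun x hx => hR (Or.inr hx))) (by rintro (h' | h'); exacts [hwΩ h', hwΓ h'])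
  have hfront : ∀ t ∈ Ioc 0 t₁, ∀ w, (Z t, w) ∉ Γ → (Z t, w) ∉ frontier Ω := fun t ht w hw hf => by
    rw [h.isOpen.frontier_eq] at hf
    exact hnj t ht w hw hf.2 hf.1
  have hline : ∀ w : ℂ, ∀ a b, IsPreconnected ((fun t => (Z t, w)) '' Icc a b) := fun w a b =>
    isPreconnected_Icc.image _ (hZc.prodMk continuous_const).continuousOn
  have hne : ∀ t ∈ Icc 0 t₁, ∀ w ∈ Metric.ball p s, ρ (Z t, w) ≠ 0 → (Z t, w) ∉ Γ :=
    fun t ht w hw h0 hΓ => h0 ((hzero _ (hmemV _ (ht₁ ht).1.2 w hw).2).1 hΓ)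
  -- As long as `ρ > 0`, a point fixed in `w` has not met `Γ`, so it keeps the side it had at time
  -- `0`; this is the case of an inner point.
  have hleft : ∀ w ∈ Metric.ball p s, w ∈ fibre Ω z₁ → ∀ t ∈ Ioc 0 t₁, 0 < ρ (Z t, w) →
      (Z t, w) ∈ Ω := by
    intro w hw hwΩ t ht hρt
    refine (hline w 0 t).subset_of_disjoint_frontier
      ⟨(Z 0, w), ⟨0, ⟨le_rfl, ht.1.le⟩, rfl⟩, by rw [hZ0]; exact hwΩ⟩ ?_ ⟨t, ⟨ht.1.le, le_rfl⟩, rfl⟩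
    rw [Set.disjoint_left]
    rintro _ ⟨τ, hτ, rfl⟩
    rcases hτ.1.eq_or_lt with h0 | h0
    · subst h0
      rw [h.isOpen.frontier_eq]
      exact fun hf => hf.2 (by simp only [hZ0]; exact hwΩ)
    · have hτ' : τ ∈ Icc 0 t₁ := ⟨hτ.1, hτ.2.trans ht.2⟩
      refine hfront τ ⟨h0, hτ'.2⟩ w (hne τ hτ' w hw ?_)
      exact (hρt.trans_le ((hanti w hw).antitoneOn hτ' ⟨ht.1.le, ht.2⟩ hτ.2)).ne'
  -- An outer point that is inside at some later time would be inside at all earlier positive times.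
  -- Then the curves would escape to infinity as `t → 0`, although they all meet the ball around
  -- `p`.
  have hright : ∀ w ∈ Metric.ball p s, w ∈ (fibre Ω z₁ ∪ fibre Γ z₁)ᶜ → ∀ t ∈ Ioc 0 t₁,
      0 < ρ (Z t, w) → (Z t, w) ∉ Ω := by
    intro w hw hwE t ht hρt hΩt
    have hall : ∀ τ ∈ Ioc 0 t, (Z τ, w) ∈ Ω := fun τ hτ => by
      refine (hline w τ t).subset_of_disjoint_frontier ⟨(Z t, w), ⟨t, ⟨hτ.2, le_rfl⟩, rfl⟩, hΩt⟩ ?_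
        ⟨τ, ⟨le_rfl, hτ.2⟩, rfl⟩
      rw [Set.disjoint_left]
      rintro _ ⟨τ', hτ', rfl⟩
      have h0 := hτ.1.trans_le hτ'.1
      have hτ'' : τ' ∈ Icc 0 t₁ := ⟨h0.le, hτ'.2.trans ht.2⟩
      refine hfront τ' ⟨h0, hτ''.2⟩ w (hne τ' hτ'' w hw ?_)
      exact (hρt.trans_le ((hanti w hw).antitoneOn hτ'' ⟨ht.1.le, ht.2⟩ hτ'.2)).ne'
    have hJ := h.eventually_disjoint_ball hz₁ hwE hRp.le (fun x hx => hR (Or.inl hx))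
    have hten : Tendsto Z (𝓝[>] 0) (𝓝 z₁) := by
      have := hZc.tendsto 0
      rw [hZ0] at this
      exact this.mono_left nhdsWithin_le_nhds
    obtain ⟨τ, hτJ, hτ⟩ := ((hten.eventually hJ).and (Ioc_mem_nhdsGT ht.1)).exists
    obtain ⟨x, hx, hxb⟩ := (hmeet τ ⟨hτ.1, hτ.2.trans ht.2⟩).self_of_nhds
    exact Set.disjoint_left.1 (hτJ (hall τ hτ)) hx (hR (Or.inr hxb))
  -- a smaller ball on which `ρ` is negative at the final time
  have ht₁mem : t₁ ∈ Ioc 0 t₁ := ⟨ht₁0, le_rfl⟩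
  have ht₁mem' : t₁ ∈ Icc 0 t₁ := ⟨ht₁0.le, le_rfl⟩
  obtain ⟨s', hs'0, hs'⟩ : ∃ s' > 0, ∀ w ∈ Metric.ball p s', w ∈ Metric.ball p s ∧ ρ (Z t₁, w) < 0 := by
    have hc : ContinuousAt (fun w => ρ (Z t₁, w)) p :=
      ContinuousAt.comp (g := ρ) (f := fun w => (Z t₁, w))
        (hdiff _ (hmemV _ (ht₁ ht₁mem').1.2 p (Metric.mem_ball_self hs0)).2).continuousAt
        (by fun_prop)
    exact Metric.eventually_nhds_iff_ball.1
      (Filter.Eventually.and (Metric.ball_mem_nhds p hs0)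
        (hc.eventually (gt_mem_nhds (hpneg t₁ ht₁mem))))
  -- The points with `ρ < 0` all lie on one side: moving forward in time keeps `ρ` negative, and at
  -- time `t₁` the whole small ball is negative.
  have habove : ∀ w ∈ Metric.ball p s', ∀ t ∈ Ioc 0 t₁, ρ (Z t, w) < 0 →
      ((Z t, w) ∈ Ω ↔ (Z t₁, p) ∈ Ω) := by
    intro w hw t ht hρt
    set S : Set ((Fin n → ℂ) × ℂ) :=
      ((fun τ => (Z τ, w)) '' Icc t t₁) ∪ ((fun x => (Z t₁, x)) '' Metric.ball p s') with hS
    have hSc : IsPreconnected S := IsPreconnected.union (Z t₁, w) ⟨t₁, ⟨ht.2, le_rfl⟩, rfl⟩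
      ⟨w, hw, rfl⟩ (hline w t t₁) ((convex_ball p s').isPreconnected.image _ (by fun_prop))
    have hSd : Disjoint S (frontier Ω) := by
      rw [Set.disjoint_left]
      rintro _ (⟨τ, hτ, rfl⟩ | ⟨x, hx, rfl⟩)
      · have h0 := ht.1.trans_le hτ.1
        have hτ' : τ ∈ Icc 0 t₁ := ⟨h0.le, hτ.2⟩
        refine hfront τ ⟨h0, hτ.2⟩ w (hne τ hτ' w (hs' w hw).1 (ne_of_lt ?_))
        exact ((hanti w (hs' w hw).1).antitoneOn ⟨ht.1.le, ht.2⟩ hτ' hτ.1).trans_lt hρt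
      · exact hfront t₁ ht₁mem x (hne t₁ ht₁mem' x (hs' x hx).1 (hs' x hx).2.ne)
    have m1 : (Z t, w) ∈ S := Or.inl ⟨t, ⟨le_rfl, ht.2⟩, rfl⟩
    have m2 : (Z t₁, p) ∈ S := Or.inr ⟨p, Metric.mem_ball_self hs'0, rfl⟩
    exact ⟨fun hm => hSc.subset_of_disjoint_frontier ⟨_, m1, hm⟩ hSd m2,
      fun hm => hSc.subset_of_disjoint_frontier ⟨_, m2, hm⟩ hSd m1⟩
  have hcross : ∀ w ∈ Metric.ball p s', w ∉ fibre Γ z₁ →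
      ∃ t ∈ Ioc 0 t₁, w ∈ fibre Γ (Z t) := by
    intro w hw hwΓ
    have hw' := (hs' w hw).1
    have hcont : ContinuousOn (fun t => ρ (Z t, w)) (Icc 0 t₁) := fun t ht =>
      (ContinuousAt.comp (g := ρ) (f := fun t => (Z t, w))
        (hdiff _ (hmemV _ (ht₁ ht).1.2 w hw').2).continuousAt (by fun_prop)).continuousWithinAt
    have h0 : 0 < ρ (Z 0, w) := by rw [hZ0]; exact hpos w hw' hwΓ
    obtain ⟨t, ht, hρt⟩ := intermediate_value_Icc' ht₁0.le hcont ⟨(hs' w hw).2.le, h0.le⟩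
    refine ⟨t, ⟨lt_of_le_of_ne ht.1 ?_, ht.2⟩, (hzero _ (hmemV _ (ht₁ ht).1.2 w hw').2).2 hρt⟩
    rintro rfl
    simp only at hρt
    exact h0.ne' hρt
  -- If the negative side is inside, take an inner point of `γ(z₁)` and the time at which `Γ` passes
  -- through it: around it both signs of `ρ` belong to `Ω`, although points of the curve are limits
  -- of exterior points. If the negative side is outside, the same argument with an outer point
  -- shows that no inner points are near.
  by_cases hin : (Z t₁, p) ∈ Ω
  · obtain ⟨w, hwb, hwΩ⟩ := mem_closure_iff.1
      (show p ∈ closure (fibre Ω z₁) by rw [hb.closure_eq]; exact Or.inr hp) _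
      Metric.isOpen_ball (Metric.mem_ball_self hs'0)
    obtain ⟨t, ht, hwt⟩ := hcross w hwb (hΩΓ z₁ hz₁ w hwΩ)
    have hDt := (ht₁ ⟨ht.1.le, ht.2⟩).1.1
    obtain ⟨x, ⟨hxb, hxΩ⟩, hx⟩ := mem_closure_iff.1 ((h.disc _ hDt).mem_closure_ext hwt)
      (Metric.ball p s' ∩ fibre Ω z₁) (Metric.isOpen_ball.inter hb.isOpen) ⟨hwb, hwΩ⟩
    have hxs := (hs' x hxb).1
    have hx0 : ρ (Z t, x) ≠ 0 := fun h0 =>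
      hx (Or.inr ((hzero _ (hmemV _ (ht₁ ⟨ht.1.le, ht.2⟩).1.2 x hxs).2).2 h0))
    rcases lt_or_gt_of_ne hx0 with hlt | hgt
    · exact hx (Or.inl ((habove x hxb t ht hlt).2 hin))
    · exact hx (Or.inl (hleft x hxs hxΩ t ht hgt))
  · obtain ⟨w, hwb, hwE⟩ := mem_closure_iff.1 (hb.mem_closure_ext hp) _
      Metric.isOpen_ball (Metric.mem_ball_self hs'0)
    obtain ⟨t, ht, hwt⟩ := hcross w hwb fun h' => hwE (Or.inr h')
    have hDt := (ht₁ ⟨ht.1.le, ht.2⟩).1.1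
    obtain ⟨x, ⟨hxb, hxE⟩, hx⟩ := mem_closure_iff.1
      (show w ∈ closure (fibre Ω (Z t)) by rw [(h.disc _ hDt).closure_eq]; exact Or.inr hwt)
      (Metric.ball p s' ∩ (fibre Ω z₁ ∪ fibre Γ z₁)ᶜ) (Metric.isOpen_ball.inter hb.isOpen_ext)
      ⟨hwb, hwE⟩
    have hxs := (hs' x hxb).1
    have hx0 : ρ (Z t, x) ≠ 0 := fun h0 => hΩΓ _ hDt x hx
      ((hzero _ (hmemV _ (ht₁ ⟨ht.1.le, ht.2⟩).1.2 x hxs).2).2 h0)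
    rcases lt_or_gt_of_ne hx0 with hlt | hgt
    · exact hin ((habove x hxb t ht hlt).1 hx)
    · exact hright x hxs hxE t ht hgt hx

/-- Near a parameter in `D`, the curves meet a fixed ball around each point of the curve. -/
theorem eventually_inter_nonempty (h : IsDiscFamily Γ Ω D) {z₁ : Fin n → ℂ} (hz₁ : z₁ ∈ D) {p : ℂ}
    (hp : p ∈ fibre Γ z₁) {r : ℝ} (hr : 0 < r) :
    ∀ᶠ z in 𝓝 z₁, (fibre Γ z ∩ Metric.ball p r).Nonempty := by
  obtain ⟨-, V, ρ, hd⟩ := h.reg z₁ hz₁ p hp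
  obtain ⟨r₀, hr₀, hball⟩ := Metric.isOpen_iff.1 hd.isOpen _ hd.mem
  have hmem : (z₁, p) ∈ Γ ∩ V := ⟨hp, hd.mem⟩
  have hρp : ρ (z₁, p) = 0 := by rw [hd.inter_eq] at hmem; exact hmem.2
  have hs : 0 < min r r₀ := lt_min hr hr₀
  have h1 := h.not_isLocalMin hz₁ hp hd
  have h2 := h.not_isLocalMin hz₁ hp hd.neg
  rw [IsLocalMin, IsMinFilter, not_eventually] at h1 h2
  obtain ⟨w, hw1, hw2⟩ := (h1.and_eventually (Metric.ball_mem_nhds p hs)).exists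
  obtain ⟨w', hw'1, hw'2⟩ := (h2.and_eventually (Metric.ball_mem_nhds p hs)).exists
  rw [hρp, not_le] at hw1
  rw [hρp, neg_zero, not_le, neg_lt_zero] at hw'1
  refine (eventually_inter_nonempty_of_sign hd.analytic.continuousOn hd.isOpen hd.inter_eq
    ((Metric.ball_subset_ball (min_le_right r r₀)).trans hball) hw2 hw'2 hw1 hw'1).mono fun z hz =>
      hz.mono (inter_subset_inter_right _ (Metric.ball_subset_ball (min_le_left _ _)))

theorem fibre_nonempty (h : IsDiscFamily Γ Ω D) {z : Fin n → ℂ} (hz : z ∈ D) :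
    (fibre Γ z).Nonempty := by
  obtain ⟨c, hc⟩ := (h.disc z hz).exists_param
  exact ⟨c 0, hc.range_eq ▸ ⟨0, rfl⟩⟩

theorem eventually_inter_ball_nonempty (h : IsDiscFamily Γ Ω D) {z₁ : Fin n → ℂ} (hz₁ : z₁ ∈ D)
    {R : ℝ} (hR : fibre Γ z₁ ⊆ Metric.ball 0 R) :
    ∀ᶠ z in 𝓝 z₁, (fibre Γ z ∩ Metric.ball 0 R).Nonempty := by
  obtain ⟨p, hp⟩ := h.fibre_nonempty hz₁
  obtain ⟨r, hr, hsub⟩ := Metric.isOpen_iff.1 Metric.isOpen_ball p (hR hp)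
  exact (h.eventually_inter_nonempty hz₁ hp hr).mono fun z hz =>
    hz.mono (inter_subset_inter_right _ hsub)

theorem exists_subset_ball (h : IsDiscFamily Γ Ω D) {z₁ : Fin n → ℂ} (hz₁ : z₁ ∈ D) :
    ∃ R > 0, closure (fibre Ω z₁) ⊆ Metric.ball 0 R := by
  obtain ⟨R, hR⟩ := (h.disc z₁ hz₁).isCompact_closure.isBounded.subset_ball 0
  exact ⟨max R 1, by positivity, hR.trans (Metric.ball_subset_ball (le_max_left _ _))⟩

/-- Over `D` the boundary of `Ω` is in `Γ`. -/
theorem mem_of_mem_frontier (h : IsDiscFamily Γ Ω D) {q : (Fin n → ℂ) × ℂ} (hq : q.1 ∈ D)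
    (hf : q ∈ frontier Ω) : q ∈ Γ := by
  by_contra hΓ
  rw [h.isOpen.frontier_eq] at hf
  obtain ⟨R, -, hR⟩ := h.exists_subset_ball hq
  refine h.notMem_closure_of_eventually hq (R := R) (w₁ := q.2)
    (h.eventually_inter_ball_nonempty hq ?_) ?_ hf.1
  · refine Subset.trans ?_ hR
    rw [(h.disc _ hq).closure_eq]
    exact subset_union_right
  · rintro (h' | h'); exacts [hf.2 h', hΓ h']

/-- The closed discs over a compact neighbourhood are uniformly bounded. -/
theorem eventually_closure_subset_ball (h : IsDiscFamily Γ Ω D) {z₁ : Fin n → ℂ} (hz₁ : z₁ ∈ D)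
    {R : ℝ} (hR : closure (fibre Ω z₁) ⊆ Metric.ball 0 R) :
    ∀ᶠ z in 𝓝 z₁, closure (fibre Ω z) ⊆ Metric.ball 0 R := by
  have hb := h.disc z₁ hz₁
  have hγ : fibre Γ z₁ ⊆ Metric.ball 0 R :=
    Subset.trans (by rw [hb.closure_eq]; exact subset_union_right) hR
  have hsph : ∀ w ∈ Metric.sphere (0 : ℂ) R, w ∉ closure (fibre Ω z₁) := fun w hw hw' => by
    have := hR hw'
    rw [mem_ball_zero_iff] at this
    rw [mem_sphere_zero_iff_norm] at hw
    exact this.ne hw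
  -- Over `z₁` the closure of `Ω` adds only points of `Γ`. By compactness the nearby closed discs
  -- miss the circle of radius `R`; being connected and meeting the ball, they stay inside it.
  have hev : ∀ᶠ z in 𝓝 z₁, ∀ w ∈ Metric.sphere (0 : ℂ) R, (z, w) ∉ closure Ω ∪ Γ := by
    refine (isCompact_sphere (0 : ℂ) R).eventually_forall_of_forall_eventually fun w hw =>
      (isClosed_closure.union h.isClosed).isOpen_compl.mem_nhds ?_
    rintro (h' | h')
    · have hnΓ : (z₁, w) ∉ Γ := fun h'' => hsph w hw (by rw [hb.closure_eq]; exact Or.inr h'')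
      have hnΩ : (z₁, w) ∉ Ω := fun h'' => hsph w hw (subset_closure h'')
      exact hnΓ (h.mem_of_mem_frontier (q := (z₁, w)) hz₁ (by
        rw [h.isOpen.frontier_eq]; exact ⟨h', hnΩ⟩))
    · exact hsph w hw (by rw [hb.closure_eq]; exact Or.inr h')
  filter_upwards [hev, h.eventually_inter_ball_nonempty hz₁ hγ, h.isOpen_base.mem_nhds hz₁]
    with z hz hne hzD
  have hbz := h.disc z hzD
  obtain ⟨w, hw, hwb⟩ := hne
  refine hbz.isPreconnected.closure.subset_of_disjoint_frontier
    ⟨w, by rw [hbz.closure_eq]; exact Or.inr hw, hwb⟩ ?_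
  rw [Set.disjoint_left]
  intro x hx hx'
  rw [hbz.closure_eq] at hx
  refine hz x (Metric.frontier_ball_subset_sphere hx') ?_
  rcases hx with hx | hx
  · exact Or.inl (subset_closure hx)
  · exact Or.inr hx

end IsDiscFamily


/-! ### The form `∂̄g ∧ ∂̄u` and its integral over a domain with tangential boundary condition. -/

noncomputable section WeakDbar
open MeasureTheory

variable {E : Type*} [NormedAddCommGroup E] [NormedSpace ℝ E] [SMul ℂ E]

theorem dbarDir_congr {g g' : E → ℂ} {x : E} (h : g =ᶠ[𝓝 x] g') (v : E) :
    dbarDir g v x = dbarDir g' v x := by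
  rw [dbarDir, dbarDir, h.fderiv_eq]

theorem dbarDir_mul {g k : E → ℂ} {x : E} (hg : DifferentiableAt ℝ g x)
    (hk : DifferentiableAt ℝ k x) (v : E) :
    dbarDir (fun y => g y * k y) v x = g x * dbarDir k v x + k x * dbarDir g v x := by
  simp only [dbarDir, fderiv_fun_mul hg hk, add_apply,
    smul_apply, smul_eq_mul]
  ring

theorem ContDiff.dbarDir {b : E → ℂ} (hb : ContDiff ℝ 2 b) (v : E) : ContDiff ℝ 1 (dbarDir b v) := by
  have h : ContDiff ℝ 1 (fderiv ℝ b) := hb.fderiv_right (by norm_num)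
  unfold _root_.dbarDir
  exact ((h.clm_apply contDiff_const).add
    (contDiff_const.mul (h.clm_apply contDiff_const))).div_const 2

/-- Symmetry of the second differential; this is `∂̄² = 0` in coordinates. -/
theorem dbarDir_dbarDir_comm {b : E → ℂ} (hb : ContDiff ℝ 2 b) (v w x : E) :
    dbarDir (dbarDir b v) w x = dbarDir (dbarDir b w) v x := by
  have hd : DifferentiableAt ℝ (fderiv ℝ b) x :=
    (hb.fderiv_right (m := 1) (by norm_num)).differentiable (by norm_num) x
  have hsymm : IsSymmSndFDerivAt ℝ b x := hb.contDiffAt.isSymmSndFDerivAt (by simp)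
  have key : ∀ v w : E, dbarDir (dbarDir b v) w x =
      ((fderiv ℝ (fderiv ℝ b) x w v + Complex.I * fderiv ℝ (fderiv ℝ b) x w (Complex.I • v)) +
        Complex.I * (fderiv ℝ (fderiv ℝ b) x (Complex.I • w) v +
          Complex.I * fderiv ℝ (fderiv ℝ b) x (Complex.I • w) (Complex.I • v))) / 4 := by
    intro v w
    have h1 : ∀ u : E, HasFDerivAt (fun y => fderiv ℝ b y u)
        ((ContinuousLinearMap.apply ℝ ℂ u).comp (fderiv ℝ (fderiv ℝ b) x)) x := fun u =>
      (ContinuousLinearMap.apply ℝ ℂ u).hasFDerivAt.comp x hd.hasFDerivAt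
    have h2 := ((h1 v).add ((h1 (Complex.I • v)).const_mul Complex.I)).mul_const (2⁻¹ : ℂ)
    have h3 : fderiv ℝ (dbarDir b v) x = _ := HasFDerivAt.fderiv h2
    rw [dbarDir, h3]
    simp only [smul_apply, add_apply,
      ContinuousLinearMap.comp_apply, ContinuousLinearMap.apply_apply, smul_eq_mul]
    ring
  rw [key, key, hsymm.eq w v, hsymm.eq w (Complex.I • v), hsymm.eq (Complex.I • w) v,
    hsymm.eq (Complex.I • w) (Complex.I • v)]
  ring

/-- The coefficient of `∂̄g ∧ ∂̄b` for a pair of directions. -/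
def dbarJ (g b : E → ℂ) (v w x : E) : ℂ :=
  dbarDir g w x * dbarDir b v x - dbarDir g v x * dbarDir b w x

theorem continuous_dbarJ {g b : E → ℂ} (hg : ContDiff ℝ 1 g) (hb : ContDiff ℝ 1 b) (v w : E) :
    Continuous (dbarJ g b v w) :=
  ((continuous_dbarDir hg w).mul (continuous_dbarDir hb v)).sub
    ((continuous_dbarDir hg v).mul (continuous_dbarDir hb w))

theorem dbarJ_eq_zero_of_notMem (g : E → ℂ) {b : E → ℂ} (v w : E) {x : E} (hx : x ∉ tsupport b) :
    dbarJ g b v w x = 0 := by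
  have h : ∀ v, dbarDir b v x = 0 := fun v => by
    by_contra hne
    exact hx (tsupport_dbarDir_subset b v (subset_tsupport _ hne))
  simp [dbarJ, h]

theorem HasCompactSupport.dbarJ (g : E → ℂ) {b : E → ℂ} (hb : HasCompactSupport b) (v w : E) :
    HasCompactSupport (dbarJ g b v w) :=
  HasCompactSupport.intro hb fun _ hx => dbarJ_eq_zero_of_notMem g v w hx

variable [FiniteDimensional ℝ E] [MeasurableSpace E] [BorelSpace E]
  {μ : Measure E} [μ.IsAddHaarMeasure]

theorem integral_fderiv_eq_zero {A : E → ℂ}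
    (hA : ContDiff ℝ 1 A) (hs : HasCompactSupport A) (v : E) : ∫ x, fderiv ℝ A x v ∂μ = 0 := by
  have hc : Continuous fun x => fderiv ℝ A x v :=
    (hA.continuous_fderiv (by norm_num)).clm_apply continuous_const
  have hcs : HasCompactSupport fun x => fderiv ℝ A x v := hs.fderiv_apply ℝ v
  have := integral_mul_fderiv_eq_neg_fderiv_mul_of_integrable (μ := μ) (f := fun _ : E => (1 : ℂ))
    (g := A) (v := v) (by simp) (by simpa using hc.integrable_of_hasCompactSupport hcs)
    (by simpa using hA.continuous.integrable_of_hasCompactSupport hs)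
    (fun x _ => by fun_prop) (fun x _ => hA.differentiable (by norm_num) x)
  simpa using this

theorem integral_dbarDir_eq_zero {A : E → ℂ} (hA : ContDiff ℝ 1 A) (hs : HasCompactSupport A)
    (v : E) : ∫ x, dbarDir A v x ∂μ = 0 := by
  have hi : ∀ u : E, Integrable (fun x => fderiv ℝ A x u) μ := fun u =>
    ((hA.continuous_fderiv (by norm_num)).clm_apply continuous_const).integrable_of_hasCompactSupport
      (hs.fderiv_apply ℝ u)
  simp only [dbarDir]
  rw [integral_div, integral_add (hi _) ((hi _).const_mul _), integral_const_mul,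
    integral_fderiv_eq_zero hA hs, integral_fderiv_eq_zero hA hs]
  simp

/-- The integrand is a coefficient of `∂̄(g ∂̄b)`, because `∂̄² b = 0`. All second derivatives fall
on `b`, so `C¹` suffices for `g`. -/
theorem integral_dbarJ_eq_zero {g b : E → ℂ} (hg : ContDiff ℝ 1 g) (hb : ContDiff ℝ 2 b)
    (hs : HasCompactSupport b) (v w : E) : ∫ x, dbarJ g b v w x ∂μ = 0 := by
  have hA : ∀ u, ContDiff ℝ 1 fun x => g x * dbarDir b u x := fun u => hg.mul (hb.dbarDir u)
  have hAs : ∀ u, HasCompactSupport fun x => g x * dbarDir b u x := fun u => (hs.dbarDir u).mul_left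
  have e : ∀ x, dbarJ g b v w x = dbarDir (fun x => g x * dbarDir b v x) w x -
      dbarDir (fun x => g x * dbarDir b w x) v x := fun x => by
    rw [dbarDir_mul (hg.differentiable (by norm_num) x)
      ((hb.dbarDir v).differentiable (by norm_num) x),
      dbarDir_mul (hg.differentiable (by norm_num) x)
      ((hb.dbarDir w).differentiable (by norm_num) x), dbarDir_dbarDir_comm hb v w, dbarJ]
    ring
  simp_rw [e]
  rw [integral_sub, integral_dbarDir_eq_zero (hA v) (hAs v),
    integral_dbarDir_eq_zero (hA w) (hAs w), sub_zero]
  · exact (continuous_dbarDir (hA v) w).integrable_of_hasCompactSupport ((hAs v).dbarDir w)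
  · exact (continuous_dbarDir (hA w) v).integrable_of_hasCompactSupport ((hAs w).dbarDir v)


/-- The volume of a thin neighbourhood of a noncritical level set. -/
theorem exists_measure_sublevel_le {ρ : E → ℝ} (hρ : ContDiff ℝ 1 ρ) {K O : Set E}
    (hK : IsCompact K) (hO : IsOpen O) (hKO : K ⊆ O) {ν : E} (hν : ∀ x ∈ O, 0 < fderiv ℝ ρ x ν) :
    ∃ C : ℝ, 0 ≤ C ∧ ∀ ε > 0, μ.real (K ∩ {x | |ρ x| ≤ 2 * ε}) ≤ C * ε := by
  obtain ⟨χ, hχ, hχs, hχO, hχ1, hχ01⟩ := exists_contDiff_cutoff hK hO hKO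
  have hχK : ∀ x ∈ K, χ x = 1 := fun x hx => hχ1.self_of_nhdsSet x hx
  have hfc : Continuous fun x => fderiv ℝ ρ x ν :=
    (hρ.continuous_fderiv (by norm_num)).clm_apply continuous_const
  obtain ⟨m, hm0, hm⟩ : ∃ m > 0, ∀ x ∈ tsupport χ, m ≤ fderiv ℝ ρ x ν := by
    rcases (tsupport χ).eq_empty_or_nonempty with he | hne
    · exact ⟨1, one_pos, by simp [he]⟩
    · obtain ⟨x₀, hx₀, hmin⟩ := hχs.isCompact.exists_isMinOn hne hfc.continuousOn
      exact ⟨_, hν x₀ (hχO hx₀), fun x hx => hmin hx⟩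
  have hdχ : Continuous fun x => fderiv ℝ χ x ν :=
    (hχ.continuous_fderiv (by norm_num)).clm_apply continuous_const
  have hdχs : HasCompactSupport fun x => fderiv ℝ χ x ν := hχs.fderiv_apply ℝ ν
  set M := ∫ x, |fderiv ℝ χ x ν| ∂μ with hM
  have hM0 : 0 ≤ M := integral_nonneg fun x => abs_nonneg _
  refine ⟨5 / m * (2 * M), by positivity, fun ε hε => ?_⟩
  have hmeas : MeasurableSet {x | |ρ x| ≤ 2 * ε} :=
    (isClosed_le hρ.continuous.abs continuous_const).measurableSet
  -- A bounded function whose derivative along `ν` is at least `m / (5ε)` in the layer `|ρ| ≤ 2ε`.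
  -- Integration by parts against the cutoff bounds the integral of this derivative independently of
  -- `ε`.
  let A : E → ℝ := fun x => Real.arctan (ρ x / ε)
  have hA : ContDiff ℝ 1 A := Real.contDiff_arctan.comp (hρ.div_const ε)
  have hdA : ∀ x, fderiv ℝ A x ν = (1 / (1 + (ρ x / ε) ^ 2)) * (fderiv ℝ ρ x ν / ε) := fun x => by
    have h1 : HasFDerivAt (fun x => ρ x * ε⁻¹) (ε⁻¹ • fderiv ℝ ρ x) x :=
      (hρ.differentiable (by norm_num) x).hasFDerivAt.mul_const ε⁻¹
    have h2 : HasFDerivAt A ((1 / (1 + (ρ x * ε⁻¹) ^ 2)) • (ε⁻¹ • fderiv ℝ ρ x)) x :=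
      (Real.hasDerivAt_arctan _).comp_hasFDerivAt x h1
    rw [h2.fderiv]
    simp only [smul_apply, smul_eq_mul, div_eq_mul_inv]
    ring
  have hIBP := integral_mul_fderiv_eq_neg_fderiv_mul_of_integrable (μ := μ) (f := χ)
    (g := A) (v := ν)
    ((hdχ.mul hA.continuous).integrable_of_hasCompactSupport hdχs.mul_right)
    ((hχ.continuous.mul ((hA.continuous_fderiv (by norm_num)).clm_apply
      continuous_const)).integrable_of_hasCompactSupport hχs.mul_right)
    ((hχ.continuous.mul hA.continuous).integrable_of_hasCompactSupport hχs.mul_right)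
    (fun x _ => hχ.differentiable (by norm_num) x) (fun x _ => hA.differentiable (by norm_num) x)
  have hup : ∫ x, χ x * fderiv ℝ A x ν ∂μ ≤ 2 * M := by
    rw [hIBP, ← integral_neg, hM, ← integral_const_mul]
    refine integral_mono
      ((hdχ.mul hA.continuous).integrable_of_hasCompactSupport hdχs.mul_right).neg
      ((hdχ.abs.integrable_of_hasCompactSupport hdχs.norm).const_mul 2) fun x => ?_
    have h1 : |A x| ≤ 2 := by
      have h1 := Real.arctan_lt_pi_div_two (ρ x / ε)
      have h2 := Real.neg_pi_div_two_lt_arctan (ρ x / ε)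
      have h3 := Real.pi_lt_four
      exact abs_le.2 ⟨by simp only [A]; linarith, by simp only [A]; linarith⟩
    calc -(fderiv ℝ χ x ν * A x) ≤ |fderiv ℝ χ x ν * A x| := neg_le_abs _
      _ = |fderiv ℝ χ x ν| * |A x| := abs_mul _ _
      _ ≤ |fderiv ℝ χ x ν| * 2 := by gcongr
      _ = 2 * |fderiv ℝ χ x ν| := mul_comm _ _
  have hlow : μ.real (K ∩ {x | |ρ x| ≤ 2 * ε}) * (m / (5 * ε)) ≤
      ∫ x, χ x * fderiv ℝ A x ν ∂μ := by
    have hfin : μ (K ∩ {x | |ρ x| ≤ 2 * ε}) ≠ ⊤ :=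
      ((measure_mono inter_subset_left).trans_lt hK.measure_lt_top).ne
    rw [← smul_eq_mul, ← setIntegral_const, ← integral_indicator (hK.measurableSet.inter hmeas)]
    refine integral_mono ((integrable_indicator_iff (hK.measurableSet.inter hmeas)).2
      (integrableOn_const hfin)) ((hχ.continuous.mul ((hA.continuous_fderiv (by norm_num)).clm_apply
      continuous_const)).integrable_of_hasCompactSupport hχs.mul_right) fun x => ?_
    by_cases hx : x ∈ K ∩ {x | |ρ x| ≤ 2 * ε}
    · rw [indicator_of_mem hx, hχK x hx.1, one_mul, hdA]
      have h1 : m ≤ fderiv ℝ ρ x ν := hm x (subset_tsupport _ (by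
        rw [Function.mem_support, hχK x hx.1]; exact one_ne_zero))
      have h2 : (ρ x / ε) ^ 2 ≤ 4 := by
        have : |ρ x / ε| ≤ 2 := by rw [abs_div, abs_of_pos hε, div_le_iff₀ hε]; exact hx.2
        nlinarith [sq_abs (ρ x / ε), abs_nonneg (ρ x / ε)]
      have h3 : (1 / 5 : ℝ) ≤ 1 / (1 + (ρ x / ε) ^ 2) := by gcongr; linarith
      calc m / (5 * ε) = 1 / 5 * (m / ε) := by field_simp
        _ ≤ _ := by gcongr
    · rw [indicator_of_notMem hx, hdA]
      by_cases hxs : x ∈ tsupport χ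
      · have h1 := hm0.le.trans (hm x hxs)
        have h2 := (hχ01 x).1
        positivity
      · rw [image_eq_zero_of_notMem_tsupport hxs, zero_mul]
  have := hlow.trans hup
  rw [← le_div_iff₀ (by positivity)] at this
  refine this.trans (le_of_eq ?_)
  field_simp

/-- If `g` satisfies the tangential Cauchy–Riemann equation along the boundary of `Ω`, then the
integral of `∂̄g ∧ ∂̄u` over `Ω` vanishes. -/
theorem setIntegral_dbarJ_eq_zero_of_level {g u : E → ℂ} (hg : ContDiff ℝ 1 g)
    (hu : ContDiff ℝ 2 u) (hs : HasCompactSupport u) {ρ : E → ℝ} (hρ : ContDiff ℝ 2 ρ)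
    {Ω O : Set E} (hΩ : IsOpen Ω) (hO : IsOpen O) (huO : tsupport u ⊆ O)
    (hfr : ∀ x ∈ O, x ∈ frontier Ω → ρ x = 0) {ν : E} (hν : ∀ x ∈ O, 0 < fderiv ℝ ρ x ν) {v w : E}
    (hL : ∀ x ∈ O, ρ x = 0 → dbarJ g (fun y => (ρ y : ℂ)) v w x = 0) :
    ∫ x in Ω, dbarJ g u v w x ∂μ = 0 := by
  classical
  set K := tsupport u with hKdef
  have hK : IsCompact K := hs
  let ρc : E → ℂ := fun y => (ρ y : ℂ)
  have hρc : ContDiff ℝ 2 ρc := Complex.ofRealCLM.contDiff.comp hρ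
  obtain ⟨C, hC0, hC⟩ := exists_measure_sublevel_le (μ := μ) (hρ.of_le (by norm_num)) hK hO huO hν
  let κ : ContDiffBump (0 : ℝ) := ⟨1, 2, one_pos, one_lt_two⟩
  have hκ : ContDiff ℝ 2 κ := κ.contDiff
  obtain ⟨Mκ, hMκ⟩ := (hκ.continuous_deriv (by norm_num)).bounded_above_of_compact_support
    κ.hasCompactSupport.deriv
  have hJc := continuous_dbarJ hg (hu.of_le (by norm_num)) v w
  have hJs : HasCompactSupport (dbarJ g u v w) := hs.dbarJ g v w
  obtain ⟨MJ, hMJ⟩ := hJc.bounded_above_of_compact_support hJs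
  obtain ⟨Mu, hMu⟩ := hu.continuous.bounded_above_of_compact_support hs
  have hLc := continuous_dbarJ hg (hρc.of_le (by norm_num)) v w
  have hMJ0 : 0 ≤ MJ := (norm_nonneg _).trans (hMJ 0)
  have hMu0 : 0 ≤ Mu := (norm_nonneg _).trans (hMu 0)
  have hMκ0 : 0 ≤ Mκ := (norm_nonneg _).trans (hMκ 0)
  -- main estimate
  have key : ∀ ε > 0, ∀ η ≥ 0, (∀ x ∈ K, |ρ x| ≤ 2 * ε → ‖dbarJ g ρc v w x‖ ≤ η) →
      ‖∫ x in Ω, dbarJ g u v w x ∂μ‖ ≤ (MJ * ε + Mu * (Mκ * η)) * C := by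
    intro ε hε η hη hηx
    -- A regularized indicator of `Ω`, zero near the frontier and therefore `C²` on `O`. Inserting
    -- `ω u` in the identity for compact support leaves an error in the layer `|ρ| ≤ 2ε`, of volume
    -- `O(ε)`. There `∂̄ω` has size `1 / ε`, but it occurs only together with `∂̄g ∧ ∂̄ρ`, which is
    -- small near the level set.
    let ω : E → ℂ := Ω.indicator fun x => ((1 - κ (ρ x / ε) : ℝ) : ℂ)
    let k : E → ℂ := Ω.indicator fun x => ((deriv κ (ρ x / ε) / ε : ℝ) : ℂ)
    have hS : IsOpen {x : E | |ρ x| < ε} := isOpen_lt hρ.continuous.abs continuous_const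
    have hω0 : ∀ x, |ρ x| < ε → ω x = 0 := fun x hx => by
      simp only [ω, indicator_apply_eq_zero]
      intro _
      rw [κ.one_of_mem_closedBall (by
        rw [mem_closedBall_zero_iff, Real.norm_eq_abs, abs_div, abs_of_pos hε, div_le_one hε]
        exact hx.le)]
      simp
    have hκz : ∀ x, 2 * ε < |ρ x| → κ (ρ x / ε) = 0 := fun x hx => by
      refine κ.zero_of_le_dist ?_
      rw [dist_zero_right, Real.norm_eq_abs, abs_div, abs_of_pos hε, le_div_iff₀ hε]
      exact hx.le
    have hκdz : ∀ x, 2 * ε < |ρ x| → deriv κ (ρ x / ε) = 0 := fun x hx => by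
      have : κ =ᶠ[𝓝 (ρ x / ε)] fun _ => 0 := by
        have ho : {y : ℝ | 2 < |y|} ∈ 𝓝 (ρ x / ε) := (isOpen_lt continuous_const
          continuous_abs).mem_nhds (by
            show 2 < |ρ x / ε|
            rw [abs_div, abs_of_pos hε, lt_div_iff₀ hε]; exact hx)
        filter_upwards [ho] with y hy
        exact κ.zero_of_le_dist (by rw [dist_zero_right]; exact le_of_lt hy)
      rw [this.deriv_eq]; simp
    have hκd0 : deriv κ 0 = 0 := by
      have : κ =ᶠ[𝓝 0] fun _ => 1 := by
        filter_upwards [Metric.closedBall_mem_nhds (0 : ℝ) one_pos] with y hy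
        exact κ.one_of_mem_closedBall hy
      rw [this.deriv_eq]; simp
    let P : E → ℂ := fun x => ((1 - κ (ρ x / ε) : ℝ) : ℂ)
    have hP : ContDiff ℝ 2 P :=
      Complex.ofRealCLM.contDiff.comp (contDiff_const.sub (hκ.comp (hρ.div_const ε)))
    have hdP : ∀ x a, dbarDir P a x = -((deriv κ (ρ x / ε) / ε : ℝ) : ℂ) * dbarDir ρc a x := by
      intro x a
      have h1 : HasFDerivAt (fun x => ρ x * ε⁻¹) (ε⁻¹ • fderiv ℝ ρ x) x :=
        (hρ.differentiable (by norm_num) x).hasFDerivAt.mul_const ε⁻¹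
      have h2 : HasFDerivAt (fun x => κ (ρ x * ε⁻¹))
          (deriv κ (ρ x * ε⁻¹) • (ε⁻¹ • fderiv ℝ ρ x)) x :=
        (hκ.differentiable (by norm_num) _).hasDerivAt.comp_hasFDerivAt x h1
      have h3 : HasFDerivAt P (Complex.ofRealCLM.comp
          (-(deriv κ (ρ x * ε⁻¹) • (ε⁻¹ • fderiv ℝ ρ x)))) x :=
        Complex.ofRealCLM.hasFDerivAt.comp x (h2.const_sub 1)
      have h4 : HasFDerivAt ρc (Complex.ofRealCLM.comp (fderiv ℝ ρ x)) x :=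
        Complex.ofRealCLM.hasFDerivAt.comp x (hρ.differentiable (by norm_num) x).hasFDerivAt
      rw [dbarDir, dbarDir, h3.fderiv, h4.fderiv]
      simp [div_eq_mul_inv]; ring
    have hcases : ∀ x ∈ O, ContDiffAt ℝ 2 ω x ∧ ∀ a, dbarDir ω a x = -k x * dbarDir ρc a x := by
      intro x hx
      by_cases hxf : x ∈ frontier Ω
      · have hρ0 := hfr x hx hxf
        have he : ω =ᶠ[𝓝 x] fun _ => 0 := by
          filter_upwards [hS.mem_nhds (show |ρ x| < ε by rw [hρ0, abs_zero]; exact hε)] with y hy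
          exact hω0 y hy
        refine ⟨contDiffAt_const.congr_of_eventuallyEq he, fun a => ?_⟩
        have hk : k x = 0 := by
          simp only [k, indicator_apply_eq_zero]
          intro _; rw [hρ0, zero_div, hκd0]; simp
        rw [dbarDir_congr he, hk]
        simp [dbarDir]
      · by_cases hxΩ : x ∈ Ω
        · have he : ω =ᶠ[𝓝 x] P := by
            filter_upwards [hΩ.mem_nhds hxΩ] with y hy
            simp only [ω, P, indicator_of_mem hy]
          refine ⟨hP.contDiffAt.congr_of_eventuallyEq he, fun a => ?_⟩
          rw [dbarDir_congr he, hdP]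
          simp only [k, indicator_of_mem hxΩ]
        · have hxc : x ∉ closure Ω := fun hxc => hxf (by rw [hΩ.frontier_eq]; exact ⟨hxc, hxΩ⟩)
          have he : ω =ᶠ[𝓝 x] fun _ => 0 := by
            filter_upwards [isClosed_closure.isOpen_compl.mem_nhds hxc] with y hy
            exact indicator_of_notMem (fun hy' => hy (subset_closure hy')) _
          refine ⟨contDiffAt_const.congr_of_eventuallyEq he, fun a => ?_⟩
          rw [dbarDir_congr he]
          simp only [k, indicator_of_notMem hxΩ]
          simp [dbarDir]
    have hb2 : ContDiff ℝ 2 fun x => ω x * u x := by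
      rw [contDiff_iff_contDiffAt]
      intro x
      by_cases hx : x ∈ K
      · exact (hcases x (huO hx)).1.mul hu.contDiffAt
      · have he : (fun x => ω x * u x) =ᶠ[𝓝 x] fun _ => 0 := by
          filter_upwards [(isClosed_tsupport u).isOpen_compl.mem_nhds hx] with y hy
          rw [image_eq_zero_of_notMem_tsupport hy, mul_zero]
        exact contDiffAt_const.congr_of_eventuallyEq he
    have hbs : HasCompactSupport fun x => ω x * u x := hs.mul_left
    have hzero := integral_dbarJ_eq_zero (μ := μ) hg hb2 hbs v w
    have hprod : ∀ x, dbarJ g (fun x => ω x * u x) v w x =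
        ω x * dbarJ g u v w x - k x * u x * dbarJ g ρc v w x := by
      intro x
      by_cases hx : x ∈ K
      · obtain ⟨h1, h2⟩ := hcases x (huO hx)
        have hd := h1.differentiableAt (by norm_num)
        have hud := hu.differentiable (by norm_num) x
        simp only [dbarJ, dbarDir_mul hd hud, h2]
        ring
      · rw [dbarJ_eq_zero_of_notMem g v w (fun h => hx (closure_mono (Function.support_mul_subset_right _ _) h)),
          dbarJ_eq_zero_of_notMem g v w hx, image_eq_zero_of_notMem_tsupport hx]
        ring
    have hD : ∀ x, ‖Ω.indicator (dbarJ g u v w) x - dbarJ g (fun x => ω x * u x) v w x‖ ≤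
        (K ∩ {x | |ρ x| ≤ 2 * ε}).indicator (fun _ => MJ + Mu * (Mκ / ε * η)) x := by
      intro x
      rw [hprod]
      by_cases hx : x ∈ K
      · by_cases hx2 : |ρ x| ≤ 2 * ε
        · rw [indicator_of_mem (show x ∈ K ∩ {x | |ρ x| ≤ 2 * ε} from ⟨hx, hx2⟩)]
          by_cases hxΩ : x ∈ Ω
          · simp only [ω, k, indicator_of_mem hxΩ]
            have e : dbarJ g u v w x - (((1 - κ (ρ x / ε) : ℝ) : ℂ) * dbarJ g u v w x -
                ((deriv κ (ρ x / ε) / ε : ℝ) : ℂ) * u x * dbarJ g ρc v w x) =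
                ((κ (ρ x / ε) : ℝ) : ℂ) * dbarJ g u v w x +
                  u x * (((deriv κ (ρ x / ε) / ε : ℝ) : ℂ) * dbarJ g ρc v w x) := by
              push_cast; ring
            rw [e]
            refine (norm_add_le _ _).trans (add_le_add ?_ ?_)
            · rw [norm_mul, Complex.norm_real, Real.norm_eq_abs, abs_of_nonneg κ.nonneg]
              exact (mul_le_of_le_one_left (norm_nonneg _) κ.le_one).trans (hMJ x)
            · rw [norm_mul, norm_mul, Complex.norm_real, norm_div, Real.norm_eq_abs ε,
                abs_of_pos hε]
              gcongr
              · exact hMu x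
              · exact hMκ _
              · exact hηx x hx hx2
          · simp only [ω, k, indicator_of_notMem hxΩ]
            simp only [zero_mul, sub_zero, norm_zero]
            positivity
        · rw [indicator_of_notMem (show x ∉ K ∩ {x | |ρ x| ≤ 2 * ε} from fun h => hx2 h.2)]
          rw [not_le] at hx2
          by_cases hxΩ : x ∈ Ω
          · simp only [ω, k, indicator_of_mem hxΩ, hκz x hx2, hκdz x hx2]
            simp
          · simp only [ω, k, indicator_of_notMem hxΩ]
            simp
      · rw [indicator_of_notMem (show x ∉ K ∩ {x | |ρ x| ≤ 2 * ε} from fun h => hx h.1), image_eq_zero_of_notMem_tsupport hx,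
          dbarJ_eq_zero_of_notMem g v w hx]
        have : Ω.indicator (dbarJ g u v w) x = 0 := by
          rw [indicator_apply_eq_zero]; intro _; exact dbarJ_eq_zero_of_notMem g v w hx
        simp [this]
    have hmeas : MeasurableSet (K ∩ {x | |ρ x| ≤ 2 * ε}) :=
      hK.measurableSet.inter (isClosed_le hρ.continuous.abs continuous_const).measurableSet
    have hfin : μ (K ∩ {x | |ρ x| ≤ 2 * ε}) ≠ ⊤ :=
      ((measure_mono inter_subset_left).trans_lt hK.measure_lt_top).ne
    have hint1 : Integrable (Ω.indicator (dbarJ g u v w)) μ :=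
      (hJc.integrable_of_hasCompactSupport hJs).indicator hΩ.measurableSet
    have hint2 : Integrable (dbarJ g (fun x => ω x * u x) v w) μ :=
      (continuous_dbarJ hg (hb2.of_le (by norm_num)) v w).integrable_of_hasCompactSupport
        (hbs.dbarJ g v w)
    rw [← integral_indicator hΩ.measurableSet, ← sub_zero (∫ x, _ ∂μ), ← hzero,
      ← integral_sub hint1 hint2]
    refine (norm_integral_le_of_norm_le ((integrable_indicator_iff hmeas).2
      (integrableOn_const hfin)) (Eventually.of_forall hD)).trans ?_
    rw [integral_indicator hmeas, setIntegral_const, smul_eq_mul]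
    calc μ.real (K ∩ {x | |ρ x| ≤ 2 * ε}) * (MJ + Mu * (Mκ / ε * η))
        ≤ (C * ε) * (MJ + Mu * (Mκ / ε * η)) := by gcongr; exact hC ε hε
      _ = _ := by field_simp
  rw [← norm_le_zero_iff]
  refine le_of_forall_pos_le_add fun θ hθ => ?_
  set η := θ / (2 * (Mu * Mκ * C + 1)) with hηdef
  have hη : 0 < η := by positivity
  -- Compactness: where the tangential expression is not small, `|ρ|` has a positive minimum.
  obtain ⟨ε₀, hε₀, hε₀x⟩ : ∃ ε₀ > 0, ∀ x ∈ K, |ρ x| ≤ 2 * ε₀ → ‖dbarJ g ρc v w x‖ ≤ η := by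
    have hK' : IsCompact (K ∩ {x | η ≤ ‖dbarJ g ρc v w x‖}) :=
      hK.inter_right (isClosed_le continuous_const hLc.norm)
    rcases (K ∩ {x | η ≤ ‖dbarJ g ρc v w x‖}).eq_empty_or_nonempty with he | hne
    · refine ⟨1, one_pos, fun x hx _ => ?_⟩
      by_contra hcon
      have : x ∈ K ∩ {x | η ≤ ‖dbarJ g ρc v w x‖} := ⟨hx, (not_le.1 hcon).le⟩
      rw [he] at this; exact this
    · obtain ⟨x₀, hx₀, hmin⟩ := hK'.exists_isMinOn hne hρ.continuous.abs.continuousOn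
      have h0 : 0 < |ρ x₀| := by
        refine abs_pos.2 fun h0 => ?_
        have h1 := hL x₀ (huO hx₀.1) h0
        have h2 : η ≤ ‖dbarJ g ρc v w x₀‖ := hx₀.2
        rw [h1, norm_zero] at h2
        linarith
      refine ⟨|ρ x₀| / 4, by positivity, fun x hx hρx => ?_⟩
      by_contra hcon
      have := hmin (show x ∈ K ∩ {x | η ≤ ‖dbarJ g ρc v w x‖} from ⟨hx, (not_le.1 hcon).le⟩)
      simp only [mem_ofPred_eq] at this
      linarith
  set ε := min ε₀ (θ / (2 * (MJ * C + 1))) with hεdef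
  have hε : 0 < ε := by positivity
  refine (key ε hε η hη.le fun x hx hρx => hε₀x x hx (hρx.trans (by gcongr; exact min_le_left _ _))).trans ?_
  have h1 : MJ * C * ε ≤ θ / 2 := by
    have : ε ≤ θ / (2 * (MJ * C + 1)) := min_le_right _ _
    rw [le_div_iff₀ (by positivity)] at this
    nlinarith
  have h2 : Mu * Mκ * C * η ≤ θ / 2 := by
    have : η * (2 * (Mu * Mκ * C + 1)) = θ := by rw [hηdef]; field_simp
    nlinarith
  nlinarith

end WeakDbar


/-! ### Uniform limits, separate holomorphy and weak solutions. -/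

section Holomorphy
open MeasureTheory

/-- Cauchy's estimate on the complex line through `x` in each direction. -/
theorem norm_fderiv_le_of_bound {E : Type*} [NormedAddCommGroup E] [NormedSpace ℂ E] {G : E → ℂ}
    {x : E} {s ε : ℝ} (hs : 0 < s) (hG : DifferentiableOn ℂ G (Metric.ball x s))
    (hb : ∀ y ∈ Metric.ball x s, ‖G y‖ ≤ ε) : ‖fderiv ℂ G x‖ ≤ 2 * ε / s := by
  have hε : 0 ≤ ε := (norm_nonneg _).trans (hb x (Metric.mem_ball_self hs))
  refine ContinuousLinearMap.opNorm_le_bound _ (by positivity) fun e => ?_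
  rcases eq_or_ne e 0 with rfl | he
  · simp
  have he' : 0 < ‖e‖ := norm_pos_iff.2 he
  set R := s / (2 * ‖e‖) with hR
  have hR0 : 0 < R := by positivity
  have hmem : ∀ t ∈ Metric.closedBall (0 : ℂ) R, x + t • e ∈ Metric.ball x s := fun t ht => by
    rw [mem_closedBall_zero_iff] at ht
    rw [Metric.mem_ball, dist_eq_norm, add_sub_cancel_left, norm_smul]
    calc ‖t‖ * ‖e‖ ≤ R * ‖e‖ := by gcongr
      _ = s / 2 := by rw [hR]; field_simp
      _ < s := by linarith
  have hd : ∀ t ∈ Metric.closedBall (0 : ℂ) R, HasDerivAt (fun t : ℂ => G (x + t • e))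
      (fderiv ℂ G (x + t • e) e) t := fun t ht => by
    have h1 : HasDerivAt (fun t : ℂ => x + t • e) e t := by
      have := ((hasDerivAt_id t).smul_const e).const_add x
      rwa [one_smul] at this
    exact (hG.differentiableAt (Metric.isOpen_ball.mem_nhds
      (hmem t ht))).hasFDerivAt.comp_hasDerivAt t h1
  have h := Complex.norm_deriv_le_of_forall_mem_sphere_norm_le (f := fun t : ℂ => G (x + t • e))
    (c := 0) hR0 (C := ε) (DifferentiableOn.diffContOnCl (by
      rw [closure_ball _ hR0.ne']
      exact fun t ht => (hd t ht).differentiableAt.differentiableWithinAt))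
    fun t ht => hb _ (hmem t (Metric.sphere_subset_closedBall ht))
  rw [(hd 0 (Metric.mem_closedBall_self hR0.le)).deriv, zero_smul, add_zero] at h
  refine h.trans (le_of_eq ?_)
  rw [hR]; field_simp

/-- A uniform limit of holomorphic functions is holomorphic. -/
theorem differentiableOn_of_tendstoUniformlyOn {E : Type*} [NormedAddCommGroup E] [NormedSpace ℂ E]
    {ι : Type*} {l : Filter ι} [l.NeBot] {G : ι → E → ℂ} {g : E → ℂ} {U : Set E} (hU : IsOpen U)
    (hG : ∀ᶠ i in l, DifferentiableOn ℂ (G i) U) (hlim : TendstoUniformlyOn G g l U) :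
    DifferentiableOn ℂ g U := by
  classical
  -- The theorem on limits of derivatives wants every index to be differentiable; the exceptional
  -- ones are replaced by zero.
  let G' : ι → E → ℂ := fun i => if DifferentiableOn ℂ (G i) U then G i else 0
  have hG' : ∀ i, DifferentiableOn ℂ (G' i) U := fun i => by
    by_cases h : DifferentiableOn ℂ (G i) U
    · simp only [G', if_pos h]; exact h
    · simp only [G', if_neg h]; exact differentiableOn_const 0
  have hlim' : TendstoUniformlyOn G' g l U := hlim.congr (by
    filter_upwards [hG] with i hi x _
    simp only [G', if_pos hi])
  intro x hx
  obtain ⟨s, hs, hball⟩ := Metric.isOpen_iff.1 hU x hx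
  have hs2 : 0 < s / 2 := by positivity
  have hsub : ∀ y ∈ Metric.ball x (s / 2), Metric.ball y (s / 2) ⊆ U := fun y hy => by
    refine (Metric.ball_subset_ball' ?_).trans hball
    rw [Metric.mem_ball] at hy; linarith
  have hUC : UniformCauchySeqOn (fun i => fderiv ℂ (G' i)) l (Metric.ball x (s / 2)) := by
    intro u hu
    obtain ⟨ε, hε, hεu⟩ := Metric.mem_uniformity_dist.1 hu
    filter_upwards [hlim'.uniformCauchySeqOn _ (Metric.dist_mem_uniformity
      (show 0 < ε * s / 8 by positivity))] with m hm y hy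
    refine hεu ?_
    have h1 := norm_fderiv_le_of_bound (G := fun x => G' m.1 x - G' m.2 x) (ε := ε * s / 8) hs2
      (((hG' m.1).sub (hG' m.2)).mono (hsub y hy)) fun p hp => by
        rw [← dist_eq_norm]; exact (hm p (hsub y hy hp)).le
    have hd : ∀ i, DifferentiableAt ℂ (G' i) y := fun i =>
      (hG' i).differentiableAt (hU.mem_nhds (hsub y hy (Metric.mem_ball_self hs2)))
    rw [fderiv_fun_sub (hd _) (hd _)] at h1
    rw [dist_eq_norm]
    refine h1.trans_lt ?_
    rw [show 2 * (ε * s / 8) / (s / 2) = ε / 2 by field_simp; norm_num]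
    linarith
  have hex : ∀ y ∈ Metric.ball x (s / 2), ∃ L, Tendsto (fun i => fderiv ℂ (G' i) y) l (𝓝 L) :=
    fun y hy => cauchy_map_iff_exists_tendsto.1 (hUC.cauchy_map hy)
  choose! L hL using hex
  have h := hasFDerivAt_of_tendstoUniformlyOn (f := G') Metric.isOpen_ball
    (hUC.tendstoUniformlyOn_of_tendsto hL)
    (fun i y hy => ((hG' i).differentiableAt (hU.mem_nhds (hsub y hy
      (Metric.mem_ball_self hs2)))).hasFDerivAt)
    (fun y hy => hlim'.tendsto_at (hsub y hy (Metric.mem_ball_self hs2)))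
    (Metric.mem_ball_self hs2 : x ∈ _)
  exact h.differentiableAt.differentiableWithinAt

/-- A bounded separately holomorphic function on a product with a disc is holomorphic. -/
theorem differentiableOn_prod_of_separately {E : Type*} [NormedAddCommGroup E] [NormedSpace ℂ E]
    {U : Set E} (hU : IsOpen U) {F : E × ℂ → ℂ} {w₀ : ℂ} {r M : ℝ} (hr : 0 < r)
    (hM : ∀ z ∈ U, ∀ w ∈ Metric.ball w₀ r, ‖F (z, w)‖ ≤ M)
    (h1 : ∀ w ∈ Metric.ball w₀ r, DifferentiableOn ℂ (fun z => F (z, w)) U)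
    (h2 : ∀ z ∈ U, DifferentiableOn ℂ (fun w => F (z, w)) (Metric.ball w₀ r)) :
    DifferentiableOn ℂ F (U ×ˢ Metric.ball w₀ (r / 4)) := by
  have hw₀ : w₀ ∈ Metric.ball w₀ r := Metric.mem_ball_self hr
  rcases U.eq_empty_or_nonempty with rfl | ⟨z₀, hz₀⟩
  · rw [empty_prod]; exact differentiableOn_empty
  have hM0 : 0 ≤ M := (norm_nonneg _).trans (hM z₀ hz₀ w₀ hw₀)
  -- Iterated divided differences at `w₀`: the values at `w₀` are the Taylor coefficients and the
  -- functions are the normalized remainders. By Schwarz's lemma each step multiplies the bound by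
  -- at most `3 / r`, so the Taylor series converges uniformly for `|w - w₀| < r / 4`.
  let G : ℕ → E → ℂ → ℂ := fun K z => (fun g => dslope g w₀)^[K] fun w => F (z, w)
  have hGs : ∀ K z, G (K + 1) z = dslope (G K z) w₀ := fun K z =>
    Function.iterate_succ_apply' _ _ _
  have hG : ∀ K, ∀ z ∈ U, DifferentiableOn ℂ (G K z) (Metric.ball w₀ r) ∧
      ∀ w ∈ Metric.ball w₀ r, ‖G K z w‖ ≤ (M + 1) * (3 / r) ^ K := by
    intro K z hz
    induction K with
    | zero => exact ⟨h2 z hz, fun w hw => by simpa [G] using (hM z hz w hw).trans (by linarith)⟩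
    | succ K ih =>
      rw [hGs]
      refine ⟨(Complex.differentiableOn_dslope (Metric.isOpen_ball.mem_nhds hw₀)).2 ih.1,
        fun w hw => ?_⟩
      have hpos : 0 < (M + 1) * (3 / r) ^ K := by positivity
      have := Complex.norm_dslope_le_div_of_mapsTo_ball ih.1
        (R₂ := 3 * ((M + 1) * (3 / r) ^ K)) (fun x hx => by
          have e1 := ih.2 x hx
          have e2 := ih.2 w₀ hw₀
          have e3 := norm_sub_le (G K z x) (G K z w₀)
          rw [Metric.mem_closedBall, dist_eq_norm]; linarith) hw
      refine this.trans (le_of_eq ?_)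
      rw [pow_succ]; ring
  have hexp : ∀ K z w, F (z, w) = ∑ k ∈ Finset.range K, G k z w₀ * (w - w₀) ^ k +
      (w - w₀) ^ K * G K z w := by
    intro K z w
    induction K with
    | zero => simp [G]
    | succ K ih =>
      rw [ih, Finset.sum_range_succ, hGs]
      have := sub_smul_dslope (G K z) w₀ w
      rw [smul_eq_mul] at this
      linear_combination (-(w - w₀) ^ K) * this
  -- Away from `w₀` a divided difference is an algebraic combination of functions holomorphic in
  -- `z`. At `w₀` it is their uniform limit, by the bound for the next difference.
  have hz : ∀ K, ∀ w ∈ Metric.ball w₀ r, DifferentiableOn ℂ (fun z => G K z w) U := by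
    intro K
    induction K with
    | zero => exact h1
    | succ K ih =>
      have hne : ∀ w ∈ Metric.ball w₀ r, w ≠ w₀ → DifferentiableOn ℂ (fun z => G (K + 1) z w) U := by
        intro w hw hww
        have : ∀ z, G (K + 1) z w = (w - w₀)⁻¹ * (G K z w - G K z w₀) := fun z => by
          rw [hGs, dslope_of_ne _ hww, slope, vsub_eq_sub, smul_eq_mul]
        simp only [this]
        exact ((ih w hw).sub (ih w₀ hw₀)).const_mul _
      intro w hw
      by_cases hww : w = w₀
      · subst hww
        refine differentiableOn_of_tendstoUniformlyOn (l := 𝓝[≠] w)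
          (G := fun w' z => G (K + 1) z w') hU ?_ ?_
        · filter_upwards [self_mem_nhdsWithin,
            mem_nhdsWithin_of_mem_nhds (Metric.ball_mem_nhds w hr)] with w' h1 h2
          exact hne w' h2 h1
        · rw [Metric.tendstoUniformlyOn_iff]
          intro ε hε
          have hC : 0 < (M + 1) * (3 / r) ^ (K + 2) := by positivity
          filter_upwards [mem_nhdsWithin_of_mem_nhds (Metric.ball_mem_nhds w
            (lt_min hr (div_pos hε hC)))] with w' hw' z hz
          rw [Metric.mem_ball, lt_min_iff] at hw'
          have h3 := sub_smul_dslope (G (K + 1) z) w w'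
          rw [← hGs, smul_eq_mul] at h3
          rw [dist_comm, dist_eq_norm, ← h3, norm_mul, ← dist_eq_norm]
          have h4 := (hG (K + 2) z hz).2 w' hw'.1
          calc dist w' w * ‖G (K + 1 + 1) z w'‖ ≤ dist w' w * ((M + 1) * (3 / r) ^ (K + 2)) := by
                gcongr
            _ < ε := by rw [← lt_div_iff₀ hC]; exact hw'.2
      · exact hne w hw hww
  have hlim : TendstoUniformlyOn (fun K (p : E × ℂ) => ∑ k ∈ Finset.range K,
      G k p.1 w₀ * (p.2 - w₀) ^ k) F atTop (U ×ˢ Metric.ball w₀ (r / 4)) := by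
    rw [Metric.tendstoUniformlyOn_iff]
    intro ε hε
    have ht : Tendsto (fun K : ℕ => (M + 1) * (3 / 4 : ℝ) ^ K) atTop (𝓝 0) := by
      simpa using (tendsto_pow_atTop_nhds_zero_of_lt_one (by norm_num)
        (by norm_num : (3 / 4 : ℝ) < 1)).const_mul (M + 1)
    filter_upwards [ht.eventually (gt_mem_nhds hε)] with K hK p hp
    have hp2 : dist p.2 w₀ < r / 4 := hp.2
    rw [dist_eq_norm, show F p = F (p.1, p.2) from rfl, hexp K p.1 p.2, add_sub_cancel_left,
      norm_mul, norm_pow, ← dist_eq_norm]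
    have h4 := (hG K p.1 hp.1).2 p.2 (Metric.ball_subset_ball (by linarith) hp.2)
    calc dist p.2 w₀ ^ K * ‖G K p.1 p.2‖ ≤ (r / 4) ^ K * ((M + 1) * (3 / r) ^ K) := by gcongr
      _ = (M + 1) * (3 / 4) ^ K := by
          rw [mul_left_comm, ← mul_pow]; congr 2; field_simp
      _ < ε := hK
  refine differentiableOn_of_tendstoUniformlyOn (hU.prod Metric.isOpen_ball)
    (Eventually.of_forall fun K => ?_) hlim
  refine DifferentiableOn.fun_sum fun k _ => DifferentiableOn.mul ?_ ?_
  · exact (hz k w₀ hw₀).comp differentiableOn_fst fun p hp => hp.1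
  · exact ((differentiable_snd.sub_const w₀).pow k).differentiableOn

theorem differentiableAt_complex_of_dbarDir {E : Type*} [NormedAddCommGroup E] [NormedSpace ℝ E]
    [NormedSpace ℂ E] [IsScalarTower ℝ ℂ E] {g : E → ℂ} {x : E} (hg : DifferentiableAt ℝ g x)
    (h : ∀ v, dbarDir g v x = 0) : DifferentiableAt ℂ g x := by
  have hI : ∀ v, fderiv ℝ g x (Complex.I • v) = Complex.I * fderiv ℝ g x v := fun v => by
    have h1 := h v
    rw [dbarDir, div_eq_zero_iff, or_iff_left two_ne_zero] at h1
    linear_combination (-Complex.I) * h1 + fderiv ℝ g x (Complex.I • v) * Complex.I_mul_I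
  rw [differentiableAt_iff_restrictScalars ℝ hg]
  refine ⟨⟨{ toFun := fderiv ℝ g x, map_add' := map_add _, map_smul' := fun c v => ?_ },
    (fderiv ℝ g x).continuous⟩, rfl⟩
  have e : c • v = (c.re : ℝ) • v + (c.im : ℝ) • (Complex.I • v) := by
    conv_lhs => rw [← Complex.re_add_im c, add_smul, mul_smul]
    rw [show ((c.re : ℂ)) • v = c.re • v from algebraMap_smul ℂ c.re v,
      show ((c.im : ℂ)) • Complex.I • v = c.im • Complex.I • v from algebraMap_smul ℂ c.im _]
  rw [e, map_add, map_smul, map_smul, hI]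
  simp only [Complex.real_smul, RingHom.id_apply, smul_eq_mul]
  conv_rhs => rw [← Complex.re_add_im c]
  ring

theorem hasFDerivAt_integral_sub_smul {E : Type*} [NormedAddCommGroup E] [NormedSpace ℝ E]
    [FiniteDimensional ℝ E] [MeasurableSpace E] [BorelSpace E] {μ : Measure E} {η : E → ℝ}
    {k : E → ℂ} (hη : ContDiff ℝ 1 η) (hs : HasCompactSupport η) (hk : Integrable k μ) (x : E) :
    Integrable (fun y => (fderiv ℝ η (x - y)).smulRight (k y)) μ ∧
    HasFDerivAt (fun x => ∫ y, η (x - y) • k y ∂μ)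
      (∫ y, (fderiv ℝ η (x - y)).smulRight (k y) ∂μ) x := by
  have hc' : Continuous (fderiv ℝ η) := hη.continuous_fderiv one_ne_zero
  obtain ⟨M, hM⟩ := hc'.bounded_above_of_compact_support (hs.fderiv (𝕜 := ℝ))
  have hm : ∀ x, AEStronglyMeasurable (fun y => (fderiv ℝ η (x - y)).smulRight (k y)) μ := by
    intro x
    have h1 : Continuous fun y => fderiv ℝ η (x - y) := hc'.comp (by fun_prop)
    exact (ContinuousLinearMap.smulRightL ℝ E ℂ).aestronglyMeasurable_comp₂
      h1.aestronglyMeasurable hk.aestronglyMeasurable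
  have hb : ∀ x y, ‖(fderiv ℝ η (x - y)).smulRight (k y)‖ ≤ M * ‖k y‖ := fun x y => by
    refine (ContinuousLinearMap.norm_smulRight_apply (fderiv ℝ η (x - y)) (k y)).le.trans ?_
    exact mul_le_mul_of_nonneg_right (hM _) (norm_nonneg _)
  have hc : ∀ x, Continuous fun y => η (x - y) := fun x => hη.continuous.comp (by fun_prop)
  obtain ⟨M', hM'⟩ := hη.continuous.bounded_above_of_compact_support hs
  have hi : ∀ x, Integrable (fun y => η (x - y) • k y) μ := fun x =>
    (hk.norm.const_mul M').mono' ((hc x).aestronglyMeasurable.smul hk.aestronglyMeasurable)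
      (Eventually.of_forall fun y => by
        rw [norm_smul]; exact mul_le_mul_of_nonneg_right (hM' _) (norm_nonneg _))
  refine ⟨(hk.norm.const_mul M).mono' (hm x) (Eventually.of_forall (hb x)), ?_⟩
  refine hasFDerivAt_integral_of_dominated_of_fderiv_le (𝕜 := ℝ)
    (F := fun x y => η (x - y) • k y)
    (F' := fun x y => (fderiv ℝ η (x - y)).smulRight (k y)) (bound := fun y => M * ‖k y‖)
    (s := univ) univ_mem (Eventually.of_forall fun x => (hi x).aestronglyMeasurable) (hi x)
    (hm x) (Eventually.of_forall fun y p _ => hb p y) (hk.norm.const_mul M)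
    (Eventually.of_forall fun y p _ => ?_)
  have h1 := (((hη.differentiable one_ne_zero) (p - y)).hasFDerivAt.comp p
    ((hasFDerivAt_id (𝕜 := ℝ) p).sub_const y)).smul_const (k y)
  exact h1

/-- A continuous weak solution of the Cauchy–Riemann equations is holomorphic. -/
theorem differentiableOn_of_weak_dbar {E : Type*} [NormedAddCommGroup E] [NormedSpace ℝ E]
    [NormedSpace ℂ E] [IsScalarTower ℝ ℂ E] [FiniteDimensional ℝ E] [MeasurableSpace E]
    [BorelSpace E] {μ : Measure E} [μ.IsAddHaarMeasure] {U : Set E} (hU : IsOpen U) {k : E → ℂ}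
    (hk : ContinuousOn k U) (hweak : ∀ χ : E → ℂ, ContDiff ℝ 2 χ → HasCompactSupport χ →
      tsupport χ ⊆ U → ∀ v, ∫ x, dbarDir χ v x * k x ∂μ = 0) : DifferentiableOn ℂ k U := by
  intro x₀ hx₀
  obtain ⟨r, hr, hball⟩ := Metric.nhds_basis_closedBall.mem_iff.1 (hU.mem_nhds hx₀)
  have hK : IsCompact (Metric.closedBall x₀ r) := FiniteDimensional.proper ℝ E |>.isCompact_closedBall x₀ r
  let k' : E → ℂ := (Metric.closedBall x₀ r).indicator k
  have hk'i : Integrable k' μ := ((hk.mono hball).integrableOn_compact hK).integrable_indicator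
    Metric.isClosed_closedBall.measurableSet
  have hr2 : 0 < r / 2 := by positivity
  suffices h : DifferentiableOn ℂ k' (Metric.ball x₀ (r / 2)) by
    have h1 := h.differentiableAt (Metric.ball_mem_nhds x₀ hr2)
    refine (h1.congr_of_eventuallyEq ?_).differentiableWithinAt
    filter_upwards [Metric.closedBall_mem_nhds x₀ hr] with x hx
    exact (indicator_of_mem hx _).symm
  -- Mollifiers of radius `δ`. The other branch only makes the family total.
  let φ : ℝ → ContDiffBump (0 : E) := fun δ =>
    if h : 0 < δ then ⟨δ / 2, δ, by positivity, by linarith⟩ else ⟨1, 2, one_pos, one_lt_two⟩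
  have hφ : ∀ δ > 0, (φ δ).rOut = δ := fun δ hδ => by simp only [φ, dif_pos hδ]
  refine differentiableOn_of_tendstoUniformlyOn (l := 𝓝[>] (0 : ℝ))
    (G := fun δ x => ∫ y, (φ δ).normed μ (x - y) • k' y ∂μ) Metric.isOpen_ball ?_ ?_
  · filter_upwards [Ioo_mem_nhdsGT hr2] with δ hδ x hx
    have hs : ContDiff ℝ 2 ((φ δ).normed μ) := (φ δ).contDiff_normed
    have hcs : HasCompactSupport ((φ δ).normed μ) := (φ δ).hasCompactSupport_normed
    have hc' : Continuous (fderiv ℝ ((φ δ).normed μ)) := hs.continuous_fderiv two_ne_zero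
    obtain ⟨hLi, hfd⟩ := hasFDerivAt_integral_sub_smul (hs.of_le one_le_two) hcs hk'i x
    refine (differentiableAt_complex_of_dbarDir hfd.differentiableAt fun v =>
      ?_).differentiableWithinAt
    -- Differentiating the convolution differentiates the mollifier. Its reflected translate `χ` is
    -- an admissible test function, so the weak equation says that the mollified function satisfies
    -- the Cauchy–Riemann equations.
    let χ : E → ℂ := fun y => ((φ δ).normed μ (x - y) : ℂ)
    have hχ : ContDiff ℝ 2 χ := Complex.ofRealCLM.contDiff.comp
      (hs.comp (contDiff_const.sub contDiff_id))
    have hχt : tsupport χ ⊆ Metric.closedBall x δ := by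
      refine closure_minimal (fun y hy => ?_) Metric.isClosed_closedBall
      have h1 : x - y ∈ Function.support ((φ δ).normed μ) := fun h => hy (by simp [χ, h])
      rw [(φ δ).support_normed_eq, hφ δ hδ.1, mem_ball_zero_iff] at h1
      rw [Metric.mem_closedBall, dist_comm, dist_eq_norm]; exact h1.le
    have hχK : tsupport χ ⊆ Metric.closedBall x₀ r := hχt.trans (Metric.closedBall_subset_closedBall'
      (by rw [Metric.mem_ball] at hx; linarith [hδ.2]))
    have hfχ : ∀ y v, fderiv ℝ χ y v = -(fderiv ℝ ((φ δ).normed μ) (x - y) v : ℂ) := fun y v => by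
      have h1 := Complex.ofRealCLM.hasFDerivAt.comp y
        (((hs.differentiable two_ne_zero) (x - y)).hasFDerivAt.comp y
          ((hasFDerivAt_id (𝕜 := ℝ) y).const_sub x))
      have h2 : fderiv ℝ χ y = _ := h1.fderiv
      rw [h2]; simp
    have hw := hweak χ hχ (hK.of_isClosed_subset (isClosed_tsupport _) hχK) (hχK.trans hball) v
    rw [dbarDir, hfd.fderiv, ContinuousLinearMap.integral_apply hLi,
      ContinuousLinearMap.integral_apply hLi, ← integral_const_mul, ← integral_add
        (hLi.apply_continuousLinearMap _) ((hLi.apply_continuousLinearMap _).const_mul _),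
      ← integral_div, ← neg_eq_zero, ← integral_neg, ← hw]
    congr 1
    ext y
    by_cases hy : y ∈ Metric.closedBall x₀ r
    · simp only [ContinuousLinearMap.smulRight_apply, dbarDir, hfχ, k', indicator_of_mem hy,
        Complex.real_smul]
      ring
    · have h0 : dbarDir χ v y = 0 := image_eq_zero_of_notMem_tsupport fun h =>
        hy (hχK (tsupport_dbarDir_subset χ v h))
      simp [h0, k', indicator_of_notMem hy]
  · rw [Metric.tendstoUniformlyOn_iff]
    intro ε hε
    have huc := hK.uniformContinuousOn_of_continuous (hk.mono hball)
    obtain ⟨δ₀, hδ₀, hδ⟩ := Metric.uniformContinuousOn_iff.1 huc (ε / 2) (by positivity)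
    filter_upwards [Ioo_mem_nhdsGT (lt_min hδ₀ hr2)] with δ hδ' x hx
    have hxK : x ∈ Metric.closedBall x₀ r :=
      Metric.ball_subset_closedBall (Metric.ball_subset_ball (by linarith) hx)
    have h1 := ContDiffBump.dist_normed_convolution_le (φ := φ δ) (μ := μ) (g := k') (x₀ := x)
      (ε := ε / 2) hk'i.aestronglyMeasurable fun y hy => by
        rw [hφ δ hδ'.1, Metric.mem_ball] at hy
        have hyK : y ∈ Metric.closedBall x₀ r := by
          rw [Metric.mem_closedBall]
          rw [Metric.mem_ball] at hx
          have := dist_triangle y x x₀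
          have := hδ'.2.trans_le (min_le_right _ _)
          linarith
        simp only [k', indicator_of_mem hyK, indicator_of_mem hxK]
        exact (hδ y hyK x hxK (hy.trans (hδ'.2.trans_le (min_le_left _ _)))).le
    rw [dist_comm]
    refine lt_of_le_of_lt ?_ (half_lt_self hε)
    convert! h1 using 2
    rw [convolution_eq_swap]
    rfl

end Holomorphy


/-! ### Tangential Cauchy–Riemann equations for arbitrary extensions. -/

section WeakEquation
open MeasureTheory
open scoped Manifold ContDiff

/-- Near `q`, the function `f` is the restriction to `Γ` of a `C¹` function whose differential at
`q` is complex linear on the complex tangent space of `Γ`. -/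
def IsLocallyCR {n : ℕ} (Γ : Set ((Fin n → ℂ) × ℂ)) (f : (Fin n → ℂ) × ℂ → ℂ)
    (q : (Fin n → ℂ) × ℂ) : Prop :=
  ∃ (V : Set ((Fin n → ℂ) × ℂ)) (ρ : (Fin n → ℂ) × ℂ → ℝ) (g : (Fin n → ℂ) × ℂ → ℂ),
    IsDefiningFunctionAt Γ V ρ q ∧ ContDiffOn ℝ 1 g V ∧ EqOn g f (Γ ∩ V) ∧
    ∀ v : (Fin n → ℂ) × ℂ, fderiv ℝ ρ q v = 0 → fderiv ℝ ρ q (Complex.I • v) = 0 →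
      fderiv ℝ g q (Complex.I • v) = Complex.I * fderiv ℝ g q v

/-- A function that is constant on a regular level set has a differential that vanishes on the
tangent space. -/
theorem fderiv_eq_zero_of_level {E : Type*} [NormedAddCommGroup E] [NormedSpace ℝ E]
    [CompleteSpace E] {ρ k : E → ℝ} {q : E} (hρ : ContDiffAt ℝ 1 ρ q) (hk : ContDiffAt ℝ 1 k q)
    (hne : fderiv ℝ ρ q ≠ 0) (h : ∀ᶠ x in 𝓝 q, ρ x = ρ q → k x = k q) {v : E}
    (hv : fderiv ℝ ρ q v = 0) : fderiv ℝ k q v = 0 := by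
  -- Constancy on the level set is a degenerate constrained extremum, so Lagrange multipliers apply.
  have hext : IsLocalExtrOn k {x | ρ x = ρ q} q := by
    refine Or.inl ?_
    filter_upwards [mem_nhdsWithin_of_mem_nhds h, self_mem_nhdsWithin] with x hx hx'
    exact (hx hx').ge
  obtain ⟨a, b, hab, e⟩ := hext.exists_multipliers_of_hasStrictFDerivAt_1d
    (hρ.hasStrictFDerivAt one_ne_zero) (hk.hasStrictFDerivAt one_ne_zero)
  have e' := congrArg (fun A : StrongDual ℝ E => A v) e
  simp only [add_apply, smul_apply, hv, smul_eq_mul, mul_zero, zero_add,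
    zero_apply, mul_eq_zero] at e'
  refine e'.resolve_left ?_
  rintro rfl
  rw [zero_smul, add_zero, smul_eq_zero] at e
  rcases e with rfl | e
  · exact hab rfl
  · exact hne e

theorem fderiv_eq_zero_of_level_complex {E : Type*} [NormedAddCommGroup E] [NormedSpace ℝ E]
    [CompleteSpace E] {ρ : E → ℝ} {k : E → ℂ} {q : E} (hρ : ContDiffAt ℝ 1 ρ q)
    (hk : ContDiffAt ℝ 1 k q) (hne : fderiv ℝ ρ q ≠ 0)
    (h : ∀ᶠ x in 𝓝 q, ρ x = ρ q → k x = k q) {v : E} (hv : fderiv ℝ ρ q v = 0) :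
    fderiv ℝ k q v = 0 := by
  have hd := (hk.differentiableAt one_ne_zero).hasFDerivAt
  have h1 := fderiv_eq_zero_of_level hρ (Complex.reCLM.contDiff.contDiffAt.comp q hk) hne
    (h.mono fun x hx hx' => by simp [hx hx']) hv
  have h2 := fderiv_eq_zero_of_level hρ (Complex.imCLM.contDiff.contDiffAt.comp q hk) hne
    (h.mono fun x hx hx' => by simp [hx hx']) hv
  rw [(Complex.reCLM.hasFDerivAt.comp q hd).fderiv] at h1
  rw [(Complex.imCLM.hasFDerivAt.comp q hd).fderiv] at h2
  exact Complex.ext h1 h2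

theorem IsDefiningFunctionAt.contDiffAt {n : ℕ} {Γ V : Set ((Fin n → ℂ) × ℂ)}
    {ρ : (Fin n → ℂ) × ℂ → ℝ} {q : (Fin n → ℂ) × ℂ} (h : IsDefiningFunctionAt Γ V ρ q) :
    ContDiffAt ℝ 1 ρ q := (h.analytic q h.mem).contDiffAt

theorem IsDefiningFunctionAt.eq_zero_iff {n : ℕ} {Γ V : Set ((Fin n → ℂ) × ℂ)}
    {ρ : (Fin n → ℂ) × ℂ → ℝ} {q : (Fin n → ℂ) × ℂ} (h : IsDefiningFunctionAt Γ V ρ q)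
    {x : (Fin n → ℂ) × ℂ} (hx : x ∈ V) : ρ x = 0 ↔ x ∈ Γ := by
  constructor
  · intro h0
    have : x ∈ {p ∈ V | ρ p = 0} := ⟨hx, h0⟩
    rw [← h.inter_eq] at this
    exact this.1
  · intro hΓ
    have : x ∈ Γ ∩ V := ⟨hΓ, hx⟩
    rw [h.inter_eq] at this
    exact this.2

/-- The tangential Cauchy–Riemann equations hold for every `C¹` extension and every defining
function. -/
theorem IsLocallyCR.dbarJ_eq_zero {n : ℕ} {Γ : Set ((Fin n → ℂ) × ℂ)} {f : (Fin n → ℂ) × ℂ → ℂ}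
    {q : (Fin n → ℂ) × ℂ} (hf : IsLocallyCR Γ f q) {g : (Fin n → ℂ) × ℂ → ℂ}
    (hg : ContDiffAt ℝ 1 g q) (hgf : ∀ᶠ x in 𝓝 q, x ∈ Γ → g x = f x)
    {V : Set ((Fin n → ℂ) × ℂ)} {ρ : (Fin n → ℂ) × ℂ → ℝ} (hρ : IsDefiningFunctionAt Γ V ρ q)
    (hq : q ∈ Γ) (v w : (Fin n → ℂ) × ℂ) : dbarJ g (fun y => (ρ y : ℂ)) v w q = 0 := by
  obtain ⟨V₁, ρ₁, g₁, hρ₁, hg₁, he₁, hL⟩ := hf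
  have hV := hρ.isOpen.mem_nhds hρ.mem
  have hV₁ := hρ₁.isOpen.mem_nhds hρ₁.mem
  have hg₁' : ContDiffAt ℝ 1 g₁ q := hg₁.contDiffAt hV₁
  have hq0 : ρ q = 0 := (hρ.eq_zero_iff hρ.mem).2 hq
  have k1 : ∀ v, fderiv ℝ ρ q v = 0 → fderiv ℝ ρ₁ q v = 0 := fun v hv => by
    refine fderiv_eq_zero_of_level hρ.contDiffAt hρ₁.contDiffAt hρ.fderiv_ne_zero ?_ hv
    filter_upwards [hV, hV₁] with x hx hx₁ hx0
    rw [hq0, hρ.eq_zero_iff hx] at hx0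
    rw [(hρ₁.eq_zero_iff hx₁).2 hx0, (hρ₁.eq_zero_iff hρ₁.mem).2 hq]
  have k2 : ∀ v, fderiv ℝ ρ q v = 0 → fderiv ℝ g q v = fderiv ℝ g₁ q v := fun v hv => by
    have := fderiv_eq_zero_of_level_complex (k := fun x => g x - g₁ x) hρ.contDiffAt
      (hg.sub hg₁') hρ.fderiv_ne_zero ?_ hv
    · rw [fderiv_fun_sub (hg.differentiableAt one_ne_zero)
        (hg₁'.differentiableAt one_ne_zero), sub_apply, sub_eq_zero] at this
      exact this
    · have key : ∀ x, x ∈ Γ → x ∈ V₁ → g x = f x → g x - g₁ x = 0 := fun x h1 h2 h3 => by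
        rw [h3, he₁ ⟨h1, h2⟩, sub_self]
      filter_upwards [hV, hV₁, hgf] with x hx hx₁ hxf hx0
      rw [hq0, hρ.eq_zero_iff hx] at hx0
      rw [key x hx0 hx₁ (hxf hx0), key q hq hρ₁.mem (hgf.self_of_nhds hq)]
  have hdρ : ∀ v, fderiv ℝ (fun y => (ρ y : ℂ)) q v = (fderiv ℝ ρ q v : ℂ) := fun v => by
    have h1 := Complex.ofRealCLM.hasFDerivAt.comp q
      (hρ.contDiffAt.differentiableAt one_ne_zero).hasFDerivAt
    have h2 : fderiv ℝ (fun y => (ρ y : ℂ)) q = _ := h1.fderiv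
    rw [h2]; rfl
  set s := fderiv ℝ ρ q with hs
  set G := fderiv ℝ g q with hG
  -- With the complex linear form `θ(x) = s x - i s(i x)` this is `θ(w) v - θ(v) w`, a vector killed
  -- by `θ` and hence complex tangent. Complex linearity of the differential at `ξ` is the asserted
  -- identity.
  set ξ : (Fin n → ℂ) × ℂ := (s w) • v - (s (Complex.I • w)) • (Complex.I • v) - (s v) • w +
    (s (Complex.I • v)) • (Complex.I • w) with hξ
  have hIξ : Complex.I • ξ = (s w) • (Complex.I • v) + (s (Complex.I • w)) • v -
      (s v) • (Complex.I • w) - (s (Complex.I • v)) • w := by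
    have hII : ∀ x : (Fin n → ℂ) × ℂ, Complex.I • Complex.I • x = -x := fun x => by
      rw [smul_smul, Complex.I_mul_I, neg_one_smul]
    have hc : ∀ (a : ℝ) (x : (Fin n → ℂ) × ℂ), Complex.I • a • x = a • Complex.I • x :=
      fun a x => smul_comm _ _ _
    rw [hξ, smul_add, smul_sub, smul_sub, hc, hc, hc, hc, hII, hII, smul_neg, smul_neg]
    abel
  have e1 : s ξ = 0 := by
    rw [hξ]; simp only [map_add, map_sub, map_smul, smul_eq_mul]; ring
  have e2 : s (Complex.I • ξ) = 0 := by
    rw [hIξ]; simp only [map_add, map_sub, map_smul, smul_eq_mul]; ring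
  have e3 : G (Complex.I • ξ) = Complex.I * G ξ := by
    rw [k2 _ e2, k2 _ e1]
    exact hL ξ (k1 _ e1) (k1 _ e2)
  rw [hIξ, hξ] at e3
  simp only [map_add, map_sub, map_smul, Complex.real_smul] at e3
  simp only [dbarJ, dbarDir, hdρ, ← hG]
  linear_combination (-Complex.I / 4) * e3 +
    (1 / 4 : ℂ) * ((s v : ℂ) * G w - (s w : ℂ) * G v) * Complex.I_mul_I

/-- Functions that are locally restrictions of `C¹` functions are so globally. -/
theorem exists_contDiff_extension {E : Type*} [NormedAddCommGroup E] [NormedSpace ℝ E]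
    [FiniteDimensional ℝ E] {K : Set E} (hK : IsCompact K) {f : E → ℂ}
    (h : ∀ x ∈ K, ∃ U ∈ 𝓝 x, ∃ g : E → ℂ, ContDiffOn ℝ 1 g U ∧ EqOn g f (K ∩ U)) :
    ∃ g : E → ℂ, ContDiff ℝ 1 g ∧ HasCompactSupport g ∧ EqOn g f K := by
  classical
  -- Partition of unity: prescribing the value on `K` and nothing elsewhere is a convex condition at
  -- each point.
  obtain ⟨g, hg⟩ := exists_contMDiffMap_forall_mem_convex_of_local (n := 1) 𝓘(ℝ, E)
    (t := fun x => if x ∈ K then {f x} else univ)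
    (fun x => by
      by_cases hx : x ∈ K
      · simp only [if_pos hx]; exact convex_singleton _
      · simp only [if_neg hx]; exact convex_univ)
    (fun x => by
      by_cases hx : x ∈ K
      · obtain ⟨U, hU, g, hg, he⟩ := h x hx
        refine ⟨U, hU, g, hg.contMDiffOn, fun y hy => ?_⟩
        by_cases hyK : y ∈ K
        · simp only [if_pos hyK]; exact he ⟨hyK, hy⟩
        · simp only [if_neg hyK]; trivial
      · refine ⟨Kᶜ, hK.isClosed.isOpen_compl.mem_nhds hx, fun _ => 0, contMDiffOn_const,
          fun y hy => ?_⟩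
        have hyK : y ∉ K := hy
        simp only [if_neg hyK]; trivial)
  obtain ⟨χ, hχ, hχs, -, hχ1, -⟩ := exists_contDiff_cutoff hK isOpen_univ (subset_univ _)
  refine ⟨fun x => (χ x : ℂ) * g x, (Complex.ofRealCLM.contDiff.comp (hχ.of_le
    one_le_two)).mul g.contMDiff.contDiff, ?_, fun x hx => ?_⟩
  · exact HasCompactSupport.mul_right (hχs.comp_left Complex.ofReal_zero)
  · have h1 := hg x
    simp only [if_pos hx] at h1
    have h2 : χ x = 1 := hχ1.self_of_nhdsSet x hx
    change (χ x : ℂ) * g x = f x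
    rw [h2, h1]; simp

end WeakEquation


/-! ### The weak equation over a family of discs. -/

section LocalIntegrals
open MeasureTheory

instance isAddHaarMeasure_volume_prod (n : ℕ) :
    (volume : Measure ((Fin n → ℂ) × ℂ)).IsAddHaarMeasure :=
  Measure.prod.instIsAddHaarMeasure volume volume

theorem contDiff_mul_of_tsupport_subset {E : Type*} [NormedAddCommGroup E] [NormedSpace ℝ E]
    {χ ρ : E → ℝ} {V : Set E} {m : WithTop ℕ∞} (hχ : ContDiff ℝ m χ) (hV : tsupport χ ⊆ V)
    (hρ : ∀ x ∈ V, ContDiffAt ℝ m ρ x) : ContDiff ℝ m fun x => χ x * ρ x := by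
  rw [contDiff_iff_contDiffAt]
  intro x
  by_cases hx : x ∈ tsupport χ
  · exact hχ.contDiffAt.mul (hρ x (hV hx))
  · have : (fun x => χ x * ρ x) =ᶠ[𝓝 x] fun _ => 0 := by
      filter_upwards [(notMem_tsupport_iff_eventuallyEq).1 hx] with y hy
      simp [hy]
    exact contDiffAt_const.congr_of_eventuallyEq this

theorem dbarJ_congr_right {E : Type*} [NormedAddCommGroup E] [NormedSpace ℝ E] [SMul ℂ E]
    {g b b' : E → ℂ} {x : E} (h : b =ᶠ[𝓝 x] b') (v w : E) : dbarJ g b v w x = dbarJ g b' v w x := by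
  rw [dbarJ, dbarJ, dbarDir_congr h, dbarDir_congr h]

theorem dbarJ_add {E : Type*} [NormedAddCommGroup E] [NormedSpace ℝ E] [SMul ℂ E]
    {g b b' : E → ℂ} {x : E} (hb : DifferentiableAt ℝ b x) (hb' : DifferentiableAt ℝ b' x)
    (v w : E) : dbarJ g (fun y => b y + b' y) v w x = dbarJ g b v w x + dbarJ g b' v w x := by
  simp only [dbarJ, dbarDir, fderiv_fun_add hb hb', add_apply]
  ring

/-- Inside `Ω` the integral is one over the whole space of an exact form; outside the closure there
is nothing to integrate. A frontier point over `D` is a regular point of `Γ`, where the level set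
argument applies with a local defining function. -/
theorem IsDiscFamily.exists_setIntegral_dbarJ_eq_zero {n : ℕ} {Γ Ω : Set ((Fin n → ℂ) × ℂ)}
    {D : Set (Fin n → ℂ)} (h : IsDiscFamily Γ Ω D) {f g : (Fin n → ℂ) × ℂ → ℂ}
    (hf : ∀ q ∈ Γ, q.1 ∈ D → IsLocallyCR Γ f q) (hg : ContDiff ℝ 1 g)
    {W : Set ((Fin n → ℂ) × ℂ)} (hW : IsOpen W) (hWD : ∀ q ∈ W, q.1 ∈ D)
    (hgf : ∀ q ∈ W, q ∈ Γ → g q = f q) (v w : (Fin n → ℂ) × ℂ) {q : (Fin n → ℂ) × ℂ}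
    (hq : q ∈ W) : ∃ O, IsOpen O ∧ q ∈ O ∧ ∀ u : (Fin n → ℂ) × ℂ → ℂ, ContDiff ℝ 2 u →
      HasCompactSupport u → tsupport u ⊆ O → ∫ x in Ω, dbarJ g u v w x = 0 := by
  by_cases hqΩ : q ∈ Ω
  · refine ⟨Ω, h.isOpen, hqΩ, fun u hu hs hsub => ?_⟩
    rw [setIntegral_eq_integral_of_forall_compl_eq_zero fun x hx =>
      dbarJ_eq_zero_of_notMem g v w fun hx' => hx (hsub hx')]
    exact integral_dbarJ_eq_zero hg hu hs v w
  by_cases hqc : q ∈ closure Ω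
  swap
  · refine ⟨(closure Ω)ᶜ, isClosed_closure.isOpen_compl, hqc, fun u hu hs hsub => ?_⟩
    exact setIntegral_eq_zero_of_forall_eq_zero fun x hx =>
      dbarJ_eq_zero_of_notMem g v w fun hx' => hsub hx' (subset_closure hx)
  have hqf : q ∈ frontier Ω := by rw [h.isOpen.frontier_eq]; exact ⟨hqc, hqΩ⟩
  have hqΓ : q ∈ Γ := h.mem_of_mem_frontier (hWD q hq) hqf
  obtain ⟨-, V, ρ, hρ⟩ := h.reg q.1 (hWD q hq) q.2 hqΓ
  -- The cutoff only makes the defining function globally `C²`; near `q` nothing changes.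
  obtain ⟨χ, hχ, -, hχV, hχ1, -⟩ := exists_contDiff_cutoff (isCompact_singleton (x := q))
    hρ.isOpen (singleton_subset_iff.2 hρ.mem)
  have hρ' : ContDiff ℝ 2 fun x => χ x * ρ x :=
    contDiff_mul_of_tsupport_subset hχ hχV fun x hx => (hρ.analytic x hx).contDiffAt
  rw [nhdsSet_singleton] at hχ1
  obtain ⟨ν, hν⟩ : ∃ ν, 0 < fderiv ℝ ρ q ν := by
    obtain ⟨ν, hν⟩ : ∃ ν, fderiv ℝ ρ q ν ≠ 0 := by
      by_contra! hall
      exact hρ.fderiv_ne_zero (ContinuousLinearMap.ext hall)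
    rcases lt_or_gt_of_ne hν with h0 | h0
    · exact ⟨-ν, by rw [map_neg]; linarith⟩
    · exact ⟨ν, h0⟩
  have heq : ∀ x, (∀ᶠ y in 𝓝 x, χ y = 1) → (fun x => χ x * ρ x) =ᶠ[𝓝 x] ρ := fun x hx =>
    hx.mono fun y hy => by simp [hy]
  have hν' : ∀ᶠ x in 𝓝 q, 0 < fderiv ℝ (fun x => χ x * ρ x) x ν := by
    have hc : Continuous fun x => fderiv ℝ (fun x => χ x * ρ x) x ν :=
      (hρ'.continuous_fderiv two_ne_zero).clm_apply continuous_const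
    refine hc.continuousAt.eventually (lt_mem_nhds ?_)
    simp only [(heq q hχ1).fderiv_eq]; exact hν
  have hall : ∀ᶠ x in 𝓝 q, x ∈ V ∧ x ∈ W ∧ (∀ᶠ y in 𝓝 x, χ y = 1) ∧
      0 < fderiv ℝ (fun x => χ x * ρ x) x ν :=
    Eventually.and (hρ.isOpen.mem_nhds hρ.mem) (Eventually.and (hW.mem_nhds hq)
      (hχ1.eventually_nhds.and hν'))
  obtain ⟨O, hO, hOo, hqO⟩ := eventually_nhds_iff.1 hall
  refine ⟨O, hOo, hqO, fun u hu hs hsub => ?_⟩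
  refine setIntegral_dbarJ_eq_zero_of_level hg hu hs hρ' h.isOpen hOo hsub
    (fun x hx hxf => ?_) (fun x hx => (hO x hx).2.2.2) fun x hx hx0 => ?_
  · have hxΓ := h.mem_of_mem_frontier (hWD x (hO x hx).2.1) hxf
    rw [(hρ.eq_zero_iff (hO x hx).1).2 hxΓ, mul_zero]
  · obtain ⟨hxV, hxW, hxχ, hxν⟩ := hO x hx
    rw [hxχ.self_of_nhds, one_mul] at hx0
    have hxΓ := (hρ.eq_zero_iff hxV).1 hx0
    have hdef : IsDefiningFunctionAt Γ V ρ x := ⟨hρ.isOpen, hxV, hρ.analytic, fun h0 => by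
      rw [(heq x hxχ).fderiv_eq, h0] at hxν
      simp at hxν, hρ.inter_eq⟩
    rw [dbarJ_congr_right (b' := fun y => (ρ y : ℂ))
      ((heq x hxχ).mono fun y hy => congrArg Complex.ofReal hy)]
    refine (hf x hxΓ (hWD x hxW)).dbarJ_eq_zero hg.contDiffAt ?_ hdef hxΓ v w
    filter_upwards [hW.mem_nhds hxW] with y hy hyΓ using hgf y hy hyΓ

/-- Compactness of the support and linearity in `u` patch the local statements together. -/
theorem IsDiscFamily.setIntegral_dbarJ_eq_zero {n : ℕ} {Γ Ω : Set ((Fin n → ℂ) × ℂ)}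
    {D : Set (Fin n → ℂ)} (h : IsDiscFamily Γ Ω D) {f g : (Fin n → ℂ) × ℂ → ℂ}
    (hf : ∀ q ∈ Γ, q.1 ∈ D → IsLocallyCR Γ f q) (hg : ContDiff ℝ 1 g)
    {W : Set ((Fin n → ℂ) × ℂ)} (hW : IsOpen W) (hWD : ∀ q ∈ W, q.1 ∈ D)
    (hgf : ∀ q ∈ W, q ∈ Γ → g q = f q) (v w : (Fin n → ℂ) × ℂ) {u : (Fin n → ℂ) × ℂ → ℂ}
    (hu : ContDiff ℝ 2 u) (hs : HasCompactSupport u) (huW : tsupport u ⊆ W) :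
    ∫ x in Ω, dbarJ g u v w x = 0 := by
  have key : ∃ O, IsOpen O ∧ tsupport u ⊆ O ∧ ∀ u : (Fin n → ℂ) × ℂ → ℂ, ContDiff ℝ 2 u →
      HasCompactSupport u → tsupport u ⊆ O → ∫ x in Ω, dbarJ g u v w x = 0 := by
    refine IsCompact.induction_on hs (p := fun K => ∃ O, IsOpen O ∧ K ⊆ O ∧
      ∀ u : (Fin n → ℂ) × ℂ → ℂ, ContDiff ℝ 2 u →
      HasCompactSupport u → tsupport u ⊆ O → ∫ x in Ω, dbarJ g u v w x = 0) ?_ ?_ ?_ ?_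
    · refine ⟨∅, isOpen_empty, Subset.rfl, fun u _ _ hu => ?_⟩
      refine setIntegral_eq_zero_of_forall_eq_zero fun x _ =>
        dbarJ_eq_zero_of_notMem g v w fun hx => hu hx
    · exact fun s t hst ⟨O, h1, h2, h3⟩ => ⟨O, h1, hst.trans h2, h3⟩
    · rintro s t ⟨O₁, ho₁, hs₁, h₁⟩ ⟨O₂, ho₂, hs₂, h₂⟩
      refine ⟨O₁ ∪ O₂, ho₁.union ho₂, union_subset_union hs₁ hs₂, fun u hu hs hsub => ?_⟩
      -- The cutoff is `1` near the part of the support outside `O₂`, so `χ u` lives in `O₁` and `(1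
      -- - χ) u` in `O₂`.
      obtain ⟨χ, hχ, hχs, hχO, hχ1, -⟩ := exists_contDiff_cutoff (hs.isCompact.diff ho₂) ho₁
        (fun x hx => (hsub hx.1).resolve_right hx.2)
      have hχc : ContDiff ℝ 2 fun x => (χ x : ℂ) := Complex.ofRealCLM.contDiff.comp hχ
      have hu₁ : ContDiff ℝ 2 fun x => (χ x : ℂ) * u x := hχc.mul hu
      have hu₂ : ContDiff ℝ 2 fun x => (1 - (χ x : ℂ)) * u x := (contDiff_const.sub hχc).mul hu
      have hs₁' : HasCompactSupport fun x => (χ x : ℂ) * u x := hs.mul_left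
      have hs₂' : HasCompactSupport fun x => (1 - (χ x : ℂ)) * u x := hs.mul_left
      have t₁ : tsupport (fun x => (χ x : ℂ) * u x) ⊆ O₁ := fun x hx => by
        refine hχO ?_
        by_contra hx'
        refine (notMem_tsupport_iff_eventuallyEq.2 ?_) hx
        filter_upwards [notMem_tsupport_iff_eventuallyEq.1 hx'] with y hy
        simp [hy]
      have t₂ : tsupport (fun x => (1 - (χ x : ℂ)) * u x) ⊆ O₂ := fun x hx => by
        by_contra hx'
        refine (notMem_tsupport_iff_eventuallyEq.2 ?_) hx
        have hxu : x ∈ tsupport u := (tsupport_mul_subset_right) hx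
        filter_upwards [hχ1.filter_mono (nhds_le_nhdsSet (show x ∈ tsupport u \ O₂ from ⟨hxu, hx'⟩))] with y hy
        simp [hy]
      have hint : ∀ b : (Fin n → ℂ) × ℂ → ℂ, ContDiff ℝ 2 b → HasCompactSupport b →
          Integrable (dbarJ g b v w) (volume.restrict Ω) := fun b hb hbs =>
        ((continuous_dbarJ hg (hb.of_le one_le_two) v w).integrable_of_hasCompactSupport
          (hbs.dbarJ g v w)).integrableOn
      have e : ∀ x, dbarJ g u v w x = dbarJ g (fun x => (χ x : ℂ) * u x) v w x +
          dbarJ g (fun x => (1 - (χ x : ℂ)) * u x) v w x := fun x => by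
        rw [← dbarJ_add (hu₁.differentiable two_ne_zero x) (hu₂.differentiable two_ne_zero x)]
        congr 1
        ext y; ring
      simp only [e]
      rw [integral_add (hint _ hu₁ hs₁') (hint _ hu₂ hs₂'), h₁ _ hu₁ hs₁' t₁, h₂ _ hu₂ hs₂' t₂,
        add_zero]
    · intro x hx
      obtain ⟨O, hO, hxO, hX⟩ := h.exists_setIntegral_dbarJ_eq_zero hf hg hW hWD hgf v w (huW hx)
      exact ⟨O, mem_nhdsWithin_of_mem_nhds (hO.mem_nhds hxO), O, hO, Subset.rfl, hX⟩
  obtain ⟨O, -, hO, hX⟩ := key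
  exact hX u hu hs hO

end LocalIntegrals


/-! ### Holomorphic dependence of line integrals on the base point. -/

section FibreIntegrals
open MeasureTheory

theorem dbarDir_comp {E F : Type*} [NormedAddCommGroup E] [NormedSpace ℝ E] [SMul ℂ E]
    [NormedAddCommGroup F] [NormedSpace ℝ F] [SMul ℂ F] {χ : F → ℂ} {A : E → F} {L : E →L[ℝ] F}
    {x : E} (hA : HasFDerivAt A L x) (hL : ∀ v, L (Complex.I • v) = Complex.I • L v)
    (hχ : DifferentiableAt ℝ χ (A x)) (v : E) :
    dbarDir (fun y => χ (A y)) v x = dbarDir χ (L v) (A x) := by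
  have h1 : fderiv ℝ (fun y => χ (A y)) x = _ := (hχ.hasFDerivAt.comp x hA).fderiv
  rw [dbarDir, dbarDir, h1, ContinuousLinearMap.comp_apply, ContinuousLinearMap.comp_apply, hL]

theorem dbarDir_slice {n : ℕ} {g : (Fin n → ℂ) × ℂ → ℂ} (hg : Differentiable ℝ g)
    (z : Fin n → ℂ) (ζ : ℂ) : dbarDir (fun w => g (z, w)) 1 ζ = dbarDir g (0, 1) (z, ζ) := by
  have h := dbarDir_comp (χ := g) (A := fun w : ℂ => (z, w))
    (L := ContinuousLinearMap.inr ℝ (Fin n → ℂ) ℂ) (x := ζ) (hasFDerivAt_prodMk_right z ζ)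
    (fun v => by ext <;> simp) (hg _) 1
  simpa using h

namespace IsDiscFamily

variable {n : ℕ} {Γ Ω : Set ((Fin n → ℂ) × ℂ)} {D : Set (Fin n → ℂ)}

theorem notMem_closure (h : IsDiscFamily Γ Ω D) {z : Fin n → ℂ} {w : ℂ} (hz : z ∈ D)
    (hw : w ∉ closure (fibre Ω z)) : (z, w) ∉ closure Ω := by
  rw [(h.disc z hz).closure_eq] at hw
  intro hc
  by_cases hΩ : (z, w) ∈ Ω
  · exact hw (Or.inl hΩ)
  · exact hw (Or.inr (h.mem_of_mem_frontier (q := (z, w)) hz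
      (by rw [h.isOpen.frontier_eq]; exact ⟨hc, hΩ⟩)))

theorem volume_fibre (h : IsDiscFamily Γ Ω D) {z : Fin n → ℂ} (hz : z ∈ D) :
    volume (fibre Γ z) = 0 := by
  obtain ⟨c, hc⟩ := (h.disc z hz).exists_param
  rw [← hc.range_eq]
  exact volume_range_eq_zero (hc.contDiff_one.differentiable one_ne_zero)

/-- Integrals over the fibres depend continuously on the base point. -/
theorem continuousAt_setIntegral (h : IsDiscFamily Γ Ω D) {b : (Fin n → ℂ) × ℂ → ℂ}
    (hb : Continuous b) {M : ℝ} (hM : ∀ p, ‖b p‖ ≤ M) {z : Fin n → ℂ} (hz : z ∈ D) :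
    ContinuousAt (fun z => ∫ w in fibre Ω z, b (z, w)) z := by
  obtain ⟨R, -, hR⟩ := h.exists_subset_ball hz
  have hm : ∀ z, MeasurableSet (fibre Ω z) := fun z => (isOpen_fibre h.isOpen z).measurableSet
  simp only [← integral_indicator (hm _)]
  refine continuousAt_of_dominated (bound := (Metric.ball (0 : ℂ) R).indicator fun _ => M)
    (Eventually.of_forall fun z => ?_) ?_ ?_ ?_
  · exact ((hb.comp (by fun_prop)).aestronglyMeasurable).indicator (hm z)
  · filter_upwards [h.eventually_closure_subset_ball hz hR] with z' hz'
    refine Eventually.of_forall fun w => ?_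
    by_cases hw : w ∈ fibre Ω z'
    · rw [indicator_of_mem hw, indicator_of_mem (hz' (subset_closure hw))]; exact hM _
    · rw [indicator_of_notMem hw, norm_zero]
      exact indicator_apply_nonneg fun _ => (norm_nonneg (b 0)).trans (hM 0)
  · exact (integrable_indicator_iff Metric.isOpen_ball.measurableSet).2
      (integrableOn_const (by exact Metric.isBounded_ball.measure_lt_top.ne))
  · have hae : ∀ᵐ w : ℂ, w ∉ fibre Γ z := measure_eq_zero_iff_ae_notMem.1 (h.volume_fibre hz)
    filter_upwards [hae] with w hw
    have hcont : ContinuousAt (fun z' => b (z', w)) z := (hb.comp (by fun_prop)).continuousAt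
    by_cases hΩ : (z, w) ∈ Ω
    · refine hcont.congr ?_
      have : ∀ᶠ z' in 𝓝 z, (z', w) ∈ Ω := (by fun_prop : Continuous fun z' : Fin n → ℂ =>
        (z', w)).continuousAt.eventually_mem (h.isOpen.mem_nhds hΩ)
      filter_upwards [this] with z' hz'
      exact (indicator_of_mem (show w ∈ fibre Ω z' from hz') fun w => b (z', w)).symm
    · have hnc : (z, w) ∉ closure Ω := h.notMem_closure hz (by
        rw [(h.disc z hz).closure_eq]
        exact fun h' => h'.elim (fun h1 => hΩ h1) hw)
      have : ∀ᶠ z' in 𝓝 z, (z', w) ∈ (closure Ω)ᶜ := (by fun_prop : Continuous fun z' : Fin n → ℂ =>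
        (z', w)).continuousAt.eventually_mem (isClosed_closure.isOpen_compl.mem_nhds hnc)
      refine (continuousAt_const (y := (0 : ℂ))).congr ?_
      filter_upwards [this] with z' hz'
      exact (indicator_of_notMem (fun h' : w ∈ fibre Ω z' => hz' (subset_closure h'))
        fun w => b (z', w)).symm

/-- The line integrals over the fibres of a CR function depend holomorphically on the base
point. -/
theorem differentiableOn_curveInt (h : IsDiscFamily Γ Ω D) {f : (Fin n → ℂ) × ℂ → ℂ}
    (hf : ∀ q ∈ Γ, q.1 ∈ D → IsLocallyCR Γ f q) {c : (Fin n → ℂ) → ℝ → ℂ}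
    (hc : ∀ z ∈ D, IsPositiveParametrization (c z) (fibre Γ z) (fibre Ω z)) :
    DifferentiableOn ℂ (fun z => curveInt (c z) fun ζ => f (z, ζ)) D := by
  intro z₁ hz₁
  obtain ⟨R, -, hR⟩ := h.exists_subset_ball hz₁
  obtain ⟨r, hr, hball⟩ := Metric.nhds_basis_closedBall.mem_iff.1
    (Eventually.and (h.isOpen_base.mem_nhds hz₁) (h.eventually_closure_subset_ball hz₁ hR))
  have hrD : ∀ z ∈ Metric.closedBall z₁ r, z ∈ D := fun z hz => (hball hz).1
  have hrR : ∀ z ∈ Metric.closedBall z₁ r, closure (fibre Ω z) ⊆ Metric.ball 0 R :=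
    fun z hz => (hball hz).2
  have hγR : ∀ z ∈ Metric.closedBall z₁ r, fibre Γ z ⊆ Metric.ball 0 R := fun z hz w hw =>
    hrR z hz (by rw [(h.disc z (hrD z hz)).closure_eq]; exact Or.inr hw)
  have hK : IsCompact (Γ ∩ Metric.closedBall z₁ r ×ˢ Metric.closedBall (0 : ℂ) R) :=
    ((isCompact_closedBall _ _).prod (isCompact_closedBall _ _)).inter_left h.isClosed
  obtain ⟨g, hg, hgs, hgf⟩ := exists_contDiff_extension hK (f := f) fun q hq => by
    obtain ⟨V, ρ, g, hρ, hg, he, -⟩ := hf q hq.1 (hrD _ hq.2.1)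
    exact ⟨V, hρ.isOpen.mem_nhds hρ.mem, g, hg, fun x hx => he ⟨hx.1.1, hx.2⟩⟩
  have hgf' : ∀ z ∈ Metric.closedBall z₁ r, ∀ w ∈ fibre Γ z, g (z, w) = f (z, w) :=
    fun z hz w hw => hgf ⟨hw, hz, Metric.ball_subset_closedBall (hγR z hz hw)⟩
  -- `B` is `∂g/∂w̄`; by Green's formula the line integral over the fibre is `2i` times the integral
  -- of `B` over the disc.
  let B : (Fin n → ℂ) × ℂ → ℂ := dbarDir g (0, 1)
  have hBc : Continuous B := continuous_dbarDir hg _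
  have hBs : HasCompactSupport B := hgs.dbarDir _
  obtain ⟨M, hM⟩ := hBc.bounded_above_of_compact_support hBs
  let k : (Fin n → ℂ) → ℂ := fun z => ∫ w in fibre Ω z, B (z, w)
  have hkh : ∀ z ∈ Metric.closedBall z₁ r,
      curveInt (c z) (fun ζ => f (z, ζ)) = 2 * Complex.I * k z := fun z hz => by
    have hcz := hc z (hrD z hz)
    have e1 : curveInt (c z) (fun ζ => f (z, ζ)) = curveInt (c z) fun ζ => g (z, ζ) :=
      curveInt_congr fun ζ hζ => (hgf' z hz ζ (hcz.range_eq ▸ hζ)).symm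
    have hgz : ContDiff ℝ 1 fun ζ => g (z, ζ) := hg.comp (contDiff_prodMk_right z)
    have hgzs : HasCompactSupport fun ζ => g (z, ζ) := by
      refine HasCompactSupport.intro (hgs.isCompact.image continuous_snd) fun ζ hζ => ?_
      by_contra h0
      exact hζ ⟨(z, ζ), subset_tsupport _ h0, rfl⟩
    rw [e1, (h.disc z (hrD z hz)).curveInt_eq hcz hgz hgzs]
    simp only [dbarDir_slice (hg.differentiable one_ne_zero), k, B]
  have hkc : ContinuousOn k (Metric.ball z₁ r) := fun z hz =>
    (h.continuousAt_setIntegral hBc hM (hrD z (Metric.ball_subset_closedBall hz))).continuousWithinAt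
  suffices hk : DifferentiableOn ℂ k (Metric.ball z₁ r) by
    have h1 := (hk.differentiableAt (Metric.ball_mem_nhds z₁ hr)).const_mul (2 * Complex.I)
    refine (h1.congr_of_eventuallyEq ?_).differentiableWithinAt
    filter_upwards [Metric.closedBall_mem_nhds z₁ hr] with z hz using hkh z hz
  refine differentiableOn_of_weak_dbar (μ := volume) Metric.isOpen_ball hkc
    fun χ hχ hχs hχb v => ?_
  -- A cutoff in `w` alone, equal to `1` on all discs in question. It gives the test function
  -- compact support without affecting it on `Ω`.
  obtain ⟨ψ, hψ, hψs, -, hψ1, -⟩ := exists_contDiff_cutoff (isCompact_closedBall (0 : ℂ) R)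
    isOpen_univ (subset_univ _)
  let ψ' : ℂ → ℂ := fun w => (ψ w : ℂ)
  have hψ' : ContDiff ℝ 2 ψ' := Complex.ofRealCLM.contDiff.comp hψ
  have hχ1 : ContDiff ℝ 2 fun p : (Fin n → ℂ) × ℂ => χ p.1 := hχ.comp contDiff_fst
  have hψ2 : ContDiff ℝ 2 fun p : (Fin n → ℂ) × ℂ => ψ' p.2 := hψ'.comp contDiff_snd
  let u : (Fin n → ℂ) × ℂ → ℂ := fun p => χ p.1 * ψ' p.2
  have hu : ContDiff ℝ 2 u := hχ1.mul hψ2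
  have hsuppu : tsupport u ⊆ tsupport χ ×ˢ tsupport ψ := by
    refine closure_minimal (fun p hp => ?_) ((isClosed_tsupport _).prod (isClosed_tsupport _))
    refine ⟨subset_tsupport _ fun h0 => hp ?_, subset_tsupport _ fun h0 => hp ?_⟩
    · simp [u, h0]
    · simp [u, ψ', h0]
  have hus : HasCompactSupport u := (hχs.isCompact.prod hψs.isCompact).of_isClosed_subset
    (isClosed_tsupport _) hsuppu
  have hX := h.setIntegral_dbarJ_eq_zero hf hg (W := Metric.ball z₁ r ×ˢ univ)
    (Metric.isOpen_ball.prod isOpen_univ)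
    (fun q hq => hrD _ (Metric.ball_subset_closedBall hq.1))
    (fun q hq hqΓ => hgf' q.1 (Metric.ball_subset_closedBall hq.1) q.2 hqΓ) (v, 0) (0, 1)
    hu hus (fun p hp => ⟨hχb (hsuppu hp).1, trivial⟩)
  -- On `Ω` the test function does not depend on `w`, so only one product of the form survives.
  -- Fubini then turns the vanishing integral into the weak equation for `k`.
  have hJ : ∀ p ∈ Ω, dbarJ g u (v, 0) (0, 1) p = B p * dbarDir χ v p.1 := by
    rintro ⟨z, w⟩ hp
    by_cases hz : z ∈ Metric.ball z₁ r
    · have hw : w ∈ Metric.closedBall (0 : ℂ) R := Metric.ball_subset_closedBall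
        (hrR z (Metric.ball_subset_closedBall hz) (subset_closure hp))
      have hw1 : ψ =ᶠ[𝓝 w] fun _ => 1 := hψ1.filter_mono (nhds_le_nhdsSet hw)
      have hψw : ∀ a, dbarDir ψ' a w = 0 := fun a => by
        rw [dbarDir_congr (g' := fun _ => 1) (hw1.mono fun y hy => by simp [ψ', hy])]
        simp [dbarDir]
      have hψw1 : ψ' w = 1 := by simp [ψ', hw1.self_of_nhds]
      have e : ∀ a, dbarDir u a (z, w) = dbarDir χ a.1 z := fun a => by
        have h1 := dbarDir_comp (χ := χ) (A := fun p : (Fin n → ℂ) × ℂ => p.1)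
          (x := (z, w)) hasFDerivAt_fst (fun v => rfl) (hχ.differentiable two_ne_zero z) a
        have h2 := dbarDir_comp (χ := ψ') (A := fun p : (Fin n → ℂ) × ℂ => p.2)
          (x := (z, w)) hasFDerivAt_snd (fun v => rfl) (hψ'.differentiable two_ne_zero w) a
        rw [dbarDir_mul (hχ1.differentiable two_ne_zero _) (hψ2.differentiable two_ne_zero _),
          h1, h2, hψw, hψw1]
        simp
      rw [dbarJ, e, e]
      simp [B, dbarDir]
    · have hz' : z ∉ tsupport χ := fun h' => hz (hχb h')
      rw [dbarJ_eq_zero_of_notMem g _ _ fun h' => hz' (hsuppu h').1]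
      have : dbarDir χ v z = 0 := image_eq_zero_of_notMem_tsupport fun h' =>
        hz' (tsupport_dbarDir_subset χ v h')
      simp [this]
  rw [setIntegral_congr_fun h.isOpen.measurableSet hJ, ← integral_indicator
    h.isOpen.measurableSet, Measure.volume_eq_prod, integral_prod] at hX
  · rw [← hX]
    congr 1
    ext z
    rw [mul_comm, ← integral_mul_const, ← integral_indicator
      (isOpen_fibre h.isOpen z).measurableSet]
    rfl
  · rw [← Measure.volume_eq_prod, integrable_indicator_iff h.isOpen.measurableSet]
    have hc : Continuous fun p : (Fin n → ℂ) × ℂ => B p * dbarDir χ v p.1 :=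
      hBc.mul ((continuous_dbarDir (hχ.of_le one_le_two) v).comp continuous_fst)
    exact (hc.integrable_of_hasCompactSupport hBs.mul_right).integrableOn

end IsDiscFamily

end FibreIntegrals


/-! ### Limits of line integrals at the boundary of the base. -/

section BoundaryLimits
open MeasureTheory

theorem norm_setIntegral_sub_setIntegral_le {α : Type*} [MeasurableSpace α] {μ : Measure α}
    {A K : Set α} (hA : MeasurableSet A) (hK : MeasurableSet K) {b : α → ℂ} (hb : Integrable b μ)
    {M a a' : ℝ} (hM : ∀ x, ‖b x‖ ≤ M) (hM0 : 0 ≤ M) (ha0 : 0 ≤ a) (ha'0 : 0 ≤ a')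
    (ha : μ (A \ K) ≤ ENNReal.ofReal a) (ha' : μ (K \ A) ≤ ENNReal.ofReal a') :
    ‖∫ x in A, b x ∂μ - ∫ x in K, b x ∂μ‖ ≤ M * (a + a') := by
  have key : ∀ s : Set α, ∀ a : ℝ, 0 ≤ a → μ s ≤ ENNReal.ofReal a → ‖∫ x in s, b x ∂μ‖ ≤ M * a := by
    intro s a ha0 hs
    refine (norm_setIntegral_le_of_norm_le_const (hs.trans_lt ENNReal.ofReal_lt_top)
      fun x _ => hM x).trans ?_
    gcongr
    exact ENNReal.toReal_le_of_le_ofReal ha0 hs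
  rw [← integral_inter_add_sdiff (s := A) hK hb.integrableOn,
    ← integral_inter_add_sdiff (s := K) hA hb.integrableOn, inter_comm A K, add_sub_add_left_eq_sub]
  refine (norm_sub_le _ _).trans ?_
  rw [mul_add]
  exact add_le_add (key _ _ ha0 ha) (key _ _ ha'0 ha')

/-- The segment from a point outside to a nearby point inside must cross the frontier. -/
theorem mem_thickening_frontier {E : Type*} [NormedAddCommGroup E] [NormedSpace ℝ E] {Δ : Set E}
    {η : ℝ} {x : E} (hx : x ∉ Δ) (hc : x ∈ Metric.thickening η (closure Δ)) :
    x ∈ Metric.thickening η (frontier Δ) := by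
  obtain ⟨y, hy, hxy⟩ := Metric.mem_thickening_iff.1 hc
  by_cases hyf : y ∈ frontier Δ
  · exact Metric.mem_thickening_iff.2 ⟨y, hyf, hxy⟩
  have hyΔ : y ∈ interior Δ := by
    by_contra h; exact hyf ⟨hy, h⟩
  have : (segment ℝ x y ∩ frontier Δ).Nonempty := by
    rw [← Set.not_disjoint_iff_nonempty_inter]
    exact fun hd => hx ((convex_segment x y).isPreconnected.subset_of_disjoint_frontier
      ⟨y, right_mem_segment ℝ x y, interior_subset hyΔ⟩ hd (left_mem_segment ℝ x y))
  obtain ⟨p, hp, hpf⟩ := this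
  refine Metric.mem_thickening_iff.2 ⟨p, hpf, lt_of_le_of_lt ?_ hxy⟩
  have h1 := (convex_closedBall x (dist x y)).segment_subset
    (Metric.mem_closedBall_self dist_nonneg) (by rw [Metric.mem_closedBall, dist_comm]) hp
  rw [dist_comm]; exact h1

namespace IsDiscFamily

variable {n : ℕ} {Γ Ω : Set ((Fin n → ℂ) × ℂ)} {D : Set (Fin n → ℂ)}

theorem eventually_subset_thickening (h : IsDiscFamily Γ Ω D) {z₀ : Fin n → ℂ} {K : Set ℂ}
    (hK : IsCompact K) (hKne : K.Nonempty) (hlim : Tendsto (fun z =>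
      Metric.hausdorffDist (closure (fibre Ω z)) K) (𝓝[D] z₀) (𝓝 0)) {η : ℝ} (hη : 0 < η) :
    ∀ᶠ z in 𝓝[D] z₀, closure (fibre Ω z) ⊆ Metric.thickening η K ∧
      K ⊆ Metric.thickening η (closure (fibre Ω z)) := by
  filter_upwards [hlim.eventually (gt_mem_nhds hη), self_mem_nhdsWithin] with z hz hzD
  have hb := h.disc z hzD
  have hfin := Metric.hausdorffEDist_ne_top_of_nonempty_of_bounded hb.nonempty.closure hKne
    hb.isCompact_closure.isBounded hK.isBounded
  exact ⟨fun x hx => Metric.mem_thickening_iff.2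
      (Metric.exists_dist_lt_of_hausdorffDist_lt hx hz hfin),
    fun x hx => by
      obtain ⟨y, hy, hxy⟩ := Metric.exists_dist_lt_of_hausdorffDist_lt' hx hz hfin
      exact Metric.mem_thickening_iff.2 ⟨y, hy, by rwa [dist_comm]⟩⟩

/-- Off the limit fibre, the limit of the discs is open. -/
theorem limit_mem_nhds (h : IsDiscFamily Γ Ω D) {z₀ : Fin n → ℂ} (hz₀ : z₀ ∈ closure D) {K : Set ℂ}
    (hK : IsCompact K) (hKne : K.Nonempty) (hlim : Tendsto (fun z =>
      Metric.hausdorffDist (closure (fibre Ω z)) K) (𝓝[D] z₀) (𝓝 0)) {w : ℂ} (hw : w ∈ K)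
    (hwΓ : w ∉ fibre Γ z₀) : K ∈ 𝓝 w := by
  have := mem_closure_iff_nhdsWithin_neBot.1 hz₀
  obtain ⟨s, hs, hball⟩ := Metric.nhds_basis_closedBall.mem_iff.1
    ((isClosed_fibre h.isClosed z₀).isOpen_compl.mem_nhds hwΓ)
  have hev : ∀ᶠ z in 𝓝[D] z₀, Disjoint (Metric.closedBall w s) (fibre Γ z) :=
    (eventually_disjoint_fibre h.isClosed (isCompact_closedBall w s)
      (Set.disjoint_left.2 fun x hx => hball hx)).filter_mono nhdsWithin_le_nhds
  -- A ball off `γ(z₀)` is off the nearby curves; since it contains points of the closed discs, it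
  -- lies in the discs.
  have hin : ∀ᶠ z in 𝓝[D] z₀, Metric.closedBall w s ⊆ fibre Ω z := by
    filter_upwards [hev, h.eventually_subset_thickening hK hKne hlim hs, self_mem_nhdsWithin]
      with z hz hz' hzD
    obtain ⟨y, hy, hwy⟩ := Metric.mem_thickening_iff.1 (hz'.2 hw)
    have hyB : y ∈ Metric.closedBall w s := by
      rw [Metric.mem_closedBall, dist_comm]; exact hwy.le
    have hyΩ : y ∈ fibre Ω z := by
      rw [(h.disc z hzD).closure_eq] at hy
      exact hy.resolve_right (Set.disjoint_left.1 hz hyB)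
    exact (convex_closedBall w s).isPreconnected.subset_of_disjoint_frontier ⟨y, hyB, hyΩ⟩
      ((h.disc z hzD).frontier_eq ▸ hz)
  refine Filter.mem_of_superset (Metric.closedBall_mem_nhds w hs) fun x hx => ?_
  rw [← hK.isClosed.closure_eq, Metric.mem_closure_iff]
  intro ε hε
  obtain ⟨z, hz1, hz2⟩ := (hin.and (h.eventually_subset_thickening hK hKne hlim hε)).exists
  exact Metric.mem_thickening_iff.1 (hz2.1 (subset_closure (hz1 hx)))

/-- Near a boundary point, the fibres over a dense set have uniformly bounded length. -/
theorem exists_curveLen_le (hΓ : IsRealAnalyticHypersurface Γ)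
    {c : (Fin n → ℂ) → ℝ → ℂ}
    (hc : ∀ z ∈ D, IsPositiveParametrization (c z) (fibre Γ z) (fibre Ω z)) (z₀ : Fin n → ℂ)
    {R : ℝ} : ∃ r > 0, ∃ L : ℝ, 0 ≤ L ∧ ∀ O : Set (Fin n → ℂ), IsOpen O → O.Nonempty →
      O ⊆ Metric.ball z₀ r → O ⊆ D → (∀ z ∈ O, fibre Γ z ⊆ Metric.closedBall 0 R) →
      ∃ z ∈ O, curveLen (c z) ≤ L := by
  obtain ⟨r, hr, N, hN⟩ := hΓ.exists_fewCrossings z₀ R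
  refine ⟨r, hr, max (2 * (N * (2 * R))) 0, le_max_right _ _, fun O hO hne hOr hOD hOR => ?_⟩
  obtain ⟨z, hz, T, hT, hcross⟩ := hN O hO hne hOr
  have hcz := hc z (hOD hz)
  refine ⟨z, hz, (curveLen_le_of_card hcz.contDiff_one hcz.injOn (fun w hw => ?_) hT
    fun a ha Z hZ => hcross a ha Z fun w hw => ?_).trans (le_max_left _ _)⟩
  · rw [hcz.range_eq] at hw
    exact mem_closedBall_zero_iff.1 (hOR z hz hw)
  · have := hZ w hw
    rw [hcz.range_eq] at this
    exact ⟨this, hOR z hz this⟩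

/-- The line integrals over the fibres converge at a boundary point, and the limit is approximated
by area integrals over the limit of the discs. -/
theorem exists_tendsto_curveInt (h : IsDiscFamily Γ Ω D) (hΓ : IsRealAnalyticHypersurface Γ)
    {f : (Fin n → ℂ) × ℂ → ℂ} (hf : ContinuousOn f Γ) {c : (Fin n → ℂ) → ℝ → ℂ}
    (hc : ∀ z ∈ D, IsPositiveParametrization (c z) (fibre Γ z) (fibre Ω z))
    (hcont : ContinuousOn (fun z => curveInt (c z) fun ζ => f (z, ζ)) D)
    {z₀ : Fin n → ℂ} (hz₀ : z₀ ∈ closure D) {K : Set ℂ}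
    (hK : IsCompact K) (hKne : K.Nonempty) (hlim : Tendsto (fun z =>
      Metric.hausdorffDist (closure (fibre Ω z)) K) (𝓝[D] z₀) (𝓝 0)) :
    ∃ l : ℂ, Tendsto (fun z => curveInt (c z) fun ζ => f (z, ζ)) (𝓝[D] z₀) (𝓝 l) ∧
      ∃ C : ℝ, ∀ ε > 0, ∃ p : ℂ → ℂ, ContDiff ℝ 1 p ∧ HasCompactSupport p ∧
        (∀ ζ ∈ fibre Γ z₀ ∩ K, ‖p ζ - f (z₀, ζ)‖ ≤ ε) ∧
        ‖l - 2 * Complex.I * ∫ ζ in K, dbarDir p 1 ζ‖ ≤ C * ε := by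
  have hne := mem_closure_iff_nhdsWithin_neBot.1 hz₀
  set H : (Fin n → ℂ) → ℂ := fun z => curveInt (c z) fun ζ => f (z, ζ) with hH
  obtain ⟨R, hR⟩ : ∃ R, Metric.thickening 1 K ⊆ Metric.closedBall 0 R :=
    hK.isBounded.thickening.subset_closedBall 0
  have hKR : K ⊆ Metric.closedBall 0 R := (Metric.self_subset_thickening one_pos K).trans hR
  have hevR : ∀ᶠ z in 𝓝[D] z₀, fibre Γ z ⊆ Metric.closedBall 0 R := by
    filter_upwards [h.eventually_subset_thickening hK hKne hlim one_pos, self_mem_nhdsWithin]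
      with z hz hzD
    refine Subset.trans ?_ (hz.1.trans hR)
    rw [(h.disc z hzD).closure_eq]; exact subset_union_right
  obtain ⟨r, hr, L, hL0, hL⟩ := exists_curveLen_le hΓ hc z₀ (R := R)
  -- Replace `f` by a smooth function `p` of `ζ` alone, close to `f` on the nearby curves. For short
  -- curves the line integrals of `f` and `p` are close, and Green's formula for `p` compares the
  -- disc with `K`.
  have key : ∀ ε > 0, ∃ p : ℂ → ℂ, ContDiff ℝ 1 p ∧ HasCompactSupport p ∧
      (∀ ζ ∈ fibre Γ z₀ ∩ K, ‖p ζ - f (z₀, ζ)‖ ≤ ε) ∧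
      ∀ᶠ z in 𝓝[D] z₀, ‖H z - 2 * Complex.I * ∫ ζ in K, dbarDir p 1 ζ‖ ≤ (2 * L + 1) * ε := by
    intro ε hε
    have hfz : ContinuousOn (fun ζ => f (z₀, ζ)) (fibre Γ z₀) :=
      hf.comp (by fun_prop) fun ζ hζ => hζ
    obtain ⟨p, hp, hps, hpf⟩ := exists_contDiff_approx_on_compact
      ((isCompact_closedBall (0 : ℂ) R).inter_left (isClosed_fibre h.isClosed z₀))
      (hfz.mono inter_subset_left) hε
    refine ⟨p, hp, hps, fun ζ hζ => hpf ζ ⟨hζ.1, hKR hζ.2⟩, ?_⟩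
    have hnear : ∀ᶠ z in 𝓝 z₀, ∀ ζ ∈ Metric.closedBall (0 : ℂ) R, (z, ζ) ∈ Γ →
        ‖f (z, ζ) - p ζ‖ ≤ 2 * ε := by
      refine (isCompact_closedBall (0 : ℂ) R).eventually_forall_of_forall_eventually
        fun ζ hζ => ?_
      by_cases hζΓ : (z₀, ζ) ∈ Γ
      · have h1 : ContinuousWithinAt (fun q : (Fin n → ℂ) × ℂ => ‖f q - p q.2‖) Γ (z₀, ζ) :=
          ((hf _ hζΓ).sub (hp.continuous.comp continuous_snd).continuousWithinAt).norm
        have h2 : ‖f (z₀, ζ) - p ζ‖ < 2 * ε := by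
          rw [norm_sub_rev]
          exact (hpf ζ ⟨hζΓ, hζ⟩).trans_lt (by linarith)
        have h3 := eventually_nhdsWithin_iff.1 (h1.eventually (gt_mem_nhds h2))
        filter_upwards [h3] with q hq hqΓ using (hq hqΓ).le
      · filter_upwards [h.isClosed.isOpen_compl.mem_nhds hζΓ] with q hq hqΓ
        exact absurd hqΓ hq
    have hBc := continuous_dbarDir hp 1
    have hBs : HasCompactSupport (dbarDir p 1) := hps.dbarDir 1
    obtain ⟨M, hM⟩ := hBc.bounded_above_of_compact_support hBs
    have hM0 : 0 ≤ M := (norm_nonneg _).trans (hM 0)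
    have hBi : Integrable (dbarDir p 1) := hBc.integrable_of_hasCompactSupport hBs
    obtain ⟨a, ha, haM⟩ : ∃ a > 0, 4 * M * a ≤ ε := by
      refine ⟨ε / (4 * M + 1), by positivity, ?_⟩
      rw [mul_div_assoc', div_le_iff₀ (by positivity)]; nlinarith
    -- The two parts of the symmetric difference of disc and limit: the disc lies in a small
    -- neighbourhood of the compact set `K`, and what `K` has in excess lies in a tube around the
    -- curve, whose area is controlled by the length.
    have hη1 : ∀ᶠ η in 𝓝[>] (0 : ℝ), volume (Metric.thickening η K \ K) ≤ ENNReal.ofReal a := by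
      have ht := tendsto_measure_thickening_of_isClosed (μ := volume)
        ⟨1, one_pos, hK.isBounded.thickening.measure_lt_top.ne⟩ hK.isClosed
      have hlt : volume K < volume K + ENNReal.ofReal a :=
        ENNReal.lt_add_right hK.measure_lt_top.ne (ENNReal.ofReal_pos.2 ha).ne'
      filter_upwards [ht.eventually (gt_mem_nhds hlt), self_mem_nhdsWithin] with η hη hη0
      rw [measure_sdiff (Metric.self_subset_thickening hη0 K)
        hK.measurableSet.nullMeasurableSet hK.measure_lt_top.ne]
      exact tsub_le_iff_left.2 hη.le
    have hη2 : ∀ᶠ η in 𝓝[>] (0 : ℝ), 4 * Real.pi * (L * η + η ^ 2) ≤ a := by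
      have : Tendsto (fun η : ℝ => 4 * Real.pi * (L * η + η ^ 2)) (𝓝 0) (𝓝 0) := by
        have : Continuous fun η : ℝ => 4 * Real.pi * (L * η + η ^ 2) := by fun_prop
        simpa using this.tendsto 0
      filter_upwards [(this.eventually (gt_mem_nhds ha)).filter_mono nhdsWithin_le_nhds] with η hη
        using hη.le
    obtain ⟨η, hη1, hη2, hη⟩ := (hη1.and (hη2.and self_mem_nhdsWithin)).exists
    replace hη : 0 < η := hη
    have hall : ∀ᶠ z in 𝓝[D] z₀, fibre Γ z ⊆ Metric.closedBall 0 R ∧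
        (∀ ζ ∈ Metric.closedBall (0 : ℂ) R, (z, ζ) ∈ Γ → ‖f (z, ζ) - p ζ‖ ≤ 2 * ε) ∧
        closure (fibre Ω z) ⊆ Metric.thickening η K ∧
          K ⊆ Metric.thickening η (closure (fibre Ω z)) :=
      hevR.and ((hnear.filter_mono nhdsWithin_le_nhds).and
        (h.eventually_subset_thickening hK hKne hlim hη))
    have hgood : ∀ z ∈ D, fibre Γ z ⊆ Metric.closedBall 0 R ∧
        (∀ ζ ∈ Metric.closedBall (0 : ℂ) R, (z, ζ) ∈ Γ → ‖f (z, ζ) - p ζ‖ ≤ 2 * ε) ∧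
        closure (fibre Ω z) ⊆ Metric.thickening η K ∧
          K ⊆ Metric.thickening η (closure (fibre Ω z)) → curveLen (c z) ≤ L →
        ‖H z - 2 * Complex.I * ∫ ζ in K, dbarDir p 1 ζ‖ ≤ (2 * L + 1) * ε := by
      rintro z hzD ⟨z1, z2, z3, z4⟩ hzL
      have hcz := hc z hzD
      have hb := h.disc z hzD
      have hfz' : ContinuousOn (fun ζ => f (z, ζ)) (range (c z)) := by
        rw [hcz.range_eq]; exact hf.comp (by fun_prop) fun ζ hζ => hζ
      have e1 : ‖H z - curveInt (c z) p‖ ≤ 2 * ε * L := by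
        rw [hH, ← curveInt_sub hcz.contDiff_one hfz' hp.continuous.continuousOn]
        refine (norm_curveInt_le hcz.contDiff_one (ε := 2 * ε) fun w hw => ?_).trans
          (mul_le_mul_of_nonneg_left hzL (by positivity))
        rw [hcz.range_eq] at hw
        exact z2 w (z1 hw) hw
      have e2 := norm_setIntegral_sub_setIntegral_le (μ := volume)
        (isOpen_fibre h.isOpen z).measurableSet hK.measurableSet hBi hM hM0 ha.le ha.le
        ((measure_mono (sdiff_subset_sdiff_left (subset_closure.trans z3))).trans hη1)
        (by
          refine (measure_mono fun x hx => ?_).trans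
            ((volume_thickening_curve_le hcz.contDiff_one hzL hη).trans
              (ENNReal.ofReal_le_ofReal hη2))
          have := mem_thickening_frontier hx.2 (z4 hx.1)
          rw [hb.frontier_eq, ← hcz.range_eq] at this
          have hrange : range (c z) = c z '' Icc 0 1 := by
            have := hcz.periodic.image_Icc one_pos 0
            rw [zero_add] at this; exact this.symm
          rwa [hrange] at this)
      rw [hb.curveInt_eq hcz hp hps] at e1
      calc ‖H z - 2 * Complex.I * ∫ ζ in K, dbarDir p 1 ζ‖
          = ‖(H z - 2 * Complex.I * ∫ ζ in fibre Ω z, dbarDir p 1 ζ) + 2 * Complex.I *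
            ((∫ ζ in fibre Ω z, dbarDir p 1 ζ) - ∫ ζ in K, dbarDir p 1 ζ)‖ := by congr 1; ring
        _ ≤ 2 * ε * L + 2 * (M * (a + a)) := by
            refine (norm_add_le _ _).trans (add_le_add e1 ?_)
            rw [norm_mul, norm_mul, Complex.norm_I, mul_one, Complex.norm_two]
            gcongr
        _ ≤ (2 * L + 1) * ε := by nlinarith
    rw [eventually_nhdsWithin_iff] at hall ⊢
    obtain ⟨O, hO, hOo, hzO⟩ := eventually_nhds_iff.1
      (hall.and (Metric.ball_mem_nhds z₀ hr))
    refine eventually_nhds_iff.2 ⟨O, fun z hz hzD => ?_, hOo, hzO⟩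
    -- Short curves occur only over a dense set. But the strict failure of the estimate is an open
    -- condition in `z`, so it would also occur over a parameter with a short curve.
    by_contra hcon
    push Not at hcon
    have hev : ∀ᶠ z' in 𝓝 z, (2 * L + 1) * ε < ‖H z' - 2 * Complex.I * ∫ ζ in K, dbarDir p 1 ζ‖ :=
      ((hcont.continuousAt (h.isOpen_base.mem_nhds hzD)).sub continuousAt_const).norm.eventually
        (lt_mem_nhds hcon)
    obtain ⟨O', hO', hO'o, hzO'⟩ := eventually_nhds_iff.1 (hev.and (Eventually.and
      (hOo.mem_nhds hz) (h.isOpen_base.mem_nhds hzD)))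
    obtain ⟨z', hz', hlen⟩ := hL O' hO'o ⟨z, hzO'⟩ (fun x hx => (hO x (hO' x hx).2.1).2)
      (fun x hx => (hO' x hx).2.2) fun x hx => ((hO x (hO' x hx).2.1).1 (hO' x hx).2.2).1
    exact absurd (hgood z' (hO' z' hz').2.2 ((hO z' (hO' z' hz').2.1).1 (hO' z' hz').2.2) hlen)
      (not_le.2 (hO' z' hz').1)
  -- The area integral over `K` is a common centre for all nearby values.
  have hcau : Cauchy (map H (𝓝[D] z₀)) := by
    rw [Metric.cauchy_iff]
    refine ⟨inferInstance, fun ε hε => ?_⟩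
    obtain ⟨p, -, -, -, hp⟩ := key (ε / (4 * (2 * L + 1))) (by positivity)
    refine ⟨_, image_mem_map hp, ?_⟩
    rintro _ ⟨x, hx, rfl⟩ _ ⟨y, hy, rfl⟩
    have e : (2 * L + 1) * (ε / (4 * (2 * L + 1))) = ε / 4 := by field_simp
    simp only [mem_ofPred_eq, e] at hx hy
    calc dist (H x) (H y) ≤ _ := dist_triangle_right _ _ (2 * Complex.I * ∫ ζ in K, dbarDir p 1 ζ)
      _ ≤ ε / 4 + ε / 4 := by rw [dist_eq_norm, dist_eq_norm]; exact add_le_add hx hy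
      _ < ε := by linarith
  obtain ⟨l, hl⟩ := cauchy_map_iff_exists_tendsto.1 hcau
  refine ⟨l, hl, 2 * L + 1, fun ε hε => ?_⟩
  obtain ⟨p, hp, hps, hpf, hev⟩ := key ε hε
  exact ⟨p, hp, hps, hpf, le_of_tendsto (hl.sub_const _).norm hev⟩

end IsDiscFamily

end BoundaryLimits


/-! ### Vanishing of the moments. -/

section Moments
open MeasureTheory

namespace IsDiscFamily

variable {n : ℕ} {Γ Ω : Set ((Fin n → ℂ) × ℂ)} {D : Set (Fin n → ℂ)}

/-- The limit of the discs contains each connected set off the limit fibre that it meets. -/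
theorem subset_limit (h : IsDiscFamily Γ Ω D) {z₀ : Fin n → ℂ} (hz₀ : z₀ ∈ closure D) {K : Set ℂ}
    (hK : IsCompact K) (hKne : K.Nonempty) (hlim : Tendsto (fun z =>
      Metric.hausdorffDist (closure (fibre Ω z)) K) (𝓝[D] z₀) (𝓝 0)) {S : Set ℂ}
    (hS : IsPreconnected S) (hd : Disjoint S (fibre Γ z₀)) (hne : (S ∩ K).Nonempty) : S ⊆ K := by
  refine hS.subset_of_disjoint_frontier hne (Set.disjoint_left.2 fun x hx hxf => hxf.2 ?_)
  exact mem_interior_iff_mem_nhds.2 (h.limit_mem_nhds hz₀ hK hKne hlim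
    (hK.isClosed.closure_eq ▸ hxf.1) (Set.disjoint_left.1 hd hx))

/-- A punctured plane is connected and unbounded, so the compact limit cannot meet it. -/
theorem limit_eq_singleton (h : IsDiscFamily Γ Ω D) {z₀ : Fin n → ℂ} (hz₀ : z₀ ∈ closure D)
    {K : Set ℂ} (hK : IsCompact K) (hKne : K.Nonempty) (hlim : Tendsto (fun z =>
      Metric.hausdorffDist (closure (fibre Ω z)) K) (𝓝[D] z₀) (𝓝 0)) {w₀ : ℂ}
    (hw₀ : fibre Γ z₀ = {w₀}) : K = {w₀} := by
  have hsub : K ⊆ {w₀} := by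
    by_contra hn
    obtain ⟨x, hx, hxw⟩ := not_subset.1 hn
    have hconn : IsPreconnected ({w₀}ᶜ : Set ℂ) :=
      (isConnected_compl_singleton_of_one_lt_rank (by rw [Complex.rank_real_complex]; norm_num)
        w₀).isPreconnected
    have hsub := h.subset_limit hz₀ hK hKne hlim hconn (hw₀ ▸ disjoint_compl_left) ⟨x, hxw, hx⟩
    have h1 : Bornology.IsBounded (univ : Set ℂ) := by
      rw [← compl_union_self {w₀}]
      exact (hK.isBounded.subset hsub).union Bornology.isBounded_singleton
    exact NormedSpace.unbounded_univ ℂ ℂ h1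
  exact hKne.subset_singleton_iff.1 hsub

/-- The limit is known through area integrals over `K`. If `K` is null they vanish. Otherwise `K`
agrees almost everywhere with the disc bounded by `γ(z₀)`, so Green's formula returns to a line
integral of `p`, which is close to that of `φ`, and the latter is zero by Cauchy's theorem. -/
theorem limit_curveInt_eq_zero (h : IsDiscFamily Γ Ω D) {z₀ : Fin n → ℂ} (hz₀ : z₀ ∈ closure D)
    {K : Set ℂ} (hK : IsCompact K) (hKne : K.Nonempty) (hlim : Tendsto (fun z =>
      Metric.hausdorffDist (closure (fibre Ω z)) K) (𝓝[D] z₀) (𝓝 0))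
    {φ : ℂ → ℂ} (hφ : ContinuousOn φ (fibre Γ z₀)) (hE : (∃ w, fibre Γ z₀ = {w}) ∨
      ∃ Δ, BoundsDisc (fibre Γ z₀) Δ ∧ ExtendsHolomorphically φ (fibre Γ z₀) Δ) {l : ℂ} {C : ℝ}
    (hl : ∀ ε > 0, ∃ p : ℂ → ℂ, ContDiff ℝ 1 p ∧ HasCompactSupport p ∧
        (∀ ζ ∈ fibre Γ z₀ ∩ K, ‖p ζ - φ ζ‖ ≤ ε) ∧
        ‖l - 2 * Complex.I * ∫ ζ in K, dbarDir p 1 ζ‖ ≤ C * ε) : l = 0 := by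
  suffices key : ∃ C' : ℝ, ∀ ε > 0, ‖l‖ ≤ C' * ε by
    obtain ⟨C', hC'⟩ := key
    rw [← norm_le_zero_iff]
    have ht : Tendsto (fun ε : ℝ => C' * ε) (𝓝[>] 0) (𝓝 0) := by
      have : Continuous fun ε : ℝ => C' * ε := by fun_prop
      simpa using (this.tendsto 0).mono_left nhdsWithin_le_nhds
    exact ge_of_tendsto ht (by filter_upwards [self_mem_nhdsWithin] with ε hε using hC' ε hε)
  have hnull : (∃ s : Set ℂ, volume s = 0 ∧ K ⊆ s) → ∃ C' : ℝ, ∀ ε > 0, ‖l‖ ≤ C' * ε := by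
    rintro ⟨s, hs, hKs⟩
    refine ⟨C, fun ε hε => ?_⟩
    obtain ⟨p, -, -, -, hp⟩ := hl ε hε
    rwa [setIntegral_measure_zero _ (measure_mono_null hKs hs), mul_zero, sub_zero] at hp
  rcases hE with ⟨w₀, hw₀⟩ | ⟨Δ, hb, g, hg, hgd, hge⟩
  · rw [h.limit_eq_singleton hz₀ hK hKne hlim hw₀] at hnull
    exact hnull ⟨{w₀}, by simp, Subset.rfl⟩
  obtain ⟨c, hc⟩ := hb.exists_param
  have hγ : volume (fibre Γ z₀) = 0 := hc.range_eq ▸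
    volume_range_eq_zero (hc.contDiff_one.differentiable one_ne_zero)
  -- The exterior is connected and unbounded; a point of it in `K` would force all of it into `K`.
  have hKsub : K ⊆ Δ ∪ fibre Γ z₀ := fun x hx => by
    by_contra hn
    exact hb.not_isBounded_ext (hK.isBounded.subset (h.subset_limit hz₀ hK hKne hlim
      hb.isPreconnected_ext (Set.disjoint_left.2 fun y hy hyγ => hy (Or.inr hyγ)) ⟨x, hn, hx⟩))
  -- The limit set either contains all of `Δ` or is reduced to part of the null curve.
  by_cases hne : (Δ ∩ K).Nonempty
  swap
  · refine hnull ⟨_, hγ, fun x hx => (hKsub hx).resolve_left fun hxΔ => hne ⟨x, hxΔ, hx⟩⟩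
  have hΔK := h.subset_limit hz₀ hK hKne hlim hb.isPreconnected hb.disjoint hne
  have hγK : fibre Γ z₀ ⊆ K := by
    have := closure_minimal hΔK hK.isClosed
    rw [hb.closure_eq] at this
    exact subset_union_right.trans this
  refine ⟨C + curveLen c, fun ε hε => ?_⟩
  obtain ⟨p, hp, hps, hpφ, hpl⟩ := hl ε hε
  have hKae : K =ᵐ[volume] Δ := by
    refine (hKsub.eventuallyLE.trans ?_).antisymm hΔK.eventuallyLE
    exact (union_ae_eq_left_of_ae_eq_empty (ae_eq_empty.2 hγ)).le
  rw [setIntegral_congr_set hKae, ← hb.curveInt_eq hc hp hps] at hpl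
  have h0 : curveInt c φ = 0 := by
    rw [← hb.curveInt_eq_zero hc.isJordanParam hc.range_eq hg hgd]
    exact curveInt_congr fun x hx => (hge (hc.range_eq ▸ hx)).symm
  have h1 : ‖curveInt c p‖ ≤ ε * curveLen c := by
    rw [← sub_zero (curveInt c p), ← h0, ← curveInt_sub hc.contDiff_one hp.continuous.continuousOn
      (hc.range_eq ▸ hφ)]
    refine norm_curveInt_le hc.contDiff_one fun w hw => ?_
    rw [hc.range_eq] at hw
    exact hpφ w ⟨hw, hγK hw⟩
  calc ‖l‖ = ‖(l - curveInt c p) + curveInt c p‖ := by rw [sub_add_cancel]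
    _ ≤ C * ε + ε * curveLen c := (norm_add_le _ _).trans (add_le_add hpl h1)
    _ = (C + curveLen c) * ε := by ring

/-- The line integrals over the fibres of a CR function vanish if they vanish on a set of
uniqueness. -/
theorem curveInt_eq_zero (h : IsDiscFamily Γ Ω D) (hΓ : IsRealAnalyticHypersurface Γ)
    (hlim : ∀ z₀ ∈ frontier D, ∃ K : Set ℂ, IsCompact K ∧ K.Nonempty ∧
      Tendsto (fun z => Metric.hausdorffDist (closure (fibre Ω z)) K) (𝓝[D] z₀) (𝓝 0))
    {f : (Fin n → ℂ) × ℂ → ℂ} (hf : ContinuousOn f Γ)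
    (hCR : ∀ q ∈ Γ, q.1 ∈ D → IsLocallyCR Γ f q) (hE : IsUniquenessSet D (extensionSet Γ D f))
    {c : (Fin n → ℂ) → ℝ → ℂ}
    (hc : ∀ z ∈ D, IsPositiveParametrization (c z) (fibre Γ z) (fibre Ω z)) :
    ∀ z ∈ D, curveInt (c z) (fun ζ => f (z, ζ)) = 0 := by
  set H : (Fin n → ℂ) → ℂ := fun z => curveInt (c z) fun ζ => f (z, ζ) with hH
  have hd : DifferentiableOn ℂ H D := h.differentiableOn_curveInt hCR hc
  have hfz : ∀ z, ContinuousOn (fun ζ => f (z, ζ)) (fibre Γ z) := fun z =>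
    hf.comp (by fun_prop) fun ζ hζ => hζ
  have hbd : ∀ z ∈ closure D, z ∉ D → ∃ l, Tendsto H (𝓝[D] z) (𝓝 l) ∧
      (z ∈ extensionSet Γ D f → l = 0) := fun z hz hzD => by
    obtain ⟨K, hK, hKne, hKlim⟩ := hlim z (by rw [h.isOpen_base.frontier_eq]; exact ⟨hz, hzD⟩)
    obtain ⟨l, hl, C, hC⟩ := h.exists_tendsto_curveInt hΓ hf hc hd.continuousOn hz hK hKne hKlim
    exact ⟨l, hl, fun hzE => h.limit_curveInt_eq_zero hz hK hKne hKlim (hfz z) hzE.2 hC⟩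
  have hin : ∀ z ∈ D, extendFrom D H z = H z := fun z hz =>
    extendFrom_eq (subset_closure hz) (hd.continuousOn z hz)
  have hext : ContinuousOn (extendFrom D H) (closure D) := by
    refine continuousOn_extendFrom Subset.rfl fun z hz => ?_
    by_cases hzD : z ∈ D
    · exact ⟨_, hd.continuousOn z hzD⟩
    · obtain ⟨l, hl, -⟩ := hbd z hz hzD
      exact ⟨l, hl⟩
  have hzero := hE (extendFrom D H) hext (hd.congr hin) fun z hz => by
    by_cases hzD : z ∈ D
    · rw [hin z hzD]
      have hcz := hc z hzD
      rcases hz.2 with ⟨w, hw⟩ | ⟨Δ, hb, g, hg, hgd, hge⟩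
      -- Over `D` the fibre is a simple closed curve, so it is not a point.
      · have e : ∀ t, c z t = w := fun t => by
          have : c z t ∈ fibre Γ z := hcz.range_eq ▸ mem_range_self t
          rwa [hw] at this
        have := hcz.injOn (show (0 : ℝ) ∈ Ico 0 1 by simp)
          (show (1 / 2 : ℝ) ∈ Ico 0 1 by constructor <;> norm_num) ((e _).trans (e _).symm)
        norm_num at this
      · rw [← hb.curveInt_eq_zero hcz.isJordanParam hcz.range_eq hg hgd]
        exact curveInt_congr fun x hx => (hge (hcz.range_eq ▸ hx)).symm
    · obtain ⟨l, hl, hl0⟩ := hbd z hz.1 hzD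
      rw [extendFrom_eq hz.1 hl, hl0 hz]
  intro z hz
  exact (hin z hz).symm.trans (hzero z (subset_closure hz))

end IsDiscFamily

/-- The product rule: a holomorphic factor has a complex linear differential. It is needed for the
powers `ζ^k` and for the Cauchy kernel `(ζ - w)⁻¹`. -/
theorem IsLocallyCR.mul_snd {n : ℕ} {Γ : Set ((Fin n → ℂ) × ℂ)} {f : (Fin n → ℂ) × ℂ → ℂ}
    {q : (Fin n → ℂ) × ℂ} (hf : IsLocallyCR Γ f q) {m : ℂ → ℂ} {N : Set ℂ} (hN : IsOpen N)
    (hqN : q.2 ∈ N) (hm : DifferentiableOn ℂ m N) : IsLocallyCR Γ (fun p => f p * m p.2) q := by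
  obtain ⟨V, ρ, g, hρ, hg, he, hL⟩ := hf
  have hVo : IsOpen (V ∩ Prod.snd ⁻¹' N) := hρ.isOpen.inter (hN.preimage continuous_snd)
  refine ⟨V ∩ Prod.snd ⁻¹' N, ρ, fun p => g p * m p.2, ⟨hVo, ⟨hρ.mem, hqN⟩,
    hρ.analytic.mono inter_subset_left, hρ.fderiv_ne_zero, ?_⟩, ?_, fun p hp => ?_, fun v h1 h2 => ?_⟩
  · rw [← inter_assoc, hρ.inter_eq]
    ext p
    simp only [mem_inter_iff, mem_ofPred_eq]
    tauto
  · have hmc : ContDiffOn ℝ 1 m N := (hm.contDiffOn hN).restrict_scalars ℝ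
    exact (hg.mono inter_subset_left).mul (hmc.comp contDiffOn_snd fun p hp => hp.2)
  · change g p * m p.2 = f p * m p.2
    rw [he ⟨hp.1, hp.2.1⟩]
  · have hgd : DifferentiableAt ℝ g q :=
      (hg.contDiffAt (hρ.isOpen.mem_nhds hρ.mem)).differentiableAt one_ne_zero
    have hmd := ((hm.differentiableAt (hN.mem_nhds hqN)).hasFDerivAt.restrictScalars ℝ).comp q
      (hasFDerivAt_snd (𝕜 := ℝ) (p := q))
    have e := (hgd.hasFDerivAt.mul hmd).fderiv
    have e' : fderiv ℝ (fun p => g p * m p.2) q = _ := e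
    rw [e']
    have h3 := hL v h1 h2
    have h4 : fderiv ℂ m q.2 (Complex.I * v.2) = Complex.I * fderiv ℂ m q.2 v.2 := by
      rw [← smul_eq_mul, map_smul, smul_eq_mul]
    simp [h3, h4]
    ring

end Moments


/-! ### Holomorphy of the fibrewise Cauchy integral. -/

section CauchyExtension
open MeasureTheory

theorem IsDiscFamily.restrict {n : ℕ} {Γ Ω : Set ((Fin n → ℂ) × ℂ)} {D D' : Set (Fin n → ℂ)}
    (h : IsDiscFamily Γ Ω D) (hD' : IsOpen D') (hsub : D' ⊆ D) :
    IsDiscFamily Γ (Ω ∩ Prod.fst ⁻¹' D') D' ∧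
      ∀ z ∈ D', fibre (Ω ∩ Prod.fst ⁻¹' D') z = fibre Ω z := by
  have e : ∀ z ∈ D', fibre (Ω ∩ Prod.fst ⁻¹' D') z = fibre Ω z := fun z hz => by
    ext w; exact ⟨fun hw => hw.1, fun hw => ⟨hw, hz⟩⟩
  refine ⟨⟨h.isClosed, h.isOpen.inter (hD'.preimage continuous_fst), hD', fun z hz => ?_,
    fun z hz => h.reg z (hsub hz), fun p hp => hp.2⟩, e⟩
  rw [e z hz]; exact h.disc z (hsub hz)

/-- On the fibres over `D`, `F` is the Cauchy integral of `f`, and all moments of `f` vanish. -/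
structure IsCauchyExtension {n : ℕ} (Γ Ω : Set ((Fin n → ℂ) × ℂ)) (D : Set (Fin n → ℂ))
    (f F : (Fin n → ℂ) × ℂ → ℂ) (c : (Fin n → ℂ) → ℝ → ℂ) : Prop where
  family : IsDiscFamily Γ Ω D
  continuousOn : ContinuousOn f Γ
  isLocallyCR : ∀ q ∈ Γ, q.1 ∈ D → IsLocallyCR Γ f q
  param : ∀ z ∈ D, IsPositiveParametrization (c z) (fibre Γ z) (fibre Ω z)
  moments : ∀ z ∈ D, ∀ k : ℕ, curveInt (c z) (fun ζ => f (z, ζ) * ζ ^ k) = 0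
  eq : ∀ z ∈ D, ∀ w, F (z, w) = cauchyExt (c z) (fun ζ => f (z, ζ)) w

namespace IsCauchyExtension

variable {n : ℕ} {Γ Ω : Set ((Fin n → ℂ) × ℂ)} {D : Set (Fin n → ℂ)}
  {f F : (Fin n → ℂ) × ℂ → ℂ} {c : (Fin n → ℂ) → ℝ → ℂ} {z : Fin n → ℂ}

theorem eq_on_curve (h : IsCauchyExtension Γ Ω D f F c) (hz : z ∈ D) {w : ℂ}
    (hw : w ∈ fibre Γ z) : F (z, w) = f (z, w) := by
  rw [h.eq z hz, cauchyExt, if_pos ((h.param z hz).range_eq ▸ hw)]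

theorem eq_on_disc (h : IsCauchyExtension Γ Ω D f F c) (hz : z ∈ D) {w : ℂ}
    (hw : w ∈ fibre Ω z) :
    F (z, w) = (2 * Real.pi * Complex.I)⁻¹ * cauchyInt (c z) (fun ζ => f (z, ζ)) w := by
  rw [h.eq z hz, (h.family.disc z hz).cauchyExt_of_mem (h.param z hz).range_eq hw]

theorem continuousOn_slice (h : IsCauchyExtension Γ Ω D f F c) (z : Fin n → ℂ) :
    ContinuousOn (fun ζ => f (z, ζ)) (fibre Γ z) :=
  h.continuousOn.comp (by fun_prop) fun _ hζ => hζ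

theorem continuousOn_fibre (h : IsCauchyExtension Γ Ω D f F c) (hz : z ∈ D) :
    DifferentiableOn ℂ (fun w => F (z, w)) (fibre Ω z) ∧
      ContinuousOn (fun w => F (z, w)) (fibre Ω z ∪ fibre Γ z) := by
  have hb := h.family.disc z hz
  have hc := h.param z hz
  simp only [h.eq z hz]
  exact hb.continuousOn_cauchyExt hc (h.continuousOn_slice z) fun w hw =>
    hb.cauchyInt_eq_zero_of_moments hc.isJordanParam hc.range_eq (h.continuousOn_slice z)
      (h.moments z hz) hw

/-- The maximum principle on the disc, where `F` has the boundary values `f`. -/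
theorem norm_sub_le (h : IsCauchyExtension Γ Ω D f F c) (hz : z ∈ D) {a : ℂ} {M : ℝ}
    (hM : ∀ w ∈ fibre Γ z, ‖f (z, w) - a‖ ≤ M) {w : ℂ} (hw : w ∈ fibre Ω z ∪ fibre Γ z) :
    ‖F (z, w) - a‖ ≤ M := by
  have hb := h.family.disc z hz
  refine Complex.norm_le_of_forall_mem_frontier_norm_le (f := fun w => F (z, w) - a) hb.isBounded
    ⟨(h.continuousOn_fibre hz).1.sub_const a, ?_⟩ (fun x hx => ?_) (by rwa [hb.closure_eq])
  · rw [hb.closure_eq]; exact (h.continuousOn_fibre hz).2.sub continuousOn_const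
  · rw [hb.frontier_eq] at hx
    rw [h.eq_on_curve hz hx]; exact hM x hx

theorem exists_bound (h : IsCauchyExtension Γ Ω D f F c) {z₁ : Fin n → ℂ} (hz₁ : z₁ ∈ D) :
    ∃ r > 0, ∃ M : ℝ, Metric.ball z₁ r ⊆ D ∧
      ∀ z ∈ Metric.ball z₁ r, ∀ w ∈ fibre Ω z ∪ fibre Γ z, ‖F (z, w)‖ ≤ M := by
  obtain ⟨R, -, hR⟩ := h.family.exists_subset_ball hz₁
  obtain ⟨r, hr, hball⟩ := Metric.nhds_basis_closedBall.mem_iff.1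
    (Eventually.and (h.family.isOpen_base.mem_nhds hz₁)
      (h.family.eventually_closure_subset_ball hz₁ hR))
  have hK : IsCompact (Γ ∩ Metric.closedBall z₁ r ×ˢ Metric.closedBall (0 : ℂ) R) :=
    ((isCompact_closedBall _ _).prod (isCompact_closedBall _ _)).inter_left h.family.isClosed
  obtain ⟨M, hM⟩ := hK.exists_bound_of_continuousOn (h.continuousOn.mono inter_subset_left)
  refine ⟨r, hr, M, fun z hz => (hball (Metric.ball_subset_closedBall hz)).1,
    fun z hz w hw => ?_⟩
  have hz' := hball (Metric.ball_subset_closedBall hz)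
  have := h.norm_sub_le hz'.1 (a := 0) (M := M) (fun ζ hζ => ?_) hw
  · simpa using this
  · rw [sub_zero]
    refine hM _ ⟨hζ, Metric.ball_subset_closedBall hz, Metric.ball_subset_closedBall (hz'.2 ?_)⟩
    rw [(h.family.disc z hz'.1).closure_eq]; exact Or.inr hζ

/-- Over `D'` the point `w` stays inside the discs, so `f (ζ - w)⁻¹` is CR near the curves, and its
line integrals are holomorphic in the base point. -/
theorem differentiableOn_base (h : IsCauchyExtension Γ Ω D f F c) {D' : Set (Fin n → ℂ)}
    (hD' : IsOpen D') {w : ℂ} (hw : ∀ z ∈ D', (z, w) ∈ Ω) :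
    DifferentiableOn ℂ (fun z => F (z, w)) D' := by
  have hsub : D' ⊆ D := fun z hz => h.family.base _ (hw z hz)
  obtain ⟨hfam, hfib⟩ := h.family.restrict hD' hsub
  have hd := hfam.differentiableOn_curveInt (f := fun p => f p * (p.2 - w)⁻¹) (c := c)
    (fun q hq hqD => (h.isLocallyCR q hq (hsub hqD)).mul_snd (m := fun ζ => (ζ - w)⁻¹)
      (isOpen_compl_singleton (x := w)) (fun he => ?_) (fun ζ hζ => ?_))
    fun z hz => by rw [hfib z hz]; exact h.param z (hsub hz)
  · refine DifferentiableOn.congr (hd.const_mul (2 * Real.pi * Complex.I)⁻¹) fun z hz => ?_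
    rw [h.eq_on_disc (hsub hz) (hw z hz), cauchyInt]
    simp only [div_eq_mul_inv]
  · have hq2 : q.2 ∈ fibre Ω q.1 := by rw [mem_singleton_iff.1 he]; exact hw q.1 hqD
    exact Set.disjoint_left.1 (h.family.disc q.1 (hsub hqD)).disjoint hq2 hq
  · exact ((differentiableAt_id.sub_const w).inv (sub_ne_zero.2 hζ)).differentiableWithinAt

/-- Separate holomorphy together with the local bound from the maximum principle. -/
theorem differentiableOn (h : IsCauchyExtension Γ Ω D f F c) : DifferentiableOn ℂ F Ω := by
  rintro ⟨z₁, w₁⟩ hp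
  obtain ⟨r, hr, M, -, hM⟩ := h.exists_bound (h.family.base _ hp)
  obtain ⟨s, hs, hball⟩ := Metric.isOpen_iff.1 h.family.isOpen _ hp
  rw [← ball_prod_same] at hball
  have hΩ : ∀ z ∈ Metric.ball z₁ (min r s), ∀ w ∈ Metric.ball w₁ s, (z, w) ∈ Ω :=
    fun z hz w hw => hball ⟨Metric.ball_subset_ball (min_le_right _ _) hz, hw⟩
  have hd := differentiableOn_prod_of_separately (F := F) (w₀ := w₁) (M := M)
    (Metric.isOpen_ball (x := z₁) (ε := min r s)) hs
    (fun z hz w hw => hM z (Metric.ball_subset_ball (min_le_left _ _) hz) w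
      (Or.inl (hΩ z hz w hw)))
    (fun w hw => h.differentiableOn_base Metric.isOpen_ball fun z hz => hΩ z hz w hw)
    (fun z hz => (h.continuousOn_fibre (h.family.base _ (hΩ z hz w₁
      (Metric.mem_ball_self hs)))).1.mono fun w hw => hΩ z hz w hw)
  refine (hd.differentiableAt ?_).differentiableWithinAt
  exact prod_mem_nhds (Metric.ball_mem_nhds _ (lt_min hr hs)) (Metric.ball_mem_nhds _ (by positivity))

end IsCauchyExtension

end CauchyExtension


/-! ### Boundary values of the extension. -/

section BoundaryContinuity
open MeasureTheory

/-- A regular closed analytic curve meets each circle around one of its points finitely often. -/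
theorem IsPositiveParametrization.finite_inter_sphere {c : ℝ → ℂ} {γ Δ : Set ℂ}
    (hc : IsPositiveParametrization c γ Δ) {w₀ : ℂ} (hw₀ : w₀ ∈ γ) {r : ℝ} (hr : 0 < r) :
    (γ ∩ Metric.sphere w₀ r).Finite := by
  -- An analytic function of the parameter. It is not identically zero because it equals `-r²` where
  -- the curve passes through `w₀`, so its zeros cannot accumulate.
  let φ : ℝ → ℝ := fun t => Complex.normSq (c t - w₀) - r ^ 2
  have hφ : AnalyticOnNhd ℝ φ univ := fun t ht => by
    have h1 : AnalyticAt ℝ (fun t => c t - w₀) t := (hc.analytic t ht).sub analyticAt_const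
    have hre : AnalyticAt ℝ (fun t => (c t - w₀).re) t :=
      (Complex.reCLM.analyticAt _).comp h1
    have him : AnalyticAt ℝ (fun t => (c t - w₀).im) t :=
      (Complex.imCLM.analyticAt _).comp h1
    exact ((hre.mul hre).add (him.mul him)).sub analyticAt_const
  have hmem : ∀ t, c t ∈ Metric.sphere w₀ r ↔ φ t = 0 := fun t => by
    rw [Metric.mem_sphere, dist_eq_norm, sub_eq_zero, Complex.normSq_eq_norm_sq,
      pow_left_inj₀ (norm_nonneg _) hr.le two_ne_zero]
  have hsub : γ ∩ Metric.sphere w₀ r ⊆ c '' (Icc 0 1 ∩ {t | φ t = 0}) := by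
    rintro w ⟨hwγ, hws⟩
    rw [← hc.range_eq, ← hc.periodic.image_Icc one_pos 0, zero_add] at hwγ
    obtain ⟨t, ht, rfl⟩ := hwγ
    exact ⟨t, ⟨ht, (hmem t).1 hws⟩, rfl⟩
  refine Set.Finite.subset (Set.Finite.image c ?_) hsub
  by_contra hinf
  obtain ⟨t, -, ht⟩ := Set.Infinite.exists_accPt_of_subset_isCompact hinf isCompact_Icc
    inter_subset_left
  have hfreq : ∃ᶠ s in 𝓝[≠] t, φ s = 0 :=
    (accPt_iff_frequently_nhdsNE.1 ht).mono fun s hs => hs.2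
  have hz := hφ.eqOn_zero_of_preconnected_of_frequently_eq_zero isPreconnected_univ (mem_univ t)
    hfreq
  rw [← hc.range_eq] at hw₀
  obtain ⟨s, rfl⟩ := hw₀
  have := hz (mem_univ s)
  simp [φ] at this
  exact hr.ne' this

namespace IsCauchyExtension

variable {n : ℕ} {Γ Ω : Set ((Fin n → ℂ) × ℂ)} {D : Set (Fin n → ℂ)}
  {f F : (Fin n → ℂ) × ℂ → ℂ} {c : (Fin n → ℂ) → ℝ → ℂ}

/-- Apply the maximum principle on the part of `Δ(z)` in a small disc around `w₀`. On `γ(z)` the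
function is close to `f₀` by continuity of `f`, and on the circle by comparison with `F(z₀, ·)`.
Only near the finitely many points where the circle meets `γ(z₀)` is there nothing but a crude
bound, and a polynomial vanishing at these points absorbs it. -/
theorem eventually_norm_sub_le (h : IsCauchyExtension Γ Ω D f F c) {z₀ : Fin n → ℂ} (hz₀ : z₀ ∈ D)
    {w₀ : ℂ} (hw₀ : w₀ ∈ fibre Γ z₀) {ε : ℝ} (hε : 0 < ε) :
    ∀ᶠ p in 𝓝 (z₀, w₀), p ∈ Ω → ‖F p - f (z₀, w₀)‖ ≤ 4 * ε := by
  set f₀ := f (z₀, w₀) with hf₀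
  have hfam := h.family
  obtain ⟨r₁, hr₁, M₀, hr₁D, hM₀⟩ := h.exists_bound hz₀
  set M := M₀ + ‖f₀‖ with hMdef
  have hM : ∀ z ∈ Metric.ball z₀ r₁, ∀ w ∈ fibre Ω z ∪ fibre Γ z, ‖F (z, w) - f₀‖ ≤ M :=
    fun z hz w hw => (_root_.norm_sub_le _ _).trans (add_le_add (hM₀ z hz w hw) le_rfl)
  have hM0 : 0 ≤ M := (norm_nonneg _).trans
    (hM z₀ (Metric.mem_ball_self hr₁) w₀ (Or.inr hw₀))
  have hA : ∀ᶠ p in 𝓝 (z₀, w₀), p ∈ Γ → ‖f p - f₀‖ ≤ ε := by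
    have := ((h.continuousOn _ hw₀).sub (continuousWithinAt_const (b := f₀))).norm
    have h2 : ∀ᶠ p in 𝓝[Γ] (z₀, w₀), ‖f p - f₀‖ < ε :=
      this.eventually (gt_mem_nhds (by simpa [hf₀] using hε))
    filter_upwards [eventually_nhdsWithin_iff.1 h2] with p hp hpΓ using (hp hpΓ).le
  have hB : ∀ᶠ w in 𝓝 w₀, w ∈ fibre Ω z₀ ∪ fibre Γ z₀ → ‖F (z₀, w) - f₀‖ ≤ ε := by
    have := (((h.continuousOn_fibre hz₀).2 w₀ (Or.inr hw₀)).sub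
      (continuousWithinAt_const (b := f₀))).norm
    have h2 : ∀ᶠ w in 𝓝[fibre Ω z₀ ∪ fibre Γ z₀] w₀, ‖F (z₀, w) - f₀‖ < ε :=
      this.eventually (gt_mem_nhds (by
        simpa [h.eq_on_curve hz₀ hw₀, hf₀] using hε))
    filter_upwards [eventually_nhdsWithin_iff.1 h2] with w hw hwS using (hw hwS).le
  obtain ⟨r₂, hr₂, hr₂A⟩ := Metric.nhds_basis_closedBall.mem_iff.1 hA
  obtain ⟨r₃, hr₃, hr₃B⟩ := Metric.nhds_basis_closedBall.mem_iff.1 hB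
  rw [← closedBall_prod_same] at hr₂A
  set r := min r₂ r₃ with hrdef
  have hr : 0 < r := lt_min hr₂ hr₃
  have hfin := (h.param z₀ hz₀).finite_inter_sphere hw₀ hr
  set Z := hfin.toFinset with hZ
  set P : ℂ → ℂ := fun w => ∏ b ∈ Z, (w - b) with hP
  have hPc : Continuous P := by fun_prop
  have hPd : Differentiable ℂ P := by fun_prop
  have hZs : ∀ b ∈ Z, b ∈ Metric.sphere w₀ r := fun b hb => (hfin.mem_toFinset.1 hb).2
  set N := Z.card with hN
  have hPle : ∀ w ∈ Metric.closedBall w₀ r, ‖P w‖ ≤ (2 * r) ^ N := fun w hw => by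
    rw [hP, norm_prod, hN, ← Finset.prod_const]
    refine Finset.prod_le_prod (fun _ _ => norm_nonneg _) fun b hb => ?_
    rw [← dist_eq_norm]
    have h1 := Metric.mem_sphere.1 (hZs b hb)
    have h2 := Metric.mem_closedBall.1 hw
    linarith [dist_triangle_right w b w₀]
  have hPge : ∀ w ∈ Metric.ball w₀ (r / 2), (r / 2) ^ N ≤ ‖P w‖ := fun w hw => by
    rw [hP, norm_prod, hN, ← Finset.prod_const]
    refine Finset.prod_le_prod (fun _ _ => (half_pos hr).le) fun b hb => ?_
    rw [← dist_eq_norm]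
    have h1 := Metric.mem_sphere.1 (hZs b hb)
    have h2 := Metric.mem_ball.1 hw
    linarith [dist_triangle_left b w₀ w, dist_comm w w₀]
  -- The polynomial lies between `(r/2)^N` on the half disc and `(2r)^N` on the disc. The loss
  -- `2^(2N)` costs only a factor `2` after taking `k`-th roots; the summand `1` keeps `k` nonzero.
  set k := 2 * N + 1 with hk
  set T : ℝ := (2 * ε) ^ k * (2 * r) ^ N with hT
  have hT0 : 0 < T := by positivity
  -- Near the zeros of `P` even the crude bound `M` is good enough.
  set O : Set ℂ := {w | M ^ k * ‖P w‖ < T} with hO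
  have hOo : IsOpen O := isOpen_lt (by fun_prop) continuous_const
  have hQ : IsCompact (Metric.sphere w₀ r \ O) := (isCompact_sphere w₀ r).diff hOo
  -- The rest of the circle is compact and off `γ(z₀)`: each of its points is either in `Ω`, where
  -- `F` is continuous, or outside the closure of `Ω`.
  have hQev : ∀ᶠ z in 𝓝 z₀, ∀ w ∈ Metric.sphere w₀ r \ O, (z, w) ∈ Ω →
      ‖F (z, w) - f₀‖ ≤ 2 * ε := by
    refine hQ.eventually_forall_of_forall_eventually fun w hw => ?_
    by_cases hΩ : (z₀, w) ∈ Ω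
    · have hca : ContinuousAt (fun p => ‖F p - f₀‖) (z₀, w) :=
        ((h.differentiableOn.differentiableAt
          (hfam.isOpen.mem_nhds hΩ)).continuousAt.sub continuousAt_const).norm
      have h1 : ‖F (z₀, w) - f₀‖ < 2 * ε := lt_of_le_of_lt
        (hr₃B (Metric.closedBall_subset_closedBall (min_le_right _ _)
          (Metric.sphere_subset_closedBall hw.1)) (Or.inl hΩ)) (by linarith)
      filter_upwards [hca.eventually (gt_mem_nhds h1)] with p hp _ using hp.le
    · have hΓ : w ∉ fibre Γ z₀ := fun hwΓ => hw.2 (by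
        have hwZ : w ∈ Z := hfin.mem_toFinset.2 ⟨hwΓ, hw.1⟩
        have : P w = 0 := Finset.prod_eq_zero hwZ (sub_self w)
        change M ^ k * ‖P w‖ < T
        rw [this, norm_zero, mul_zero]; exact hT0)
      have hnc : (z₀, w) ∉ closure Ω := hfam.notMem_closure hz₀ (by
        rw [(hfam.disc z₀ hz₀).closure_eq]; exact fun h' => h'.elim hΩ hΓ)
      filter_upwards [isClosed_closure.isOpen_compl.mem_nhds hnc] with p hp hpΩ
      exact absurd (subset_closure hpΩ) hp
  have hz : ∀ᶠ z in 𝓝 z₀, z ∈ Metric.ball z₀ (min r₁ r₂) ∧ ∀ w ∈ Metric.sphere w₀ r \ O,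
      (z, w) ∈ Ω → ‖F (z, w) - f₀‖ ≤ 2 * ε :=
    Eventually.and (Metric.ball_mem_nhds z₀ (lt_min hr₁ hr₂)) hQev
  rw [nhds_prod_eq]
  filter_upwards [hz.prod_mk (Metric.ball_mem_nhds w₀ (half_pos hr))]
  rintro ⟨z, w⟩ ⟨⟨hzr, hzQ⟩, hw⟩ hpΩ
  dsimp only at hzr hzQ hw
  have hzr₁ : z ∈ Metric.ball z₀ r₁ := Metric.ball_subset_ball (min_le_left _ _) hzr
  have hzr₂ : z ∈ Metric.closedBall z₀ r₂ :=
    Metric.ball_subset_closedBall (Metric.ball_subset_ball (min_le_right _ _) hzr)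
  have hzD := hr₁D hzr₁
  have hb := hfam.disc z hzD
  have hfib := h.continuousOn_fibre hzD
  have hclo : closure (fibre Ω z ∩ Metric.ball w₀ r) ⊆
      (fibre Ω z ∪ fibre Γ z) ∩ Metric.closedBall w₀ r := by
    rw [← hb.closure_eq]
    exact (closure_inter_subset_inter_closure _ _).trans
      (inter_subset_inter_right _ Metric.closure_ball_subset_closedBall)
  have hUo : IsOpen (fibre Ω z ∩ Metric.ball w₀ r) := hb.isOpen.inter Metric.isOpen_ball
  have hmax : ‖(F (z, w) - f₀) ^ k * P w‖ ≤ T := by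
    refine Complex.norm_le_of_forall_mem_frontier_norm_le
      (f := fun w => (F (z, w) - f₀) ^ k * P w)
      (hb.isBounded.subset (inter_subset_left (t := Metric.ball w₀ r)))
      ⟨(((hfib.1.sub_const f₀).pow k).mul hPd.differentiableOn).mono inter_subset_left,
        (((hfib.2.sub continuousOn_const).pow k).mul hPc.continuousOn).mono
          fun x hx => (hclo hx).1⟩ (fun x hx => ?_)
      (subset_closure ⟨hpΩ, Metric.ball_subset_ball (by linarith) hw⟩)
    rw [hUo.frontier_eq] at hx
    obtain ⟨hxS, hxB⟩ := hclo hx.1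
    rw [norm_mul, norm_pow]
    have hε2 : ‖F (z, x) - f₀‖ ≤ 2 * ε → ‖F (z, x) - f₀‖ ^ k * ‖P x‖ ≤ T := fun h1 =>
      mul_le_mul (pow_le_pow_left₀ (norm_nonneg _) h1 _) (hPle x hxB) (norm_nonneg _)
        (by positivity)
    rcases hxS with hxΩ | hxΓ
    · have hxs : x ∈ Metric.sphere w₀ r := by
        rw [Metric.mem_sphere]
        refine le_antisymm hxB (not_lt.1 fun hlt => hx.2 ⟨hxΩ, hlt⟩)
      by_cases hxO : x ∈ O
      · exact (mul_le_mul_of_nonneg_right (pow_le_pow_left₀ (norm_nonneg _)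
          (hM z hzr₁ x (Or.inl hxΩ)) _) (norm_nonneg _)).trans (le_of_lt hxO)
      · exact hε2 (hzQ x ⟨hxs, hxO⟩ hxΩ)
    · refine hε2 ?_
      rw [h.eq_on_curve hzD hxΓ]
      have : ‖f (z, x) - f₀‖ ≤ ε := hr₂A (show (z, x) ∈ _ from ⟨hzr₂,
        Metric.closedBall_subset_closedBall (min_le_left _ _) hxB⟩) hxΓ
      linarith
  rw [norm_mul, norm_pow] at hmax
  refine le_of_pow_le_pow_left₀ (n := k) (by omega) (by positivity) ?_
  have hrN : 0 < (r / 2) ^ N := by positivity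
  refine le_of_mul_le_mul_right ?_ hrN
  calc ‖F (z, w) - f₀‖ ^ k * (r / 2) ^ N ≤ ‖F (z, w) - f₀‖ ^ k * ‖P w‖ := by
        gcongr; exact hPge w hw
    _ ≤ T := hmax
    _ = (2 * ε) ^ k * 2 ^ (2 * N) * (r / 2) ^ N := by
        rw [hT, pow_mul, mul_assoc, ← mul_pow]; congr 2; ring
    _ ≤ (2 * ε) ^ k * 2 ^ k * (r / 2) ^ N := by
        gcongr
        · norm_num
        · omega
    _ = (4 * ε) ^ k * (r / 2) ^ N := by rw [← mul_pow]; congr 2; ring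

/-- `F` has the boundary values `f`. -/
theorem continuousOn_union (h : IsCauchyExtension Γ Ω D f F c) (hFΓ : ∀ p ∈ Γ, F p = f p)
    {S : Set ((Fin n → ℂ) × ℂ)} (hSΓ : S ⊆ Γ)
    (hS : ∀ p ∈ S, ∀ ε > 0, ∀ᶠ q in 𝓝 p, q ∈ Ω → ‖F q - f p‖ ≤ ε) :
    ContinuousOn F (Ω ∪ S) := by
  rintro p (hp | hp)
  · exact (h.differentiableOn.differentiableAt
      (h.family.isOpen.mem_nhds hp)).continuousAt.continuousWithinAt
  · rw [ContinuousWithinAt, hFΓ p (hSΓ hp), Metric.tendsto_nhds]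
    intro ε hε
    rw [eventually_nhdsWithin_iff]
    have h2 : ∀ᶠ q in 𝓝[Γ] p, dist (f q) (f p) < ε :=
      (Metric.tendsto_nhds.1 (h.continuousOn p (hSΓ hp))) ε hε
    filter_upwards [hS p hp (ε / 2) (by positivity), eventually_nhdsWithin_iff.1 h2]
      with q hqΩ hqΓ hq
    rcases hq with hq | hq
    · rw [dist_eq_norm]; exact (hqΩ hq).trans_lt (half_lt_self hε)
    · rw [hFΓ q (hSΓ hq)]; exact hqΓ (hSΓ hq)

/-- The discs shrink to `w₀`, so the boundary values of `F` on them are values of `f` near `(z₀,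
w₀)`; the maximum principle does the rest. -/
theorem eventually_norm_sub_le_of_singleton (h : IsCauchyExtension Γ Ω D f F c)
    {z₀ : Fin n → ℂ} (hz₀ : z₀ ∈ closure D) {w₀ : ℂ} (hw₀ : fibre Γ z₀ = {w₀}) {K : Set ℂ}
    (hK : IsCompact K) (hKne : K.Nonempty) (hlim : Tendsto (fun z =>
      Metric.hausdorffDist (closure (fibre Ω z)) K) (𝓝[D] z₀) (𝓝 0)) {ε : ℝ} (hε : 0 < ε) :
    ∀ᶠ p in 𝓝 (z₀, w₀), p ∈ Ω → ‖F p - f (z₀, w₀)‖ ≤ ε := by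
  have hKw := h.family.limit_eq_singleton hz₀ hK hKne hlim hw₀
  have hmem : (z₀, w₀) ∈ Γ := (show w₀ ∈ fibre Γ z₀ by rw [hw₀]; rfl)
  have h2 : ∀ᶠ p in 𝓝[Γ] (z₀, w₀), dist (f p) (f (z₀, w₀)) < ε :=
    (Metric.tendsto_nhds.1 (h.continuousOn _ hmem)) ε hε
  obtain ⟨r, hr, hball⟩ := Metric.mem_nhds_iff.1 (eventually_nhdsWithin_iff.1 h2)
  rw [← ball_prod_same] at hball
  have h3 := h.family.eventually_subset_thickening hK hKne hlim hr
  rw [hKw, Metric.thickening_singleton] at h3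
  have h4 : ∀ᶠ z in 𝓝 z₀, z ∈ Metric.ball z₀ r ∧
      (z ∈ D → closure (fibre Ω z) ⊆ Metric.ball w₀ r) :=
    Eventually.and (Metric.ball_mem_nhds z₀ hr)
      ((eventually_nhdsWithin_iff.1 h3).mono fun z hz hzD => (hz hzD).1)
  filter_upwards [(continuous_fst.tendsto (z₀, w₀)).eventually h4]
  rintro ⟨z, w⟩ ⟨hz, hzΔ⟩ hp
  have hzD := h.family.base _ hp
  refine h.norm_sub_le hzD (fun ζ hζ => ?_) (Or.inl hp)
  rw [← dist_eq_norm]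
  refine (hball (show (z, ζ) ∈ _ from ⟨hz, hzΔ hzD ?_⟩) hζ).le
  rw [(h.family.disc z hzD).closure_eq]; exact Or.inr hζ

end IsCauchyExtension

end BoundaryContinuity

/-! ### The extension theorem. -/

theorem mainTheorem3 (n : ℕ) (Γ U Ω : Set ((Fin n → ℂ) × ℂ)) (D : Set (Fin n → ℂ))
    (f : (Fin n → ℂ) × ℂ → ℂ)
    -- `Γ` is a real analytic hypersurface through `0`, and `Ω` is a connected component of
    -- `U \ Γ` for an open neighbourhood `U` of `0`
    (hΓ : IsRealAnalyticHypersurface Γ) (hΓ0 : (0 : (Fin n → ℂ) × ℂ) ∈ Γ)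
    (hU : IsOpen U) (hU0 : (0 : (Fin n → ℂ) × ℂ) ∈ U)
    (hΩ : ∃ p ∈ Γᶜ ∩ U, Ω = connectedComponentIn (Γᶜ ∩ U) p)
    -- `Ω` is the union of the fibres `Δ(z)`, `z ∈ D`, and these are discs bounded by `γ(z)`
    (hDo : IsOpen D) (hDc : IsConnected D)
    (hdisc : ∀ z ∈ D, BoundsDisc (fibre Γ z) (fibre Ω z))
    (hreg : ∀ z ∈ D, ∀ w ∈ fibre Γ z, (z, w) ∈ regularLocus Γ)
    (hΩD : ∀ p ∈ Ω, p.1 ∈ D)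
    -- the closed discs converge, in the Hausdorff distance, at every boundary point of `D`
    (hlim : ∀ z₀ ∈ frontier D, ∃ K : Set ℂ, IsCompact K ∧ K.Nonempty ∧
      Tendsto (fun z => Metric.hausdorffDist (closure (fibre Ω z)) K) (𝓝[D] z₀) (𝓝 0))
    (hf : ContinuousOn f Γ) (hCR : IsCROnRegularLocus Γ f)
    (hE : IsUniquenessSet D (extensionSet Γ D f)) :
    ∃ F : (Fin n → ℂ) × ℂ → ℂ,
      DifferentiableOn ℂ F Ω ∧
      -- `F` has the boundary values `f` on the part of `Γ` over `D` and at the points over the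
      -- boundary of `D` where the fibre of `Γ` is a single point
      ContinuousOn F (Ω ∪ {p ∈ Γ | p.1 ∈ D ∨ (p.1 ∈ frontier D ∧ fibre Γ p.1 = {p.2})}) ∧
      (∀ p ∈ Γ, p.1 ∈ D ∨ (p.1 ∈ frontier D ∧ fibre Γ p.1 = {p.2}) → F p = f p) ∧
      -- `F` is the fibrewise Cauchy integral of `f`
      ∀ z ∈ D, ∀ w ∈ fibre Ω z, ∀ c : ℝ → ℂ,
        IsPositiveParametrization c (fibre Γ z) (fibre Ω z) →
          F (z, w) = (2 * Real.pi * Complex.I)⁻¹ *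
            ∫ t in (0 : ℝ)..1, f (z, c t) / (c t - w) * deriv c t := by
  classical
  obtain ⟨p₀, -, hΩp⟩ := hΩ
  have hfam : IsDiscFamily Γ Ω D :=
    ⟨hΓ.isClosed, hΩp ▸ (hΓ.isClosed.isOpen_compl.inter hU).connectedComponentIn, hDo, hdisc,
      hreg, hΩD⟩
  have hpar : ∀ z, ∃ c, z ∈ D → IsPositiveParametrization c (fibre Γ z) (fibre Ω z) := fun z => by
    by_cases hz : z ∈ D
    · obtain ⟨c, hc⟩ := (hdisc z hz).exists_param
      exact ⟨c, fun _ => hc⟩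
    · exact ⟨0, fun h => absurd h hz⟩
  choose c hc using hpar
  have hCR' : ∀ q ∈ Γ, q.1 ∈ D → IsLocallyCR Γ f q := fun q hq hqD => hCR q (hreg q.1 hqD q.2 hq)
  -- The function `f w^k` is again continuous and CR. If `f(z, ·)` extends to the disc then so does
  -- `f(z, ·) ζ^k`, so `E(f)` is contained in the corresponding set for `f w^k`, which is therefore
  -- a set of uniqueness too.
  have hmom : ∀ z ∈ D, ∀ k : ℕ, curveInt (c z) (fun ζ => f (z, ζ) * ζ ^ k) = 0 := fun z hz k => by
    refine hfam.curveInt_eq_zero hΓ hlim (f := fun p => f p * p.2 ^ k)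
      (hf.mul (by fun_prop)) (fun q hq hqD => (hCR' q hq hqD).mul_snd (m := fun ζ => ζ ^ k)
        isOpen_univ trivial (by fun_prop)) (fun h hh hd hE0 => hE h hh hd fun z hz => hE0 z ?_)
      hc z hz
    refine ⟨hz.1, hz.2.imp_right ?_⟩
    rintro ⟨Δ, hb, g, hg, hgd, hge⟩
    exact ⟨Δ, hb, fun ζ => g ζ * ζ ^ k, hg.mul (by fun_prop), hgd.mul (by fun_prop),
      fun ζ hζ => congrArg (· * ζ ^ k) (hge hζ)⟩
  -- On `Γ` the value is `f` even over points outside `D`, which covers the one-point fibres over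
  -- the boundary.
  let F : (Fin n → ℂ) × ℂ → ℂ := fun p => if p ∈ Γ then f p else
    (2 * Real.pi * Complex.I)⁻¹ * cauchyInt (c p.1) (fun ζ => f (p.1, ζ)) p.2
  have hFΓ : ∀ p ∈ Γ, F p = f p := fun p hp => if_pos hp
  have hF : IsCauchyExtension Γ Ω D f F c := ⟨hfam, hf, hCR', hc, hmom, fun z hz w => by
    by_cases hw : (z, w) ∈ Γ
    · rw [hFΓ _ hw, cauchyExt, if_pos (by rw [(hc z hz).range_eq]; exact hw)]
    · rw [cauchyExt, if_neg (by rw [(hc z hz).range_eq]; exact hw)]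
      exact if_neg hw⟩
  refine ⟨F, hF.differentiableOn, hF.continuousOn_union hFΓ (fun p hp => hp.1) ?_,
    fun p hp _ => hFΓ p hp, fun z hz w hw c' hc' => ?_⟩
  · rintro ⟨z₀, w₀⟩ ⟨hp, hz₀ | ⟨hz₀, hw₀⟩⟩ ε hε
    · have := hF.eventually_norm_sub_le hz₀ hp (ε := ε / 4) (by positivity)
      rwa [mul_div_cancel₀ _ four_ne_zero] at this
    · obtain ⟨K, hK, hKne, hKlim⟩ := hlim z₀ hz₀
      exact hF.eventually_norm_sub_le_of_singleton hz₀.1 hw₀ hK hKne hKlim hε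
  · have hcont : ContinuousOn (fun ζ => f (z, ζ) / (ζ - w)) (fibre Γ z) :=
      (hF.continuousOn_slice z).div (by fun_prop) fun ζ hζ h0 =>
        Set.disjoint_left.1 (hdisc z hz).disjoint hw (sub_eq_zero.1 h0 ▸ hζ)
    rw [hF.eq_on_disc hz hw, cauchyInt, (hdisc z hz).curveInt_eq_curveInt (hc z hz) hc' hcont]
    rfl
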